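/- A transverse link (up to transverse isotopy) is presented as the closure of a braid, two braids presenting the same transverse link if and only if they are related by braid group relations, conjugations, and positive stabilizations and destabilizations $w\leftrightarrow w\sigma_b$, where $w$ is a braid on $b\ge 1$ strands (transverse Markov theorem). A transverse link $L$ is a negative stabilization of a transverse link $L'$ if there is a braid $w$ on $b$ strands such that $L'$ is the closure of $w$ and $L$ is the closure of the braid $w\sigma_b^{-1}$ on $b+1$ strands. Let $R$ be a commutative ring and let $D$ be a braid diagram, i.e. the closure of a braid word on $b$ strands. Choose one of the two possible arrows at each crossing and an order of the crossings, and let $C(D)=\bigoplus_\alpha \Lambda^*V_\alpha$ be the resulting odd Khovanov complex over $R$, where $\alpha$ runs over the resolutions of $D$ and $V_\alpha$ is the free $R$-module on the circles of $\alpha$. Its differential is the sum of the edge maps of the cube of resolutions (for a merge of two circles, the algebra map that identifies their generators; for a split, $\omega\mapsto (v_0-v_1)\wedge\omega$), with the signs of the inductive sign assignment determined by the arrows and the order: at each stage the cube is the mapping cone along the last crossing. Let $Kh'(D)$ be its homology. Let $\alpha'$ be the resolution with a $0$-smoothing at every positive and a $1$-smoothing at every negative crossing, which consists of $b$ parallel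 circles with generators $v_1,\dots,v_b$, and let $\psi(D)\in Kh'(D)$ be the class of the cycle $v_1\wedge\cdots\wedge v_b\in\Lambda^bV_{\alpha'}$. **Proposition.** If a transverse link $L$ is a negative stabilization of another transverse link, then $\psi(L)=0$; that is, $\psi(D)=0$ in $Kh'(D)$ for every braid diagram $D$ of $L$, every choice of arrows and every order of the crossings. -/

import Mathlib

noncomputable section

/-- A letter of a braid word on `m + 1` strands: `(i, true)` is the positive generator crossing the
strands in positions `i` and `i + 1` (counted from `0`), and `(i, false)` is its inverse, a negative
crossing. -/
abbrev BraidWord (m : ℕ) : Type := List (Fin m × Bool)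

/-- A braid diagram: a word on `strands + 1 ≥ 1` strands, read upwards, together with the standard
closing arcs, which join the top of each strand position to its bottom. -/
structure BraidDiagram where
  strands : ℕ
  word : BraidWord strands

namespace BraidDiagram

/-! ### Transverse links -/

/-- The word `w` seen as a word on one more strand, which is added on the right. -/
def addStrand {m : ℕ} (w : BraidWord m) : BraidWord (m + 1) :=
  w.map fun c => (c.1.castSucc, c.2)

/-- The moves of the transverse Markov theorem: the relations of the braid group, conjugation, and
positive stabilization. The inverse moves are obtained by passing to the generated
equivalence relation. -/
inductive TransverseMove : BraidDiagram → BraidDiagram → Prop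
  /-- free cancellation -/
  | cancel {m : ℕ} (u v : BraidWord m) (i : Fin m) (ε : Bool) :
      TransverseMove ⟨m, u ++ (i, ε) :: (i, !ε) :: v⟩ ⟨m, u ++ v⟩
  /-- `σᵢ σⱼ = σⱼ σᵢ` for `|i - j| ≥ 2` -/
  | comm {m : ℕ} (u v : BraidWord m) (i j : Fin m) (h : (i : ℕ) + 2 ≤ j) :
      TransverseMove ⟨m, u ++ (i, true) :: (j, true) :: v⟩
        ⟨m, u ++ (j, true) :: (i, true) :: v⟩
  /-- `σᵢ σᵢ₊₁ σᵢ = σᵢ₊₁ σᵢ σᵢ₊₁` -/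
  | braid {m : ℕ} (u v : BraidWord m) (i j : Fin m) (h : (i : ℕ) + 1 = j) :
      TransverseMove ⟨m, u ++ (i, true) :: (j, true) :: (i, true) :: v⟩
        ⟨m, u ++ (j, true) :: (i, true) :: (j, true) :: v⟩
  /-- conjugation: together with cancellation this identifies `w` and `g w g⁻¹` -/
  | conj {m : ℕ} (u v : BraidWord m) :
      TransverseMove ⟨m, u ++ v⟩ ⟨m, v ++ u⟩
  /-- positive stabilization -/
  | stab {m : ℕ} (w : BraidWord m) :
      TransverseMove ⟨m, w⟩ ⟨m + 1, addStrand w ++ [(Fin.last m, true)]⟩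

end BraidDiagram

/-- Transverse links up to transverse isotopy, presented as closed braids modulo the moves
of the transverse Markov theorem (`Quot` passes to the generated equivalence relation). -/
def TransverseLink : Type := Quot BraidDiagram.TransverseMove

/-- `D` is a braid diagram of the transverse link `L`. -/
def BraidDiagram.IsDiagramOf (D : BraidDiagram) (L : TransverseLink) : Prop :=
  Quot.mk _ D = L

/-- `L` is the negative stabilization of `L'`: for some braid `w` whose closure is `L'`, on the
strands `0, …, m`, the link `L` is the closure of the braid obtained by adding a strand `m + 1` and
a negative crossing between the strands `m` and `m + 1`. -/
def TransverseLink.IsNegativeStabilizationOf (L L' : TransverseLink) : Prop :=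
  ∃ (m : ℕ) (w : BraidWord m), BraidDiagram.IsDiagramOf ⟨m, w⟩ L' ∧
    BraidDiagram.IsDiagramOf
      ⟨m + 1, BraidDiagram.addStrand w ++ [(Fin.last m, false)]⟩ L

namespace BraidDiagram

/-! ### Crossings and resolutions -/

/-- The crossings, numbered from bottom to top. -/
abbrev Crossing (D : BraidDiagram) : Type := Fin D.word.length

/-- The sign of a crossing: `true` for positive, `false` for negative. -/
def pos (D : BraidDiagram) (k : D.Crossing) : Bool := (D.word.get k).2

/-- The position of the left strand at a crossing. -/
def left (D : BraidDiagram) (k : D.Crossing) : Fin (D.strands + 1) := (D.word.get k).1.castSucc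

/-- The position of the right strand at a crossing. -/
def right (D : BraidDiagram) (k : D.Crossing) : Fin (D.strands + 1) := (D.word.get k).1.succ

/-- Marked points of the diagram: the point `(l, j)` lies at level `l` in strand position `j`. The
crossing `k` lies between the levels `k` and `k + 1`, so that its four ends are marked. -/
abbrev Point (D : BraidDiagram) : Type := Fin (D.word.length + 1) × Fin (D.strands + 1)

/-- The ends of a crossing: bottom left. -/
def ptBL (D : BraidDiagram) (k : D.Crossing) : D.Point := (k.castSucc, D.left k)
/-- The ends of a crossing: bottom right. -/
def ptBR (D : BraidDiagram) (k : D.Crossing) : D.Point := (k.castSucc, D.right k)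
/-- The ends of a crossing: top left. -/
def ptTL (D : BraidDiagram) (k : D.Crossing) : D.Point := (k.succ, D.left k)
/-- The ends of a crossing: top right. -/
def ptTR (D : BraidDiagram) (k : D.Crossing) : D.Point := (k.succ, D.right k)

/-- A vertex of the cube of resolutions: `false` and `true` stand for the 0- and 1-smoothing. -/
abbrev Resolution (D : BraidDiagram) : Type := D.Crossing → Bool

/-- Whether the smoothing at `k` consists of the two vertical arcs `BL - TL`, `BR - TR`: this is the
0-smoothing of a positive and the 1-smoothing of a negative crossing. The other smoothing consists
of the two horizontal arcs `BL - BR`, `TL - TR`. -/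
def IsVertical (D : BraidDiagram) (α : D.Resolution) (k : D.Crossing) : Prop :=
  α k = !D.pos k

/-- The arcs that make up the resolution `α`. -/
inductive Arc (D : BraidDiagram) (α : D.Resolution) : D.Point → D.Point → Prop
  /-- arcs going up from level `k` to level `k + 1` -/
  | up (k : D.Crossing) (j : Fin (D.strands + 1))
      (h : D.IsVertical α k ∨ (j ≠ D.left k ∧ j ≠ D.right k)) :
      Arc D α (k.castSucc, j) (k.succ, j)
  /-- the lower arc of a horizontal smoothing -/
  | lower (k : D.Crossing) (h : ¬ D.IsVertical α k) : Arc D α (D.ptBL k) (D.ptBR k)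
  /-- the upper arc of a horizontal smoothing -/
  | upper (k : D.Crossing) (h : ¬ D.IsVertical α k) : Arc D α (D.ptTL k) (D.ptTR k)
  /-- the closing arcs of the braid -/
  | closing (j : Fin (D.strands + 1)) : Arc D α (Fin.last _, j) (0, j)

/-- The circles of the resolution `α`: the classes of marked points under the equivalence relation
generated by the arcs. -/
def Circle (D : BraidDiagram) (α : D.Resolution) : Type := Quot (D.Arc α)

/-- The circle of the resolution `α` through a marked point. -/
def circle (D : BraidDiagram) (α : D.Resolution) (p : D.Point) : D.Circle α := Quot.mk _ p

/-- Replace the smoothing at `k` by the 1-smoothing. -/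
def set1 (D : BraidDiagram) (α : D.Resolution) (k : D.Crossing) : D.Resolution :=
  Function.update α k true

/-- Replace the smoothing at `k` by the 0-smoothing. -/
def set0 (D : BraidDiagram) (α : D.Resolution) (k : D.Crossing) : D.Resolution :=
  Function.update α k false

/-! ### Arrows

Each crossing carries one of its two possible arrows. In the 0-smoothing the arrow joins the two
arcs, and in the 1-smoothing it is turned clockwise by a right angle and again joins the two arcs.
A choice of arrows is a function `o` on the crossings. At a positive crossing with `o k = true` the
arrow of the 0-smoothing points from left to right and that of the 1-smoothing from top to bottom;
at a negative crossing with `o k = true` the arrow of the 0-smoothing points from bottom to top and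
that of the 1-smoothing from left to right. With `o k = false` all of these are reversed. -/

/-- A choice of an arrow at every crossing. -/
abbrev Arrows (D : BraidDiagram) : Type := D.Crossing → Bool

/-- Two points on the arcs at which the arrow of the 0-smoothing starts and ends. -/
def arrow0 (D : BraidDiagram) (o : D.Arrows) (k : D.Crossing) : D.Point × D.Point :=
  let p := if D.pos k then (D.ptBL k, D.ptBR k) else (D.ptBL k, D.ptTL k)
  if o k then p else p.swap

/-- Two points on the arcs at which the arrow of the 1-smoothing starts and ends. -/
def arrow1 (D : BraidDiagram) (o : D.Arrows) (k : D.Crossing) : D.Point × D.Point :=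
  let p := if D.pos k then (D.ptTL k, D.ptBL k) else (D.ptBL k, D.ptBR k)
  if o k then p else p.swap

/-! ### The maps on the edges -/

/-- For `α k = 0`: changing the smoothing at `k` merges two circles of `α`, i.e. the two arcs at `k`
lie on different circles. Otherwise it splits a circle. -/
def IsMerge (D : BraidDiagram) (o : D.Arrows) (α : D.Resolution) (k : D.Crossing) : Prop :=
  D.circle α (D.arrow0 o k).1 ≠ D.circle α (D.arrow0 o k).2

/-- The free module `V_α` on the circles of the resolution `α`. -/
abbrev V (R : Type*) [CommRing R] (D : BraidDiagram) (α : D.Resolution) : Type _ :=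
  D.Circle α →₀ R

/-- The generator of `V_α` that belongs to the circle through `p`. -/
def gen (R : Type*) [CommRing R] (D : BraidDiagram) (α : D.Resolution) (p : D.Point) :
    V R D α :=
  Finsupp.single (D.circle α p) 1

/-- The map `V_α → V_β` that sends the generator of a circle `a` of `α` to the generator of the
circle of `β` through a point of `a`. If `β` arises by merging two circles of `α` this does
not depend on the point. If `β` arises by splitting a circle, it depends on the point for this
circle only, and the map on the edge below does not depend on it. -/
def relabel (R : Type*) [CommRing R] (D : BraidDiagram) (α β : D.Resolution) :
    V R D α →ₗ[R] V R D β :=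
  Finsupp.lmapDomain R R fun a => D.circle β (Quot.out a)

open Classical in
/-- The unsigned map on the edge from `α` to `β = set1 α k`, where `α k = 0`: for a merge of two
circles it is the algebra map identifying their generators, and for a split it
is `ω ↦ (v₀ - v₁) ∧ ω`, where the arrow of the 1-smoothing at `k` points from the circle of `v₀` to
the circle of `v₁`. -/
def edgeMap (R : Type*) [CommRing R] (D : BraidDiagram) (o : D.Arrows) (α β : D.Resolution)
    (k : D.Crossing) :
    ExteriorAlgebra R (V R D α) →ₗ[R] ExteriorAlgebra R (V R D β) :=
  if D.IsMerge o α k then (ExteriorAlgebra.map (relabel R D α β)).toLinearMap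
  else LinearMap.mulLeft R
      (ExteriorAlgebra.ι R (gen R D β (D.arrow1 o k).1 - gen R D β (D.arrow1 o k).2)) ∘ₗ
    (ExteriorAlgebra.map (relabel R D α β)).toLinearMap

/-! ### The sign assignment -/

/-- The types of two-dimensional faces of the cube of resolutions. -/
inductive FaceType
  | A
  | C
  | X
  | Y

/-- The sign of a face. -/
def FaceType.sgn : FaceType → ℤ
  | .A => -1
  | .C => 1
  | .X => -1
  | .Y => 1

open Classical in
/-- The type of the face at `α` in the directions `k ≠ l`, where `α k = α l = 0`.

* If both `k` and `l` split a circle of `α`, and `l` still splits a circle after the change at `k`,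
  then the two splits are independent or are given by parallel chords of a circle: type A.
* If both split a circle of `α`, but `l` merges the two circles created by the change at `k`, the
  two chords of this circle have interlaced ends. The type is X if the arrow of `l` ends to the
  left of the arrow of `k` (that is, after the change at `k`, on the circle at which the
  arrow of the 1-smoothing at `k` starts), and Y if it ends to the right of the arrow of `k`.
* If both merge the same two circles, the type is A or C according to whether the two arrows go in
  the same or in opposite directions between these circles.
* In the other cases (two merges in a row, or a merge and an independent split): type C. -/
def faceType (D : BraidDiagram) (o : D.Arrows) (α : D.Resolution) (k l : D.Crossing) : FaceType :=
  if ¬ D.IsMerge o α k ∧ ¬ D.IsMerge o α l then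
    if D.IsMerge o (D.set1 α k) l then
      if D.circle (D.set1 α k) (D.arrow0 o l).2 = D.circle (D.set1 α k) (D.arrow1 o k).1 then .X
      else .Y
    else .A
  else if D.IsMerge o α k ∧ D.IsMerge o α l ∧ ¬ D.IsMerge o (D.set1 α k) l then
    if D.circle α (D.arrow0 o k).1 = D.circle α (D.arrow0 o l).1 then .A else .C
  else .C

/-- A total order of the crossings, in which the cube is built up as an iterated mapping cone. -/
abbrev Order (D : BraidDiagram) : Type := Equiv.Perm D.Crossing

/-- The sign of the edge at `α` in direction `x`, where `α x = 0`, as given by the inductive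
construction: if the last crossing `y` is `x`, then the sign is `1`; if `y ≠ x` and `α y = 0`, it
is the sign given by the remaining crossings; if `y ≠ x` and `α y = 1`, it is minus the sign of the
edge at `set0 α y` in direction `x`, times the sign of the face spanned by these two edges. Unwound,
this is a product over the crossings `y` after `x` with `α y = 1`, and the face that belongs to `y`
is the one at the resolution obtained from `α` by setting `y` and everything after `y` to `0`. -/
def edgeSign (D : BraidDiagram) (o : D.Arrows) (π : D.Order) (α : D.Resolution) (x : D.Crossing) :
    ℤ :=
  ∏ y : D.Crossing with π x < π y ∧ α y = true,
    -(D.faceType o (fun z => if π y ≤ π z then false else α z) x y).sgn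

/-! ### Odd Khovanov homology -/

/-- The chain module `C(D)`: the (finite) direct sum over all resolutions `α` of `Λ* V_α`. -/
abbrev Chains (R : Type*) [CommRing R] (D : BraidDiagram) : Type _ :=
  (α : D.Resolution) → ExteriorAlgebra R (V R D α)

/-- The differential: the sum of the signed maps on all edges. Its component at `β` is the sum over
the edges ending at `β`, that is over the crossings `k` with `β k = 1`. -/
def diff (R : Type*) [CommRing R] (D : BraidDiagram) (o : D.Arrows) (π : D.Order) :
    Chains R D →ₗ[R] Chains R D :=
  LinearMap.pi fun β => ∑ k : D.Crossing with β k = true,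
    D.edgeSign o π (D.set0 β k) k •
      (edgeMap R D o (D.set0 β k) β k ∘ₗ LinearMap.proj (D.set0 β k))

/-- The odd Khovanov homology of `D`: cycles modulo boundaries (in all bidegrees together), computed
with the arrows `o` and the order `π`. -/
abbrev Kh (R : Type*) [CommRing R] (D : BraidDiagram) (o : D.Arrows) (π : D.Order) : Type _ :=
  LinearMap.ker (diff R D o π) ⧸
    (LinearMap.range (diff R D o π)).comap (LinearMap.ker (diff R D o π)).subtype

/-! ### The invariant -/

/-- The resolution into parallel strands: every positive crossing is 0-smoothed and every negative
crossing is 1-smoothed. -/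
def braidRes (D : BraidDiagram) : D.Resolution := fun k => !D.pos k

/-- The element `v₁ ∧ ⋯ ∧ v_b` of `Λ^b V_α`, where `α` is the resolution into parallel strands and
`v₁, …, v_b` belong to its `b` circles, ordered from left to right. -/
def psiChain (R : Type*) [CommRing R] (D : BraidDiagram) : Chains R D :=
  Pi.single D.braidRes
    (ExteriorAlgebra.ιMulti R (D.strands + 1) fun j => gen R D D.braidRes (0, j))

theorem left_ne_right (D : BraidDiagram) (k : D.Crossing) : D.left k ≠ D.right k := by
  intro h
  have := congrArg Fin.val h
  simp [left, right] at this

theorem circle_arc {D : BraidDiagram} {α : D.Resolution} {p q : D.Point} (h : D.Arc α p q) :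
    D.circle α p = D.circle α q := Quot.sound h

theorem arc_braidRes {D : BraidDiagram} {p q : D.Point} (h : D.Arc D.braidRes p q) :
    p.2 = q.2 := by
  cases h with
  | up k j h => rfl
  | lower k h => exact absurd rfl h
  | upper k h => exact absurd rfl h
  | closing j => rfl

theorem strand_eq {D : BraidDiagram} {p q : D.Point}
    (h : D.circle D.braidRes p = D.circle D.braidRes q) : p.2 = q.2 :=
  congrArg (Quot.lift (fun p : D.Point => p.2) fun _ _ h => arc_braidRes h) h

theorem circle_strand {D : BraidDiagram} {β : D.Resolution} (k : D.Crossing)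
    (hv : ∀ k', k' ≠ k → D.IsVertical β k') (p : D.Point) :
    D.circle β p = D.circle β (0, p.2) := by
  obtain ⟨l, j⟩ := p
  have up : ∀ k', k' ≠ k → D.circle β (k'.castSucc, j) = D.circle β (k'.succ, j) :=
    fun k' hk' => circle_arc (.up k' j (.inl (hv k' hk')))
  rcases le_or_gt l k.castSucc with h | h
  · induction l using Fin.induction with
    | zero => rfl
    | succ i ih =>
      have hi : i < k := by
        rw [Fin.lt_def]; rw [Fin.le_def] at h; simpa using h
      rw [← up i hi.ne]
      exact ih (by rw [Fin.le_def]; rw [Fin.lt_def] at hi; simpa using hi.le)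
  · induction l using Fin.reverseInduction with
    | last => exact circle_arc (.closing j)
    | cast i ih =>
      have hi : k < i := by
        rw [Fin.lt_def]; rw [Fin.lt_def] at h; simpa using h
      rw [up i hi.ne']
      exact ih (by rw [Fin.lt_def]; rw [Fin.lt_def] at hi; simp; omega)

/-- The element `psiChain` is a cycle. -/
theorem diff_psiChain (R : Type*) [CommRing R] (D : BraidDiagram) (o : D.Arrows) (π : D.Order) :
    diff R D o π (psiChain R D) = 0 := by
  classical
  funext β
  simp only [diff, LinearMap.pi_apply, LinearMap.sum_apply, LinearMap.smul_apply,
    LinearMap.comp_apply, LinearMap.proj_apply, Pi.zero_apply]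
  refine Finset.sum_eq_zero fun k hk => ?_
  have hβ : β k = true := by simpa using hk
  suffices h : ∀ α, α = D.set0 β k → edgeMap R D o α β k (psiChain R D α) = 0 by
    rw [h _ rfl, smul_zero]
  intro α hα
  by_cases hb : α = D.braidRes
  swap
  · rw [psiChain, Pi.single_eq_of_ne hb, map_zero]
  subst hb
  have hpos : D.pos k = true := by
    have : D.braidRes k = false := by rw [hα]; simp [set0]
    simpa [braidRes] using this
  have hv : ∀ k', k' ≠ k → D.IsVertical β k' := by
    intro k' hk'
    have := congrFun hα k'
    simp only [set0, Function.update_of_ne hk'] at this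
    exact this.symm
  have hnv : ¬ D.IsVertical β k := by simp [IsVertical, hβ, hpos]
  have hm : D.IsMerge o D.braidRes k := by
    intro h
    have h' := strand_eq h
    have := D.left_ne_right k
    cases ho : o k <;> simp [arrow0, hpos, ho, ptBL, ptBR] at h' <;> simp_all
  have hLR : D.circle β (0, D.left k) = D.circle β (0, D.right k) := by
    have := circle_arc (Arc.lower k hnv)
    rwa [circle_strand k hv, circle_strand k hv (D.ptBR k)] at this
  have hrel : ∀ j, relabel R D D.braidRes β (gen R D D.braidRes (0, j)) =
      Finsupp.single (D.circle β (0, j)) 1 := by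
    intro j
    have : (Quot.out (D.circle D.braidRes (0, j))).2 = j :=
      strand_eq (p := Quot.out (D.circle D.braidRes (0, j))) (q := (0, j)) (Quot.out_eq _)
    simp only [relabel, gen, Finsupp.lmapDomain_apply, Finsupp.mapDomain_single]
    rw [circle_strand k hv, this]
  rw [edgeMap, if_pos hm, psiChain, Pi.single_eq_same, AlgHom.toLinearMap_apply,
    ExteriorAlgebra.map_apply_ιMulti]
  refine AlternatingMap.map_eq_zero_of_eq _ _ (i := D.left k) (j := D.right k) ?_
    (D.left_ne_right k)
  simp only [Function.comp_apply, hrel, hLR]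

/-- The class `ψ(D)` in the odd Khovanov homology of `D`. -/
def psi (R : Type*) [CommRing R] (D : BraidDiagram) (o : D.Arrows) (π : D.Order) : Kh R D o π :=
  Submodule.Quotient.mk ⟨psiChain R D, LinearMap.mem_ker.mpr (diff_psiChain R D o π)⟩

end BraidDiagram

end

/-! Vanishing of `ψ` is shown to be invariant under every transverse move, so one diagram of the
negative stabilization suffices: the closure of `w σ_b⁻¹`. Change the last crossing of the braid
resolution to its 0-smoothing. This joins the strands `b` and `b + 1`, so the vertex has `b`
circles; take `v₁ ∧ ⋯ ∧ v_b` there. The edge at the last crossing is a split and multiplies by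
`±(v_{b+1} - v_b)`, which yields `±v₁ ∧ ⋯ ∧ v_{b+1}`. Every other edge leaving the vertex merges two
of the strands `1, …, b` and kills the element. Hence `ψ` is a boundary (`null_negative_stab`).

Arrows and signs are treated flexibly. `Null` only asks that `ψ` bounds for one choice of arrows and
some sign assignment that makes the faces anticommute. Two such assignments differ by signs at the
vertices (`Valid.gauge`), reversing arrows only changes signs (`Good.bounding_flip`), and the
inductive assignment is one of them (`Good.valid_coneSign`); so `psi_eq_zero` recovers all arrows
and all orders.

The algebra takes place in the exterior algebra on the marked points, which is the same at all
vertices: a merge is the identity, a split is multiplication by a difference of two points, and only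
at the end does one project to the circles of a resolution.

Planarity enters through `ResCube.Good`, which collects the facts about faces and three-dimensional
cubes. The strand positions, up in the even and down in the odd ones, orient the circles of all
resolutions at once, so these are cycles of permutations that differ by exchanges at the crossings.
First return maps reduce the claims to permutations of at most six points and to a computation
(`Six.chkPerm_all`); the Jordan curve theorem is replaced by a parity count (`side`).

Opposite crossings cancel because the small circle between them gives a contraction
(`Bigon.bounding_iff`). The braid relation follows from `σᵢ σᵢ₊₁ σᵢ⁻¹ = σᵢ₊₁⁻¹ σᵢ σᵢ₊₁`, where both
sides contain such a circle (`Bigon.bounding_of_faceIso`). A positive stabilization adds a circle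
that can be split off in the 0-smoothing of the new crossing (`null_stab_iff`). -/

set_option linter.unusedSectionVars false

/-! ### Exterior algebras on marked points. -/

noncomputable section

/-- The exterior algebra on the free module with basis `Ω`. -/
abbrev PtAlg (R : Type*) [CommRing R] (Ω : Type) : Type _ := ExteriorAlgebra R (Ω →₀ R)

namespace PtAlg

variable {R : Type*} [CommRing R] {Ω Ω' Ω'' : Type}

/-- The algebra map induced by a map of basis elements. -/
def emap (R : Type*) [CommRing R] (φ : Ω → Ω') : PtAlg R Ω →ₐ[R] PtAlg R Ω' :=
  ExteriorAlgebra.map (Finsupp.lmapDomain R R φ)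

/-- The degree one element of a point. -/
def pt (R : Type*) [CommRing R] (p : Ω) : PtAlg R Ω := ExteriorAlgebra.ι R (Finsupp.single p 1)

@[simp] theorem emap_pt (φ : Ω → Ω') (p : Ω) : emap R φ (pt R p) = pt R (φ p) := by
  simp [emap, pt]

theorem emap_emap (φ : Ω → Ω') (ψ : Ω' → Ω'') (x : PtAlg R Ω) :
    emap R ψ (emap R φ x) = emap R (ψ ∘ φ) x := by
  have h : (emap R ψ).comp (emap R φ) = emap R (ψ ∘ φ) := by
    simp only [emap]
    rw [ExteriorAlgebra.map_comp_map, Finsupp.lmapDomain_comp]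
  exact DFunLike.congr_fun h x

theorem emap_id (x : PtAlg R Ω) : emap R id x = x := by
  have : emap R (id : Ω → Ω) = AlgHom.id R _ := by
    simp only [emap, Finsupp.lmapDomain_id, ExteriorAlgebra.map_id]
  rw [this]; rfl

theorem sub_sq (p q : Ω) : (pt R p - pt R q) * (pt R p - pt R q) = 0 := by
  rw [pt, pt, ← map_sub]; exact ExteriorAlgebra.ι_sq_zero _

theorem pt_sub_anticomm (p q p' q' : Ω) :
    (pt R p - pt R q) * (pt R p' - pt R q') = -((pt R p' - pt R q') * (pt R p - pt R q)) := by
  simp only [pt, ← map_sub]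
  exact eq_neg_of_add_eq_zero_left (ExteriorAlgebra.ι_add_mul_swap _ _)

theorem left_induction {M : Type*} [AddCommGroup M] [Module R M] {P : ExteriorAlgebra R M → Prop}
    (h0 : ∀ r : R, P (algebraMap R _ r)) (hadd : ∀ x y, P x → P y → P (x + y))
    (hmul : ∀ x m, P x → P (ExteriorAlgebra.ι R m * x)) (x) : P x :=
  CliffordAlgebra.left_induction (Q := (0 : QuadraticForm R M)) h0 hadd (fun x m h => hmul x m h) x

/-- Moving `w` past one factor after another costs only signs, and the difference between `f m` and
`g m` is a multiple of `w`, which `w ∧ w = 0` kills. This is why a split map does not depend on the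
point that represents the circle being split. -/
theorem mul_map_congr {M N : Type*} [AddCommGroup M] [Module R M] [AddCommGroup N] [Module R N]
    (f g : M →ₗ[R] N) (w : N) (h : ∀ m, ∃ c : R, f m - g m = c • w) (x : ExteriorAlgebra R M) :
    ExteriorAlgebra.ι R w * ExteriorAlgebra.map f x =
      ExteriorAlgebra.ι R w * ExteriorAlgebra.map g x := by
  induction x using left_induction with
  | h0 r => simp
  | hadd x y hx hy => simp only [map_add, mul_add, hx, hy]
  | hmul x m hx =>
    obtain ⟨c, hc⟩ := h m
    have sw : ∀ a : N, ExteriorAlgebra.ι R w * ExteriorAlgebra.ι R a =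
        -(ExteriorAlgebra.ι R a * ExteriorAlgebra.ι R w) := fun a =>
      eq_neg_of_add_eq_zero_left (ExteriorAlgebra.ι_add_mul_swap _ _)
    have hf : f m = g m + c • w := by rw [← hc]; abel
    simp only [map_mul, ExteriorAlgebra.map_apply_ι]
    rw [← mul_assoc, ← mul_assoc, sw, sw, neg_mul, neg_mul, mul_assoc, mul_assoc, hx, hf, map_add,
      add_mul, map_smul]
    have : (c • ExteriorAlgebra.ι R w) * (ExteriorAlgebra.ι R w * ExteriorAlgebra.map g x) = 0 := by
      rw [smul_mul_assoc, ← mul_assoc, ExteriorAlgebra.ι_sq_zero, zero_mul, smul_zero]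
    rw [this, add_zero]

/-- If `φ p` and `ψ p` agree up to the exchange of `a` and `b`, then `emap φ` and `emap ψ` agree
after multiplication by `a - b`. -/
theorem mul_emap_congr (φ ψ : Ω → Ω') (a b : Ω')
    (h : ∀ p, φ p = ψ p ∨ (φ p = a ∧ ψ p = b) ∨ (φ p = b ∧ ψ p = a)) (x : PtAlg R Ω) :
    (pt R a - pt R b) * emap R φ x = (pt R a - pt R b) * emap R ψ x := by
  rw [pt, pt, ← map_sub]
  refine mul_map_congr _ _ _ (fun m => ?_) x
  induction m using Finsupp.induction_linear with
  | zero => exact ⟨0, by simp⟩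
  | add f g hf hg =>
    obtain ⟨c, hc⟩ := hf
    obtain ⟨c', hc'⟩ := hg
    refine ⟨c + c', ?_⟩
    rw [add_smul, ← hc, ← hc', map_add, map_add]; abel
  | single p r =>
    have e : ∀ q : Ω', Finsupp.single q r = r • Finsupp.single q (1 : R) := by simp
    simp only [Finsupp.lmapDomain_apply, Finsupp.mapDomain_single]
    rcases h p with h | ⟨h, h'⟩ | ⟨h, h'⟩
    · exact ⟨0, by simp [h]⟩
    · exact ⟨r, by rw [h, h', e a, e b, smul_sub]⟩
    · exact ⟨-r, by rw [h, h', e a, e b, neg_smul, smul_sub, neg_sub]⟩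

end PtAlg

/-! ### Abstract cubes of resolutions and their two-dimensional faces. -/

open PtAlg

/-- A cube of resolutions, with crossings `ι` and marked points `Ω`: for every resolution the
partition of the points into circles, and for every crossing the start and the end of the arrow of
the 0-smoothing and of the arrow of the 1-smoothing. -/
structure ResCube (ι Ω : Type) where
  rel : (ι → Bool) → Setoid Ω
  s0 : ι → Ω
  t0 : ι → Ω
  s1 : ι → Ω
  t1 : ι → Ω

/-- Change the smoothing at `k` to the 1-smoothing. -/
abbrev up {ι : Type} [DecidableEq ι] (α : ι → Bool) (k : ι) : ι → Bool := Function.update α k true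
/-- Change the smoothing at `k` to the 0-smoothing. -/
abbrev dn {ι : Type} [DecidableEq ι] (α : ι → Bool) (k : ι) : ι → Bool := Function.update α k false

theorem up_dn {ι : Type} [DecidableEq ι] {α : ι → Bool} {k : ι} (h : α k = true) :
    up (dn α k) k = α := by simp [up, dn, ← h]

theorem dn_up {ι : Type} [DecidableEq ι] {α : ι → Bool} {k : ι} (h : α k = false) :
    dn (up α k) k = α := by simp [up, dn, ← h]

namespace ResCube

variable {ι Ω Ω' : Type} [DecidableEq ι] (K : ResCube ι Ω) (R : Type*) [CommRing R]

/-- Changing the smoothing at `k` splits a circle of `α`. -/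
def Splits (α : ι → Bool) (k : ι) : Prop := K.rel α (K.s0 k) (K.t0 k)

open Classical in
/-- The sign of a face of the cube. -/
def fsgn (α : ι → Bool) (k l : ι) : ℤˣ :=
  if K.Splits α k ∧ K.Splits α l then
    if ¬ K.Splits (up α k) l then
      if K.rel (up α k) (K.t0 l) (K.s1 k) then -1 else 1
    else -1
  else if ¬ K.Splits α k ∧ ¬ K.Splits α l ∧ K.Splits (up α k) l then
    if K.rel α (K.s0 k) (K.s0 l) then -1 else 1
  else 1

/-- The properties shared by the cubes of resolutions of planar diagrams. -/
structure Good : Prop where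
  merge_iff : ∀ {α k}, α k = false → ¬ K.Splits α k → ∀ p q, K.rel (up α k) p q ↔
    K.rel α p q ∨ (K.rel α p (K.s0 k) ∧ K.rel α q (K.t0 k)) ∨
      (K.rel α p (K.t0 k) ∧ K.rel α q (K.s0 k))
  split_iff : ∀ {α k}, α k = false → K.Splits α k → ∀ p q, K.rel α p q ↔
    K.rel (up α k) p q ∨ (K.rel (up α k) p (K.s1 k) ∧ K.rel (up α k) q (K.t1 k)) ∨
      (K.rel (up α k) p (K.t1 k) ∧ K.rel (up α k) q (K.s1 k))
  split_ne : ∀ {α k}, α k = false → K.Splits α k → ¬ K.rel (up α k) (K.s1 k) (K.t1 k)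
  merge_ends : ∀ {α k}, α k = false → ¬ K.Splits α k → K.rel (up α k) (K.s1 k) (K.t1 k)
  split_splits : ∀ {α k l}, k ≠ l → α k = false → α l = false → K.Splits α k → K.Splits α l →
    K.Splits (up α k) l → K.Splits (up α l) k
  -- If two crossings merge the same two circles, then each becomes a split after the other. `par`
  -- and `antipar` compare the 1-arrows of these two splits; this decides between the types A and C.
  par : ∀ {α k l}, k ≠ l → α k = false → α l = false → ¬ K.Splits α k → ¬ K.Splits α l →
    K.Splits (up α k) l → K.rel α (K.s0 k) (K.s0 l) →
      K.rel (up (up α k) l) (K.s1 k) (K.t1 l) ∧ K.rel (up (up α k) l) (K.t1 k) (K.s1 l)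
  antipar : ∀ {α k l}, k ≠ l → α k = false → α l = false → ¬ K.Splits α k → ¬ K.Splits α l →
    K.Splits (up α k) l → K.rel α (K.s0 k) (K.t0 l) →
      K.rel (up (up α k) l) (K.s1 k) (K.s1 l) ∧ K.rel (up (up α k) l) (K.t1 k) (K.t1 l)
  fsgn_symm : ∀ {α k l}, k ≠ l → α k = false → α l = false → K.fsgn α k l = K.fsgn α l k
  -- Each of the six faces of a three-dimensional cube contributes its sign once. This cocycle
  -- condition allows signs to be extended from a cube to a mapping cone over it.
  cube : ∀ {α k l m}, k ≠ l → k ≠ m → l ≠ m → α k = false → α l = false → α m = false →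
    K.fsgn α k l * K.fsgn (up α m) k l * (K.fsgn α k m * K.fsgn (up α l) k m) *
      (K.fsgn α l m * K.fsgn (up α k) l m) = 1

/-- Two elements upstairs are congruent if they agree in the exterior algebra on the circles. -/
def proj (α : ι → Bool) : PtAlg R Ω →ₐ[R] PtAlg R (Quotient (K.rel α)) :=
  emap R (Quotient.mk (K.rel α))

open Classical in
/-- The map of an edge, on the exterior algebra on the points. -/
def edge (α : ι → Bool) (k : ι) : PtAlg R Ω →ₗ[R] PtAlg R Ω :=
  if K.Splits α k then LinearMap.mulLeft R (pt R (K.s1 k) - pt R (K.t1 k)) else LinearMap.id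

variable {R} {K}

theorem edge_split {α : ι → Bool} {k : ι} (h : K.Splits α k) (x : PtAlg R Ω) :
    K.edge R α k x = (pt R (K.s1 k) - pt R (K.t1 k)) * x := by
  rw [edge, if_pos h]; rfl

theorem edge_merge {α : ι → Bool} {k : ι} (h : ¬ K.Splits α k) (x : PtAlg R Ω) :
    K.edge R α k x = x := by
  rw [edge, if_neg h]; rfl

theorem proj_pt_eq {α : ι → Bool} {p q : Ω} (h : K.rel α p q) :
    K.proj R α (pt R p) = K.proj R α (pt R q) := by
  simp only [proj, emap_pt]
  rw [Quotient.sound h]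

theorem proj_emap_of_rel {κ : Type} {L : ResCube κ Ω'} {α : ι → Bool} {β : κ → Bool} {φ : Ω → Ω'}
    (h : ∀ p q, K.rel α p q → L.rel β (φ p) (φ q)) {x y : PtAlg R Ω}
    (hxy : K.proj R α x = K.proj R α y) :
    L.proj R β (emap R φ x) = L.proj R β (emap R φ y) := by
  have key : ∀ z, L.proj R β (emap R φ z) = emap R (Quotient.map φ h) (K.proj R α z) := by
    intro z
    simp only [proj, emap_emap]; rfl
  rw [key, key, hxy]

theorem proj_emap_congr {κ : Type} {L : ResCube κ Ω'} {β : κ → Bool} {φ ψ : Ω → Ω'}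
    (h : ∀ p, L.rel β (φ p) (ψ p)) (x : PtAlg R Ω) :
    L.proj R β (emap R φ x) = L.proj R β (emap R ψ x) := by
  simp only [proj, emap_emap]
  congr 2
  funext p
  exact Quotient.sound (h p)

theorem proj_le {α β : ι → Bool} (h : ∀ p q, K.rel α p q → K.rel β p q) {x y : PtAlg R Ω}
    (hxy : K.proj R α x = K.proj R α y) : K.proj R β x = K.proj R β y := by
  have := proj_emap_of_rel (φ := id) h hxy
  rwa [emap_id, emap_id] at this

/-- The element `(s - t) ∧ x` only depends on `x` up to exchanging `s` and `t`. -/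
theorem proj_sub_mul {α β : ι → Bool} {s t : Ω}
    (h : ∀ p q, K.rel α p q → K.rel β p q ∨ (K.rel β p s ∧ K.rel β q t) ∨
      (K.rel β p t ∧ K.rel β q s)) {x y : PtAlg R Ω}
    (hxy : K.proj R α x = K.proj R α y) :
    K.proj R β ((pt R s - pt R t) * x) = K.proj R β ((pt R s - pt R t) * y) := by
  -- The right-hand side sees `z` only through its image on the circles of `α`. Each circle is
  -- represented by one chosen point, and the factor `s - t` absorbs the choice.
  have key : ∀ z : PtAlg R Ω, K.proj R β ((pt R s - pt R t) * z) =
      (pt R (Quotient.mk (K.rel β) s) - pt R (Quotient.mk (K.rel β) t)) *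
        emap R (fun a => Quotient.mk (K.rel β) (Quotient.out a)) (K.proj R α z) := by
    intro z
    rw [map_mul, map_sub]
    simp only [proj, emap_pt, emap_emap]
    refine mul_emap_congr _ _ _ _ (fun p => ?_) z
    have hp : K.rel α p (Quotient.out (Quotient.mk (K.rel α) p)) :=
      (K.rel α).symm (Quotient.mk_out p)
    rcases h _ _ hp with h | ⟨h, h'⟩ | ⟨h, h'⟩
    · exact .inl (Quotient.sound h)
    · exact .inr (.inl ⟨Quotient.sound h, Quotient.sound h'⟩)
    · exact .inr (.inr ⟨Quotient.sound h, Quotient.sound h'⟩)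
  rw [key, key, hxy]

/-- Edge maps descend to circles. A merge only coarsens the relation; for a split, two points on one
circle of `α` lie on one circle afterwards or on those of `s1` and `t1`, which multiplication by `s1
- t1` identifies. -/
theorem Good.edge_congr (hK : K.Good) {α : ι → Bool} {k : ι} (hk : α k = false) {x y : PtAlg R Ω}
    (hxy : K.proj R α x = K.proj R α y) :
    K.proj R (up α k) (K.edge R α k x) = K.proj R (up α k) (K.edge R α k y) := by
  by_cases h : K.Splits α k
  · rw [edge_split h, edge_split h]
    exact proj_sub_mul (fun p q => (hK.split_iff hk h p q).1) hxy
  · rw [edge_merge h, edge_merge h]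
    exact proj_le (fun p q hpq => (hK.merge_iff hk h p q).2 (.inl hpq)) hxy

/-! ### Faces -/

theorem Good.splits_mono (hK : K.Good) {α : ι → Bool} {k l : ι} (hk : α k = false)
    (h : ¬ K.Splits α k) (hl : K.Splits α l) : K.Splits (up α k) l :=
  (hK.merge_iff hk h _ _).2 (.inl hl)

theorem Good.splits_of_up (hK : K.Good) {α : ι → Bool} {k l : ι} (hk : α k = false)
    (h : K.Splits α k) (hl : K.Splits (up α k) l) : K.Splits α l :=
  (hK.split_iff hk h _ _).2 (.inl hl)

/-- Two merges of the same two circles. -/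
theorem Good.par_or (hK : K.Good) {α : ι → Bool} {k l : ι} (hk : α k = false)
    (h : ¬ K.Splits α k) (h' : ¬ K.Splits α l) (hl : K.Splits (up α k) l) :
    (K.rel α (K.s0 l) (K.s0 k) ∧ K.rel α (K.t0 l) (K.t0 k)) ∨
      (K.rel α (K.s0 l) (K.t0 k) ∧ K.rel α (K.t0 l) (K.s0 k)) :=
  ((hK.merge_iff hk h _ _).1 hl).resolve_left h'

/-- Two interlaced splits. -/
theorem Good.cross_or (hK : K.Good) {α : ι → Bool} {k l : ι} (hk : α k = false)
    (h : K.Splits α k) (h' : K.Splits α l) (hl : ¬ K.Splits (up α k) l) :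
    (K.rel (up α k) (K.s0 l) (K.s1 k) ∧ K.rel (up α k) (K.t0 l) (K.t1 k)) ∨
      (K.rel (up α k) (K.s0 l) (K.t1 k) ∧ K.rel (up α k) (K.t0 l) (K.s1 k)) :=
  ((hK.split_iff hk h _ _).1 h').resolve_left hl

theorem Good.merge_merge_symm (hK : K.Good) {α : ι → Bool} {k l : ι} (hk : α k = false)
    (hl' : α l = false) (h : ¬ K.Splits α k) (h' : ¬ K.Splits α l) (hl : K.Splits (up α k) l) :
    K.Splits (up α l) k := by
  refine (hK.merge_iff hl' h' _ _).2 (.inr ?_)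
  have symm := @(K.rel α).symm
  rcases hK.par_or hk h h' hl with ⟨h1, h2⟩ | ⟨h1, h2⟩
  · exact .inl ⟨symm h1, symm h2⟩
  · exact .inr ⟨symm h2, symm h1⟩

theorem up_comm {α : ι → Bool} {k l : ι} (hkl : k ≠ l) : up (up α k) l = up (up α l) k :=
  Function.update_comm hkl _ _ _

/-- The second change rejoins the two circles created by the first, so the factor `s1 - t1` becomes
zero. Both ways around such a face vanish, and the face commutes up to any sign, be it that of type
X or of type Y. -/
theorem Good.cross_zero (hK : K.Good) {α : ι → Bool} {k l : ι} (hkl : k ≠ l) (hk : α k = false)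
    (hl' : α l = false) (h : K.Splits α k) (h' : K.Splits α l) (hl : ¬ K.Splits (up α k) l)
    (x : PtAlg R Ω) :
    K.proj R (up (up α k) l) (K.edge R (up α k) l (K.edge R α k x)) = 0 := by
  have hl0 : up α k l = false := by simp [up, hkl.symm, hl']
  rw [edge_merge hl, edge_split h, map_mul, map_sub]
  have : K.rel (up (up α k) l) (K.s1 k) (K.t1 k) := by
    refine (hK.merge_iff hl0 hl _ _).2 (.inr ?_)
    have symm := @(K.rel (up α k)).symm
    rcases hK.cross_or hk h h' hl with ⟨h1, h2⟩ | ⟨h1, h2⟩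
    · exact .inl ⟨symm h1, symm h2⟩
    · exact .inr ⟨symm h2, symm h1⟩
  rw [proj_pt_eq this, sub_self, zero_mul]

/-- The two ways around a face agree up to the sign of the face. -/
theorem Good.face (hK : K.Good) {α : ι → Bool} {k l : ι} (hkl : k ≠ l) (hk : α k = false)
    (hl : α l = false) (x : PtAlg R Ω) :
    K.proj R (up (up α k) l) (K.edge R (up α k) l (K.edge R α k x)) =
      K.fsgn α k l • K.proj R (up (up α k) l) (K.edge R (up α l) k (K.edge R α l x)) := by
  by_cases h : K.Splits α k <;> by_cases h' : K.Splits α l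
  · by_cases hl' : K.Splits (up α k) l
    · have hk' := hK.split_splits hkl hk hl h h' hl'
      rw [edge_split hl', edge_split h, edge_split hk', edge_split h', fsgn, if_pos ⟨h, h'⟩,
        if_neg (not_not.2 hl'), ← mul_assoc, ← mul_assoc, pt_sub_anticomm]
      simp [Units.smul_def]
    · have hk' : ¬ K.Splits (up α l) k := fun hc => hl' (hK.split_splits hkl.symm hl hk h' h hc)
      rw [hK.cross_zero hkl hk hl h h' hl', up_comm hkl, hK.cross_zero hkl.symm hl hk h' h hk',
        smul_zero]
  · have h1 : ¬ K.Splits (up α k) l := fun hc => h' (hK.splits_of_up hk h hc)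
    have h2 : K.Splits (up α l) k := hK.splits_mono hl h' h
    rw [edge_merge h1, edge_split h, edge_split h2, edge_merge h', fsgn, if_neg (by tauto),
      if_neg (by tauto), one_smul]
  · have h1 : K.Splits (up α k) l := hK.splits_mono hk h h'
    have h2 : ¬ K.Splits (up α l) k := fun hc => h (hK.splits_of_up hl h' hc)
    rw [edge_split h1, edge_merge h, edge_merge h2, edge_split h', fsgn, if_neg (by tauto),
      if_neg (by tauto), one_smul]
  · by_cases hl' : K.Splits (up α k) l
    · have hk' := hK.merge_merge_symm hk hl h h' hl'
      rw [edge_split hl', edge_merge h, edge_split hk', edge_merge h', fsgn, if_neg (by tauto),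
        if_pos ⟨h, h', hl'⟩, map_mul, map_mul, map_sub, map_sub]
      rcases hK.par_or hk h h' hl' with ⟨h1, h2⟩ | ⟨h1, h2⟩
      · obtain ⟨e1, e2⟩ := hK.par hkl hk hl h h' hl' ((K.rel α).symm h1)
        rw [if_pos ((K.rel α).symm h1), proj_pt_eq e1, proj_pt_eq e2]
        simp [Units.smul_def, sub_mul]
      · obtain ⟨e1, e2⟩ := hK.antipar hkl hk hl h h' hl' ((K.rel α).symm h2)
        rw [if_neg, proj_pt_eq e1, proj_pt_eq e2, one_smul]
        intro hc
        exact h ((K.rel α).trans hc h1)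
    · have hk' : ¬ K.Splits (up α l) k := fun hc => hl' (hK.merge_merge_symm hl hk h' h hc)
      rw [edge_merge hl', edge_merge h, edge_merge hk', edge_merge h', fsgn, if_neg (by tauto),
        if_neg (by tauto), one_smul]

end ResCube

end

/-! ### Cycles of permutations and a finite check on six points. -/

section

open Equiv

/-! ### First return maps -/

/-- The first return map of `σ` to a subset. It also describes the cycles of the permutations that
arise from `σ` by first permuting the points of the subset. -/
theorem exists_return {Ω S : Type} [Finite Ω] (σ : Perm Ω) (e : S → Ω)
    (he : Function.Injective e) : ∃ ρ : Perm S, ∀ (τ : Perm Ω) (t : S → S) (θ : Perm S),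
      (∀ x, τ (e x) = σ (e (t x))) → (∀ z, z ∉ Set.range e → τ z = σ z) →
      (∀ x, θ x = ρ (t x)) → ∀ x y, τ.SameCycle (e x) (e y) ↔ θ.SameCycle x y := by
  classical
  have : Finite S := Finite.of_injective e he
  -- Some positive power of `σ` is the identity, so every point of the subset returns at the latest
  -- to itself.
  have ex : ∀ x, ∃ n, 1 ≤ n ∧ (σ ^ n) (e x) ∈ Set.range e := fun x =>
    ⟨orderOf σ, orderOf_pos σ, x, by simp [pow_orderOf_eq_one]⟩
  let N : S → ℕ := fun x => Nat.find (ex x)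
  have hN1 : ∀ x, 1 ≤ N x := fun x => (Nat.find_spec (ex x)).1
  have hmin : ∀ x j, 1 ≤ j → j < N x → (σ ^ j) (e x) ∉ Set.range e := fun x j h1 h2 h3 =>
    Nat.find_min (ex x) h2 ⟨h1, h3⟩
  choose r hr using fun x => (Nat.find_spec (ex x)).2
  have hr' : ∀ x, e (r x) = (σ ^ N x) (e x) := hr
  -- If two first returns coincide, cancel the shorter path: `e x` lies on the path from `e y` at
  -- the time `N y - N x`, which contradicts the minimality of `N y` unless this time is zero.
  have aux : ∀ x y, r x = r y → N x ≤ N y → x = y := by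
    intro x y hxy hle
    have h1 : (σ ^ N x) (e x) = (σ ^ N x) ((σ ^ (N y - N x)) (e y)) := by
      rw [← hr', hxy, hr', ← Perm.mul_apply, ← pow_add, Nat.add_sub_cancel' hle]
    have h2 := (σ ^ N x).injective h1
    by_cases h0 : N y - N x = 0
    · rw [h0] at h2; exact he (by simpa using h2)
    · exact absurd ⟨x, h2⟩ (hmin y _ (by omega) (by have := hN1 x; omega))
  have inj : Function.Injective r := fun x y hxy =>
    (le_total (N x) (N y)).elim (aux x y hxy) fun h => (aux y x hxy.symm h).symm
  refine ⟨Equiv.ofBijective r (Finite.injective_iff_bijective.1 inj), ?_⟩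
  intro τ t θ h1 h2 h3 x y
  have hθ : ∀ x, θ x = r (t x) := h3
  -- The path of `τ` from `e x` enters the path of `σ` from `e (t x)` and can leave it only at a
  -- point of the subset. So the first return of `τ` is `ρ ∘ t`, with the same `ρ` for all `τ`.
  have step : ∀ x j, 1 ≤ j → j ≤ N (t x) → (τ ^ j) (e x) = (σ ^ j) (e (t x)) := by
    intro x j hj
    induction j, hj using Nat.le_induction with
    | base => intro _; simp [h1]
    | succ j hj ih =>
      intro hle
      rw [pow_succ', pow_succ', Perm.mul_apply, Perm.mul_apply, ih (by omega)]
      exact h2 _ (hmin _ _ hj (by omega))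
  have ret : ∀ x, (τ ^ N (t x)) (e x) = e (θ x) := fun x => by
    rw [step x _ (hN1 _) le_rfl, hθ, hr']
  constructor
  · intro h
    obtain ⟨n, hn⟩ := h.exists_nat_pow_eq
    induction n using Nat.strong_induction_on generalizing x with
    | _ n ih =>
      rcases Nat.eq_zero_or_pos n with rfl | hpos
      · have : x = y := he (by simpa using hn)
        exact this ▸ Perm.SameCycle.refl _ _
      · by_cases hlt : n < N (t x)
        · exact absurd ⟨y, by rw [← step x n hpos hlt.le, hn]⟩ (hmin _ n hpos hlt)
        · push Not at hlt
          have e1 : (τ ^ (n - N (t x))) (e (θ x)) = e y := by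
            rw [← ret, ← Perm.mul_apply, ← pow_add, Nat.sub_add_cancel hlt, hn]
          have := hN1 (t x)
          have := ih (n - N (t x)) (by omega) (θ x) ⟨((n - N (t x) : ℕ) : ℤ), by simpa using e1⟩ e1
          exact Perm.sameCycle_apply_left.1 this
  · intro h
    obtain ⟨n, hn⟩ := h.exists_nat_pow_eq
    induction n generalizing x with
    | zero => rw [show x = y by simpa using hn]
    | succ n ih =>
      have : τ.SameCycle (e (θ x)) (e y) := by
        refine ih (θ x) (Perm.sameCycle_apply_left.2 h) ?_
        rw [← Perm.mul_apply, ← pow_succ, hn]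
      rw [← ret] at this
      exact Perm.sameCycle_pow_left.1 this

/-! ### Permutations of six points -/

namespace Six

/-- Whether `y` is among the first `n + 1` points of the orbit of `x`. -/
def reach (g : ℕ → ℕ) : ℕ → ℕ → ℕ → Bool
  | 0, x, y => Nat.beq x y
  | n + 1, x, y => Nat.beq x y || reach g n (g x) y

/-- The number with the binary digits `f 0, …, f (n - 1)`. -/
def bitsOf : ℕ → (ℕ → Bool) → ℕ
  | 0, _ => 0
  | n + 1, f => Nat.add (cond (f 0) 1 0) (Nat.mul 2 (bitsOf n fun i => f (Nat.succ i)))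

/-- Application, with a first argument that the kernel evaluates before substituting it. -/
def force {α : Type} (n : ℕ) (f : ℕ → α) : α :=
  Nat.rec (f 0) (fun k _ => f (Nat.succ k)) n

/-- The number with the octal digits `v 0, …, v 5`. -/
def code (v : ℕ → ℕ) : ℕ :=
  Nat.add (v 0) (Nat.mul 8 (Nat.add (v 1) (Nat.mul 8 (Nat.add (v 2) (Nat.mul 8
    (Nat.add (v 3) (Nat.mul 8 (Nat.add (v 4) (Nat.mul 8 (v 5))))))))))

/-- The octal digits of a number. -/
def look (r x : ℕ) : ℕ := Nat.mod (Nat.div r (Nat.pow 8 x)) 8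

/-- Exchange `2 i` and `2 i + 1` for those `i` for which `δ` has a binary digit `1`. -/
def flipc (δ x : ℕ) : ℕ := Nat.xor x (Nat.mod (Nat.div δ (Nat.pow 2 (Nat.div x 2))) 2)

/-- The table of the relation to be in the same cycle. -/
def table (r δ : ℕ) : ℕ :=
  force (code fun x => look r (flipc δ x)) fun s =>
    bitsOf 36 fun i => reach (look s) 7 (Nat.div i 6) (Nat.mod i 6)

/-- An entry of a table. -/
def query (m x y : ℕ) : Bool := Nat.testBit m (6 * x + y)

/-- Whether the sign of a face is `-1`. -/
def fs (q : ℕ → ℕ → ℕ → Bool) (c : ℕ → Bool) (d k l : ℕ) : Bool :=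
  cond (q d (2 * k) (2 * k + 1))
    (cond (q d (2 * l) (2 * l + 1))
      (cond (q (d + 2 ^ k) (2 * l) (2 * l + 1)) true
        (q (d + 2 ^ k) (2 * l + 1) (cond (c k) (2 * k + 1) (2 * k))))
      false)
    (cond (q d (2 * l) (2 * l + 1)) false
      (cond (q (d + 2 ^ k) (2 * l) (2 * l + 1)) (q d (2 * k) (2 * l)) false))

/-- The colours of two crossings between the same two circles agree. -/
def pl (q : ℕ → ℕ → ℕ → Bool) (c : ℕ → Bool) (d k l : ℕ) : Bool :=
  q d (2 * k) (2 * k + 1) ||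
    cond (q d (2 * k) (2 * l)) (!(q d (2 * k + 1) (2 * l + 1)))
      (!(q d (2 * k) (2 * l + 1) && q d (2 * k + 1) (2 * l))) ||
    xor (c k) (d.testBit k) == xor (c l) (d.testBit l)

/-- The product of the signs of the faces of a planar cube is `1`. -/
def chkCube (q : ℕ → ℕ → ℕ → Bool) (c : ℕ → Bool) : Bool :=
  !([0, 1, 2, 3, 4, 5, 6, 7].all fun d => pl q c d 0 1 && pl q c d 0 2 && pl q c d 1 2) ||
  (xor (xor (fs q c 0 0 1) (fs q c 4 0 1)) (xor (xor (fs q c 0 0 2) (fs q c 2 0 2))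
    (xor (fs q c 0 1 2) (fs q c 1 1 2))) == false)

/-- The properties of a planar face. -/
def chkFace (q : ℕ → ℕ → ℕ → Bool) (c : ℕ → Bool) : Bool :=
  !([0, 1, 2, 3].all fun d => pl q c d 0 1) ||
  ((!(q 0 0 1 && q 0 2 3 && q 1 2 3) || q 2 0 1) &&
   (!(!q 0 0 1 && !q 0 2 3 && q 1 2 3 && q 0 0 2) ||
      (q 3 (cond (c 0) 1 0) (cond (c 1) 2 3) && q 3 (cond (c 0) 0 1) (cond (c 1) 3 2))) &&
   (!(!q 0 0 1 && !q 0 2 3 && q 1 2 3 && q 0 0 3) ||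
      (q 3 (cond (c 0) 1 0) (cond (c 1) 3 2) && q 3 (cond (c 0) 0 1) (cond (c 1) 2 3))) &&
   fs q c 0 0 1 == fs q c 0 1 0)

/-- A change of smoothing changes whether its two arcs lie on the same circle. -/
def chkEdge (q : ℕ → ℕ → ℕ → Bool) : Bool := q 0 0 1 == !q 1 0 1

/-- The colouring with the colours `a`, `b`, `c`. -/
def col (a b c : Bool) (i : ℕ) : Bool := [a, b, c].getD i false

/-- The relations given by eight tables. -/
def rels (m0 m1 m2 m3 m4 m5 m6 m7 : ℕ) (d x y : ℕ) : Bool :=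
  query ([m0, m1, m2, m3, m4, m5, m6, m7].getD d 0) x y

/-- All properties, for all colourings. -/
def chkPerm (r : ℕ) : Bool :=
  force (table r 0) fun m0 => force (table r 1) fun m1 =>
  force (table r 2) fun m2 => force (table r 3) fun m3 =>
  force (table r 4) fun m4 => force (table r 5) fun m5 =>
  force (table r 6) fun m6 => force (table r 7) fun m7 =>
  [true, false].all fun a => [true, false].all fun b => [true, false].all fun c =>
    chkCube (rels m0 m1 m2 m3 m4 m5 m6 m7) (col a b c) &&
      chkFace (rels m0 m1 m2 m3 m4 m5 m6 m7) (col a b c) &&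
      chkEdge (rels m0 m1 m2 m3 m4 m5 m6 m7)

/-- All injective values at the remaining points. -/
def allInj : ℕ → List ℕ → (List ℕ → Bool) → Bool
  | 0, l, P => P l
  | n + 1, l, P => [0, 1, 2, 3, 4, 5].all fun b => l.elem b || allInj n (l ++ [b]) P

/-- The computation behind all facts about faces and cubes: 720 permutations of six ends, eight
resolutions, eight colourings. Configurations that violate the colour condition `pl` satisfy the
checks of faces and cubes vacuously. Permutations and tables are coded as single numbers, which
`force` has evaluated before they are used, so that the kernel computes with numerals. -/
theorem chkPerm_all : (allInj 6 [] fun l => force (code fun x => l.getD x 0) chkPerm) = true := by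
  decide +kernel

theorem rels_eq (m : ℕ → ℕ) (d x y : ℕ) (hd : d < 8) :
    rels (m 0) (m 1) (m 2) (m 3) (m 4) (m 5) (m 6) (m 7) d x y = query (m d) x y := by
  interval_cases d <;> rfl

theorem force_eq {α : Type} (n : ℕ) (f : ℕ → α) : force n f = f n := by
  cases n <;> rfl

theorem allInj_spec (v : ℕ → ℕ) (hv : ∀ x < 6, v x < 6)
    (hinj : ∀ x < 6, ∀ y < 6, v x = v y → x = y) (P : List ℕ → Bool) :
    ∀ n m, n + m = 6 → allInj n ((List.range m).map v) P = true →
      P ((List.range 6).map v) = true := by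
  intro n
  induction n with
  | zero => intro m hm h; obtain rfl : m = 6 := by omega
            exact h
  | succ n ih =>
    intro m hm h
    refine ih (m + 1) (by omega) ?_
    rw [allInj, List.all_eq_true] at h
    have := h (v m) (by have := hv m (by omega); simp; omega)
    rw [Bool.or_eq_true] at this
    rw [List.range_succ, List.map_append, List.map_singleton]
    refine this.resolve_left fun hc => ?_
    simp only [List.elem_eq_mem, List.mem_map, List.mem_range, decide_eq_true_eq] at hc
    obtain ⟨y, hy, hyv⟩ := hc
    have := hinj y (by omega) m (by omega) hyv
    omega

theorem look_code (v : ℕ → ℕ) (hv : ∀ x < 6, v x < 6) (x : ℕ) (hx : x < 6) :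
    look (code v) x = v x := by
  have h0 := hv 0; have h1 := hv 1; have h2 := hv 2; have h3 := hv 3; have h4 := hv 4
  have h5 := hv 5
  simp only [look, code, Nat.add_eq, Nat.mul_eq, Nat.pow_eq]
  change (_ : ℕ) / (_ : ℕ) % (_ : ℕ) = _
  interval_cases x <;> norm_num <;> omega

theorem testBit_bitsOf (n : ℕ) (f : ℕ → Bool) (i : ℕ) (hi : i < n) :
    (bitsOf n f).testBit i = f i := by
  induction n generalizing f i with
  | zero => omega
  | succ n ih =>
    have e : bitsOf (n + 1) f = Nat.bit (f 0) (bitsOf n fun i => f (i + 1)) := by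
      rw [bitsOf, Nat.bit_val]
      cases f 0 <;> simp [Nat.add_comm]
    rw [e]
    cases i with
    | zero => simp
    | succ i => rw [Nat.testBit_bit_succ, ih _ _ (by omega)]

theorem flipc_lt : ∀ d < 8, ∀ x < 6, flipc d x < 6 := by decide

theorem query_table (v : ℕ → ℕ) (hv : ∀ x < 6, v x < 6) (d : ℕ) (hd : d < 8) (x y : ℕ) (hx : x < 6)
    (hy : y < 6) : ∃ g : ℕ → ℕ, (∀ z < 6, g z = v (flipc d z)) ∧
      query (table (code v) d) x y = reach g 7 x y := by
  refine ⟨look (code fun x => look (code v) (flipc d x)), fun z hz => ?_, ?_⟩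
  · have hb : ∀ x < 6, look (code v) (flipc d x) = v (flipc d x) := fun x hx =>
      look_code v hv _ (flipc_lt d hd x hx)
    rw [look_code _ _ z hz, hb z hz]
    intro x hx
    rw [hb x hx]
    exact hv _ (flipc_lt d hd x hx)
  · rw [query, table, force_eq, testBit_bitsOf _ _ _ (by omega)]
    change reach _ 7 ((6 * x + y) / 6) ((6 * x + y) % 6) = _
    rw [show (6 * x + y) / 6 = x by omega, show (6 * x + y) % 6 = y by omega]

theorem reach_iff {S : Type} [Fintype S] [DecidableEq S] (hS : Fintype.card S ≤ 6) (θ : Perm S)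
    (enc : S → ℕ) (henc : Function.Injective enc) (g : ℕ → ℕ) (hg : ∀ z, g (enc z) = enc (θ z))
    (x y : S) : reach g 7 (enc x) (enc y) = true ↔ θ.SameCycle x y := by
  have key : ∀ n x, reach g n (enc x) (enc y) = true ↔ ∃ i ≤ n, (θ ^ i) x = y := by
    intro n
    induction n with
    | zero =>
      intro x
      rw [reach, Nat.beq_eq]
      constructor
      · intro h; exact ⟨0, le_rfl, henc h⟩
      · rintro ⟨i, hi, h⟩
        obtain rfl : i = 0 := by omega
        exact congrArg enc h
    | succ n ih =>
      intro x
      rw [reach, Bool.or_eq_true, Nat.beq_eq, hg, ih]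
      constructor
      · rintro (h | ⟨i, hi, h⟩)
        · exact ⟨0, by omega, henc h⟩
        · exact ⟨i + 1, by omega, by rw [pow_succ, Perm.mul_apply, h]⟩
      · rintro ⟨i, hi, h⟩
        cases i with
        | zero => exact .inl (congrArg enc h)
        | succ i => exact .inr ⟨i, by omega, by rw [← Perm.mul_apply, ← pow_succ, h]⟩
  rw [key]
  constructor
  · rintro ⟨i, -, h⟩
    exact ⟨i, by simpa using h⟩
  · intro h
    classical
    obtain ⟨i, -, hi, h⟩ := h.exists_pow_eq
    -- The exponent is bounded by one more than the size of a cycle, hence by 7; this is where the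
    -- number of steps in `reach g 7` comes from.
    have := (Finset.card_le_univ (θ.cycleOf x).support).trans hS
    exact ⟨i, by omega, h⟩

/-- The number of an end of a crossing. -/
def enc {n : ℕ} (z : Fin n × Bool) : ℕ := 2 * z.1 + cond z.2 1 0

theorem enc_injective {n : ℕ} : Function.Injective (enc (n := n)) := by
  rintro ⟨i, b⟩ ⟨j, c⟩ h
  simp only [enc] at h
  cases b <;> cases c <;> simp at h <;> simp [Fin.ext_iff]
  all_goals omega

theorem enc_lt {n : ℕ} (z : Fin n × Bool) : enc z < 2 * n := by
  obtain ⟨i, b⟩ := z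
  cases b <;> simp [enc] <;> omega

theorem flipc_enc_aux : ∀ d < 8, ∀ i < 3, ∀ b : Bool,
    flipc d (2 * i + cond b 1 0) = 2 * i + cond (xor (d.testBit i) b) 1 0 := by decide

theorem chkPerm_spec {r : ℕ} (h : chkPerm r = true) (a b c : Bool) :
    chkCube (rels (table r 0) (table r 1) (table r 2) (table r 3) (table r 4) (table r 5)
        (table r 6) (table r 7)) (col a b c) = true ∧
      chkFace (rels (table r 0) (table r 1) (table r 2) (table r 3) (table r 4) (table r 5)
        (table r 6) (table r 7)) (col a b c) = true ∧
      chkEdge (rels (table r 0) (table r 1) (table r 2) (table r 3) (table r 4) (table r 5)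
        (table r 6) (table r 7)) = true := by
  simp only [chkPerm, force_eq, List.all_eq_true, Bool.and_eq_true] at h
  have hb : ∀ b : Bool, b ∈ [true, false] := by decide
  have := h a (hb a) b (hb b) c (hb c)
  exact ⟨this.1.1, this.1.2, this.2⟩

/-- The properties of the relations that come from a planar configuration of crossings. -/
theorem exists_rels {n : ℕ} (hn : n ≤ 3) (ρ : Perm (Fin n × Bool)) :
    ∃ q : ℕ → ℕ → ℕ → Bool,
      (∀ d < 8, ∀ θ : Perm (Fin n × Bool), (∀ i b, θ (i, b) = ρ (i, xor (d.testBit i) b)) →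
        ∀ z w, q d (enc z) (enc w) = true ↔ θ.SameCycle z w) ∧
      ∀ a b c, chkCube q (col a b c) = true ∧ chkFace q (col a b c) = true ∧
        chkEdge q = true := by
  classical
  -- The numbers that are not ends of the `n` crossings are fixed. This makes configurations of one
  -- or two crossings special cases of those with three.
  let v : ℕ → ℕ := fun x => if h : ∃ z : Fin n × Bool, enc z = x then enc (ρ h.choose) else x
  have hve : ∀ z : Fin n × Bool, v (enc z) = enc (ρ z) := by
    intro z
    have h : ∃ z' : Fin n × Bool, enc z' = enc z := ⟨z, rfl⟩
    simp only [v, dif_pos h]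
    rw [enc_injective h.choose_spec]
  have hvn : ∀ x, (¬ ∃ z : Fin n × Bool, enc z = x) → v x = x := fun x h => dif_neg h
  have hv : ∀ x < 6, v x < 6 := by
    intro x hx
    by_cases h : ∃ z : Fin n × Bool, enc z = x
    · obtain ⟨z, rfl⟩ := h
      rw [hve]; have := enc_lt (ρ z); omega
    · rwa [hvn x h]
  have hinj : ∀ x < 6, ∀ y < 6, v x = v y → x = y := by
    intro x _ y _ hxy
    by_cases h : ∃ z : Fin n × Bool, enc z = x <;> by_cases h' : ∃ z : Fin n × Bool, enc z = y
    · obtain ⟨z, rfl⟩ := h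
      obtain ⟨w, rfl⟩ := h'
      rw [hve, hve] at hxy
      rw [ρ.injective (enc_injective hxy)]
    · obtain ⟨z, rfl⟩ := h
      rw [hve, hvn y h'] at hxy
      exact absurd ⟨_, hxy⟩ h'
    · obtain ⟨w, rfl⟩ := h'
      rw [hve, hvn x h] at hxy
      exact absurd ⟨_, hxy.symm⟩ h
    · rwa [hvn x h, hvn y h'] at hxy
  have hall := allInj_spec v hv hinj _ 6 0 rfl chkPerm_all
  rw [force_eq] at hall
  have hcode : (code fun x => ((List.range 6).map v).getD x 0) = code v := rfl
  rw [hcode] at hall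
  refine ⟨rels (table (code v) 0) (table (code v) 1) (table (code v) 2) (table (code v) 3)
    (table (code v) 4) (table (code v) 5) (table (code v) 6) (table (code v) 7), ?_, ?_⟩
  · intro d hd θ hθ z w
    have hz := enc_lt z
    have hw := enc_lt w
    obtain ⟨g, hg, hq⟩ := query_table v hv d hd (enc z) (enc w) (by omega) (by omega)
    refine (iff_of_eq (congrArg (· = true) ((rels_eq (table (code v)) d _ _ hd).trans hq))).trans ?_
    refine reach_iff (by simp; omega) θ enc enc_injective g ?_ z w
    rintro ⟨i, b⟩
    have := enc_lt (i, b)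
    rw [hg _ (by omega), hθ, ← hve]
    exact congrArg v (flipc_enc_aux d hd i (by omega) b)
  · exact chkPerm_spec hall

end Six

end

/-! ### Cubes that are described by permutations have the required properties. -/

section

open Equiv

theorem sameCycle_le {Ω : Type} [Finite Ω] {σ : Perm Ω} (R : Setoid Ω) (h : ∀ x, R x (σ x))
    {x y : Ω} (hxy : σ.SameCycle x y) : R x y := by
  obtain ⟨n, hn⟩ := hxy.exists_nat_pow_eq
  induction n generalizing x with
  | zero => rw [show x = y by simpa using hn]
  | succ n ih =>
    refine R.trans (h x) (ih (Perm.sameCycle_apply_left.2 hxy) ?_)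
    rw [← Perm.mul_apply, ← pow_succ, hn]

/-- The equivalence relation that arises by joining two classes. -/
def joinSetoid {Ω : Type} (R : Setoid Ω) (p q : Ω) : Setoid Ω where
  r x y := R x y ∨ (R x p ∧ R y q) ∨ (R x q ∧ R y p)
  iseqv :=
    { refl := fun x => .inl (R.refl x)
      symm := by
        rintro x y (h | ⟨h, h'⟩ | ⟨h, h'⟩)
        · exact .inl (R.symm h)
        · exact .inr (.inr ⟨h', h⟩)
        · exact .inr (.inl ⟨h', h⟩)
      trans := by
        rintro x y z (h | ⟨h, h'⟩ | ⟨h, h'⟩) (g | ⟨g, g'⟩ | ⟨g, g'⟩)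
        · exact .inl (R.trans h g)
        · exact .inr (.inl ⟨R.trans h g, g'⟩)
        · exact .inr (.inr ⟨R.trans h g, g'⟩)
        · exact .inr (.inl ⟨h, R.trans (R.symm g) h'⟩)
        · exact .inl (R.trans h (R.trans (R.symm g) (R.trans h' (R.symm g'))))
        · exact .inl (R.trans h (R.symm g'))
        · exact .inr (.inr ⟨h, R.trans (R.symm g) h'⟩)
        · exact .inl (R.trans h (R.symm g'))
        · exact .inl (R.trans h (R.trans (R.symm g) (R.trans h' (R.symm g')))) }

/-- The cycles of a permutation. -/
def cycles {Ω : Type} (σ : Perm Ω) : Setoid Ω := Perm.SameCycle.setoid σ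

theorem cycles_iff {Ω : Type} {σ : Perm Ω} {x y : Ω} : cycles σ x y ↔ σ.SameCycle x y := Iff.rfl

/-- The permutations differ by a transposition, so their cycles differ at most by joining those of
`p` and `q`. This inclusion and the next, with the roles of `σ` and `τ` exchanged as needed, yield
`merge_iff` and `split_iff`. -/
theorem cycles_le_of_swap {Ω : Type} [Finite Ω] {σ τ : Perm Ω} {p q : Ω} (h1 : τ p = σ q)
    (h2 : τ q = σ p) (h3 : ∀ x, x ≠ p → x ≠ q → τ x = σ x) (hpq : τ.SameCycle p q) {x y : Ω}
    (h : σ.SameCycle x y) : τ.SameCycle x y := by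
  refine sameCycle_le (cycles τ) (fun x => ?_) h
  rw [cycles_iff]
  by_cases hp : x = p
  · subst hp; rw [← h2]; exact Perm.sameCycle_apply_right.2 hpq
  by_cases hq : x = q
  · subst hq; rw [← h1]; exact Perm.sameCycle_apply_right.2 hpq.symm
  · rw [← h3 x hp hq]; exact Perm.sameCycle_apply_right.2 (Perm.SameCycle.refl _ _)

theorem cycles_join_of_swap {Ω : Type} [Finite Ω] {σ τ : Perm Ω} {p q : Ω} (h1 : τ p = σ q)
    (h2 : τ q = σ p) (h3 : ∀ x, x ≠ p → x ≠ q → τ x = σ x) {x y : Ω}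
    (h : τ.SameCycle x y) : joinSetoid (cycles σ) p q x y := by
  have hr : ∀ x, cycles σ x x := (cycles σ).refl
  have hr' : ∀ x, cycles σ (σ x) x := fun x =>
    Perm.sameCycle_apply_left.2 (Perm.SameCycle.refl _ _)
  refine sameCycle_le _ (fun x => ?_) h
  by_cases hp : x = p
  · subst hp; rw [h1]; exact .inr (.inl ⟨hr _, hr' _⟩)
  by_cases hq : x = q
  · subst hq; rw [h2]; exact .inr (.inr ⟨hr _, hr' _⟩)
  · rw [h3 x hp hq]; exact .inl ((cycles σ).symm (hr' _))

namespace ResCube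

variable {ι Ω : Type} [DecidableEq ι]

/-- A description of a cube of resolutions by permutations: `σ α` follows the oriented circles
of `α`, `P k b` are the points at which the two arcs of the crossing `k` start, and `color k` tells
on which side of the oriented arcs of the 0-smoothing the arrow at `k` lies. -/
structure PermModel (K : ResCube ι Ω) where
  P : ι → Bool → Ω
  inj : ∀ {k b k' b'}, P k b = P k' b' → k = k' ∧ b = b'
  base : Perm Ω
  σ : (ι → Bool) → Perm Ω
  σ_P : ∀ α k b, σ α (P k b) = base (P k (xor (α k) b))
  σ_N : ∀ α x, (∀ k b, x ≠ P k b) → σ α x = base x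
  rel_iff : ∀ {α p q}, K.rel α p q ↔ (σ α).SameCycle p q
  color : ι → Bool
  s0 : ∀ k, K.s0 k = P k false
  t0 : ∀ k, K.t0 k = P k true
  s1 : ∀ k, K.s1 k = P k (color k)
  t1 : ∀ k, K.t1 k = P k (!color k)
  -- What is used of planarity beyond the permutations: crossings between the same two circles have
  -- the same colour, once it is corrected by the smoothing. The finite check assumes this as
  -- `Six.pl`.
  planar : ∀ {α k l}, ¬ K.rel α (P k false) (P k true) →
    (K.rel α (P k false) (P l false) ∧ K.rel α (P k true) (P l true)) ∨
      (K.rel α (P k false) (P l true) ∧ K.rel α (P k true) (P l false)) →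
    xor (color k) (α k) = xor (color l) (α l)

variable {K : ResCube ι Ω} (M : PermModel K)

namespace PermModel

/-- The relations between the ends of at most three crossings. -/
theorem config [Finite Ω] {n : ℕ} (hn : n ≤ 3) (c : Fin n → ι) (hc : Function.Injective c)
    {α : ι → Bool} (hα : ∀ i, α (c i) = false) :
    ∃ q : ℕ → ℕ → ℕ → Bool,
      (∀ d < 8, ∀ i j b b', q d (Six.enc (i, b)) (Six.enc (j, b')) = true ↔
        K.rel (Function.extend c (fun i => d.testBit i) α) (M.P (c i) b) (M.P (c j) b')) ∧
      ∀ a b c, Six.chkCube q (Six.col a b c) = true ∧ Six.chkFace q (Six.col a b c) = true ∧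
        Six.chkEdge q = true := by
  have he : Function.Injective fun z : Fin n × Bool => M.P (c z.1) z.2 := by
    rintro ⟨i, b⟩ ⟨j, b'⟩ h
    obtain ⟨h1, h2⟩ := M.inj h
    exact Prod.ext (hc h1) h2
  -- One return map, taken at `α`, serves all resolutions that differ from `α` only at the chosen
  -- crossings: such a resolution exchanges the two ends of the changed crossings before `ρ` is
  -- applied.
  obtain ⟨ρ, hρ⟩ := exists_return (M.σ α) _ he
  obtain ⟨q, hq, hchk⟩ := Six.exists_rels hn ρ
  refine ⟨q, fun d hd i j b b' => ?_, hchk⟩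
  have hinv : Function.Involutive fun z : Fin n × Bool => (z.1, xor (d.testBit z.1) z.2) := by
    rintro ⟨i, b⟩; simp
  rw [hq d hd (ρ * hinv.toPerm) (fun i b => rfl), M.rel_iff,
    hρ (M.σ (Function.extend c (fun i => d.testBit i) α))
      (fun z => (z.1, xor (d.testBit z.1) z.2)) (ρ * hinv.toPerm) ?_ ?_ (fun _ => rfl)
      (i, b) (j, b')]
  · rintro ⟨i, b⟩
    simp only [M.σ_P, hα, hc.extend_apply, Bool.false_xor]
  · intro z hz
    by_cases h : ∃ k b, z = M.P k b
    · obtain ⟨k, b, rfl⟩ := h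
      rw [M.σ_P, M.σ_P, Function.extend_apply']
      rintro ⟨i, rfl⟩
      exact hz ⟨(i, b), rfl⟩
    · push Not at h
      rw [M.σ_N _ _ h, M.σ_N _ _ h]

/-- Composition with the transposition of two points cuts their common cycle or joins their two
cycles; there is no third possibility for oriented circles. -/
theorem edge_iff [Finite Ω] {α : ι → Bool} {k : ι} (hk : α k = false) :
    K.rel α (M.P k false) (M.P k true) ↔ ¬ K.rel (up α k) (M.P k false) (M.P k true) := by
  obtain ⟨q, hq, hchk⟩ := M.config (n := 1) (by omega) (fun _ => k)
    (fun i j _ => Subsingleton.elim i j) (α := α) (fun _ => hk)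
  have h0 := hq 0 (by omega) 0 0 false true
  have h1 := hq 1 (by omega) 0 0 false true
  have hc : Function.Injective fun _ : Fin 1 => k := fun i j _ => Subsingleton.elim i j
  have e0 : Function.extend (fun _ : Fin 1 => k) (fun i => (0 : ℕ).testBit i) α = α := by
    funext l
    by_cases h : ∃ i : Fin 1, (fun _ : Fin 1 => k) i = l
    · obtain ⟨i, rfl⟩ := h
      rw [hc.extend_apply _ _ i]; simp [hk]
    · rw [Function.extend_apply' _ _ _ h]
  have e1 : Function.extend (fun _ : Fin 1 => k) (fun i => (1 : ℕ).testBit i) α = up α k := by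
    funext l
    by_cases h : ∃ i : Fin 1, (fun _ : Fin 1 => k) i = l
    · obtain ⟨i, rfl⟩ := h
      rw [hc.extend_apply _ _ i]
      simp [up]
    · rw [Function.extend_apply' _ _ _ h, up, Function.update_of_ne]
      rintro rfl; exact h ⟨0, rfl⟩
  rw [e0] at h0; rw [e1] at h1
  have := (hchk false false false).2.2
  rw [← h0, ← h1]
  simp only [Six.chkEdge] at this
  simp only [Six.enc]
  simp at this ⊢
  rw [this]

theorem swap_facts {α : ι → Bool} {k : ι} (hk : α k = false) :
    M.σ (up α k) (M.P k false) = M.σ α (M.P k true) ∧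
    M.σ (up α k) (M.P k true) = M.σ α (M.P k false) ∧
    ∀ x, x ≠ M.P k false → x ≠ M.P k true → M.σ (up α k) x = M.σ α x := by
  refine ⟨by simp [M.σ_P, up, hk], by simp [M.σ_P, up, hk], fun x h1 h2 => ?_⟩
  by_cases h : ∃ l b, x = M.P l b
  · obtain ⟨l, b, rfl⟩ := h
    have : l ≠ k := by
      rintro rfl
      cases b
      · exact h1 rfl
      · exact h2 rfl
    rw [M.σ_P, M.σ_P, up, Function.update_of_ne this]
  · push Not at h
    rw [M.σ_N _ _ h, M.σ_N _ _ h]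

theorem splits_iff {α : ι → Bool} {k : ι} :
    K.Splits α k ↔ K.rel α (M.P k false) (M.P k true) := by
  rw [Splits, M.s0, M.t0]

/-- The ends of the crossings in a nonempty list, two for each crossing. -/
def ends (l : List ι) (x : ℕ) (h : l ≠ [] := by simp) : Ω :=
  M.P (l.getD (x / 2) (l.head h)) (x % 2 == 1)

/-- The relations between the ends of two crossings. -/
theorem config_two [Finite Ω] {k l : ι} (hkl : k ≠ l) {α : ι → Bool} (hk : α k = false)
    (hl : α l = false) :
    ∃ q : ℕ → ℕ → ℕ → Bool,
      (∀ d < 4, ∀ x < 4, ∀ y < 4, q d x y = true ↔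
        K.rel ([α, up α k, up α l, up (up α k) l].getD d α) (M.ends [k, l] x) (M.ends [k, l] y)) ∧
      ∀ a b c, Six.chkFace q (Six.col a b c) = true := by
  have hc : Function.Injective ![k, l] := by
    intro i j h
    fin_cases i <;> fin_cases j <;> simp_all
  obtain ⟨q, hq, hchk⟩ := M.config (n := 2) (by omega) ![k, l] hc (α := α)
    (by intro i; fin_cases i <;> simp [hk, hl])
  refine ⟨q, fun d hd x hx y hy => ?_, fun a b c => (hchk a b c).2.1⟩
  have e : Function.extend ![k, l] (fun i => d.testBit i) α =
      [α, up α k, up α l, up (up α k) l].getD d α := by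
    funext m
    by_cases h : ∃ i, ![k, l] i = m
    · obtain ⟨i, rfl⟩ := h
      rw [hc.extend_apply]
      interval_cases d <;> fin_cases i <;> simp [hk, hl, up, hkl, hkl.symm, Nat.testBit]
    · rw [Function.extend_apply' _ _ _ h]
      have h1 : m ≠ k := by rintro rfl; exact h ⟨0, rfl⟩
      have h2 : m ≠ l := by rintro rfl; exact h ⟨1, rfl⟩
      interval_cases d <;> simp [up, h1, h2]
  rw [← e]
  have hE : ∀ x < 4, ∃ i b, Six.enc (i, b) = x ∧ M.ends [k, l] x = M.P (![k, l] i) b := by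
    intro x hx
    interval_cases x
    · exact ⟨0, false, rfl, rfl⟩
    · exact ⟨0, true, rfl, rfl⟩
    · exact ⟨1, false, rfl, rfl⟩
    · exact ⟨1, true, rfl, rfl⟩
  obtain ⟨i, b, rfl, hx'⟩ := hE x hx
  obtain ⟨j, b', rfl, hy'⟩ := hE y hy
  rw [hx', hy']
  exact hq d (by omega) i j b b'

/-- The relations between the ends of three crossings. -/
theorem config_three [Finite Ω] {k l m : ι} (hkl : k ≠ l) (hkm : k ≠ m) (hlm : l ≠ m)
    {α : ι → Bool} (hk : α k = false) (hl : α l = false) (hm : α m = false) :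
    ∃ q : ℕ → ℕ → ℕ → Bool,
      (∀ d < 8, ∀ x < 6, ∀ y < 6, q d x y = true ↔
        K.rel ([α, up α k, up α l, up (up α k) l, up α m, up (up α k) m, up (up α l) m,
          up (up (up α k) l) m].getD d α) (M.ends [k, l, m] x)
          (M.ends [k, l, m] y)) ∧
      ∀ a b c, Six.chkCube q (Six.col a b c) = true := by
  have hc : Function.Injective ![k, l, m] := by
    intro i j h
    fin_cases i <;> fin_cases j <;> simp_all
  obtain ⟨q, hq, hchk⟩ := M.config (n := 3) (by omega) ![k, l, m] hc (α := α)
    (by intro i; fin_cases i <;> simp [hk, hl, hm])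
  refine ⟨q, fun d hd x hx y hy => ?_, fun a b c => (hchk a b c).1⟩
  have e : Function.extend ![k, l, m] (fun i => d.testBit i) α =
      [α, up α k, up α l, up (up α k) l, up α m, up (up α k) m, up (up α l) m,
          up (up (up α k) l) m].getD d α := by
    funext z
    by_cases h : ∃ i, ![k, l, m] i = z
    · obtain ⟨i, rfl⟩ := h
      rw [hc.extend_apply]
      interval_cases d <;> fin_cases i <;>
        simp [hk, hl, hm, up, hkl, hkl.symm, hkm, hkm.symm, hlm, hlm.symm, Nat.testBit]
    · rw [Function.extend_apply' _ _ _ h]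
      have h1 : z ≠ k := by rintro rfl; exact h ⟨0, rfl⟩
      have h2 : z ≠ l := by rintro rfl; exact h ⟨1, rfl⟩
      have h3 : z ≠ m := by rintro rfl; exact h ⟨2, rfl⟩
      interval_cases d <;> simp [up, h1, h2, h3]
  rw [← e]
  have hE : ∀ x < 6, ∃ i b, Six.enc (i, b) = x ∧ M.ends [k, l, m] x = M.P (![k, l, m] i) b := by
    intro x hx
    interval_cases x
    · exact ⟨0, false, rfl, rfl⟩
    · exact ⟨0, true, rfl, rfl⟩
    · exact ⟨1, false, rfl, rfl⟩
    · exact ⟨1, true, rfl, rfl⟩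
    · exact ⟨2, false, rfl, rfl⟩
    · exact ⟨2, true, rfl, rfl⟩
  obtain ⟨i, b, rfl, hx'⟩ := hE x hx
  obtain ⟨j, b', rfl, hy'⟩ := hE y hy
  rw [hx', hy']
  exact hq d (by omega) i j b b'

theorem _root_.Six.pl_of {q : ℕ → ℕ → ℕ → Bool} {c : ℕ → Bool} {d k l : ℕ}
    (h : q d (2 * k) (2 * k + 1) ≠ true →
      (q d (2 * k) (2 * l) = true ∧ q d (2 * k + 1) (2 * l + 1) = true) ∨
        (q d (2 * k) (2 * l + 1) = true ∧ q d (2 * k + 1) (2 * l) = true) →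
      xor (c k) (d.testBit k) = xor (c l) (d.testBit l)) : Six.pl q c d k l = true := by
  rw [Six.pl]
  cases h1 : q d (2 * k) (2 * k + 1) <;> cases h2 : q d (2 * k) (2 * l) <;>
    cases h3 : q d (2 * k + 1) (2 * l + 1) <;> cases h4 : q d (2 * k) (2 * l + 1) <;>
    cases h5 : q d (2 * k + 1) (2 * l) <;> simp_all

theorem fsgn_eq_cond {q : ℕ → ℕ → ℕ → Bool} {c : ℕ → Bool} {d i j : ℕ} {α : ι → Bool} {k l : ι}
    (h1 : q d (2 * i) (2 * i + 1) = true ↔ K.Splits α k)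
    (h2 : q d (2 * j) (2 * j + 1) = true ↔ K.Splits α l)
    (h3 : q (d + 2 ^ i) (2 * j) (2 * j + 1) = true ↔ K.Splits (up α k) l)
    (h4 : q (d + 2 ^ i) (2 * j + 1) (cond (c i) (2 * i + 1) (2 * i)) = true ↔
      K.rel (up α k) (K.t0 l) (K.s1 k))
    (h5 : q d (2 * i) (2 * j) = true ↔ K.rel α (K.s0 k) (K.s0 l)) :
    K.fsgn α k l = cond (Six.fs q c d i j) (-1) 1 := by
  rw [fsgn, Six.fs]
  cases e1 : q d (2 * i) (2 * i + 1) <;> cases e2 : q d (2 * j) (2 * j + 1) <;>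
    cases e3 : q (d + 2 ^ i) (2 * j) (2 * j + 1) <;>
    cases e4 : q (d + 2 ^ i) (2 * j + 1) (cond (c i) (2 * i + 1) (2 * i)) <;>
    cases e5 : q d (2 * i) (2 * j) <;> simp_all

theorem planar' {α : ι → Bool} {k l : ι} (h : ¬ K.rel α (M.P k false) (M.P k true))
    (h' : (K.rel α (M.P k false) (M.P l false) ∧ K.rel α (M.P k true) (M.P l true)) ∨
      (K.rel α (M.P k false) (M.P l true) ∧ K.rel α (M.P k true) (M.P l false)))
    {a b : Bool} (ha : α k = a) (hb : α l = b) : xor (M.color k) a = xor (M.color l) b := by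
  subst ha hb
  exact M.planar h h'

/-- The ends of the two crossings form, over the four resolutions of the face, a configuration
covered by the finite check. `planar` supplies the colour condition under which the check was made,
and the conclusions are read off from `Six.chkFace`. -/
theorem face_facts (M : PermModel K) [Finite Ω] {k l : ι} (hkl : k ≠ l) {α : ι → Bool} (hk : α k = false)
    (hl : α l = false) :
    (K.Splits α k → K.Splits α l → K.Splits (up α k) l → K.Splits (up α l) k) ∧
    (¬ K.Splits α k → ¬ K.Splits α l → K.Splits (up α k) l → K.rel α (K.s0 k) (K.s0 l) →
      K.rel (up (up α k) l) (K.s1 k) (K.t1 l) ∧ K.rel (up (up α k) l) (K.t1 k) (K.s1 l)) ∧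
    (¬ K.Splits α k → ¬ K.Splits α l → K.Splits (up α k) l → K.rel α (K.s0 k) (K.t0 l) →
      K.rel (up (up α k) l) (K.s1 k) (K.s1 l) ∧ K.rel (up (up α k) l) (K.t1 k) (K.t1 l)) ∧
    K.fsgn α k l = K.fsgn α l k := by
  obtain ⟨q, hq, hchk⟩ := M.config_two hkl hk hl
  have h := hchk (M.color k) (M.color l) false
  have hpl : ∀ d < 4, Six.pl q (Six.col (M.color k) (M.color l) false) d 0 1 = true := by
    intro d hd
    refine Six.pl_of fun h1 h2 => ?_
    rw [ne_eq, hq d hd _ (by omega) _ (by omega)] at h1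
    rw [hq d hd _ (by omega) _ (by omega), hq d hd _ (by omega) _ (by omega),
      hq d hd _ (by omega) _ (by omega), hq d hd _ (by omega) _ (by omega)] at h2
    refine M.planar' h1 h2 ?_ ?_ <;> interval_cases d <;>
      simp [hk, hl, up, hkl, hkl.symm, Nat.testBit]
  have hall : ([0, 1, 2, 3].all fun d =>
      Six.pl q (Six.col (M.color k) (M.color l) false) d 0 1) = true := by
    simp [hpl]
  have hfs1 : K.fsgn α k l =
      cond (Six.fs q (Six.col (M.color k) (M.color l) false) 0 0 1) (-1) 1 := by
    refine fsgn_eq_cond ?_ ?_ ?_ ?_ ?_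
    · rw [hq _ (by omega) _ (by omega) _ (by omega), M.splits_iff]; rfl
    · rw [hq _ (by omega) _ (by omega) _ (by omega), M.splits_iff]; rfl
    · rw [hq _ (by omega) _ (by omega) _ (by omega), M.splits_iff]; rfl
    · rw [hq _ (by omega) _ (by omega) _ (by cases M.color k <;> simp [Six.col]), M.t0, M.s1]
      cases hc : M.color k <;> simp [Six.col] <;> rfl
    · rw [hq _ (by omega) _ (by omega) _ (by omega), M.s0, M.s0]; rfl
  have hfs2 : K.fsgn α l k =
      cond (Six.fs q (Six.col (M.color k) (M.color l) false) 0 1 0) (-1) 1 := by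
    refine fsgn_eq_cond ?_ ?_ ?_ ?_ ?_
    · rw [hq _ (by omega) _ (by omega) _ (by omega), M.splits_iff]; rfl
    · rw [hq _ (by omega) _ (by omega) _ (by omega), M.splits_iff]; rfl
    · rw [hq _ (by omega) _ (by omega) _ (by omega), M.splits_iff]; rfl
    · rw [hq _ (by omega) _ (by omega) _ (by cases M.color l <;> simp [Six.col]), M.t0, M.s1]
      cases hc : M.color l <;> simp [Six.col] <;> rfl
    · rw [hq _ (by omega) _ (by omega) _ (by omega), M.s0, M.s0]; rfl
  simp only [Six.chkFace, hall, Bool.not_true, Bool.false_or, Bool.and_eq_true, Bool.or_eq_true,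
    Bool.not_eq_true', beq_iff_eq, Bool.and_eq_false_iff, Bool.not_eq_false'] at h
  obtain ⟨⟨⟨h1, h2⟩, h3⟩, h4⟩ := h
  have a1 : q 0 0 1 = true ↔ K.Splits α k := by
    rw [hq _ (by omega) _ (by omega) _ (by omega), M.splits_iff]; rfl
  have a2 : q 0 2 3 = true ↔ K.Splits α l := by
    rw [hq _ (by omega) _ (by omega) _ (by omega), M.splits_iff]; rfl
  have a3 : q 1 2 3 = true ↔ K.Splits (up α k) l := by
    rw [hq _ (by omega) _ (by omega) _ (by omega), M.splits_iff]; rfl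
  have a4 : q 2 0 1 = true ↔ K.Splits (up α l) k := by
    rw [hq _ (by omega) _ (by omega) _ (by omega), M.splits_iff]; rfl
  have a5 : q 0 0 2 = true ↔ K.rel α (K.s0 k) (K.s0 l) := by
    rw [hq _ (by omega) _ (by omega) _ (by omega), M.s0, M.s0]; rfl
  have a6 : q 0 0 3 = true ↔ K.rel α (K.s0 k) (K.t0 l) := by
    rw [hq _ (by omega) _ (by omega) _ (by omega), M.s0, M.t0]; rfl
  have b1 : ∀ b b' : Bool, q 3 (cond b 1 0) (cond b' 3 2) = true ↔
      K.rel (up (up α k) l) (M.P k b) (M.P l b') := by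
    intro b b'
    rw [hq _ (by omega) _ (by cases b <;> simp) _ (by cases b' <;> simp)]
    cases b <;> cases b' <;> rfl
  have b2 : ∀ b : Bool, cond b 0 1 = cond (!b) 1 0 := by decide
  have b3 : ∀ b : Bool, cond b 2 3 = cond (!b) 3 2 := by decide
  simp only [Six.col, List.getD_cons_zero, List.getD_cons_succ, b2, b3, b1] at h2 h3
  simp only [M.s1, M.t1]
  simp only [← a1, ← a2, ← a3, ← a4, ← a5, ← a6]
  refine ⟨?_, ?_, ?_, by rw [hfs1, hfs2, h4]⟩
  · intro e1 e2 e3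
    simpa [e1, e2, e3] using h1
  · intro e1 e2 e3 e4
    simpa [e1, e2, e3, e4] using h2
  · intro e1 e2 e3 e4
    simpa [e1, e2, e3, e4] using h3

/-- The same argument for the eight resolutions of three crossings and `Six.chkCube`. -/
theorem cube_fact (M : PermModel K) [Finite Ω] {k l m : ι} (hkl : k ≠ l) (hkm : k ≠ m)
    (hlm : l ≠ m) {α : ι → Bool} (hk : α k = false) (hl : α l = false) (hm : α m = false) :
    K.fsgn α k l * K.fsgn (up α m) k l * (K.fsgn α k m * K.fsgn (up α l) k m) *
      (K.fsgn α l m * K.fsgn (up α k) l m) = 1 := by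
  obtain ⟨q, hq, hchk⟩ := M.config_three hkl hkm hlm hk hl hm
  have h := hchk (M.color k) (M.color l) (M.color m)
  set c := Six.col (M.color k) (M.color l) (M.color m)
  have hcol : ∀ i < 3, c i = M.color ([k, l, m].getD i k) := by
    intro i hi; interval_cases i <;> rfl
  have hpl : ∀ d < 8, ∀ i < 3, ∀ j < 3, Six.pl q c d i j = true := by
    intro d hd i hi j hj
    have hval : ∀ i < 3, [α, up α k, up α l, up (up α k) l, up α m, up (up α k) m, up (up α l) m,
          up (up (up α k) l) m].getD d α ([k, l, m].getD i k) = d.testBit i := by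
      intro i hi
      interval_cases d <;> interval_cases i <;>
        simp [hk, hl, hm, up, hkl, hkl.symm, hkm, hkm.symm, hlm, hlm.symm, Nat.testBit]
    have hends : ∀ i < 3, M.ends [k, l, m] (2 * i) = M.P ([k, l, m].getD i k) false ∧
        M.ends [k, l, m] (2 * i + 1) = M.P ([k, l, m].getD i k) true := by
      intro i hi; interval_cases i <;> exact ⟨rfl, rfl⟩
    refine Six.pl_of fun h1 h2 => ?_
    rw [ne_eq, hq d hd _ (by omega) _ (by omega)] at h1
    rw [hq d hd _ (by omega) _ (by omega), hq d hd _ (by omega) _ (by omega),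
      hq d hd _ (by omega) _ (by omega), hq d hd _ (by omega) _ (by omega)] at h2
    rw [(hends i hi).1, (hends i hi).2] at h1 h2
    rw [(hends j hj).1, (hends j hj).2] at h2
    rw [hcol i hi, hcol j hj]
    exact M.planar' h1 h2 (hval i hi) (hval j hj)
  have hall : ([0, 1, 2, 3, 4, 5, 6, 7].all fun d =>
      Six.pl q c d 0 1 && Six.pl q c d 0 2 && Six.pl q c d 1 2) = true := by
    simp [hpl]
  rw [Six.chkCube, hall, Bool.not_true, Bool.false_or, beq_iff_eq] at h
  have hends : ∀ i < 3, ∀ b : Bool, M.ends [k, l, m] (cond b (2 * i + 1) (2 * i)) =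
      M.P ([k, l, m].getD i k) b := by
    intro i hi b; interval_cases i <;> cases b <;> rfl
  -- The vertices are listed by the binary number `d` of their 1-smoothings, so a change at the
  -- crossing with index `i` leads from `d` to `d + 2 ^ i`.
  have fsg : ∀ d < 8, ∀ i < 3, ∀ j < 3, d + 2 ^ i < 8 → ∀ β γ : ι → Bool,
      [α, up α k, up α l, up (up α k) l, up α m, up (up α k) m, up (up α l) m,
          up (up (up α k) l) m].getD d α = β →
      [α, up α k, up α l, up (up α k) l, up α m, up (up α k) m, up (up α l) m,
          up (up (up α k) l) m].getD (d + 2 ^ i) α = γ → ∀ x y : ι,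
      [k, l, m].getD i k = x → [k, l, m].getD j k = y → γ = up β x →
      K.fsgn β x y = cond (Six.fs q c d i j) (-1) 1 := by
    rintro d hd i hi j hj hdi β γ hβ hγ x y hx hy rfl
    have e0 := fun i hi => hends i hi false
    have e1 := fun i hi => hends i hi true
    simp only [cond_true, cond_false] at e0 e1
    refine fsgn_eq_cond ?_ ?_ ?_ ?_ ?_
    · rw [hq _ (by omega) _ (by omega) _ (by omega), M.splits_iff, e0 i hi, e1 i hi, hβ, hx]
    · rw [hq _ (by omega) _ (by omega) _ (by omega), M.splits_iff, e0 j hj, e1 j hj, hβ, hy]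
    · rw [hq _ (by omega) _ (by omega) _ (by omega), M.splits_iff, e0 j hj, e1 j hj, hγ, hy]
    · rw [hq _ (by omega) _ (by omega) _ (by cases c i <;> simp <;> omega), M.t0, M.s1, e1 j hj,
        hends i hi, hγ, hy, hx, hcol i hi, hx]
    · rw [hq _ (by omega) _ (by omega) _ (by omega), M.s0, M.s0, e0 i hi, e0 j hj, hβ, hx, hy]
  rw [fsg 0 (by omega) 0 (by omega) 1 (by omega) (by omega) α _ rfl rfl k l rfl rfl rfl,
    fsg 4 (by omega) 0 (by omega) 1 (by omega) (by omega) (up α m) _ rfl rfl k l rfl rfl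
      (up_comm hkm),
    fsg 0 (by omega) 0 (by omega) 2 (by omega) (by omega) α _ rfl rfl k m rfl rfl rfl,
    fsg 2 (by omega) 0 (by omega) 2 (by omega) (by omega) (up α l) _ rfl rfl k m rfl rfl
      (up_comm hkl),
    fsg 0 (by omega) 1 (by omega) 2 (by omega) (by omega) α _ rfl rfl l m rfl rfl rfl,
    fsg 1 (by omega) 1 (by omega) 2 (by omega) (by omega) (up α k) _ rfl rfl l m rfl rfl rfl]
  revert h
  generalize Six.fs q c 0 0 1 = x1
  generalize Six.fs q c 4 0 1 = x2
  generalize Six.fs q c 0 0 2 = x3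
  generalize Six.fs q c 2 0 2 = x4
  generalize Six.fs q c 0 1 2 = x5
  generalize Six.fs q c 1 1 2 = x6
  revert x1 x2 x3 x4 x5 x6
  decide

end PermModel

/-- A cube with a description by permutations has all the properties used below. -/
theorem PermModel.good (M : PermModel K) [Finite Ω] : K.Good where
  merge_iff := by
    intro α k hk h p q
    obtain ⟨h1, h2, h3⟩ := M.swap_facts hk
    have hup : K.rel (up α k) (M.P k false) (M.P k true) := by
      by_contra hc
      exact h (M.splits_iff.2 ((M.edge_iff hk).2 hc))
    rw [M.s0, M.t0]
    constructor
    · intro hpq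
      have := cycles_join_of_swap h1 h2 h3 (M.rel_iff.1 hpq)
      simp only [M.rel_iff]
      exact this
    · intro hpq
      have hle : ∀ {x y}, K.rel α x y → K.rel (up α k) x y := fun hxy =>
        M.rel_iff.2 (cycles_le_of_swap h1 h2 h3 (M.rel_iff.1 hup) (M.rel_iff.1 hxy))
      have tr := @(K.rel (up α k)).trans
      have sy := @(K.rel (up α k)).symm
      rcases hpq with hpq | ⟨hp, hq⟩ | ⟨hp, hq⟩
      · exact hle hpq
      · exact tr (hle hp) (tr hup (sy (hle hq)))
      · exact tr (hle hp) (tr (sy hup) (sy (hle hq)))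
  split_iff := by
    intro α k hk h p q
    obtain ⟨h1, h2, h3⟩ := M.swap_facts hk
    have hsp := M.splits_iff.1 h
    have h4 : ∀ x, x ≠ M.P k false → x ≠ M.P k true → M.σ α x = M.σ (up α k) x :=
      fun x hx hx' => (h3 x hx hx').symm
    have main : K.rel α p q ↔ K.rel (up α k) p q ∨
        (K.rel (up α k) p (M.P k false) ∧ K.rel (up α k) q (M.P k true)) ∨
          (K.rel (up α k) p (M.P k true) ∧ K.rel (up α k) q (M.P k false)) := by
      constructor
      · intro hpq
        have := cycles_join_of_swap h2.symm h1.symm h4 (M.rel_iff.1 hpq)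
        simp only [M.rel_iff]
        exact this
      · intro hpq
        have hle : ∀ {x y}, K.rel (up α k) x y → K.rel α x y := fun hxy =>
          M.rel_iff.2 (cycles_le_of_swap h2.symm h1.symm h4 (M.rel_iff.1 hsp) (M.rel_iff.1 hxy))
        have tr := @(K.rel α).trans
        have sy := @(K.rel α).symm
        rcases hpq with hpq | ⟨hp, hq⟩ | ⟨hp, hq⟩
        · exact hle hpq
        · exact tr (hle hp) (tr hsp (sy (hle hq)))
        · exact tr (hle hp) (tr (sy hsp) (sy (hle hq)))
    rw [main, M.s1, M.t1]
    cases M.color k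
    · rfl
    · simp only [Bool.not_true]
      tauto
  split_ne := by
    intro α k hk h hc
    have hsp := (M.edge_iff hk).1 (M.splits_iff.1 h)
    rw [M.s1, M.t1] at hc
    cases hcol : M.color k <;> rw [hcol] at hc
    · exact hsp hc
    · exact hsp ((K.rel _).symm hc)
  merge_ends := by
    intro α k hk h
    have hup : K.rel (up α k) (M.P k false) (M.P k true) := by
      by_contra hc
      exact h (M.splits_iff.2 ((M.edge_iff hk).2 hc))
    rw [M.s1, M.t1]
    cases M.color k
    · exact hup
    · exact (K.rel _).symm hup
  split_splits := fun hkl hk hl => (M.face_facts hkl hk hl).1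
  par := fun hkl hk hl => (M.face_facts hkl hk hl).2.1
  antipar := fun hkl hk hl => (M.face_facts hkl hk hl).2.2.1
  fsgn_symm := fun hkl hk hl => (M.face_facts hkl hk hl).2.2.2
  cube := fun hkl hkm hlm hk hl hm => M.cube_fact hkl hkm hlm hk hl hm

end ResCube

end

/-! ### Signs, arrows and boundaries in an abstract cube. -/

noncomputable section

open PtAlg

namespace ResCube

variable {ι Ω : Type} [DecidableEq ι] {K : ResCube ι Ω} {R : Type*} [CommRing R]

/-! ### Sign assignments -/

/-- A sign assignment that makes the faces of the cube anticommute. -/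
def Valid (K : ResCube ι Ω) (ε : (ι → Bool) → ι → ℤˣ) : Prop :=
  ∀ α k l, k ≠ l → α k = false → α l = false →
    ε α k * ε (up α k) l * (ε α l * ε (up α l) k) = -K.fsgn α k l

/-- Two sign assignments differ by a sign for every vertex. -/
theorem Valid.gauge [Fintype ι] {ε ε' : (ι → Bool) → ι → ℤˣ} (h : K.Valid ε) (h' : K.Valid ε') :
    ∃ η : (ι → Bool) → ℤˣ, ∀ α k, α k = false → ε' α k = η α * η (up α k) * ε α k := by
  -- The signs at the vertices are built up one direction at a time; `s` is the set of directions
  -- already treated.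
  suffices H : ∀ s : Finset ι, ∃ η : (ι → Bool) → ℤˣ, ∀ k ∈ s, ∀ α, α k = false →
      ε' α k = η α * η (up α k) * ε α k by
    obtain ⟨η, hη⟩ := H Finset.univ
    exact ⟨η, fun α k => hη k (Finset.mem_univ k) α⟩
  intro s
  induction s using Finset.induction_on with
  | empty => exact ⟨fun _ => 1, by simp⟩
  | insert a s ha ih =>
    obtain ⟨η, hη⟩ := ih
    -- On the half `α a = 1` the value is forced by the edge in the direction `a`. The conditions
    -- for the faces containing that direction then carry the comparison in the directions of `s`
    -- over from the half `α a = 0`.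
    refine ⟨fun α => if α a then ε (dn α a) a * ε' (dn α a) a * η (dn α a) else η α, ?_⟩
    intro k hk α hα
    rcases Finset.mem_insert.1 hk with rfl | hks
    · have : (up α k) k = true := by simp
      simp only [hα, this, if_true, dn_up hα, Bool.false_eq_true, if_false]
      generalize η α = x; generalize ε α k = y; generalize ε' α k = z
      revert x y z; decide
    · have hka : k ≠ a := by rintro rfl; exact ha hks
      have e1 : (up α k) a = α a := by simp [up, hka.symm]
      cases hαa : α a with
      | false => simpa [e1, hαa] using hη k hks α hα
      | true =>
        have e2 : dn (up α k) a = up (dn α a) k := Function.update_comm hka _ _ _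
        have e3 : up (dn α a) a = α := up_dn hαa
        have hk0 : dn α a k = false := by simp [dn, hka, hα]
        have ha0 : dn α a a = false := by simp
        have f1 := h (dn α a) a k hka.symm ha0 hk0
        have f2 := h' (dn α a) a k hka.symm ha0 hk0
        have f3 := hη k hks (dn α a) hk0
        have e1' : up α k a = true := e1.trans hαa
        simp only [e1', hαa, if_true, e2]
        rw [e3] at f1 f2
        rw [← f1] at f2
        revert f2 f3
        generalize ε' (dn α a) a = x1
        generalize ε' α k = x2
        generalize ε' (dn α a) k = x3
        generalize ε' (up (dn α a) k) a = x4
        generalize ε (dn α a) a = y1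
        generalize ε α k = y2
        generalize ε (dn α a) k = y3
        generalize ε (up (dn α a) k) a = y4
        generalize η (dn α a) = z1
        generalize η (up (dn α a) k) = z2
        intro f2 f3
        subst f3
        revert f2
        revert x1 x2 x4 y1 y2 y3 y4 z1 z2
        decide

/-- The sign assignment of the iterated mapping cone, in the order given by `r`. -/
def coneSign [Fintype ι] (K : ResCube ι Ω) (r : ι → ℕ) (α : ι → Bool) (x : ι) : ℤˣ :=
  ∏ y : ι with r x < r y ∧ α y = true, -K.fsgn (fun z => if r y ≤ r z then false else α z) x y

theorem coneSign_top [Fintype ι] {r : ι → ℕ} {α : ι → Bool} {x : ι}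
    (h : ∀ y, r x < r y → α y = false) : K.coneSign r α x = 1 := by
  rw [coneSign, Finset.filter_eq_empty_iff.2, Finset.prod_empty]
  rintro y - ⟨h1, h2⟩
  simp [h y h1] at h2

theorem coneSign_rec [Fintype ι] {r : ι → ℕ} (hr : Function.Injective r) {α : ι → Bool} {x z : ι}
    (hxz : r x < r z) (hz : α z = true) (h : ∀ y, r z < r y → α y = false) :
    K.coneSign r α x = -K.fsgn (dn α z) x z * K.coneSign r (dn α z) x := by
  have e : (Finset.univ.filter fun y => r x < r y ∧ α y = true) =
      insert z (Finset.univ.filter fun y => r x < r y ∧ dn α z y = true) := by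
    ext y
    by_cases hy : y = z
    · subst hy; simp [hxz, hz]
    · simp [hy, dn]
  rw [coneSign, e, Finset.prod_insert (by simp [dn])]
  congr 1
  · congr 2
    funext w
    by_cases hw : w = z
    · subst hw; simp
    · by_cases hle : r z ≤ r w
      · rw [if_pos hle, dn, Function.update_of_ne hw,
          h w (lt_of_le_of_ne hle fun hc => hw (hr hc).symm)]
      · rw [if_neg hle, dn, Function.update_of_ne hw]
  · refine Finset.prod_congr rfl fun y hy => ?_
    simp only [Finset.mem_filter, Finset.mem_univ, true_and] at hy
    have hyz : y ≠ z := by rintro rfl; simp at hy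
    have hyα : α y = true := by simpa [dn, hyz] using hy.2
    have hlt : r y < r z := by
      rcases lt_trichotomy (r y) (r z) with hlt | heq | hgt
      · exact hlt
      · exact absurd (hr heq) hyz
      · rw [h y hgt] at hyα; simp at hyα
    congr 2
    funext w
    by_cases hw : w = z
    · subst hw; simp [hlt.le]
    · simp [dn, hw]

/-- Let `l` be the later of the two directions; induct on the number of 1-smoothings. If some
crossing after `l` is 1-smoothed, take the last one, `z`: the recursion moves the face to the
opposite face of the cube in the directions `k`, `l`, `z`, and the six face signs multiply to `1`.
If there is none, both edges in direction `l` have sign `1` and the recursion for the edge in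
direction `k` is the claim. -/
theorem Good.valid_coneSign [Fintype ι] (hK : K.Good) {r : ι → ℕ} (hr : Function.Injective r) :
    K.Valid (K.coneSign r) := by
  have main : ∀ n, ∀ α k l, (Finset.univ.filter fun y => α y = true).card = n → r k < r l →
      α k = false → α l = false →
      K.coneSign r α k * K.coneSign r (up α k) l * (K.coneSign r α l * K.coneSign r (up α l) k) =
        -K.fsgn α k l := by
    intro n
    induction n using Nat.strong_induction_on with
    | _ n ih =>
      intro α k l hn hkl hk hl
      have hne : k ≠ l := by rintro rfl; exact lt_irrefl _ hkl
      by_cases hex : ∃ z, α z = true ∧ r l < r z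
      · obtain ⟨z, ⟨hz, hlz⟩, hmax⟩ : ∃ z, (α z = true ∧ r l < r z) ∧
            ∀ y, r z < r y → α y = false := by
          obtain ⟨z, hz, hm⟩ := Finset.exists_max_image
            (Finset.univ.filter fun z => α z = true ∧ r l < r z) r
            (by obtain ⟨z, hz⟩ := hex; exact ⟨z, by simpa using hz⟩)
          refine ⟨z, by simpa using hz, fun y hy => ?_⟩
          by_contra hc
          have := hm y (by simp at hz ⊢; exact ⟨by simpa using hc, by omega⟩)
          omega
        have hkz : k ≠ z := by rintro rfl; omega
        have hlz' : l ≠ z := by rintro rfl; omega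
        have a1 : up α k z = true := by simp [up, hkz.symm, hz]
        have a2 : up α l z = true := by simp [up, hlz'.symm, hz]
        have b1 : ∀ y, r z < r y → up α k y = false := fun y hy => by
          have : y ≠ k := by rintro rfl; omega
          simp [up, this, hmax y hy]
        have b2 : ∀ y, r z < r y → up α l y = false := fun y hy => by
          have : y ≠ l := by rintro rfl; omega
          simp [up, this, hmax y hy]
        have c1 : dn (up α k) z = up (dn α z) k := Function.update_comm hkz _ _ _
        have c2 : dn (up α l) z = up (dn α z) l := Function.update_comm hlz' _ _ _
        have hk0 : dn α z k = false := by simp [dn, hkz, hk]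
        have hl0 : dn α z l = false := by simp [dn, hlz', hl]
        have hcard : (Finset.univ.filter fun y => dn α z y = true).card < n := by
          rw [← hn]
          refine Finset.card_lt_card (Finset.ssubset_iff.2 ⟨z, by simp, ?_⟩)
          intro y hy
          rcases Finset.mem_insert.1 hy with rfl | hy
          · simpa using hz
          · by_cases hyz : y = z
            · subst hyz; simp at hy
            · simpa [dn, hyz] using hy
        have IH := ih _ hcard (dn α z) k l rfl hkl hk0 hl0
        have C := hK.cube hne hkz hlz' hk0 hl0 (by simp)
        rw [up_dn hz] at C
        rw [coneSign_rec hr (by omega) hz hmax, coneSign_rec hr hlz a1 b1, coneSign_rec hr hlz hz hmax,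
          coneSign_rec hr (by omega) a2 b2, c1, c2]
        revert IH C
        generalize K.fsgn (dn α z) k l = x1
        generalize K.fsgn α k l = x2
        generalize K.fsgn (dn α z) k z = x3
        generalize K.fsgn (up (dn α z) l) k z = x4
        generalize K.fsgn (dn α z) l z = x5
        generalize K.fsgn (up (dn α z) k) l z = x6
        generalize K.coneSign r (dn α z) k = y1
        generalize K.coneSign r (up (dn α z) k) l = y2
        generalize K.coneSign r (dn α z) l = y3
        generalize K.coneSign r (up (dn α z) l) k = y4
        intro IH
        have e : x1 = -(y1 * y2 * (y3 * y4)) := by rw [IH, neg_neg]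
        subst e
        clear IH
        intro C
        have e : x2 = -(y1 * y2 * (y3 * y4)) * (x3 * x4) * (x5 * x6) := by
          revert C; revert x2 x3 x4 x5 x6
          generalize -(y1 * y2 * (y3 * y4)) = w
          revert w
          decide
        rw [e]
        simp only [neg_mul, mul_neg, neg_neg]
        ac_rfl
      · push Not at hex
        have htop : ∀ y, r l < r y → α y = false := fun y hy => by
          by_contra hc
          have := hex y (by simpa using hc)
          omega
        have b1 : ∀ y, r l < r y → up α k y = false := fun y hy => by
          have : y ≠ k := by rintro rfl; omega
          simp [up, this, htop y hy]
        have b2 : ∀ y, r l < r y → up α l y = false := fun y hy => by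
          have : y ≠ l := by rintro rfl; omega
          simp [up, this, htop y hy]
        rw [coneSign_top htop, coneSign_top b1, coneSign_rec hr hkl (by simp) b2, dn_up hl]
        generalize K.fsgn α k l = x
        generalize K.coneSign r α k = y
        revert x y; decide
  intro α k l hkl hk hl
  rcases lt_trichotomy (r k) (r l) with h | h | h
  · exact main _ α k l rfl h hk hl
  · exact absurd (hr h) hkl
  · have := main _ α l k rfl h hl hk
    rw [hK.fsgn_symm hkl.symm hl hk] at this
    rw [← this, mul_comm]

theorem Good.exists_valid [Finite ι] (hK : K.Good) : ∃ ε, K.Valid ε := by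
  cases nonempty_fintype ι
  exact ⟨_, hK.valid_coneSign (r := fun i => (Fintype.equivFin ι i : ℕ))
    (Fin.val_injective.comp (Fintype.equivFin ι).injective)⟩

/-! ### The differential -/

/-- The differential, on elements upstairs. -/
def d [Fintype ι] (K : ResCube ι Ω) (ε : (ι → Bool) → ι → ℤˣ) (x : (ι → Bool) → PtAlg R Ω)
    (β : ι → Bool) : PtAlg R Ω :=
  ∑ k, if β k = true then ε (dn β k) k • K.edge R (dn β k) k (x (dn β k)) else 0

/-- The element `z` at the resolution `a` represents a boundary. -/
def Bounds [Fintype ι] (K : ResCube ι Ω) (ε : (ι → Bool) → ι → ℤˣ) (a : ι → Bool)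
    (z : PtAlg R Ω) : Prop :=
  ∃ x : (ι → Bool) → PtAlg R Ω, ∀ β, (β = a → K.proj R β (K.d ε x β) = K.proj R β z) ∧
    (β ≠ a → K.proj R β (K.d ε x β) = 0)

theorem edge_units_smul (α : ι → Bool) (k : ι) (u : ℤˣ) (x : PtAlg R Ω) :
    K.edge R α k (u • x) = u • K.edge R α k x := by
  simp only [Units.smul_def, map_zsmul]

theorem proj_units_smul (α : ι → Bool) (u : ℤˣ) (x : PtAlg R Ω) :
    K.proj R α (u • x) = u • K.proj R α x := by
  simp only [Units.smul_def, map_zsmul]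

/-- Multiplication by the vertex signs is an isomorphism between the two complexes; the extra factor
`η a` makes it fix `z`. -/
theorem Bounds.of_valid [Fintype ι] {ε ε' : (ι → Bool) → ι → ℤˣ} (h : K.Valid ε)
    (h' : K.Valid ε') {a : ι → Bool} {z : PtAlg R Ω} (hz : K.Bounds ε a z) : K.Bounds ε' a z := by
  obtain ⟨η, hη⟩ := h.gauge h'
  obtain ⟨x, hx⟩ := hz
  have key : ∀ β, K.d ε' (fun α => (η a * η α) • x α) β = (η a * η β) • K.d ε x β := by
    intro β
    rw [d, d, Finset.smul_sum]
    refine Finset.sum_congr rfl fun k _ => ?_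
    by_cases hk : β k = true
    · rw [if_pos hk, if_pos hk, hη _ _ (by simp), up_dn hk, edge_units_smul, smul_smul, smul_smul]
      congr 1
      generalize η (dn β k) = x; generalize η β = y; generalize η a = z
      generalize ε (dn β k) k = w
      revert x y z w; decide
    · rw [if_neg hk, if_neg hk, smul_zero]
  refine ⟨fun α => (η a * η α) • x α, fun β => ⟨?_, fun hβ => ?_⟩⟩
  · rintro rfl
    rw [key, proj_units_smul, (hx β).1 rfl, Int.units_mul_self, one_smul]
  · rw [key, proj_units_smul, (hx β).2 hβ, smul_zero]

/-- The element `z` at the resolution `a` represents a boundary, for some sign assignment. -/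
def Bounding [Fintype ι] (K : ResCube ι Ω) (a : ι → Bool) (z : PtAlg R Ω) : Prop :=
  ∃ ε, K.Valid ε ∧ K.Bounds ε a z

/-! ### Reversal of arrows -/

/-- Reverse the arrows at the crossings with `w k = true`. -/
def flip (K : ResCube ι Ω) (w : ι → Bool) : ResCube ι Ω where
  rel := K.rel
  s0 k := cond (w k) (K.t0 k) (K.s0 k)
  t0 k := cond (w k) (K.s0 k) (K.t0 k)
  s1 k := cond (w k) (K.t1 k) (K.s1 k)
  t1 k := cond (w k) (K.s1 k) (K.t1 k)

theorem flip_rel (w : ι → Bool) : (K.flip w).rel = K.rel := rfl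

theorem flip_s0 (w : ι → Bool) (k : ι) : (K.flip w).s0 k = cond (w k) (K.t0 k) (K.s0 k) := rfl

theorem flip_t0 (w : ι → Bool) (k : ι) : (K.flip w).t0 k = cond (w k) (K.s0 k) (K.t0 k) := rfl

theorem flip_s1 (w : ι → Bool) (k : ι) : (K.flip w).s1 k = cond (w k) (K.t1 k) (K.s1 k) := rfl

theorem splits_flip {w : ι → Bool} {α : ι → Bool} {k : ι} :
    (K.flip w).Splits α k ↔ K.Splits α k := by
  change K.rel α (cond (w k) (K.t0 k) (K.s0 k)) (cond (w k) (K.s0 k) (K.t0 k)) ↔ K.rel α _ _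
  cases w k
  · exact Iff.rfl
  · exact ⟨fun h => (K.rel α).symm h, fun h => (K.rel α).symm h⟩

open Classical in
/-- The sign by which the map of an edge changes when arrows are reversed. -/
def flipSign (K : ResCube ι Ω) (w : ι → Bool) (α : ι → Bool) (k : ι) : ℤˣ :=
  if w k = true ∧ K.Splits α k then -1 else 1

/-- Reversing an arrow negates exactly the split maps in its direction, and the sign of a face
changes by the product of these signs over its four edges. For interlaced splits, where both
compositions vanish, the rule still holds: reversing one arrow exchanges the types X and Y, and only
the two initial edges of the face are splits. -/
theorem Good.fsgn_flip (hK : K.Good) (w : ι → Bool) {α : ι → Bool} {k l : ι} (hkl : k ≠ l)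
    (hk : α k = false) (hl : α l = false) :
    (K.flip w).fsgn α k l = K.fsgn α k l *
      (K.flipSign w α k * K.flipSign w (up α l) k * (K.flipSign w α l * K.flipSign w (up α k) l)) := by
  have e : (K.flip w).Splits = K.Splits := by
    funext α k
    exact propext splits_flip
  simp only [fsgn, flipSign]
  rw [e, flip_rel, flip_s0, flip_s0, flip_t0, flip_s1]
  have sy : ∀ {p q}, K.rel α p q → K.rel α q p := (K.rel α).symm
  have tr : ∀ {p q r}, K.rel α p q → K.rel α q r → K.rel α p r := (K.rel α).trans
  have sy' : ∀ {p q}, K.rel (up α k) p q → K.rel (up α k) q p := (K.rel (up α k)).symm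
  have tr' : ∀ {p q r}, K.rel (up α k) p q → K.rel (up α k) q r → K.rel (up α k) p r :=
    (K.rel (up α k)).trans
  by_cases h : K.Splits α k <;> by_cases h' : K.Splits α l
  · by_cases hl' : K.Splits (up α k) l
    · have hk' := hK.split_splits hkl hk hl h h' hl'
      cases w k <;> cases w l <;> simp [h, h', hl', hk']
    · have hk' : ¬ K.Splits (up α l) k := fun hc => hl' (hK.split_splits hkl.symm hl hk h' h hc)
      have hne := hK.split_ne hk h
      rcases hK.cross_or hk h h' hl' with ⟨h1, h2⟩ | ⟨h1, h2⟩
      · have n1 : ¬ K.rel (up α k) (K.s0 l) (K.t1 k) := fun hc => hne (tr' (sy' h1) hc)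
        have n2 : ¬ K.rel (up α k) (K.t0 l) (K.s1 k) := fun hc => hne (tr' (sy' hc) h2)
        generalize w k = b
        generalize w l = c
        cases b <;> cases c <;>
          dsimp only [cond_true, cond_false] <;>
          simp [h, h', hl', hk', h1, h2, n1, n2]
      · have n1 : ¬ K.rel (up α k) (K.s0 l) (K.s1 k) := fun hc => hne (tr' (sy' hc) h1)
        have n2 : ¬ K.rel (up α k) (K.t0 l) (K.t1 k) := fun hc => hne (tr' (sy' h2) hc)
        generalize w k = b
        generalize w l = c
        cases b <;> cases c <;>
          dsimp only [cond_true, cond_false] <;>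
          simp [h, h', hl', hk', h1, h2, n1, n2]
  · have h1 : ¬ K.Splits (up α k) l := fun hc => h' (hK.splits_of_up hk h hc)
    have h2 : K.Splits (up α l) k := hK.splits_mono hl h' h
    cases w k <;> cases w l <;> simp [h, h', h1, h2]
  · have h1 : K.Splits (up α k) l := hK.splits_mono hk h h'
    have h2 : ¬ K.Splits (up α l) k := fun hc => h (hK.splits_of_up hl h' hc)
    cases w k <;> cases w l <;> simp [h, h', h1, h2]
  · by_cases hl' : K.Splits (up α k) l
    · have hk' := hK.merge_merge_symm hk hl h h' hl'
      rcases hK.par_or hk h h' hl' with ⟨h1, h2⟩ | ⟨h1, h2⟩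
      · have m1 := sy h1
        have m2 := sy h2
        have n1 : ¬ K.rel α (K.s0 k) (K.t0 l) := fun hc => h (tr hc h2)
        have n2 : ¬ K.rel α (K.t0 k) (K.s0 l) := fun hc => h (sy (tr hc h1))
        generalize w k = b
        generalize w l = c
        cases b <;> cases c <;>
          dsimp only [cond_true, cond_false] <;>
          simp [h, h', hl', hk', m1, m2, n1, n2]
      · have m1 := sy h1
        have m2 := sy h2
        have n1 : ¬ K.rel α (K.s0 k) (K.s0 l) := fun hc => h (tr hc h1)
        have n2 : ¬ K.rel α (K.t0 k) (K.t0 l) := fun hc => h (sy (tr hc h2))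
        generalize w k = b
        generalize w l = c
        cases b <;> cases c <;>
          dsimp only [cond_true, cond_false] <;>
          simp [h, h', hl', hk', m1, m2, n1, n2]
    · have hk' : ¬ K.Splits (up α l) k := fun hc => hl' (hK.merge_merge_symm hl hk h' h hc)
      cases w k <;> cases w l <;> simp [h, h', hl', hk']

/-- Multiplying the sign assignment by `flipSign` keeps it valid and undoes the change of the edge
maps. The differential on elements upstairs is then literally unchanged, so the same family bounds
`z`. -/
theorem Good.bounding_flip [Fintype ι] (hK : K.Good) (w : ι → Bool) {a : ι → Bool}
    {z : PtAlg R Ω} (h : K.Bounding a z) : (K.flip w).Bounding a z := by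
  obtain ⟨ε, hε, x, hx⟩ := h
  refine ⟨fun α k => ε α k * K.flipSign w α k, ?_, x, ?_⟩
  · intro α k l hkl hk hl
    rw [hK.fsgn_flip w hkl hk hl, ← neg_mul, ← hε α k l hkl hk hl]
    dsimp only
    ac_rfl
  · have key : ∀ β, (K.flip w).d (fun α k => ε α k * K.flipSign w α k) x β = K.d ε x β := by
      intro β
      refine Finset.sum_congr rfl fun k _ => ?_
      by_cases hk : β k = true
      · rw [if_pos hk, if_pos hk, mul_smul]
        congr 1
        by_cases hs : K.Splits (dn β k) k
        · rw [edge_split (splits_flip.2 hs), edge_split hs]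
          cases hw : w k <;> simp [flipSign, flip, hs, hw, Units.smul_def, ← neg_mul]
        · rw [edge_merge (mt splits_flip.1 hs), edge_merge hs, flipSign, if_neg (by tauto), one_smul]
      · rw [if_neg hk, if_neg hk]
    intro β
    rw [key]
    exact hx β

end ResCube

end

/-! ### Maps between cubes, and the square of the differential. -/

noncomputable section

open PtAlg

namespace ResCube

variable {ι κ Ω Ω' : Type} [DecidableEq ι] [DecidableEq κ] {K : ResCube ι Ω} {L : ResCube κ Ω'}
  {R : Type*} [CommRing R]

/-! ### Comparison of cubes -/

/-- A map of points that is compatible with the circles and the arrows. -/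
structure Hom (K : ResCube ι Ω) (L : ResCube κ Ω') (e : κ ≃ ι) (φ : Ω → Ω') : Prop where
  rel : ∀ α p q, K.rel α p q → L.rel (α ∘ e) (φ p) (φ q)
  s0 : ∀ α k, α (e k) = false → L.rel (α ∘ e) (φ (K.s0 (e k))) (L.s0 k)
  t0 : ∀ α k, α (e k) = false → L.rel (α ∘ e) (φ (K.t0 (e k))) (L.t0 k)
  s1 : ∀ α k, α (e k) = true → L.rel (α ∘ e) (φ (K.s1 (e k))) (L.s1 k)
  t1 : ∀ α k, α (e k) = true → L.rel (α ∘ e) (φ (K.t1 (e k))) (L.t1 k)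

theorem rel_conj {α : ι → Bool} {p q p' q' : Ω} (h : K.rel α p q) (hp : K.rel α p p')
    (hq : K.rel α q q') : K.rel α p' q' :=
  (K.rel α).trans ((K.rel α).symm hp) ((K.rel α).trans h hq)

theorem up_comp (e : κ ≃ ι) (α : ι → Bool) (k : κ) : up α (e k) ∘ e = up (α ∘ e) k := by
  funext x
  by_cases h : x = k
  · subst h; simp [up]
  · simp [up, h]

theorem dn_comp (e : κ ≃ ι) (α : ι → Bool) (k : κ) : dn α (e k) ∘ e = dn (α ∘ e) k := by
  funext x
  by_cases h : x = k
  · subst h; simp [dn]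
  · simp [dn, h]

variable {e : κ ≃ ι} {φ : Ω → Ω'} {ψ : Ω' → Ω}

theorem comp_symm (α : ι → Bool) : (α ∘ e) ∘ e.symm = α := by
  funext x; simp

/-- The two maps of points go in opposite directions but need not be inverse to each other. Since
both respect circles and arrows, relations between ends of arrows can be transferred both ways, and
this is all that splits and face signs depend on. -/
theorem Hom.splits_iff (h : K.Hom L e φ) (h' : L.Hom K e.symm ψ) {α : ι → Bool} {k : κ}
    (hk : α (e k) = false) : L.Splits (α ∘ e) k ↔ K.Splits α (e k) := by
  constructor
  · intro hs
    have hk' : (α ∘ e) (e.symm (e k)) = false := by simpa using hk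
    have := rel_conj (h'.rel _ _ _ hs) (p' := K.s0 (e k)) (q' := K.t0 (e k))
      (by simpa using h'.s0 (α ∘ e) (e k) hk') (by simpa using h'.t0 (α ∘ e) (e k) hk')
    rwa [comp_symm] at this
  · intro hs
    exact rel_conj (h.rel _ _ _ hs) (h.s0 _ _ hk) (h.t0 _ _ hk)

theorem Hom.fsgn_eq (h : K.Hom L e φ) (h' : L.Hom K e.symm ψ) {α : ι → Bool} {k l : κ}
    (hkl : k ≠ l) (hk : α (e k) = false) (hl : α (e l) = false) :
    L.fsgn (α ∘ e) k l = K.fsgn α (e k) (e l) := by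
  have hk' : (α ∘ e) (e.symm (e k)) = false := by simpa using hk
  have hl' : (α ∘ e) (e.symm (e l)) = false := by simpa using hl
  have hl1 : up α (e k) (e l) = false := by simp [up, hkl.symm, hl]
  have e1 : L.rel (up (α ∘ e) k) (L.t0 l) (L.s1 k) ↔ K.rel (up α (e k)) (K.t0 (e l)) (K.s1 (e k)) := by
    rw [← up_comp]
    constructor
    · intro hs
      have := rel_conj (h'.rel _ _ _ hs) (p' := K.t0 (e l)) (q' := K.s1 (e k))
        (by simpa using h'.t0 (up α (e k) ∘ e) (e l) (by simpa using hl1))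
        (by simpa using h'.s1 (up α (e k) ∘ e) (e k) (by simp))
      rwa [comp_symm] at this
    · intro hs
      exact rel_conj (h.rel _ _ _ hs) (h.t0 _ _ hl1) (h.s1 _ _ (by simp))
  have e2 : L.rel (α ∘ e) (L.s0 k) (L.s0 l) ↔ K.rel α (K.s0 (e k)) (K.s0 (e l)) := by
    constructor
    · intro hs
      have := rel_conj (h'.rel _ _ _ hs) (p' := K.s0 (e k)) (q' := K.s0 (e l))
        (by simpa using h'.s0 (α ∘ e) (e k) hk') (by simpa using h'.s0 (α ∘ e) (e l) hl')
      rwa [comp_symm] at this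
    · intro hs
      exact rel_conj (h.rel _ _ _ hs) (h.s0 _ _ hk) (h.s0 _ _ hl)
  have e3 : L.Splits (up (α ∘ e) k) l ↔ K.Splits (up α (e k)) (e l) := by
    rw [← up_comp]
    exact h.splits_iff h' hl1
  rw [fsgn, fsgn, propext e1, propext e2, propext e3, propext (h.splits_iff h' hk),
    propext (h.splits_iff h' hl)]

theorem Hom.proj_edge (h : K.Hom L e φ) (h' : L.Hom K e.symm ψ) {α : ι → Bool} {k : κ}
    (hk : α (e k) = false) (x : PtAlg R Ω) :
    L.proj R (up (α ∘ e) k) (L.edge R (α ∘ e) k (emap R φ x)) =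
      L.proj R (up (α ∘ e) k) (emap R φ (K.edge R α (e k) x)) := by
  by_cases hs : K.Splits α (e k)
  · rw [edge_split hs, edge_split ((h.splits_iff h' hk).2 hs), map_mul, map_mul, map_mul, map_sub,
      map_sub, map_sub, emap_pt, emap_pt, ← up_comp, proj_pt_eq (h.s1 _ _ (by simp)),
      proj_pt_eq (h.t1 _ _ (by simp))]
  · rw [edge_merge hs, edge_merge (mt (h.splits_iff h' hk).1 hs)]

/-- The family that bounds `z` is pushed forward along `φ`; the map `ψ` only serves to match splits
and face signs. In particular `φ` may send different circles to the same one. -/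
theorem Hom.bounding [Fintype ι] [Fintype κ] (h : K.Hom L e φ) (h' : L.Hom K e.symm ψ)
    {a : ι → Bool} {z : PtAlg R Ω} (hb : K.Bounding a z) : L.Bounding (a ∘ e) (emap R φ z) := by
  obtain ⟨ε, hε, x, hx⟩ := hb
  have surj : ∀ β : κ → Bool, ∃ α : ι → Bool, β = α ∘ e := fun β => ⟨β ∘ e.symm, by funext x; simp⟩
  have hcomp : ∀ α : ι → Bool, (α ∘ e) ∘ e.symm = α := comp_symm
  refine ⟨fun β k => ε (β ∘ e.symm) (e k), ?_, fun β => emap R φ (x (β ∘ e.symm)), ?_⟩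
  · intro β k l hkl hk hl
    obtain ⟨α, rfl⟩ := surj β
    have hkl' : e k ≠ e l := fun hc => hkl (e.injective hc)
    rw [h.fsgn_eq h' hkl hk hl, ← hε α _ _ hkl' hk hl]
    simp only [← up_comp, hcomp]
  · have key : ∀ α, L.proj R (α ∘ e) (L.d (fun β k => ε (β ∘ e.symm) (e k))
        (fun β => emap R φ (x (β ∘ e.symm))) (α ∘ e)) =
        L.proj R (α ∘ e) (emap R φ (K.d ε x α)) := by
      intro α
      simp only [d, map_sum]
      rw [← e.sum_comp]
      refine Finset.sum_congr rfl fun k _ => ?_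
      by_cases hk : α (e k) = true
      · have hk' : (α ∘ e) k = true := hk
        rw [if_pos hk, if_pos hk', ← dn_comp, hcomp, proj_units_smul]
        have := h.proj_edge h' (α := dn α (e k)) (k := k) (by simp) (x (dn α (e k)))
        rw [← up_comp, up_dn hk] at this
        rw [this]
        simp only [Units.smul_def, map_zsmul]
      · have hk' : ¬ (α ∘ e) k = true := hk
        rw [if_neg hk, if_neg hk']
        simp
    intro β
    obtain ⟨α, rfl⟩ := surj β
    refine ⟨fun hβ => ?_, fun hβ => ?_⟩
    · have : α = a := by rw [← hcomp α, ← hcomp a, hβ]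
      subst this
      rw [key]
      exact proj_emap_of_rel (h.rel α) ((hx α).1 rfl)
    · have : α ≠ a := by rintro rfl; exact hβ rfl
      rw [key]
      have h0 := proj_emap_of_rel (R := R) (h.rel α) (y := 0) (((hx α).2 this).trans (map_zero _).symm)
      rw [h0]; simp

theorem Bounding.congr [Fintype ι] {a : ι → Bool} {z z' : PtAlg R Ω} (h : K.Bounding a z)
    (hz : K.proj R a z = K.proj R a z') : K.Bounding a z' := by
  obtain ⟨ε, hε, x, hx⟩ := h
  refine ⟨ε, hε, x, fun β => ⟨?_, (hx β).2⟩⟩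
  rintro rfl
  rw [(hx β).1 rfl, hz]

theorem Bounding.units_smul [Fintype ι] {a : ι → Bool} {z : PtAlg R Ω} (u : ℤˣ)
    (h : K.Bounding a z) : K.Bounding a (u • z) := by
  obtain ⟨ε, hε, x, hx⟩ := h
  have key : ∀ β, K.d ε (fun α => u • x α) β = u • K.d ε x β := by
    intro β
    rw [d, d, Finset.smul_sum]
    refine Finset.sum_congr rfl fun k _ => ?_
    by_cases hk : β k = true
    · rw [if_pos hk, if_pos hk, edge_units_smul, smul_comm]
    · rw [if_neg hk, if_neg hk, smul_zero]
  refine ⟨ε, hε, fun α => u • x α, fun β => ⟨fun hβ => ?_, fun hβ => ?_⟩⟩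
  · rw [key, proj_units_smul, proj_units_smul, (hx β).1 hβ]
  · rw [key, proj_units_smul, (hx β).2 hβ, smul_zero]

/-! ### The differential of a good cube -/

theorem Good.face_signed (hK : K.Good) {ε : (ι → Bool) → ι → ℤˣ} (hε : K.Valid ε) {α : ι → Bool}
    {k l : ι} (hkl : k ≠ l) (hk : α k = false) (hl : α l = false) (x : PtAlg R Ω) :
    K.proj R (up (up α k) l) (ε (up α k) l • K.edge R (up α k) l (ε α k • K.edge R α k x)) =
      -K.proj R (up (up α k) l) (ε (up α l) k • K.edge R (up α l) k (ε α l • K.edge R α l x)) := by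
  have h := hε α k l hkl hk hl
  simp only [edge_units_smul, proj_units_smul]
  rw [hK.face hkl hk hl x, smul_smul, smul_smul, smul_smul, ← neg_eq_iff_eq_neg.2 h]
  generalize K.proj R (up (up α k) l) (K.edge R (up α l) k (K.edge R α l x)) = y
  generalize ε (up α k) l = a
  generalize ε α k = b
  generalize ε (up α l) k = c
  generalize ε α l = f
  have : a * b * -(b * a * (f * c)) = -(c * f) := by
    revert a b c f; decide
  rw [this]
  simp [Units.smul_def]

theorem proj_d [Fintype ι] (ε : (ι → Bool) → ι → ℤˣ) (x : (ι → Bool) → PtAlg R Ω) (β : ι → Bool) :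
    K.proj R β (K.d ε x β) =
      ∑ k, if β k = true then K.proj R β (ε (dn β k) k • K.edge R (dn β k) k (x (dn β k))) else 0 := by
  rw [d, map_sum]
  refine Finset.sum_congr rfl fun k _ => ?_
  split_ifs <;> simp

theorem d_add [Fintype ι] (ε : (ι → Bool) → ι → ℤˣ) (x y : (ι → Bool) → PtAlg R Ω) :
    K.d ε (x + y) = K.d ε x + K.d ε y := by
  funext β
  simp only [d, Pi.add_apply, map_add, smul_add]
  rw [← Finset.sum_add_distrib]
  refine Finset.sum_congr rfl fun k _ => ?_
  split_ifs <;> simp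

/-- The terms of the square are indexed by ordered pairs of directions, and exchanging the two
directions cancels them in pairs, because signed faces anticommute. -/
theorem Good.d_d [Fintype ι] (hK : K.Good) {ε : (ι → Bool) → ι → ℤˣ} (hε : K.Valid ε)
    (x : (ι → Bool) → PtAlg R Ω) (β : ι → Bool) : K.proj R β (K.d ε (K.d ε x) β) = 0 := by
  have e : ∀ k, (if β k = true then
      K.proj R β (ε (dn β k) k • K.edge R (dn β k) k (K.d ε x (dn β k))) else 0) =
      ∑ l, if k ≠ l ∧ β k = true ∧ β l = true then
        K.proj R β (ε (dn β k) k • K.edge R (dn β k) k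
          (ε (dn (dn β k) l) l • K.edge R (dn (dn β k) l) l (x (dn (dn β k) l)))) else 0 := by
    intro k
    by_cases hk : β k = true
    · rw [if_pos hk, d, map_sum, Finset.smul_sum, map_sum]
      refine Finset.sum_congr rfl fun l _ => ?_
      by_cases hkl : k = l
      · subst hkl
        simp [dn]
      · have : dn β k l = β l := by simp [dn, Ne.symm hkl]
        rw [this]
        by_cases hl : β l = true
        · rw [if_pos hl, if_pos ⟨hkl, hk, hl⟩]
        · rw [if_neg hl, if_neg (by tauto)]; simp
    · rw [if_neg hk]
      symm
      refine Finset.sum_eq_zero fun l _ => if_neg (by tauto)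
  rw [proj_d, Finset.sum_congr rfl fun k _ => e k, ← Finset.sum_product']
  refine Finset.sum_involution (fun z _ => (z.2, z.1)) ?_ ?_ (fun _ _ => by simp) (fun _ _ => rfl)
  · rintro ⟨k, l⟩ -
    dsimp only
    by_cases h : k ≠ l ∧ β k = true ∧ β l = true
    · obtain ⟨hkl, hk, hl⟩ := h
      rw [if_pos ⟨hkl, hk, hl⟩, if_pos ⟨hkl.symm, hl, hk⟩]
      have c : dn (dn β k) l = dn (dn β l) k := Function.update_comm hkl _ _ _
      have f := hK.face_signed hε (α := dn (dn β k) l) hkl (by simp [dn, hkl]) (by simp)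
        (x (dn (dn β k) l))
      have c1 : up (dn (dn β k) l) l = dn β k := up_dn (by simp [dn, hkl.symm, hl])
      have c2 : up (dn (dn β k) l) k = dn β l := by
        rw [c]; exact up_dn (by simp [dn, hkl, hk])
      rw [c1, c2, up_dn hl] at f
      rw [← c, f]
      exact add_neg_cancel _
    · rw [if_neg h, if_neg (by tauto), add_zero]
  · rintro ⟨k, l⟩ - h hc
    simp only [Prod.mk.injEq] at hc
    exact h (if_neg (by rintro ⟨h1, -⟩; exact h1 hc.2))

end ResCube

end

/-! ### Contractions, slices of a cube, and bigons. -/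

noncomputable section

namespace PtAlg

variable {R : Type*} [CommRing R] {Ω Ω' : Type}

/-- Contraction with the functional whose values on the points are given by `f`. -/
def contr (f : Ω → R) : PtAlg R Ω →ₗ[R] PtAlg R Ω :=
  CliffordAlgebra.contractLeft (Q := (0 : QuadraticForm R (Ω →₀ R))) (Finsupp.linearCombination R f)

theorem contr_ι_mul (f : Ω → R) (m : Ω →₀ R) (x : PtAlg R Ω) :
    contr f (ExteriorAlgebra.ι R m * x) =
      Finsupp.linearCombination R f m • x - ExteriorAlgebra.ι R m * contr f x :=
  CliffordAlgebra.contractLeft_ι_mul _ _ _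

theorem contr_algebraMap (f : Ω → R) (r : R) : contr f (algebraMap R (PtAlg R Ω) r) = 0 :=
  CliffordAlgebra.contractLeft_algebraMap _ _ _

theorem contr_sub_mul (f : Ω → R) (p q : Ω) (x : PtAlg R Ω) :
    contr f ((pt R p - pt R q) * x) = (f p - f q) • x - (pt R p - pt R q) * contr f x := by
  rw [pt, pt, ← map_sub, contr_ι_mul]
  simp

theorem emap_ι (φ : Ω → Ω') (m : Ω →₀ R) :
    emap R φ (ExteriorAlgebra.ι R m) = ExteriorAlgebra.ι R (Finsupp.mapDomain φ m) := by
  rw [emap, ExteriorAlgebra.map_apply_ι]; rfl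

theorem contr_emap (φ : Ω → Ω') (g : Ω' → R) (x : PtAlg R Ω) :
    contr g (emap R φ x) = emap R φ (contr (g ∘ φ) x) := by
  induction x using left_induction with
  | h0 r => rw [AlgHom.commutes, contr_algebraMap, contr_algebraMap, map_zero]
  | hadd x y hx hy => simp only [map_add, hx, hy]
  | hmul x m hx =>
    rw [map_mul, emap_ι, contr_ι_mul, contr_ι_mul, hx, map_sub, map_smul, map_mul, emap_ι,
      Finsupp.linearCombination_mapDomain]

open Classical in
/-- The indicator function of a set of points. -/
def ind (R : Type*) [CommRing R] (O : Ω → Prop) (q : Ω) : R := if O q then 1 else 0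

theorem ind_pos {O : Ω → Prop} {q : Ω} (h : O q) : ind R O q = 1 := if_pos h

theorem ind_neg {O : Ω → Prop} {q : Ω} (h : ¬ O q) : ind R O q = 0 := if_neg h

open Classical in
/-- Replace the points of `O` by `v`. -/
def collapse (O : Ω → Prop) (v q : Ω) : Ω := if O q then v else q

theorem collapse_pos {O : Ω → Prop} {v q : Ω} (h : O q) : collapse O v q = v := if_pos h

theorem collapse_neg {O : Ω → Prop} {v q : Ω} (h : ¬ O q) : collapse O v q = q := if_neg h

end PtAlg

open PtAlg

namespace ResCube

variable {ι κ Ω : Type} [DecidableEq ι] [DecidableEq κ] {R : Type*} [CommRing R]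

/-- A set that is a union of circles has an indicator function on the circles, and contraction is
natural. -/
theorem proj_contr {K : ResCube ι Ω} {α : ι → Bool} {O : Ω → Prop}
    (hO : ∀ p q, K.rel α p q → O p → O q) {x y : PtAlg R Ω} (h : K.proj R α x = K.proj R α y) :
    K.proj R α (contr (ind R O) x) = K.proj R α (contr (ind R O) y) := by
  let g : Quotient (K.rel α) → R := Quotient.lift (ind R O) fun p q hpq => by
    by_cases hp : O p
    · rw [ind_pos hp, ind_pos (hO p q hpq hp)]
    · rw [ind_neg hp, ind_neg fun hq => hp (hO q p ((K.rel α).symm hpq) hq)]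
  have key : ∀ z : PtAlg R Ω, K.proj R α (contr (ind R O) z) = contr g (K.proj R α z) :=
    fun z => (contr_emap _ g z).symm
  rw [key, key, h]

/-- Since `(s - t) ∧ (s - t) = 0`, both sides are multiplicative in `x`, and it suffices to look at
points: a point of `O` is congruent to `s` and becomes `s - (s - t) = t`; other points do not
change. -/
theorem proj_sub_contr {K : ResCube ι Ω} {α : ι → Bool} {O : Ω → Prop} {s t : Ω} (hs : O s)
    (hO : ∀ p q, O p → O q → K.rel α p q) (x : PtAlg R Ω) :
    K.proj R α (x - (pt R s - pt R t) * contr (ind R O) x) =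
      K.proj R α (emap R (collapse O t) x) := by
  induction x using left_induction with
  | h0 r => rw [contr_algebraMap, AlgHom.commutes, mul_zero, sub_zero]
  | hadd x y hx hy =>
    have e : x + y - (pt R s - pt R t) * contr (ind R O) (x + y) =
        (x - (pt R s - pt R t) * contr (ind R O) x) +
          (y - (pt R s - pt R t) * contr (ind R O) y) := by
      rw [map_add, mul_add]; abel
    rw [e, map_add, hx, hy, map_add, map_add]
  | hmul x m hx =>
    have e1 : K.proj R α (ExteriorAlgebra.ι R m -
        Finsupp.linearCombination R (ind R O) m • (pt R s - pt R t)) =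
        K.proj R α (emap R (collapse O t) (ExteriorAlgebra.ι R m)) := by
      induction m using Finsupp.induction_linear with
      | zero => simp
      | add f g hf hg =>
        have e : ExteriorAlgebra.ι R (f + g) -
            Finsupp.linearCombination R (ind R O) (f + g) • (pt R s - pt R t) =
            (ExteriorAlgebra.ι R f - Finsupp.linearCombination R (ind R O) f • (pt R s - pt R t)) +
            (ExteriorAlgebra.ι R g - Finsupp.linearCombination R (ind R O) g • (pt R s - pt R t)) := by
          rw [map_add, map_add, add_smul]; abel
        rw [e, map_add, hf, hg, map_add, map_add, map_add]
      | single p r =>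
        have e : Finsupp.single p r = r • Finsupp.single p (1 : R) := by simp
        rw [e, map_smul, map_smul, smul_assoc, ← smul_sub, map_smul (emap R _),
          map_smul, map_smul]
        congr 1
        change K.proj R α (pt R p - _) = K.proj R α (emap R _ (pt R p))
        rw [emap_pt, Finsupp.linearCombination_single, one_smul]
        by_cases hp : O p
        · rw [ind_pos hp, collapse_pos hp, one_smul, map_sub, map_sub, proj_pt_eq (hO p s hp hs)]
          abel
        · rw [ind_neg hp, collapse_neg hp, zero_smul, sub_zero]
    have e2 : ExteriorAlgebra.ι R m * x - (pt R s - pt R t) * contr (ind R O) (ExteriorAlgebra.ι R m * x)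
        = (ExteriorAlgebra.ι R m - Finsupp.linearCombination R (ind R O) m • (pt R s - pt R t)) *
          (x - (pt R s - pt R t) * contr (ind R O) x) := by
      have sw : (pt R s - pt R t) * ExteriorAlgebra.ι R m =
          -(ExteriorAlgebra.ι R m * (pt R s - pt R t)) := by
        rw [pt, pt, ← map_sub]
        exact eq_neg_of_add_eq_zero_left (ExteriorAlgebra.ι_add_mul_swap _ _)
      rw [contr_ι_mul]
      have hW := sub_sq (R := R) s t
      generalize pt R s - pt R t = W at sw hW ⊢
      generalize Finsupp.linearCombination R (ind R O) m = c
      generalize contr (ind R O) x = y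
      rw [mul_sub, ← mul_assoc, sw, mul_sub, sub_mul, sub_mul, smul_mul_assoc, smul_mul_assoc,
        ← mul_assoc W W, hW, zero_mul, smul_zero, mul_smul_comm, neg_mul, mul_assoc]
      abel
    rw [e2, map_mul, e1, hx, ← map_mul, ← map_mul]

/-! ### Slices -/

open Sum in
/-- The part of a cube in which the smoothings at the crossings in `κ` are given by `β`. -/
def slice (K : ResCube (ι ⊕ κ) Ω) (β : κ → Bool) : ResCube ι Ω where
  rel α := K.rel (Sum.elim α β)
  s0 k := K.s0 (inl k)
  t0 k := K.t0 (inl k)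
  s1 k := K.s1 (inl k)
  t1 k := K.t1 (inl k)

open Sum

theorem up_inl (α : ι → Bool) (β : κ → Bool) (k : ι) :
    up (Sum.elim α β) (inl k) = Sum.elim (up α k) β := Sum.update_elim_inl

theorem up_inr (α : ι → Bool) (β : κ → Bool) (k : κ) :
    up (Sum.elim α β) (inr k) = Sum.elim α (up β k) := Sum.update_elim_inr

theorem dn_inl (α : ι → Bool) (β : κ → Bool) (k : ι) :
    dn (Sum.elim α β) (inl k) = Sum.elim (dn α k) β := Sum.update_elim_inl

theorem dn_inr (α : ι → Bool) (β : κ → Bool) (k : κ) :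
    dn (Sum.elim α β) (inr k) = Sum.elim α (dn β k) := Sum.update_elim_inr

variable {K : ResCube (ι ⊕ κ) Ω}

theorem slice_fsgn (β : κ → Bool) (α : ι → Bool) (k l : ι) :
    (K.slice β).fsgn α k l = K.fsgn (Sum.elim α β) (inl k) (inl l) := by
  rw [fsgn, fsgn, up_inl]; rfl

theorem Valid.slice {ε : (ι ⊕ κ → Bool) → ι ⊕ κ → ℤˣ} (h : K.Valid ε) (β : κ → Bool) :
    (K.slice β).Valid fun α k => ε (Sum.elim α β) (inl k) := by
  intro α k l hkl hk hl
  rw [slice_fsgn, ← h _ _ _ (by simpa using hkl) (by simpa using hk) (by simpa using hl), up_inl,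
    up_inl]

variable (R) in
/-- The elements of the slice at `β`, up to congruence. -/
def pr (K : ResCube (ι ⊕ κ) Ω) (β : κ → Bool) :
    ((ι → Bool) → PtAlg R Ω) →ₗ[R] (α : ι → Bool) → PtAlg R (Quotient (K.rel (Sum.elim α β))) :=
  LinearMap.pi fun α => (K.proj R (Sum.elim α β)).toLinearMap ∘ₗ LinearMap.proj α

theorem pr_apply (β : κ → Bool) (x : (ι → Bool) → PtAlg R Ω) (α : ι → Bool) :
    K.pr R β x α = K.proj R (Sum.elim α β) (x α) := rfl

/-- The part of the differential inside of a slice. -/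
def inner [Fintype ι] (K : ResCube (ι ⊕ κ) Ω) (ε : (ι ⊕ κ → Bool) → ι ⊕ κ → ℤˣ) (β : κ → Bool) :
    ((ι → Bool) → PtAlg R Ω) →ₗ[R] (ι → Bool) → PtAlg R Ω :=
  LinearMap.pi fun α => ∑ k : ι, if α k = true then ((ε (Sum.elim (dn α k) β) (inl k) : ℤˣ) : ℤ) •
    (K.edge R (Sum.elim (dn α k) β) (inl k) ∘ₗ LinearMap.proj (dn α k)) else 0

theorem inner_apply [Fintype ι] (ε : (ι ⊕ κ → Bool) → ι ⊕ κ → ℤˣ) (β : κ → Bool)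
    (x : (ι → Bool) → PtAlg R Ω) (α : ι → Bool) :
    K.inner ε β x α = ∑ k : ι, if α k = true then ε (Sum.elim (dn α k) β) (inl k) •
      K.edge R (Sum.elim (dn α k) β) (inl k) (x (dn α k)) else 0 := by
  rw [inner, LinearMap.pi_apply, LinearMap.sum_apply]
  refine Finset.sum_congr rfl fun k _ => ?_
  split_ifs
  · rfl
  · rfl

theorem inner_eq_d [Fintype ι] (ε : (ι ⊕ κ → Bool) → ι ⊕ κ → ℤˣ) (β : κ → Bool)
    (x : (ι → Bool) → PtAlg R Ω) :
    K.inner ε β x = (K.slice β).d (fun α k => ε (Sum.elim α β) (inl k)) x := by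
  funext α
  rw [inner_apply]; rfl

/-- The part of the differential from a slice to another one. -/
def cross (K : ResCube (ι ⊕ κ) Ω) (ε : (ι ⊕ κ → Bool) → ι ⊕ κ → ℤˣ) (β : κ → Bool) (q : κ) :
    ((ι → Bool) → PtAlg R Ω) →ₗ[R] (ι → Bool) → PtAlg R Ω :=
  LinearMap.pi fun α => ((ε (Sum.elim α β) (inr q) : ℤˣ) : ℤ) •
    (K.edge R (Sum.elim α β) (inr q) ∘ₗ LinearMap.proj α)

theorem cross_apply (ε : (ι ⊕ κ → Bool) → ι ⊕ κ → ℤˣ) (β : κ → Bool) (q : κ)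
    (x : (ι → Bool) → PtAlg R Ω) (α : ι → Bool) :
    K.cross ε β q x α = ε (Sum.elim α β) (inr q) • K.edge R (Sum.elim α β) (inr q) (x α) := rfl

variable {ε : (ι ⊕ κ → Bool) → ι ⊕ κ → ℤˣ}

/-- The differential is sorted by slices: directions in `ι` act inside a slice, those in `κ` pass
between slices. Equations hold only after `pr`, since the maps upstairs merely represent the maps on
circles. -/
theorem bounds_iff [Fintype ι] [Fintype κ] {a : ι → Bool} {b : κ → Bool} {z : PtAlg R Ω} :
    K.Bounds ε (Sum.elim a b) z ↔ ∃ x : (κ → Bool) → (ι → Bool) → PtAlg R Ω, ∀ β,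
      K.pr R β (K.inner ε β (x β)) +
        ∑ q, (if β q = true then K.pr R β (K.cross ε (dn β q) q (x (dn β q))) else 0) =
      if β = b then K.pr R β (Pi.single a z) else 0 := by
  have key : ∀ (x : (ι ⊕ κ → Bool) → PtAlg R Ω) α β,
      K.proj R (Sum.elim α β) (K.d ε x (Sum.elim α β)) =
      (K.pr R β (K.inner ε β fun α => x (Sum.elim α β)) +
        ∑ q, (if β q = true then K.pr R β (K.cross ε (dn β q) q fun α => x (Sum.elim α (dn β q)))
          else 0)) α := by
    intro x α β
    rw [Pi.add_apply, Finset.sum_apply, pr_apply, inner_apply, d, Fintype.sum_sum_type, map_add,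
      map_sum (K.proj R _) _ (Finset.univ : Finset κ)]
    simp only [Sum.elim_inl, Sum.elim_inr, dn_inl, dn_inr]
    congr 1
    refine Finset.sum_congr rfl fun q _ => ?_
    split_ifs
    · rfl
    · simp
  have key2 : ∀ α β, (if β = b then K.pr R β (Pi.single a z) else 0) α =
      if Sum.elim α β = Sum.elim a b then K.proj R (Sum.elim α β) z else 0 := by
    intro α β
    by_cases hβ : β = b
    · rw [if_pos hβ, pr_apply]
      by_cases hα : α = a
      · subst hα; subst hβ; simp
      · rw [Pi.single_eq_of_ne hα, map_zero, if_neg]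
        intro hc
        exact hα (by simpa using congrArg (· ∘ inl) hc)
    · rw [if_neg hβ, if_neg]
      · rfl
      · intro hc
        exact hβ (by simpa using congrArg (· ∘ inr) hc)
  constructor
  · rintro ⟨x, hx⟩
    refine ⟨fun β α => x (Sum.elim α β), fun β => funext fun α => ?_⟩
    rw [← key x, key2]
    split_ifs with h
    · exact (hx _).1 h
    · exact (hx _).2 h
  · rintro ⟨x, hx⟩
    refine ⟨fun γ => x (γ ∘ inr) (γ ∘ inl), fun γ => ?_⟩
    obtain ⟨α, β, rfl⟩ : ∃ α β, γ = Sum.elim α β :=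
      ⟨γ ∘ inl, γ ∘ inr, (Sum.elim_comp_inl_inr γ).symm⟩
    rw [key]
    have := congrFun (hx β) α
    rw [key2] at this
    simp only [Sum.elim_comp_inl, Sum.elim_comp_inr]
    refine ⟨fun h => ?_, fun h => ?_⟩
    · rw [if_pos h] at this; exact this
    · rw [if_neg h] at this; exact this

theorem Good.cross_congr (hK : K.Good) {β β' : κ → Bool} {q : κ} (hq : β q = false)
    (hβ : up β q = β') {x y : (ι → Bool) → PtAlg R Ω} (h : K.pr R β x = K.pr R β y) :
    K.pr R β' (K.cross ε β q x) = K.pr R β' (K.cross ε β q y) := by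
  subst hβ
  funext α
  have h' : K.proj R _ (x α) = K.proj R _ (y α) := congrFun h α
  have := hK.edge_congr (k := inr q) (by simpa using hq) h'
  rw [up_inr] at this
  rw [pr_apply, pr_apply, cross_apply, cross_apply, proj_units_smul, proj_units_smul, this]

theorem Good.inner_congr [Fintype ι] (hK : K.Good) {β : κ → Bool}
    {x y : (ι → Bool) → PtAlg R Ω} (h : K.pr R β x = K.pr R β y) :
    K.pr R β (K.inner ε β x) = K.pr R β (K.inner ε β y) := by
  funext α
  rw [pr_apply, pr_apply, inner_apply, inner_apply, map_sum, map_sum]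
  refine Finset.sum_congr rfl fun k _ => ?_
  by_cases hk : α k = true
  · have h' : K.proj R _ (x (dn α k)) = K.proj R _ (y (dn α k)) := congrFun h (dn α k)
    have := hK.edge_congr (k := inl k) (by simp) h'
    rw [up_inl, up_dn hk] at this
    rw [if_pos hk, if_pos hk, proj_units_smul, proj_units_smul, this]
  · rw [if_neg hk, if_neg hk]

theorem Good.inner_cross [Fintype ι] (hK : K.Good) (hε : K.Valid ε) {β β' : κ → Bool} {q : κ}
    (hq : β q = false) (hβ : up β q = β') (x : (ι → Bool) → PtAlg R Ω) :
    K.pr R β' (K.inner ε β' (K.cross ε β q x)) = -K.pr R β' (K.cross ε β q (K.inner ε β x)) := by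
  subst hβ
  funext α
  rw [Pi.neg_apply, pr_apply, pr_apply, inner_apply, cross_apply, inner_apply, map_sum, map_sum,
    Finset.smul_sum, map_sum, ← Finset.sum_neg_distrib]
  refine Finset.sum_congr rfl fun k _ => ?_
  by_cases hk : α k = true
  · have := hK.face_signed hε (α := Sum.elim (dn α k) β) (k := inr q) (l := inl k) (by simp)
      (by simpa using hq) (by simp) (x (dn α k))
    rw [up_inr, up_inl, up_inl, up_dn hk] at this
    rw [if_pos hk, if_pos hk, cross_apply, this]
  · simp [hk]

end ResCube

end

noncomputable section

open PtAlg Sum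

namespace ResCube

variable {ι κ Ω : Type} [DecidableEq ι] [DecidableEq κ] {R : Type*} [CommRing R]

/-- A circle `O` in the slice at `β₁ = up β p` that is split off by the change at `p` and merged
with another circle by the change at `n`, and that does not meet the crossings in `ι`. -/
structure Bigon (K : ResCube (ι ⊕ κ) Ω) (β β₁ : κ → Bool) (p n : κ) where
  O : Ω → Prop
  a : Ω
  b : Ω
  a' : Ω
  v : Ω
  hp : β p = false
  hβ : up β p = β₁
  hn : β₁ n = false
  sat : ∀ α q q', K.rel (Sum.elim α β₁) q q' → O q → O q'
  single : ∀ α q q', O q → O q' → K.rel (Sum.elim α β₁) q q'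
  s0 : ∀ k, ¬ O (K.s0 (inl k))
  t0 : ∀ k, ¬ O (K.t0 (inl k))
  s1 : ∀ k, ¬ O (K.s1 (inl k))
  t1 : ∀ k, ¬ O (K.t1 (inl k))
  ha : O a
  hb : ¬ O b
  ha' : O a'
  hv : ¬ O v
  ends_p : (K.s1 (inr p) = a ∧ K.t1 (inr p) = b) ∨ (K.s1 (inr p) = b ∧ K.t1 (inr p) = a)
  ends_n : (K.s0 (inr n) = a' ∧ K.t0 (inr n) = v) ∨ (K.s0 (inr n) = v ∧ K.t0 (inr n) = a')

namespace Bigon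

variable {K : ResCube (ι ⊕ κ) Ω} {β β₁ β₂ : κ → Bool} {p n : κ} (B : K.Bigon β β₁ p n)
  {ε : (ι ⊕ κ → Bool) → ι ⊕ κ → ℤˣ}

include B

theorem up_p (α : ι → Bool) : up (Sum.elim α β) (inr p) = Sum.elim α β₁ := by
  rw [up_inr, B.hβ]

theorem p_false (α : ι → Bool) : Sum.elim α β (inr p) = false := by simpa using B.hp

theorem n_false (α : ι → Bool) : Sum.elim α β₁ (inr n) = false := by simpa using B.hn

theorem splits_p (hK : K.Good) (α : ι → Bool) : K.Splits (Sum.elim α β) (inr p) := by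
  by_contra h
  have := hK.merge_ends (by simpa using B.hp) h
  rw [B.up_p] at this
  rcases B.ends_p with ⟨h1, h2⟩ | ⟨h1, h2⟩
  · rw [h1, h2] at this; exact B.hb (B.sat _ _ _ this B.ha)
  · rw [h1, h2] at this; exact B.hb (B.sat _ _ _ ((K.rel _).symm this) B.ha)

theorem merges_n (α : ι → Bool) : ¬ K.Splits (Sum.elim α β₁) (inr n) := by
  intro h
  rw [Splits] at h
  rcases B.ends_n with ⟨h1, h2⟩ | ⟨h1, h2⟩
  · rw [h1, h2] at h; exact B.hv (B.sat _ _ _ h B.ha')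
  · rw [h1, h2] at h; exact B.hv (B.sat _ _ _ ((K.rel _).symm h) B.ha')

/-- The circle `O` appears at `p` and is absorbed at `n`. Away from it the slices at `β`, `β₁` and
`β₂` have the same circles, and so the crossings in `ι`, whose arrows avoid `O`, split and merge
alike in all three. -/
theorem rel_p (hK : K.Good) {α : ι → Bool} {q q' : Ω} (hq : ¬ B.O q) (hq' : ¬ B.O q') :
    K.rel (Sum.elim α β) q q' ↔ K.rel (Sum.elim α β₁) q q' := by
  rw [hK.split_iff (B.p_false α) (B.splits_p hK α), B.up_p]
  refine ⟨fun h => ?_, .inl⟩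
  have key : ∀ x, K.rel (Sum.elim α β₁) x B.a → B.O x := fun x h =>
    B.sat _ _ _ ((K.rel _).symm h) B.ha
  rcases h with h | ⟨h, h'⟩ | ⟨h, h'⟩
  · exact h
  · rcases B.ends_p with ⟨h1, h2⟩ | ⟨h1, h2⟩
    · rw [h1] at h; exact absurd (key _ h) hq
    · rw [h2] at h'; exact absurd (key _ h') hq'
  · rcases B.ends_p with ⟨h1, h2⟩ | ⟨h1, h2⟩
    · rw [h1] at h'; exact absurd (key _ h') hq'
    · rw [h2] at h; exact absurd (key _ h) hq

theorem rel_n (hK : K.Good) (hβ₂ : up β₁ n = β₂) {α : ι → Bool} {q q' : Ω} :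
    K.rel (Sum.elim α β₂) q q' ↔ K.rel (Sum.elim α β₁) q q' ∨
      (K.rel (Sum.elim α β₁) q B.v ∧ B.O q') ∨ (B.O q ∧ K.rel (Sum.elim α β₁) q' B.v) := by
  have key : ∀ x, K.rel (Sum.elim α β₁) x B.a' ↔ B.O x := fun x =>
    ⟨fun h => B.sat _ _ _ ((K.rel _).symm h) B.ha', fun h => B.single _ _ _ h B.ha'⟩
  rw [← hβ₂, ← up_inr, hK.merge_iff (B.n_false α) (B.merges_n α)]
  rcases B.ends_n with ⟨h1, h2⟩ | ⟨h1, h2⟩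
  · rw [h1, h2, key, key]; tauto
  · rw [h1, h2, key, key]

theorem rel_n_of_not (hK : K.Good) (hβ₂ : up β₁ n = β₂) {α : ι → Bool} {q q' : Ω} (hq : ¬ B.O q)
    (hq' : ¬ B.O q') : K.rel (Sum.elim α β₂) q q' ↔ K.rel (Sum.elim α β₁) q q' := by
  rw [B.rel_n hK hβ₂]; tauto

theorem splits_inl_p (hK : K.Good) (α : ι → Bool) (k : ι) :
    K.Splits (Sum.elim α β) (inl k) ↔ K.Splits (Sum.elim α β₁) (inl k) :=
  B.rel_p hK (B.s0 k) (B.t0 k)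

theorem splits_inl_n (hK : K.Good) (hβ₂ : up β₁ n = β₂) (α : ι → Bool) (k : ι) :
    K.Splits (Sum.elim α β₂) (inl k) ↔ K.Splits (Sum.elim α β₁) (inl k) :=
  B.rel_n_of_not hK hβ₂ (B.s0 k) (B.t0 k)

open Classical in
/-- The sign of the arrow at `p` with respect to `O`. -/
def sgn : ℤˣ := if B.O (K.s1 (inr p)) then 1 else -1

theorem sgn_smul : (ind R B.O (K.s1 (inr p)) - ind R B.O (K.t1 (inr p))) = ((B.sgn : ℤ) : R) := by
  rcases B.ends_p with ⟨h1, h2⟩ | ⟨h1, h2⟩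
  · rw [sgn, h1, h2, if_pos B.ha, ind_pos B.ha, ind_neg B.hb]; simp
  · rw [sgn, h1, h2, if_neg B.hb, ind_pos B.ha, ind_neg B.hb]; simp

/-- The left inverse of the map at `p`. -/
def theta (ε : (ι ⊕ κ → Bool) → ι ⊕ κ → ℤˣ) : ((ι → Bool) → PtAlg R Ω) →ₗ[R] (ι → Bool) → PtAlg R Ω :=
  LinearMap.pi fun α => ((B.sgn * ε (Sum.elim α β) (inr p) : ℤˣ) : ℤ) •
    (contr (ind R B.O) ∘ₗ LinearMap.proj α)

theorem theta_apply (x : (ι → Bool) → PtAlg R Ω) (α : ι → Bool) :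
    B.theta ε x α = (B.sgn * ε (Sum.elim α β) (inr p)) • contr (ind R B.O) (x α) := rfl

/-- The right inverse of the map at `n`. -/
def sect (ε : (ι ⊕ κ → Bool) → ι ⊕ κ → ℤˣ) : ((ι → Bool) → PtAlg R Ω) →ₗ[R] (ι → Bool) → PtAlg R Ω :=
  LinearMap.pi fun α => ((ε (Sum.elim α β₁) (inr n) : ℤˣ) : ℤ) •
    ((emap R (collapse B.O B.v)).toLinearMap ∘ₗ LinearMap.proj α)

theorem sect_apply (x : (ι → Bool) → PtAlg R Ω) (α : ι → Bool) :
    B.sect ε x α = ε (Sum.elim α β₁) (inr n) • emap R (collapse B.O B.v) (x α) := rfl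

theorem theta_congr (hK : K.Good) {x y : (ι → Bool) → PtAlg R Ω} (h : K.pr R β₁ x = K.pr R β₁ y) :
    K.pr R β (B.theta ε x) = K.pr R β (B.theta ε y) := by
  funext α
  have h' : K.proj R _ (x α) = K.proj R _ (y α) := congrFun h α
  rw [pr_apply, pr_apply, theta_apply, theta_apply, proj_units_smul, proj_units_smul]
  congr 1
  refine proj_le (fun q q' hq => ?_) (proj_contr (B.sat α) h')
  rw [hK.split_iff (B.p_false α) (B.splits_p hK α), B.up_p]
  exact .inl hq

/-- Contraction is an antiderivation: applied to `(s1 - t1) ∧ x` it gives `±x`, as exactly one of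
`s1`, `t1` lies on `O`, and a multiple of `s1 - t1`, which vanishes in the slice at `β`. `sgn` and
the sign of the edge normalize `±x` to `x`. -/
theorem theta_cross (hK : K.Good) (x : (ι → Bool) → PtAlg R Ω) :
    K.pr R β (B.theta ε (K.cross ε β p x)) = K.pr R β x := by
  funext α
  have hs := B.splits_p hK α
  have e0 : K.proj R (Sum.elim α β) (pt R (K.s1 (inr p)) - pt R (K.t1 (inr p))) = 0 := by
    rw [map_sub, proj_pt_eq, sub_self]
    rw [hK.split_iff (B.p_false α) hs, B.up_p]
    exact .inr (.inl ⟨(K.rel _).refl _, (K.rel _).refl _⟩)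
  rw [pr_apply, pr_apply, theta_apply, cross_apply, edge_split hs, Units.smul_def, Units.smul_def,
    map_zsmul (contr _), smul_smul, contr_sub_mul, B.sgn_smul, map_zsmul (K.proj R _), map_sub, map_mul, e0, zero_mul,
    sub_zero, Int.cast_smul_eq_zsmul, map_zsmul, smul_smul, ← Units.val_mul, ← Units.val_mul]
  generalize B.sgn = c
  generalize ε (Sum.elim α β) (inr p) = c'
  have : c * c' * c' * c = 1 := by revert c c'; decide
  rw [this]; simp

theorem sign_p (hε : K.Valid ε) (α : ι → Bool) (k : ι) (hk : α k = false) :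
    ε (Sum.elim (up α k) β) (inr p) * ε (Sum.elim α β) (inl k) =
      ε (Sum.elim α β) (inr p) * ε (Sum.elim α β₁) (inl k) * -K.fsgn (Sum.elim α β) (inl k) (inr p) := by
  have := hε (Sum.elim α β) (inl k) (inr p) (by simp) (by simpa using hk) (B.p_false α)
  rw [B.up_p, up_inl] at this
  rw [← this]
  generalize ε (Sum.elim (up α k) β) (inr p) = a
  generalize ε (Sum.elim α β) (inl k) = b
  generalize ε (Sum.elim α β) (inr p) = c
  generalize ε (Sum.elim α β₁) (inl k) = d
  revert a b c d; decide

/-- The crossings in `ι` do not touch `O`, so contraction anticommutes with their split factors and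
commutes with their merges. The edge signs compensate, since the face with direction `p` has sign
`-1` for a split in the direction `k` and `1` for a merge. -/
theorem theta_inner [Fintype ι] (hK : K.Good) (hε : K.Valid ε) (x : (ι → Bool) → PtAlg R Ω) :
    K.pr R β (K.inner ε β (B.theta ε x)) = -K.pr R β (B.theta ε (K.inner ε β₁ x)) := by
  funext α
  rw [Pi.neg_apply, pr_apply, pr_apply, theta_apply, inner_apply, inner_apply, map_sum, map_sum,
    Finset.smul_sum, map_sum, ← Finset.sum_neg_distrib]
  refine Finset.sum_congr rfl fun k _ => ?_
  by_cases hk : α k = true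
  · rw [if_pos hk, if_pos hk, theta_apply]
    have sg := B.sign_p hε (dn α k) k (by simp)
    rw [up_dn hk] at sg
    rw [← map_neg]
    congr 1
    by_cases hs : K.Splits (Sum.elim (dn α k) β) (inl k)
    · have hs' := (B.splits_inl_p hK _ _).1 hs
      have hs'' : K.Splits (up (Sum.elim (dn α k) β) (inl k)) (inr p) := by
        rw [up_inl]; exact B.splits_p hK _
      rw [fsgn, if_pos ⟨hs, B.splits_p hK _⟩, if_neg (not_not.2 hs''), neg_neg, mul_one] at sg
      rw [edge_split hs, edge_split hs']
      simp only [Units.smul_def, map_zsmul]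
      rw [contr_sub_mul, ind_neg (B.s1 k), ind_neg (B.t1 k), sub_zero, zero_smul, zero_sub,
        mul_smul_comm, smul_smul, smul_smul, smul_neg, neg_neg, ← Units.val_mul, ← Units.val_mul]
      congr 2
      revert sg
      generalize B.sgn = e
      generalize ε (Sum.elim α β) (inr p) = a
      generalize ε (Sum.elim (dn α k) β) (inl k) = b
      generalize ε (Sum.elim (dn α k) β) (inr p) = c
      generalize ε (Sum.elim (dn α k) β₁) (inl k) = d
      revert a b c d e; decide
    · have hs' := mt (B.splits_inl_p hK _ _).2 hs
      rw [fsgn, if_neg (by tauto), if_neg (fun h => h.2.1 (B.splits_p hK _)), mul_neg,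
        mul_one] at sg
      rw [edge_merge hs, edge_merge hs']
      simp only [Units.smul_def, map_zsmul]
      rw [smul_smul, smul_smul, ← neg_smul, ← Units.val_mul, ← Units.val_mul, ← Units.val_neg]
      congr 2
      revert sg
      generalize B.sgn = e
      generalize ε (Sum.elim α β) (inr p) = a
      generalize ε (Sum.elim (dn α k) β) (inl k) = b
      generalize ε (Sum.elim (dn α k) β) (inr p) = c
      generalize ε (Sum.elim (dn α k) β₁) (inl k) = d
      revert a b c d e; decide
  · rw [if_neg hk, if_neg hk]; simp

theorem collapse_rel (hK : K.Good) (hβ₂ : up β₁ n = β₂) (α : ι → Bool) (q q' : Ω)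
    (h : K.rel (Sum.elim α β₂) q q') :
    K.rel (Sum.elim α β₁) (collapse B.O B.v q) (collapse B.O B.v q') := by
  rcases (B.rel_n hK hβ₂).1 h with h | ⟨h, h'⟩ | ⟨h, h'⟩
  · by_cases hq : B.O q
    · rw [collapse_pos hq, collapse_pos (B.sat _ _ _ h hq)]
    · rw [collapse_neg hq, collapse_neg fun hc => hq (B.sat _ _ _ ((K.rel _).symm h) hc)]
      exact h
  · rw [collapse_pos h', collapse_neg fun hc => B.hv (B.sat _ _ _ h hc)]; exact h
  · rw [collapse_pos h, collapse_neg fun hc => B.hv (B.sat _ _ _ h' hc)]; exact (K.rel _).symm h'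

theorem sect_congr (hK : K.Good) (hβ₂ : up β₁ n = β₂) {x y : (ι → Bool) → PtAlg R Ω}
    (h : K.pr R β₂ x = K.pr R β₂ y) : K.pr R β₁ (B.sect ε x) = K.pr R β₁ (B.sect ε y) := by
  funext α
  have h' : K.proj R _ (x α) = K.proj R _ (y α) := congrFun h α
  rw [pr_apply, pr_apply, sect_apply, sect_apply, proj_units_smul, proj_units_smul,
    proj_emap_of_rel (B.collapse_rel hK hβ₂ α) h']

theorem proj_collapse (hK : K.Good) (hβ₂ : up β₁ n = β₂) (α : ι → Bool) (x : PtAlg R Ω) :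
    K.proj R (Sum.elim α β₂) (emap R (collapse B.O B.v) x) = K.proj R (Sum.elim α β₂) x := by
  conv_rhs => rw [← emap_id x]
  refine proj_emap_congr (fun q => ?_) x
  by_cases hq : B.O q
  · rw [collapse_pos hq, B.rel_n hK hβ₂]
    exact .inr (.inl ⟨(K.rel _).refl _, hq⟩)
  · rw [collapse_neg hq]; exact (K.rel _).refl _

/-- Once `n` has merged `O` with the circle of `v`, replacing the points of `O` by `v` changes
nothing. -/
theorem cross_sect (hK : K.Good) (hβ₂ : up β₁ n = β₂) (x : (ι → Bool) → PtAlg R Ω) :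
    K.pr R β₂ (K.cross ε β₁ n (B.sect ε x)) = K.pr R β₂ x := by
  funext α
  rw [pr_apply, pr_apply, cross_apply, sect_apply, edge_merge (B.merges_n α), smul_smul,
    Int.units_mul_self, one_smul, B.proj_collapse hK hβ₂]

/-- A direction that merges throughout the slice spans only faces of type C with the directions of
`ι`. -/
theorem fsgn_n (α : ι → Bool) (k : ι) {m : κ}
    (hm : ∀ α : ι → Bool, ¬ K.Splits (Sum.elim α β₁) (inr m)) :
    K.fsgn (Sum.elim α β₁) (inl k) (inr m) = 1 := by
  rw [fsgn, if_neg (fun h => hm _ h.2), if_neg]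
  rintro ⟨-, -, h⟩
  rw [up_inl] at h
  exact hm _ h

theorem sect_inner [Fintype ι] (hK : K.Good) (hε : K.Valid ε) (hβ₂ : up β₁ n = β₂)
    (x : (ι → Bool) → PtAlg R Ω) :
    K.pr R β₁ (K.inner ε β₁ (B.sect ε x)) = -K.pr R β₁ (B.sect ε (K.inner ε β₂ x)) := by
  funext α
  rw [Pi.neg_apply, pr_apply, pr_apply, sect_apply, inner_apply, inner_apply, map_sum, map_sum,
    Finset.smul_sum, map_sum, ← Finset.sum_neg_distrib]
  refine Finset.sum_congr rfl fun k _ => ?_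
  by_cases hk : α k = true
  · rw [if_pos hk, if_pos hk, sect_apply]
    have sg := hε (Sum.elim (dn α k) β₁) (inl k) (inr n) (by simp) (by simp) (B.n_false _)
    rw [B.fsgn_n _ _ B.merges_n, up_inr, up_inl, up_dn hk, hβ₂] at sg
    rw [← map_neg]
    congr 1
    have ed : K.edge R (Sum.elim (dn α k) β₁) (inl k) (emap R (collapse B.O B.v) (x (dn α k))) =
        emap R (collapse B.O B.v) (K.edge R (Sum.elim (dn α k) β₂) (inl k) (x (dn α k))) := by
      by_cases hs : K.Splits (Sum.elim (dn α k) β₁) (inl k)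
      · rw [edge_split hs, edge_split ((B.splits_inl_n hK hβ₂ _ _).2 hs), map_mul, map_sub, emap_pt,
          emap_pt, collapse_neg (B.s1 k), collapse_neg (B.t1 k)]
      · rw [edge_merge hs, edge_merge (mt (B.splits_inl_n hK hβ₂ _ _).1 hs)]
    simp only [Units.smul_def, map_zsmul, ed]
    rw [smul_smul, smul_smul, ← neg_smul, ← Units.val_mul, ← Units.val_mul, ← Units.val_neg]
    congr 2
    revert sg
    generalize ε (Sum.elim (dn α k) β₁) (inl k) = a
    generalize ε (Sum.elim (dn α k) β₁) (inr n) = b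
    generalize ε (Sum.elim α β₁) (inr n) = c
    generalize ε (Sum.elim (dn α k) β₂) (inl k) = d
    revert a b c d; decide
  · rw [if_neg hk, if_neg hk]; simp

/-- If the contraction of `x` with `O` vanishes in the slice at `β`, then `(a - b) ∧` this
contraction vanishes in the slice at `β₁`. By `proj_sub_contr`, `x` is congruent to the element in
which `b` replaces the points of `O`. This element no longer involves `O`, so `collapse` with target
`v` fixes it. Thus `sect` inverts the merge on the kernel of `theta`. -/
theorem sect_cross (hK : K.Good) {x : (ι → Bool) → PtAlg R Ω}
    (hβ₂ : up β₁ n = β₂) (h : K.pr R β (B.theta ε x) = 0) :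
    K.pr R β₁ (B.sect ε (K.cross ε β₁ n x)) = K.pr R β₁ x := by
  funext α
  have e1 : K.proj R (Sum.elim α β₁) (emap R (collapse B.O B.b) (x α)) =
      K.proj R (Sum.elim α β₁) (x α) := by
    rw [← proj_sub_contr B.ha (B.single α)]
    have h' : K.proj R (Sum.elim α β) (contr (ind R B.O) (x α)) = K.proj R (Sum.elim α β) 0 := by
      have := congrFun h α
      rw [pr_apply, theta_apply, proj_units_smul, Pi.zero_apply, smul_eq_zero_iff_eq] at this
      rw [this, map_zero]
    have e2 := hK.edge_congr (B.p_false α) h'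
    rw [edge_split (B.splits_p hK α), edge_split (B.splits_p hK α), mul_zero, map_zero, B.up_p] at e2
    rw [map_sub]
    rcases B.ends_p with ⟨h1, h2⟩ | ⟨h1, h2⟩
    · rw [h1, h2] at e2; rw [e2, sub_zero]
    · rw [h1, h2, ← neg_sub, neg_mul, map_neg, neg_eq_zero] at e2; rw [e2, sub_zero]
  rw [pr_apply, pr_apply, sect_apply, cross_apply, edge_merge (B.merges_n α), proj_units_smul]
  simp only [Units.smul_def, map_zsmul]
  rw [smul_smul, ← Units.val_mul, Int.units_mul_self, Units.val_one, one_smul, ← e1]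
  have hle : ∀ q q', K.rel (Sum.elim α β₁) q q' → K.rel (Sum.elim α β₂) q q' := fun q q' hq =>
    (B.rel_n hK hβ₂).2 (.inl hq)
  rw [← proj_emap_of_rel (B.collapse_rel hK hβ₂ α) (proj_le hle e1), emap_emap]
  congr 3
  funext q
  by_cases hq : B.O q
  · simp only [Function.comp_apply]; rw [collapse_pos hq, collapse_neg B.hb]
  · simp only [Function.comp_apply]; rw [collapse_neg hq, collapse_neg hq]

end Bigon

end ResCube

end

/-! ### The second Reidemeister move for abstract cubes. -/

noncomputable section

open PtAlg Sum

namespace ResCube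

variable {ι κ Ω : Type} [DecidableEq ι] [DecidableEq κ] [Fintype ι] {R : Type*} [CommRing R]

theorem slice_bounds_iff {K : ResCube (ι ⊕ κ) Ω} {ε : (ι ⊕ κ → Bool) → ι ⊕ κ → ℤˣ}
    {β : κ → Bool} {a : ι → Bool} {z : PtAlg R Ω} :
    (K.slice β).Bounds (fun α k => ε (Sum.elim α β) (inl k)) a z ↔
      ∃ y, K.pr R β (K.inner ε β y) = K.pr R β (Pi.single a z) := by
  refine exists_congr fun y => ?_
  rw [funext_iff]
  refine forall_congr' fun α => ?_
  rw [pr_apply, pr_apply, inner_eq_d]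
  by_cases h : α = a
  · subst h
    simp only [ne_eq, not_true_eq_false, false_implies, and_true, forall_const, Pi.single_eq_same]
    rfl
  · simp only [h, false_implies, ne_eq, not_false_eq_true, true_and, forall_const,
      Pi.single_eq_of_ne h, map_zero]
    rfl

theorem slice_bounding_iff {K : ResCube (ι ⊕ κ) Ω} {ε : (ι ⊕ κ → Bool) → ι ⊕ κ → ℤˣ}
    (hε : K.Valid ε) {β : κ → Bool} {a : ι → Bool} {z : PtAlg R Ω} :
    (K.slice β).Bounding a z ↔ ∃ y, K.pr R β (K.inner ε β y) = K.pr R β (Pi.single a z) := by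
  rw [← slice_bounds_iff]
  exact ⟨fun ⟨ε', hε', h⟩ => h.of_valid hε' (hε.slice β), fun h => ⟨_, hε.slice β, h⟩⟩

theorem bounding_iff [Fintype κ] {K : ResCube ι Ω} {ε : (ι → Bool) → ι → ℤˣ} (hε : K.Valid ε)
    {a : ι → Bool} {z : PtAlg R Ω} : K.Bounding a z ↔ K.Bounds ε a z :=
  ⟨fun ⟨_, hε', h⟩ => h.of_valid hε' hε, fun h => ⟨_, hε, h⟩⟩

theorem pr_cross_single {K : ResCube (ι ⊕ κ) Ω} {ε : (ι ⊕ κ → Bool) → ι ⊕ κ → ℤˣ}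
    {β β' : κ → Bool} {q : κ} {a : ι → Bool} {z : PtAlg R Ω}
    (hz : K.proj R (Sum.elim a β') (K.edge R (Sum.elim a β) (inr q) z) = 0) :
    K.pr R β' (K.cross ε β q (Pi.single a z)) = 0 := by
  funext α
  rw [pr_apply, cross_apply, proj_units_smul]
  by_cases h : α = a
  · subst h
    rw [Pi.single_eq_same, hz, smul_zero]; rfl
  · rw [Pi.single_eq_of_ne h, map_zero, map_zero, smul_zero]; rfl

/-- Invariance under the second Reidemeister move. -/
theorem Bigon.bounding_iff {K : ResCube (ι ⊕ Fin 2) Ω} (hK : K.Good)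
    (B : K.Bigon ![false, false] ![true, false] 0 1) {a : ι → Bool} {z : PtAlg R Ω}
    (hz : K.proj R (Sum.elim a ![true, true]) (K.edge R (Sum.elim a ![false, true]) (inr 0) z) = 0) :
    K.Bounding (Sum.elim a ![false, true]) z ↔ (K.slice ![false, true]).Bounding a z := by
  obtain ⟨ε, hε⟩ := hK.exists_valid
  have d1 : dn ![false, true] (1 : Fin 2) = ![false, false] := by decide
  have d2 : dn ![true, false] (0 : Fin 2) = ![false, false] := by decide
  have d3 : dn ![true, true] (0 : Fin 2) = ![false, true] := by decide
  have d4 : dn ![true, true] (1 : Fin 2) = ![true, false] := by decide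
  have u1 : up ![false, false] (1 : Fin 2) = ![false, true] := by decide
  have u2 : up ![true, false] (1 : Fin 2) = ![true, true] := by decide
  have u3 : up ![false, true] (0 : Fin 2) = ![true, true] := by decide
  rw [slice_bounding_iff hε, ResCube.bounding_iff (κ := Fin 2) hε, bounds_iff]
  constructor
  · rintro ⟨x, hx⟩
    have h01 := hx ![false, true]
    have h10 := hx ![true, false]
    simp only [Fin.sum_univ_two, Matrix.cons_val_zero, Matrix.cons_val_one, Bool.false_eq_true,
      if_false, if_true, add_zero, zero_add, d1, d2] at h01 h10
    rw [if_neg (by decide)] at h10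
    -- Gaussian elimination: `theta` applied to the equation at `![true, false]` shows that the
    -- component at `![false, false]` is the inner differential of `theta (x ![true, false])`, so
    -- the correction removes what enters from `![false, false]`.
    refine ⟨x ![false, true] - K.cross ε ![false, false] 1 (B.theta ε (x ![true, false])), ?_⟩
    have e1 : K.pr R ![false, false] (K.inner ε ![false, false] (B.theta ε (x ![true, false]))) =
        K.pr R ![false, false] (x ![false, false]) := by
      rw [B.theta_inner hK hε, B.theta_congr hK (y := -(K.cross ε ![false, false] 0 (x ![false, false])))]
      · rw [map_neg, map_neg, neg_neg, B.theta_cross hK]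
      · rw [map_neg]; exact eq_neg_of_add_eq_zero_left h10
    rw [map_sub, map_sub, hK.inner_cross hε rfl u1, hK.cross_congr rfl u1 e1, sub_neg_eq_add, h01]
  · rintro ⟨y, hy⟩
    -- Extending `y` by zero would leave its image at `![true, true]`. The component on the bigon
    -- slice cancels that image through the merge, and `hz` ensures that its own inner differential
    -- vanishes.
    let x10 := -(B.sect ε (K.cross ε ![false, true] 0 y))
    refine ⟨fun β => if β = ![false, true] then y else if β = ![true, false] then x10 else 0,
      fun β => ?_⟩
    have hz' := pr_cross_single (K := K) (ε := ε) (β := ![false, true]) (β' := ![true, true]) (q := 0)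
      (a := a) (z := z) hz
    have e1 : K.pr R ![true, false] (K.inner ε ![true, false] x10) = 0 := by
      rw [map_neg, map_neg, B.sect_inner hK hε u2, neg_neg, B.sect_congr hK u2 (y := 0), map_zero,
        map_zero]
      rw [hK.inner_cross hε rfl u3, hK.cross_congr rfl u3 hy, hz', neg_zero, map_zero]
    have e2 : K.pr R ![true, true] (K.cross ε ![true, false] 1 x10) =
        -K.pr R ![true, true] (K.cross ε ![false, true] 0 y) := by
      rw [map_neg, map_neg, B.cross_sect hK u2]
    obtain ⟨b, c, rfl⟩ : ∃ b c, β = ![b, c] := ⟨β 0, β 1, by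
      funext i; fin_cases i <;> rfl⟩
    rw [Fin.sum_univ_two]
    cases b <;> cases c
    · simp
    · simp [d1, hy]
    · simp [d2, e1]
    · simp [d3, d4, e2]

end ResCube

end

/-! ### The third Reidemeister move for abstract cubes. -/

noncomputable section

open PtAlg Sum

namespace ResCube

variable {ι κ κ' Ω Ω' : Type} [DecidableEq ι] [DecidableEq κ] [DecidableEq κ']
  {R : Type*} [CommRing R]

theorem _root_.PtAlg.emap_units_smul (φ : Ω → Ω') (u : ℤˣ) (x : PtAlg R Ω) :
    emap R φ (u • x) = u • emap R φ x := by
  simp only [Units.smul_def, map_zsmul]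

/-! ### Faces -/

/-- The face of a cube that is spanned by the directions in `ι` and the directions `j k`; the map
`b` is its inclusion. -/
def face (K : ResCube (ι ⊕ κ) Ω) (j : κ' → κ) (b : (κ' → Bool) → κ → Bool) :
    ResCube (ι ⊕ κ') Ω where
  rel γ := K.rel (Sum.elim (γ ∘ inl) (b (γ ∘ inr)))
  s0 k := K.s0 (Sum.map id j k)
  t0 k := K.t0 (Sum.map id j k)
  s1 k := K.s1 (Sum.map id j k)
  t1 k := K.t1 (Sum.map id j k)

/-- The map `b` is the inclusion of a face with the directions `j`. -/
structure IsFace (j : κ' → κ) (b : (κ' → Bool) → κ → Bool) : Prop where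
  inj : ∀ k l, j k = j l → k = l
  app : ∀ c k, b c (j k) = c k
  upd : ∀ c k, b (up c k) = up (b c) (j k)

/-- The inclusion of a face. -/
def incl (b : (κ' → Bool) → κ → Bool) (γ : ι ⊕ κ' → Bool) : ι ⊕ κ → Bool :=
  Sum.elim (γ ∘ inl) (b (γ ∘ inr))

theorem incl_elim (b : (κ' → Bool) → κ → Bool) (α : ι → Bool) (c : κ' → Bool) :
    incl b (Sum.elim α c) = Sum.elim α (b c) := rfl

variable {j : κ' → κ} {b : (κ' → Bool) → κ → Bool}

theorem IsFace.up (h : IsFace j b) (γ : ι ⊕ κ' → Bool) (k : ι ⊕ κ') :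
    incl b (up γ k) = up (incl b γ) (Sum.map id j k) := by
  obtain ⟨α, c, rfl⟩ : ∃ α c, γ = Sum.elim α c := ⟨_, _, (Sum.elim_comp_inl_inr γ).symm⟩
  rcases k with k | k
  · rw [up_inl, incl_elim, incl_elim, Sum.map_inl, up_inl]; rfl
  · rw [up_inr, incl_elim, incl_elim, Sum.map_inr, up_inr, h.upd]

theorem IsFace.apply (h : IsFace j b) (γ : ι ⊕ κ' → Bool) (k : ι ⊕ κ') :
    incl b γ (Sum.map id j k) = γ k := by
  rcases k with k | k
  · rfl
  · exact h.app _ k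

theorem IsFace.fsgn (h : IsFace j b) (K : ResCube (ι ⊕ κ) Ω) (γ : ι ⊕ κ' → Bool)
    (k l : ι ⊕ κ') :
    (K.face j b).fsgn γ k l = K.fsgn (incl b γ) (Sum.map id j k) (Sum.map id j l) := by
  rw [ResCube.fsgn, ResCube.fsgn, ← h.up]; rfl

theorem IsFace.valid (h : IsFace j b) {K : ResCube (ι ⊕ κ) Ω}
    {ε : (ι ⊕ κ → Bool) → ι ⊕ κ → ℤˣ} (hε : K.Valid ε) :
    (K.face j b).Valid fun γ k => ε (incl b γ) (Sum.map id j k) := by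
  intro γ k l hkl hk hl
  rw [h.fsgn, ← hε _ _ _ _ ((h.apply γ k).trans hk) ((h.apply γ l).trans hl)]
  dsimp only
  rw [h.up, h.up]
  rcases k with k | k <;> rcases l with l | l
  · simpa using hkl
  · simp
  · simp
  · intro hc
    simp only [Sum.map_inr, Sum.inr.injEq] at hc
    exact hkl (by rw [h.inj _ _ hc])

/-- An identification of a face of `K` with a face of `L`. -/
structure FaceIso (K : ResCube (ι ⊕ κ) Ω) (L : ResCube (ι ⊕ κ) Ω') (j : κ' → κ)
    (b : (κ' → Bool) → κ → Bool) (j' : κ' → κ) (b' : (κ' → Bool) → κ → Bool) (φ : Ω → Ω')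
    (ψ : Ω' → Ω) : Prop where
  face : IsFace j b
  face' : IsFace j' b'
  hom : (K.face j b).Hom (L.face j' b') (Equiv.refl _) φ
  hom' : (L.face j' b').Hom (K.face j b) (Equiv.refl _) ψ

namespace FaceIso

variable {K : ResCube (ι ⊕ κ) Ω} {L : ResCube (ι ⊕ κ) Ω'} {j' : κ' → κ}
  {b' : (κ' → Bool) → κ → Bool} {φ : Ω → Ω'} {ψ : Ω' → Ω} (F : FaceIso K L j b j' b' φ ψ)
  {ε : (ι ⊕ κ → Bool) → ι ⊕ κ → ℤˣ} {ε' : (ι ⊕ κ → Bool) → ι ⊕ κ → ℤˣ}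
include F

/-- Both sign assignments restrict to valid ones on the common face, so they differ there by signs
at the vertices. -/
theorem exists_gauge [Fintype ι] [Fintype κ'] (hε : K.Valid ε) (hε' : L.Valid ε') :
    ∃ μ : (ι ⊕ κ' → Bool) → ℤˣ, ∀ γ k, γ k = false →
      ε' (incl b' γ) (Sum.map id j' k) = μ γ * μ (up γ k) * ε (incl b γ) (Sum.map id j k) := by
  refine (F.face.valid hε).gauge fun γ k l hkl hk hl => ?_
  rw [F.face'.valid hε' γ k l hkl hk hl]
  congr 1
  exact F.hom.fsgn_eq F.hom' (α := γ) hkl hk hl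

theorem edge (γ : ι ⊕ κ' → Bool) (k : ι ⊕ κ') (hk : γ k = false) (x : PtAlg R Ω) :
    L.proj R (incl b' (up γ k)) (L.edge R (incl b' γ) (Sum.map id j' k) (emap R φ x)) =
      L.proj R (incl b' (up γ k)) (emap R φ (K.edge R (incl b γ) (Sum.map id j k) x)) :=
  F.hom.proj_edge F.hom' (α := γ) hk x

omit F in
/-- The map of chains of a face. -/
def map (φ : Ω → Ω') (μ : (ι ⊕ κ' → Bool) → ℤˣ) (c : κ' → Bool) :
    ((ι → Bool) → PtAlg R Ω) →ₗ[R] (ι → Bool) → PtAlg R Ω' :=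
  LinearMap.pi fun α => ((μ (Sum.elim α c) : ℤˣ) : ℤ) • ((emap R φ).toLinearMap ∘ₗ LinearMap.proj α)

omit F in
theorem map_apply (μ : (ι ⊕ κ' → Bool) → ℤˣ) (c : κ' → Bool) (x : (ι → Bool) → PtAlg R Ω)
    (α : ι → Bool) : map φ μ c x α = μ (Sum.elim α c) • emap R φ (x α) := rfl

variable {μ : (ι ⊕ κ' → Bool) → ℤˣ}

theorem map_congr (c : κ' → Bool) {x y : (ι → Bool) → PtAlg R Ω}
    (h : K.pr R (b c) x = K.pr R (b c) y) :
    L.pr R (b' c) (map φ μ c x) = L.pr R (b' c) (map φ μ c y) := by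
  funext α
  have h' : K.proj R _ (x α) = K.proj R _ (y α) := congrFun h α
  rw [pr_apply, pr_apply, map_apply, map_apply, proj_units_smul, proj_units_smul]
  congr 1
  exact proj_emap_of_rel (F.hom.rel (Sum.elim α c)) h'

variable (hμ : ∀ γ k, γ k = false →
  ε' (incl b' γ) (Sum.map id j' k) = μ γ * μ (up γ k) * ε (incl b γ) (Sum.map id j k))
include hμ

theorem map_inner [Fintype ι] (c : κ' → Bool) (x : (ι → Bool) → PtAlg R Ω) :
    L.pr R (b' c) (L.inner ε' (b' c) (map φ μ c x)) =
      L.pr R (b' c) (map φ μ c (K.inner ε (b c) x)) := by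
  funext α
  rw [pr_apply, pr_apply, map_apply, inner_apply, inner_apply, map_sum, map_sum, Finset.smul_sum,
    map_sum]
  refine Finset.sum_congr rfl fun k _ => ?_
  by_cases hk : α k = true
  · rw [if_pos hk, if_pos hk, map_apply]
    have h1 := F.edge (Sum.elim (dn α k) c) (inl k) (by simp) (x (dn α k))
    have h2 := hμ (Sum.elim (dn α k) c) (inl k) (by simp)
    rw [up_inl, up_dn hk] at h1 h2
    change L.proj R (Sum.elim α (b' c)) (L.edge R (Sum.elim (dn α k) (b' c)) (inl k) _) =
      L.proj R (Sum.elim α (b' c))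
        (emap R φ (K.edge R (Sum.elim (dn α k) (b c)) (inl k) _)) at h1
    simp only [incl_elim, Sum.map_inl, id] at h2
    rw [h2]
    rw [edge_units_smul, proj_units_smul, proj_units_smul, proj_units_smul, h1, emap_units_smul,
      proj_units_smul, smul_smul, smul_smul]
    congr 1
    generalize μ _ = p; generalize μ _ = q; generalize ε _ _ = r
    revert p q r; decide
  · rw [if_neg hk, if_neg hk]; simp

theorem map_cross {c c' : κ' → Bool} {k : κ'} (hk : c k = false) (hc : up c k = c')
    (x : (ι → Bool) → PtAlg R Ω) :
    L.pr R (b' c') (L.cross ε' (b' c) (j' k) (map φ μ c x)) =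
      L.pr R (b' c') (map φ μ c' (K.cross ε (b c) (j k) x)) := by
  subst hc
  funext α
  rw [pr_apply, pr_apply, map_apply, cross_apply, cross_apply, map_apply]
  have h1 := F.edge (Sum.elim α c) (inr k) (by simpa using hk) (x α)
  have h2 := hμ (Sum.elim α c) (inr k) (by simpa using hk)
  rw [up_inr] at h1 h2
  change L.proj R (Sum.elim α (b' (up c k))) (L.edge R (Sum.elim α (b' c)) (inr (j' k)) _) =
    L.proj R (Sum.elim α (b' (up c k)))
      (emap R φ (K.edge R (Sum.elim α (b c)) (inr (j k)) _)) at h1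
  simp only [incl_elim, Sum.map_inr] at h2
  rw [h2]
  rw [edge_units_smul, proj_units_smul, proj_units_smul, proj_units_smul, h1, emap_units_smul,
    proj_units_smul, smul_smul, smul_smul]
  congr 1
  generalize μ _ = p; generalize μ _ = q; generalize ε _ _ = r
  revert p q r; decide

end FaceIso

/-! ### Families of elements of the slices -/

/-- The differential of a family of elements of the slices. -/
def total [Fintype ι] [Fintype κ] (K : ResCube (ι ⊕ κ) Ω) (ε : (ι ⊕ κ → Bool) → ι ⊕ κ → ℤˣ)
    (x : (κ → Bool) → (ι → Bool) → PtAlg R Ω) (β : κ → Bool) (α : ι → Bool) : PtAlg R Ω :=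
  K.d ε (fun γ => x (γ ∘ inr) (γ ∘ inl)) (Sum.elim α β)

variable {K : ResCube (ι ⊕ κ) Ω} {ε : (ι ⊕ κ → Bool) → ι ⊕ κ → ℤˣ} [Fintype ι] [Fintype κ]

theorem pr_total (x : (κ → Bool) → (ι → Bool) → PtAlg R Ω) (β : κ → Bool) :
    K.pr R β (K.total ε x β) = K.pr R β (K.inner ε β (x β)) +
        ∑ q, (if β q = true then K.pr R β (K.cross ε (dn β q) q (x (dn β q))) else 0) := by
  funext α
  rw [Pi.add_apply, Finset.sum_apply, pr_apply, pr_apply, inner_apply, total, d,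
    Fintype.sum_sum_type, map_add, map_sum (K.proj R _) _ (Finset.univ : Finset κ)]
  simp only [Sum.elim_inl, Sum.elim_inr, dn_inl, dn_inr, Sum.elim_comp_inl, Sum.elim_comp_inr]
  congr 1
  refine Finset.sum_congr rfl fun q _ => ?_
  split_ifs
  · rfl
  · simp

theorem total_add (x y : (κ → Bool) → (ι → Bool) → PtAlg R Ω) :
    K.total ε (x + y) = K.total ε x + K.total ε y := by
  funext β α
  exact congrFun (K.d_add ε _ _) _

theorem Good.total_total (hK : K.Good) (hε : K.Valid ε)
    (x : (κ → Bool) → (ι → Bool) → PtAlg R Ω) (β : κ → Bool) :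
    K.pr R β (K.total ε (K.total ε x) β) = 0 := by
  funext α
  rw [pr_apply]
  have := hK.d_d hε (R := R) (fun γ => x (γ ∘ inr) (γ ∘ inl)) (Sum.elim α β)
  rw [Pi.zero_apply, ← this]
  simp only [total, Sum.elim_comp_inl_inr]

theorem bounds_iff_total {a : ι → Bool} {b : κ → Bool} {z : PtAlg R Ω} :
    K.Bounds ε (Sum.elim a b) z ↔ ∃ x : (κ → Bool) → (ι → Bool) → PtAlg R Ω, ∀ β,
      K.pr R β (K.total ε x β) = if β = b then K.pr R β (Pi.single a z) else 0 := by
  simp only [pr_total]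
  exact bounds_iff

theorem eq_of_up {f : (ι → Bool) → ℤˣ} (h : ∀ α k, α k = false → f (up α k) = f α)
    (α α' : ι → Bool) : f α = f α' := by
  have key : ∀ s : Finset ι, ∀ α, f (fun k => if k ∈ s then false else α k) = f α := by
    intro s
    induction s using Finset.induction_on with
    | empty => intro α; simp
    | insert k s hk ih =>
      intro α
      rw [← ih α]
      cases hα : α k
      · congr 1; funext x
        by_cases hx : x = k
        · subst hx; simp [hα]
        · simp [hx]
      · rw [← h _ k (by simp)]
        congr 1; funext x
        by_cases hx : x = k
        · subst hx; simp [up, hα, hk]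
        · simp [up, hx]
  rw [← key Finset.univ α, ← key Finset.univ α']
  simp

end ResCube

end

noncomputable section

open PtAlg Sum

namespace ResCube

variable {ι Ω Ω' : Type} [DecidableEq ι] [Fintype ι] {R : Type*} [CommRing R]

theorem pr_units_smul {κ : Type} {K : ResCube (ι ⊕ κ) Ω} (β : κ → Bool) (u : ℤˣ)
    (x : (ι → Bool) → PtAlg R Ω) : K.pr R β (u • x) = u • K.pr R β x := by
  simp only [Units.smul_def, map_zsmul]

namespace Bigon

variable {K : ResCube (ι ⊕ Fin 3) Ω} (B : K.Bigon ![false, false, false] ![true, false, false] 0 2)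
  {ε : (ι ⊕ Fin 3 → Bool) → ι ⊕ Fin 3 → ℤˣ}
include B

/-- A boundary is the image of a family whose components at three of the vertices are controlled
by the bigon. -/
theorem exists_reduced (hK : K.Good) (hε : K.Valid ε) {a : ι → Bool} {z : PtAlg R Ω}
    (h : K.Bounds ε (Sum.elim a ![false, false, true]) z) :
    ∃ y : (Fin 3 → Bool) → (ι → Bool) → PtAlg R Ω,
      (∀ β, K.pr R β (K.total ε y β) =
        if β = ![false, false, true] then K.pr R β (Pi.single a z) else 0) ∧
      K.pr R ![false, false, false] (y ![false, false, false]) = 0 ∧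
      K.pr R ![true, false, true] (y ![true, false, true]) = 0 ∧
      K.pr R ![true, false, false] (y ![true, false, false]) =
        -K.pr R ![true, false, false] (B.sect ε (K.cross ε ![false, false, true] 0
          (y ![false, false, true]))) := by
  have d1 : dn ![true, false, true] (0 : Fin 3) = ![false, false, true] := by decide
  have d2 : dn ![true, false, true] (2 : Fin 3) = ![true, false, false] := by decide
  have d3 : dn ![true, false, false] (0 : Fin 3) = ![false, false, false] := by decide
  have u1 : up ![true, false, false] (2 : Fin 3) = ![true, false, true] := by decide
  obtain ⟨x, hx⟩ := bounds_iff_total.1 h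
  -- The section of the merge at `n` allows the component at `101` to be removed by a boundary.
  let η₁ : (Fin 3 → Bool) → (ι → Bool) → PtAlg R Ω :=
    Pi.single ![true, false, false] (-B.sect ε (x ![true, false, true]))
  let y := x + K.total ε η₁
  have hy : ∀ β, K.pr R β (K.total ε y β) =
      if β = ![false, false, true] then K.pr R β (Pi.single a z) else 0 := fun β => by
    rw [total_add, Pi.add_apply, map_add, hK.total_total hε, add_zero, hx]
  -- This boundary makes `theta` vanish at `100`. The equation at `100`, contracted, then makes the
  -- component at `000` vanish as well, and `101` is not reached from `000` by one edge.
  let η₂ : (Fin 3 → Bool) → (ι → Bool) → PtAlg R Ω :=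
    Pi.single ![false, false, false] (-B.theta ε (y ![true, false, false]))
  let w := y + K.total ε η₂
  have hw : ∀ β, K.pr R β (K.total ε w β) =
      if β = ![false, false, true] then K.pr R β (Pi.single a z) else 0 := fun β => by
    rw [total_add, Pi.add_apply, map_add, hK.total_total hε, add_zero, hy]
  have w101 : K.pr R ![true, false, true] (w ![true, false, true]) = 0 := by
    have e1 : η₁ ![true, false, true] = 0 := Pi.single_eq_of_ne (by decide) _
    have e2 : η₁ ![false, false, true] = 0 := Pi.single_eq_of_ne (by decide) _
    have e3 : η₂ ![true, false, true] = 0 := Pi.single_eq_of_ne (by decide) _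
    have e4 : η₂ ![false, false, true] = 0 := Pi.single_eq_of_ne (by decide) _
    have e5 : η₂ ![true, false, false] = 0 := Pi.single_eq_of_ne (by decide) _
    have e6 : η₁ ![true, false, false] = -B.sect ε (x ![true, false, true]) := Pi.single_eq_same _ _
    simp only [w, y, Pi.add_apply, map_add, pr_total, Fin.sum_univ_three, d1, d2, e1, e2, e3, e4, e5,
      e6, map_zero, map_neg, B.cross_sect hK u1]
    simp
  have y100 : K.pr R ![true, false, false] (w ![true, false, false]) =
      K.pr R ![true, false, false] (y ![true, false, false]) -
      K.pr R ![true, false, false]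
        (K.cross ε ![false, false, false] 0 (B.theta ε (y ![true, false, false]))) := by
    have e1 : η₂ ![true, false, false] = 0 := Pi.single_eq_of_ne (by decide) _
    have e2 : η₂ ![false, false, false] = -B.theta ε (y ![true, false, false]) :=
      Pi.single_eq_same _ _
    simp only [w, Pi.add_apply, map_add, pr_total, Fin.sum_univ_three, d3, e1, e2, map_zero, map_neg]
    simp [sub_eq_add_neg]
  have θw : K.pr R ![false, false, false] (B.theta ε (w ![true, false, false])) = 0 := by
    rw [← map_sub] at y100
    rw [B.theta_congr hK y100, map_sub, map_sub, B.theta_cross hK, sub_self]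
  have w000 : K.pr R ![false, false, false] (w ![false, false, false]) = 0 := by
    have e2 : η₂ ![false, false, false] = -B.theta ε (y ![true, false, false]) :=
      Pi.single_eq_same _ _
    have h100 := hy ![true, false, false]
    rw [pr_total, Fin.sum_univ_three] at h100
    simp only [Matrix.cons_val, Bool.false_eq_true, if_true, if_false, add_zero, d3] at h100
    rw [if_neg (by decide), ← map_add] at h100
    have e3 := B.theta_congr (ε := ε) hK (h100.trans (map_zero _).symm)
    rw [map_add, map_add, map_zero, map_zero, B.theta_cross hK] at e3
    simp only [w, Pi.add_apply, map_add, pr_total, Fin.sum_univ_three, e2, map_neg, B.theta_inner hK hε]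
    simp only [Matrix.cons_val, Bool.false_eq_true, if_false, add_zero, neg_neg]
    rw [add_comm, e3]
  refine ⟨w, hw, w000, w101, ?_⟩
  -- On the kernel of `theta` the component at `100` is recovered from its image at `101`, and the
  -- equation at that vertex gives this image.
  rw [← B.sect_cross hK u1 θw]
  have h101 := hw ![true, false, true]
  rw [pr_total, Fin.sum_univ_three] at h101
  simp only [Matrix.cons_val, Bool.false_eq_true, if_true, if_false, add_zero, d1, d2] at h101
  rw [if_neg (by decide), hK.inner_congr (w101.trans (map_zero _).symm), map_zero, map_zero,
    zero_add] at h101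
  rw [← map_neg, ← map_neg]
  refine B.sect_congr hK u1 ?_
  rw [map_neg]
  exact eq_neg_of_add_eq_zero_right h101

end Bigon

end ResCube

end

noncomputable section

open PtAlg Sum

namespace ResCube

variable {ι Ω Ω' : Type} [DecidableEq ι] [Fintype ι] {R : Type*} [CommRing R]

namespace Bigon

variable {K : ResCube (ι ⊕ Fin 3) Ω} (B : K.Bigon ![false, false, false] ![true, false, false] 0 2)
  {ε : (ι ⊕ Fin 3 → Bool) → ι ⊕ Fin 3 → ℤˣ}

/-- The sign of the path through the slice of the bigon. -/
def pathSign (ε : (ι ⊕ Fin 3 → Bool) → ι ⊕ Fin 3 → ℤˣ) (α : ι → Bool) : ℤˣ :=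
  ε (Sum.elim α ![true, false, false]) (inr 1) * ε (Sum.elim α ![true, false, false]) (inr 2)

include B

/-- Both directions merge throughout the bigon slice, so their faces with `k` have sign `1`, and the
two anticommutation rules can be divided by each other. -/
theorem pathSign_up (hε : K.Valid ε)
    (hm : ∀ α : ι → Bool, ¬ K.Splits (Sum.elim α ![true, false, false]) (inr 1))
    {α : ι → Bool} {k : ι} (hk : α k = false) :
    pathSign ε (up α k) = pathSign ε α * (ε (Sum.elim α ![true, true, false]) (inl k) *
      ε (Sum.elim α ![true, false, true]) (inl k)) := by
  have u1 : up ![true, false, false] (1 : Fin 3) = ![true, true, false] := by decide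
  have u2 : up ![true, false, false] (2 : Fin 3) = ![true, false, true] := by decide
  have h1 := hε (Sum.elim α ![true, false, false]) (inl k) (inr 1) (by simp) (by simpa using hk)
    (by simp)
  have h2 := hε (Sum.elim α ![true, false, false]) (inl k) (inr 2) (by simp) (by simpa using hk)
    (by simp)
  rw [B.fsgn_n _ _ hm, up_inl, up_inr, u1] at h1
  rw [B.fsgn_n _ _ B.merges_n, up_inl, up_inr, u2] at h2
  rw [pathSign, pathSign]
  revert h1 h2
  generalize ε (Sum.elim α ![true, false, false]) (inl k) = x1
  generalize ε (Sum.elim (up α k) ![true, false, false]) (inr 1) = x2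
  generalize ε (Sum.elim (up α k) ![true, false, false]) (inr 2) = x3
  generalize ε (Sum.elim α ![true, false, false]) (inr 1) = x4
  generalize ε (Sum.elim α ![true, false, false]) (inr 2) = x5
  generalize ε (Sum.elim α ![true, true, false]) (inl k) = x6
  generalize ε (Sum.elim α ![true, false, true]) (inl k) = x7
  revert x1 x2 x3 x4 x5 x6 x7
  decide

/-- The two merges span a face at `100` that is not of type A, as their arrows do not start on the
same circle. Its sign is therefore `1`, and anticommutation compares the two paths to `111`. -/
theorem pathSign_eq (hε : K.Valid ε)
    (hm : ∀ α : ι → Bool, ¬ K.Splits (Sum.elim α ![true, false, false]) (inr 1))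
    (hs : ∀ α : ι → Bool, ¬ K.rel (Sum.elim α ![true, false, false]) (K.s0 (inr 1)) (K.s0 (inr 2)))
    (α : ι → Bool) :
    pathSign ε α = -(ε (Sum.elim α ![true, true, false]) (inr 2) *
      ε (Sum.elim α ![true, false, true]) (inr 1)) := by
  have u1 : up ![true, false, false] (1 : Fin 3) = ![true, true, false] := by decide
  have u2 : up ![true, false, false] (2 : Fin 3) = ![true, false, true] := by decide
  have h1 := hε (Sum.elim α ![true, false, false]) (inr 1) (inr 2) (by simp) (by simp) (by simp)
  have hf : K.fsgn (Sum.elim α ![true, false, false]) (inr 1) (inr 2) = 1 := by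
    rw [fsgn, if_neg (fun h => hm _ h.1)]
    split_ifs with h1 h2
    · exact absurd h2 (hs α)
    · rfl
    · rfl
  rw [hf, up_inr, up_inr, u1, u2] at h1
  rw [pathSign]
  revert h1
  generalize ε (Sum.elim α ![true, false, false]) (inr 1) = x4
  generalize ε (Sum.elim α ![true, false, false]) (inr 2) = x5
  generalize ε (Sum.elim α ![true, true, false]) (inr 2) = x6
  generalize ε (Sum.elim α ![true, false, true]) (inr 1) = x7
  revert x4 x5 x6 x7
  decide

theorem path_apply
    (hm : ∀ α : ι → Bool, ¬ K.Splits (Sum.elim α ![true, false, false]) (inr 1))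
    (w : (ι → Bool) → PtAlg R Ω) (α : ι → Bool) :
    K.cross ε ![true, false, false] 1 (B.sect ε w) α =
      pathSign ε α • emap R (collapse B.O B.v) (w α) := by
  rw [cross_apply, sect_apply, edge_merge (hm α), smul_smul]; rfl

end Bigon

theorem units_eq_of_gauge {a x y c : ℤˣ} (h : a = x * y * c) : x = a * c * y := by
  subst h; revert x y c; decide

theorem signs_of_mul {x y c e : ℤˣ} (h : x * y * c = -e) : y * c = -(e * x) := by
  revert x y c e; decide

theorem signs_of_mul' {x y c e : ℤˣ} (h : x * y * c = -e) : x * c = -(e * y) := by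
  revert x y c e; decide

/-- Invariance under a third Reidemeister move, in one direction. -/
theorem Bigon.bounding_of_faceIso {K : ResCube (ι ⊕ Fin 3) Ω} {L : ResCube (ι ⊕ Fin 3) Ω'}
    (hK : K.Good) (hL : L.Good)
    (B : K.Bigon ![false, false, false] ![true, false, false] 0 2)
    (B' : L.Bigon ![false, false, false] ![true, false, false] 0 2)
    (hm : ∀ α : ι → Bool, ¬ K.Splits (Sum.elim α ![true, false, false]) (inr 1))
    (hs : ∀ α : ι → Bool, ¬ K.rel (Sum.elim α ![true, false, false]) (K.s0 (inr 1)) (K.s0 (inr 2)))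
    (hm' : ∀ α : ι → Bool, ¬ L.Splits (Sum.elim α ![true, false, false]) (inr 1))
    (hs' : ∀ α : ι → Bool, ¬ L.rel (Sum.elim α ![true, false, false]) (L.s0 (inr 1)) (L.s0 (inr 2)))
    {φ₁ φ₂ : Ω → Ω'} {ψ₁ ψ₂ : Ω' → Ω}
    (F₁ : FaceIso K L (![0, 1] : Fin 2 → Fin 3) (fun c => ![c 0, c 1, true]) ![1, 0]
      (fun c => ![c 1, c 0, true]) φ₁ ψ₁)
    (F₂ : FaceIso K L (![0, 2] : Fin 2 → Fin 3) (fun c => ![c 0, true, c 1]) ![2, 0]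
      (fun c => ![c 1, true, c 0]) φ₂ ψ₂)
    (h₁ : ∀ α q, L.rel (Sum.elim α ![false, true, true]) (φ₂ (collapse B.O B.v q)) (φ₁ q))
    (h₂ : ∀ α q, L.rel (Sum.elim α ![true, true, false]) (φ₂ q) (collapse B'.O B'.v (φ₁ q)))
    {a : ι → Bool} {z : PtAlg R Ω}
    (hz : L.proj R (Sum.elim a ![true, false, true])
      (L.edge R (Sum.elim a ![false, false, true]) (inr 0) (emap R φ₁ z)) = 0)
    (hb : K.Bounding (Sum.elim a ![false, false, true]) z) :
    L.Bounding (Sum.elim a ![false, false, true]) (emap R φ₁ z) := by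
  obtain ⟨ε, hε⟩ := hK.exists_valid
  obtain ⟨ε', hε'⟩ := hL.exists_valid
  obtain ⟨μ, hμ⟩ := F₁.exists_gauge hε hε'
  obtain ⟨ν, hν⟩ := F₂.exists_gauge hε hε'
  obtain ⟨y, hy, y000, y101, y100⟩ := B.exists_reduced hK hε ((ResCube.bounding_iff (κ := Fin 3) hε).1 hb)
  have u1 : up ![true, false, false] (2 : Fin 3) = ![true, false, true] := by decide
  have u2 : up ![false, false, true] (0 : Fin 3) = ![true, false, true] := by decide
  have u3 : up ![true, false, false] (1 : Fin 3) = ![true, true, false] := by decide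
  have u4 : up ![true, false, true] (1 : Fin 3) = ![true, true, true] := by decide
  have v1 : up ![false, false] (0 : Fin 2) = ![true, false] := by decide
  have v2 : up ![false, false] (1 : Fin 2) = ![false, true] := by decide
  have v3 : up ![true, false] (1 : Fin 2) = ![true, true] := by decide
  have v4 : up ![false, true] (0 : Fin 2) = ![true, true] := by decide
  -- the sign by which the two identifications differ
  have m1 : ∀ α, ε' (Sum.elim α ![false, true, true]) (inr 0) = μ (Sum.elim α ![true, false]) *
      μ (Sum.elim α ![true, true]) * ε (Sum.elim α ![true, false, true]) (inr 1) := fun α => by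
    have := hμ (Sum.elim α ![true, false]) (inr 1) (by simp)
    rw [up_inr, v3] at this; exact this
  have m2 : ∀ α, ε' (Sum.elim α ![true, false, true]) (inr 1) = μ (Sum.elim α ![false, true]) *
      μ (Sum.elim α ![true, true]) * ε (Sum.elim α ![false, true, true]) (inr 0) := fun α => by
    have := hμ (Sum.elim α ![false, true]) (inr 0) (by simp)
    rw [up_inr, v4] at this; exact this
  have m3 : ∀ α, ε' (Sum.elim α ![false, true, true]) (inr 0) = ν (Sum.elim α ![true, false]) *
      ν (Sum.elim α ![true, true]) * ε (Sum.elim α ![true, true, false]) (inr 2) := fun α => by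
    have := hν (Sum.elim α ![true, false]) (inr 1) (by simp)
    rw [up_inr, v3] at this; exact this
  have m4 : ∀ α, ε' (Sum.elim α ![true, true, false]) (inr 2) = ν (Sum.elim α ![false, true]) *
      ν (Sum.elim α ![true, true]) * ε (Sum.elim α ![false, true, true]) (inr 0) := fun α => by
    have := hν (Sum.elim α ![false, true]) (inr 0) (by simp)
    rw [up_inr, v4] at this; exact this
  -- `F₁` and `F₂` send the vertices `101` and `110` of `K` both to `011` of `L`, and the vertex
  -- `011` of `K` to `101` and `110` of `L`. The signs of these two comparisons agree by the square
  -- of merges in either cube.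
  have hEq : ∀ α, μ (Sum.elim α ![true, false]) * ν (Sum.elim α ![true, false]) * pathSign ε α =
      μ (Sum.elim α ![false, true]) * ν (Sum.elim α ![false, true]) * pathSign ε' α := by
    intro α
    rw [units_eq_of_gauge (m1 α), units_eq_of_gauge (m2 α), units_eq_of_gauge (m3 α),
      units_eq_of_gauge (m4 α), B.pathSign_eq hε hm hs, B'.pathSign_eq hε' hm' hs']
    generalize ε' (Sum.elim α ![false, true, true]) (inr 0) = x1
    generalize ε (Sum.elim α ![true, false, true]) (inr 1) = x2
    generalize ε' (Sum.elim α ![true, false, true]) (inr 1) = x3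
    generalize ε (Sum.elim α ![false, true, true]) (inr 0) = x4
    generalize ε (Sum.elim α ![true, true, false]) (inr 2) = x5
    generalize ε' (Sum.elim α ![true, true, false]) (inr 2) = x6
    generalize μ (Sum.elim α ![true, true]) = x7
    generalize ν (Sum.elim α ![true, true]) = x8
    revert x1 x2 x3 x4 x5 x6 x7 x8
    decide
  have hUp : ∀ α k, α k = false →
      μ (Sum.elim (up α k) ![true, false]) * ν (Sum.elim (up α k) ![true, false]) *
        pathSign ε (up α k) =
      μ (Sum.elim α ![true, false]) * ν (Sum.elim α ![true, false]) * pathSign ε α := by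
    intro α k hk
    have n1 : ε' (Sum.elim α ![false, true, true]) (inl k) = μ (Sum.elim α ![true, false]) *
        μ (Sum.elim (up α k) ![true, false]) * ε (Sum.elim α ![true, false, true]) (inl k) := by
      have := hμ (Sum.elim α ![true, false]) (inl k) (by simpa using hk)
      rw [up_inl] at this; exact this
    have n2 : ε' (Sum.elim α ![false, true, true]) (inl k) = ν (Sum.elim α ![true, false]) *
        ν (Sum.elim (up α k) ![true, false]) * ε (Sum.elim α ![true, true, false]) (inl k) := by
      have := hν (Sum.elim α ![true, false]) (inl k) (by simpa using hk)
      rw [up_inl] at this; exact this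
    rw [B.pathSign_up hε hm hk, units_eq_of_gauge n1, units_eq_of_gauge n2]
    generalize ε' (Sum.elim α ![false, true, true]) (inl k) = x1
    generalize μ (Sum.elim (up α k) ![true, false]) = x2
    generalize ν (Sum.elim (up α k) ![true, false]) = x3
    generalize pathSign ε α = x4
    generalize ε (Sum.elim α ![true, false, true]) (inl k) = x5
    generalize ε (Sum.elim α ![true, true, false]) (inl k) = x6
    revert x1 x2 x3 x4 x5 x6
    decide
  -- By `hUp` the sign does not change along edges in the directions of `ι`, so it is the same at
  -- all vertices of the slice.
  obtain ⟨e, he⟩ : ∃ e : ℤˣ, ∀ α, μ (Sum.elim α ![true, false]) * ν (Sum.elim α ![true, false]) *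
      pathSign ε α = -e := ⟨-(μ (Sum.elim a ![true, false]) *
      ν (Sum.elim a ![true, false]) * pathSign ε a), fun α => by
        rw [neg_neg]
        exact eq_of_up (f := fun α => μ (Sum.elim α ![true, false]) * ν (Sum.elim α ![true, false]) *
          pathSign ε α) hUp α a⟩
  have he' := fun α => (hEq α).symm.trans (he α)
  -- The detour in `K` from `101` back to `100` and on to `110`, followed by `F₂`, equals `F₁` up to
  -- the sign `-e`. `second_face` is the mirror statement for the detour in `L`.
  have first_face : ∀ w : (ι → Bool) → PtAlg R Ω, L.pr R ![false, true, true]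
      (FaceIso.map φ₂ ν ![true, false] (K.cross ε ![true, false, false] 1 (B.sect ε w))) =
      -(e • L.pr R ![false, true, true] (FaceIso.map φ₁ μ ![true, false] w)) := by
    intro w
    funext α
    rw [Pi.neg_apply, Pi.smul_apply, pr_apply, pr_apply, FaceIso.map_apply, FaceIso.map_apply,
      B.path_apply hm, emap_units_smul, proj_units_smul, proj_units_smul, proj_units_smul, emap_emap,
      proj_emap_congr (φ := φ₂ ∘ collapse B.O B.v) (ψ := φ₁) (h₁ α), smul_smul,
      signs_of_mul (he α), Units.neg_smul, mul_smul]
  have second_face : ∀ w : (ι → Bool) → PtAlg R Ω, L.pr R ![true, true, false]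
      (L.cross ε' ![true, false, false] 1 (B'.sect ε' (FaceIso.map φ₁ μ ![false, true] w))) =
      -(e • L.pr R ![true, true, false] (FaceIso.map φ₂ ν ![false, true] w)) := by
    intro w
    funext α
    rw [Pi.neg_apply, Pi.smul_apply, pr_apply, pr_apply, B'.path_apply hm', FaceIso.map_apply,
      FaceIso.map_apply, emap_units_smul, proj_units_smul, proj_units_smul, proj_units_smul, emap_emap,
      ← proj_emap_congr (φ := φ₂) (ψ := collapse B'.O B'.v ∘ φ₁) (h₂ α), smul_smul, mul_comm,
      signs_of_mul' (he' α), Units.neg_smul, mul_smul]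
  have c0 : ∀ b c, dn ![true, b, c] (0 : Fin 3) = ![false, b, c] := by decide
  have c1 : ∀ b c, dn ![b, true, c] (1 : Fin 3) = ![b, false, c] := by decide
  have c2 : ∀ b c, dn ![b, c, true] (2 : Fin 3) = ![b, c, false] := by decide
  have k001 := hy ![false, false, true]
  have k010 := hy ![false, true, false]
  have k011 := hy ![false, true, true]
  have k110 := hy ![true, true, false]
  have k111 := hy ![true, true, true]
  rw [pr_total, Fin.sum_univ_three] at k001 k010 k011 k110 k111
  simp only [Matrix.cons_val, Bool.false_eq_true, if_true, if_false, add_zero, zero_add, c0, c1, c2]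
    at k001 k010 k011 k110 k111
  rw [if_neg (by decide)] at k010 k011 k110 k111
  have z000 := y000.trans (map_zero (K.pr R _)).symm
  have z101 := y101.trans (map_zero (K.pr R _)).symm
  rw [hK.cross_congr (by rfl) (by decide) z000, map_zero, map_zero, add_zero] at k001 k010
  rw [hK.cross_congr (by rfl) u4 z101, map_zero, map_zero, add_zero] at k111
  rw [← map_neg] at y100
  rw [hK.cross_congr (by rfl) u3 y100, map_neg, map_neg] at k110
  -- The component at `001` is carried over by `F₁`. The one on the bigon slice of `L` is then
  -- chosen as in the reduced form, so that nothing is left at `101`.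
  let w := e • FaceIso.map φ₁ μ ![false, false] (y ![false, false, true])
  let w' := -B'.sect ε' (L.cross ε' ![false, false, true] 0 w)
  have hw : ∀ β, L.pr R β w = e • L.pr R β (FaceIso.map φ₁ μ ![false, false] (y ![false, false, true])) :=
    fun β => pr_units_smul _ _ _
  have cross_w : ∀ β β' q, L.pr R β' (L.cross ε' β q w) = e • L.pr R β' (L.cross ε' β q
      (FaceIso.map φ₁ μ ![false, false] (y ![false, false, true]))) := fun β β' q => by
    rw [← pr_units_smul]
    simp only [w, Units.smul_def, map_zsmul]
  -- the equations at the vertices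
  have l001 : L.pr R ![false, false, true] (L.inner ε' ![false, false, true] w) =
      L.pr R ![false, false, true] (Pi.single a (e • μ (Sum.elim a ![false, false]) • emap R φ₁ z)) := by
    have h1 : L.pr R ![false, false, true] (L.inner ε' ![false, false, true]
        (FaceIso.map φ₁ μ ![false, false] (y ![false, false, true]))) =
        L.pr R ![false, false, true] (FaceIso.map φ₁ μ ![false, false]
          (K.inner ε ![false, false, true] (y ![false, false, true]))) :=
      F₁.map_inner hμ ![false, false] _
    have h2 : L.pr R ![false, false, true] (FaceIso.map φ₁ μ ![false, false]
          (K.inner ε ![false, false, true] (y ![false, false, true]))) =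
        L.pr R ![false, false, true] (FaceIso.map φ₁ μ ![false, false] (Pi.single a z)) :=
      F₁.map_congr ![false, false] k001
    have h3 : L.inner ε' ![false, false, true] w = e • L.inner ε' ![false, false, true]
        (FaceIso.map φ₁ μ ![false, false] (y ![false, false, true])) := by
      simp only [w, Units.smul_def, map_zsmul]
    rw [h3, pr_units_smul, h1, h2, ← pr_units_smul]
    congr 1
    funext α
    rw [Pi.smul_apply, FaceIso.map_apply]
    by_cases hα : α = a
    · subst hα; rw [Pi.single_eq_same, Pi.single_eq_same]
    · rw [Pi.single_eq_of_ne hα, Pi.single_eq_of_ne hα, map_zero, smul_zero, smul_zero]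
  have l100 : L.pr R ![true, false, false] (L.inner ε' ![true, false, false] w') = 0 := by
    rw [map_neg, map_neg, B'.sect_inner hL hε' u1, neg_neg, B'.sect_congr hL u1 (y := 0), map_zero,
      map_zero]
    rw [hL.inner_cross hε' rfl u2, hL.cross_congr rfl u2 l001, pr_cross_single, neg_zero, map_zero]
    rw [edge_units_smul, edge_units_smul, proj_units_smul, proj_units_smul, hz, smul_zero, smul_zero]
  have l101 : L.pr R ![true, false, true] (L.cross ε' ![true, false, false] 2 w') =
      -L.pr R ![true, false, true] (L.cross ε' ![false, false, true] 0 w) := by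
    rw [map_neg, map_neg, B'.cross_sect hL u1]
  have l011 : L.pr R ![false, true, true] (L.cross ε' ![false, false, true] 1 w) =
      -L.pr R ![false, true, true] (FaceIso.map φ₂ ν ![true, false]
        (K.cross ε ![true, false, false] 1
          (B.sect ε (K.cross ε ![false, false, true] 0 (y ![false, false, true]))))) := by
    rw [cross_w, first_face, neg_neg]
    congr 1
    exact F₁.map_cross hμ (c := ![false, false]) (k := 0) rfl v1 _
  have l110 : L.pr R ![true, true, false] (L.cross ε' ![true, false, false] 1 w') =
      L.pr R ![true, true, false] (FaceIso.map φ₂ ν ![false, true]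
        (K.cross ε ![false, false, true] 1 (y ![false, false, true]))) := by
    have h1 : L.pr R ![true, false, true] (L.cross ε' ![false, false, true] 0
        (FaceIso.map φ₁ μ ![false, false] (y ![false, false, true]))) =
        L.pr R ![true, false, true] (FaceIso.map φ₁ μ ![false, true]
          (K.cross ε ![false, false, true] 1 (y ![false, false, true]))) :=
      F₁.map_cross hμ (c := ![false, false]) (k := 1) rfl v2 _
    have h2 : L.pr R ![true, false, true] (L.cross ε' ![false, false, true] 0 w) =
        L.pr R ![true, false, true] (e • FaceIso.map φ₁ μ ![false, true]
          (K.cross ε ![false, false, true] 1 (y ![false, false, true]))) := by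
      rw [cross_w, h1, pr_units_smul]
    have h3 := hL.cross_congr (ε := ε') (by rfl) u3 (B'.sect_congr (ε := ε') hL u1 h2)
    have h4 : ∀ x, L.cross ε' ![true, false, false] 1 (B'.sect ε' (e • x)) =
        e • L.cross ε' ![true, false, false] 1 (B'.sect (R := R) ε' x) := fun x => by
      simp only [Units.smul_def, map_zsmul]
    rw [h4, pr_units_smul, second_face] at h3
    rw [map_neg, map_neg, h3, smul_neg, smul_smul, Int.units_mul_self, one_smul, neg_neg]
  have t_inner : ∀ b c x, L.pr R ![c, true, b] (L.inner ε' ![c, true, b]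
      (FaceIso.map φ₂ ν ![b, c] x)) = L.pr R ![c, true, b]
        (FaceIso.map φ₂ ν ![b, c] (K.inner ε ![b, true, c] x)) := fun b c x =>
    F₂.map_inner hν ![b, c] x
  have t_zero : ∀ b c {x}, K.pr R ![b, true, c] x = 0 →
      L.pr R ![c, true, b] (FaceIso.map φ₂ ν ![b, c] x) = 0 := fun b c x h => by
    have h' : L.pr R ![c, true, b] (FaceIso.map φ₂ ν ![b, c] x) =
      L.pr R ![c, true, b] (FaceIso.map φ₂ ν ![b, c] 0) :=
        F₂.map_congr ![b, c] (h.trans (map_zero _).symm)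
    rw [h', map_zero, map_zero]
  have t10 : ∀ x, L.pr R ![false, true, true] (L.cross ε' ![false, true, false] 2
      (FaceIso.map φ₂ ν ![false, false] x)) = L.pr R ![false, true, true]
        (FaceIso.map φ₂ ν ![true, false] (K.cross ε ![false, true, false] 0 x)) := fun x =>
    F₂.map_cross hν (c := ![false, false]) (k := 0) rfl v1 x
  have t01 : ∀ x, L.pr R ![true, true, false] (L.cross ε' ![false, true, false] 0
      (FaceIso.map φ₂ ν ![false, false] x)) = L.pr R ![true, true, false]
        (FaceIso.map φ₂ ν ![false, true] (K.cross ε ![false, true, false] 2 x)) := fun x =>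
    F₂.map_cross hν (c := ![false, false]) (k := 1) rfl v2 x
  have t11 : ∀ x, L.pr R ![true, true, true] (L.cross ε' ![false, true, true] 0
      (FaceIso.map φ₂ ν ![true, false] x)) = L.pr R ![true, true, true]
        (FaceIso.map φ₂ ν ![true, true] (K.cross ε ![true, true, false] 2 x)) := fun x =>
    F₂.map_cross hν (c := ![true, false]) (k := 1) rfl v3 x
  have t11' : ∀ x, L.pr R ![true, true, true] (L.cross ε' ![true, true, false] 2
      (FaceIso.map φ₂ ν ![false, true] x)) = L.pr R ![true, true, true]
        (FaceIso.map φ₂ ν ![true, true] (K.cross ε ![false, true, true] 0 x)) := fun x =>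
    F₂.map_cross hν (c := ![false, true]) (k := 0) rfl v4 x
  have concl : L.Bounding (Sum.elim a ![false, false, true])
      (e • μ (Sum.elim a ![false, false]) • emap R φ₁ z) := by
    -- `F₂` exchanges the directions `0` and `2`, whence `![β 2, β 0]`. The components at `000` and
    -- `101` are zero, as in the reduced family.
    refine ⟨ε', hε', bounds_iff_total.2 ⟨fun β =>
      if β 1 = true then FaceIso.map φ₂ ν ![β 2, β 0] (y ![β 2, true, β 0])
      else if β 0 = true then (if β 2 = true then 0 else w') else if β 2 = true then w else 0,
      fun β => ?_⟩⟩
    obtain ⟨b, c, f, rfl⟩ : ∃ b c f, β = ![b, c, f] := ⟨β 0, β 1, β 2, by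
      funext i; fin_cases i <;> rfl⟩
    rw [pr_total, Fin.sum_univ_three]
    cases c
    · cases b <;> cases f
      · simp
      · simp [c2, l001]
      · simp [c0, l100]
      · simp [c0, c2, l101]
    · have hne : ¬ ![b, true, f] = ![false, false, true] := fun h => by simpa using congrFun h 1
      rw [if_neg hne]
      cases b <;> cases f
      · simp only [Matrix.cons_val, Bool.false_eq_true, if_true, if_false, add_zero, zero_add, c1]
        rw [t_inner, t_zero _ _ k010, map_zero, map_zero, add_zero]
      · rw [← map_neg, ← map_add, ← map_add] at k110
        have h2 := t_zero _ _ k110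
        simp only [Matrix.cons_val, Bool.false_eq_true, if_true, if_false, zero_add, c1, c2]
        rw [t_inner, t10, l011, ← h2]
        simp only [map_add, map_neg]
        abel
      · rw [← map_add, ← map_add] at k011
        have h2 := t_zero _ _ k011
        simp only [Matrix.cons_val, Bool.false_eq_true, if_true, if_false, add_zero, c0, c1]
        rw [t_inner, t01, l110, ← h2]
        simp only [map_add]
        abel
      · rw [← map_add, ← map_add] at k111
        have h2 := t_zero _ _ k111
        simp only [Matrix.cons_val, Bool.false_eq_true, if_true, if_false, c0, c1,
          c2]
        rw [t_inner, t11, t11', map_zero, map_zero, add_zero, ← h2]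
        simp only [map_add]
        abel
  have := concl.units_smul (μ (Sum.elim a ![false, false]) * e)
  rwa [smul_smul, smul_smul, mul_assoc _ e e, Int.units_mul_self, mul_one,
    Int.units_mul_self, one_smul] at this

end ResCube

end

/-! ### Removing and adding isolated circles. -/

noncomputable section

open PtAlg Sum

namespace PtAlg

variable {R : Type*} [CommRing R] {Ω Ω' : Type}

/-- Remove a point of `O`, from the right. -/
def remove (O : Ω → Prop) : PtAlg R Ω →ₗ[R] PtAlg R Ω :=
  (CliffordAlgebra.involute (Q := (0 : QuadraticForm R (Ω →₀ R)))).toLinearMap ∘ₗ contr (ind R O)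

theorem remove_apply (O : Ω → Prop) (x : PtAlg R Ω) :
    remove O x = CliffordAlgebra.involute (Q := (0 : QuadraticForm R (Ω →₀ R)))
      (contr (ind R O) x) := rfl

theorem involute_ι (m : Ω →₀ R) :
    CliffordAlgebra.involute (Q := (0 : QuadraticForm R (Ω →₀ R))) (ExteriorAlgebra.ι R m) =
      -ExteriorAlgebra.ι R m := CliffordAlgebra.involute_ι m

theorem involute_emap (φ : Ω → Ω') (x : PtAlg R Ω) :
    CliffordAlgebra.involute (Q := (0 : QuadraticForm R (Ω' →₀ R))) (emap R φ x) =
      emap R φ (CliffordAlgebra.involute (Q := (0 : QuadraticForm R (Ω →₀ R))) x) := by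
  induction x using left_induction with
  | h0 r => rw [AlgHom.commutes, AlgHom.commutes, AlgHom.commutes, AlgHom.commutes]
  | hadd x y hx hy => simp only [map_add, hx, hy]
  | hmul x m hx =>
    rw [map_mul, map_mul, map_mul, hx, map_mul, emap_ι, involute_ι, involute_ι, map_neg, emap_ι]

/-- The grading involution turns the antiderivation into a map that commutes with split factors away
from `O`. It is thus a chain map without any change of signs. -/
theorem remove_sub_mul {O : Ω → Prop} {p q : Ω} (hp : ¬ O p) (hq : ¬ O q) (x : PtAlg R Ω) :
    remove O ((pt R p - pt R q) * x) = (pt R p - pt R q) * remove O x := by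
  rw [remove_apply, remove_apply, contr_sub_mul, ind_neg hp, ind_neg hq, sub_zero, zero_smul,
    zero_sub, map_neg, map_mul, pt, pt, ← map_sub, involute_ι, neg_mul, neg_neg]

theorem remove_prod {O : Ω → Prop} {o : Ω} (ho : O o) (l : List Ω) (hl : ∀ p ∈ l, ¬ O p) :
    remove O ((l.map (pt R)).prod * pt R o) = (l.map (pt R)).prod := by
  induction l with
  | nil =>
    rw [List.map_nil, List.prod_nil, one_mul, ← mul_one (pt R o), remove_apply, pt, contr_ι_mul,
      ← map_one (algebraMap R (PtAlg R Ω)), contr_algebraMap, mul_zero, sub_zero]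
    simp [ind_pos ho]
  | cons p l ih =>
    rw [List.map_cons, List.prod_cons, mul_assoc, remove_apply, pt, contr_ι_mul]
    have hp := hl p (by simp)
    rw [Finsupp.linearCombination_single, ind_neg hp, smul_zero, zero_smul, zero_sub, map_neg,
      map_mul, involute_ι, neg_mul, neg_neg, ← remove_apply, ih fun q hq => hl q (by simp [hq])]

end PtAlg

namespace ResCube

variable {ι Ω : Type} [DecidableEq ι] [Fintype ι] {R : Type*} [CommRing R]

/-- A circle that is disjoint from the rest of the diagram may be removed. -/
theorem Bounding.of_isolated {K : ResCube ι Ω} {O : Ω → Prop}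
    (sat : ∀ α q q', K.rel α q q' → O q → O q') (s1 : ∀ k, ¬ O (K.s1 k)) (t1 : ∀ k, ¬ O (K.t1 k))
    {a : ι → Bool} {o : Ω} (ho : O o) {l : List Ω} (hl : ∀ p ∈ l, ¬ O p)
    (h : K.Bounding a ((l.map (pt R)).prod * pt R o)) : K.Bounding a (l.map (pt R)).prod := by
  obtain ⟨ε, hε, x, hx⟩ := h
  have congr : ∀ α {x y : PtAlg R Ω}, K.proj R α x = K.proj R α y →
      K.proj R α (remove O x) = K.proj R α (remove O y) := fun α x y h => by
    rw [remove_apply, remove_apply, proj, ← involute_emap, ← involute_emap]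
    congr 1
    exact proj_contr (sat α) h
  have key : ∀ β, K.d ε (fun α => remove O (x α)) β = remove O (K.d ε x β) := by
    intro β
    rw [d, d, map_sum]
    refine Finset.sum_congr rfl fun k _ => ?_
    by_cases hk : β k = true
    · rw [if_pos hk, if_pos hk, Units.smul_def, Units.smul_def, map_zsmul]
      congr 1
      by_cases hs : K.Splits (dn β k) k
      · rw [edge_split hs, edge_split hs, remove_sub_mul (s1 k) (t1 k)]
      · rw [edge_merge hs, edge_merge hs]
    · rw [if_neg hk, if_neg hk, map_zero]
  refine ⟨ε, hε, fun α => remove O (x α), fun β => ⟨fun hβ => ?_, fun hβ => ?_⟩⟩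
  · rw [key, congr β ((hx β).1 hβ), remove_prod ho l hl]
  · rw [key, congr β (((hx β).2 hβ).trans (map_zero _).symm), map_zero, map_zero]

/-- No edge enters the slice at `![false]` from outside, so the boundary equation restricts to it.
-/
theorem Bounding.slice_zero {K : ResCube (ι ⊕ Fin 1) Ω} {a : ι → Bool} {z : PtAlg R Ω}
    (h : K.Bounding (Sum.elim a ![false]) z) : (K.slice ![false]).Bounding a z := by
  obtain ⟨ε, hε, h⟩ := h
  rw [slice_bounding_iff hε]
  obtain ⟨x, hx⟩ := bounds_iff.1 h
  have := hx ![false]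
  rw [if_pos rfl] at this
  exact ⟨x ![false], by simpa using this⟩

/-- A circle that is disjoint from the rest of the diagram may be added, if the last crossing
merges it with another circle. -/
theorem Bounding.of_slice_zero {K : ResCube (ι ⊕ Fin 1) Ω} (hK : K.Good) {o v : Ω}
    (hm : ∀ α : ι → Bool, ¬ K.Splits (Sum.elim α ![false]) (inr 0))
    (ho : ∀ α : ι → Bool, K.rel (Sum.elim α ![true]) o v) {a : ι → Bool} {z : PtAlg R Ω}
    (h : (K.slice ![false]).Bounding a z) :
    K.Bounding (Sum.elim a ![false]) (z * (pt R o - pt R v)) := by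
  obtain ⟨ε, hε⟩ := hK.exists_valid
  rw [slice_bounding_iff hε] at h
  obtain ⟨y, hy⟩ := h
  -- Edge maps multiply from the left, hence commute with the right factor `o - v`; this factor
  -- vanishes once the last crossing has merged the two circles.
  let w : (ι → Bool) → PtAlg R Ω := fun α => y α * (pt R o - pt R v)
  have h0 : K.pr R ![false] (K.inner ε ![false] w) =
      K.pr R ![false] (Pi.single a (z * (pt R o - pt R v))) := by
    have e1 : ∀ α, K.inner ε ![false] w α = K.inner ε ![false] y α * (pt R o - pt R v) := by
      intro α
      rw [inner_apply, inner_apply, Finset.sum_mul]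
      refine Finset.sum_congr rfl fun k _ => ?_
      split_ifs
      · rw [smul_mul_assoc]
        congr 1
        by_cases hs : K.Splits (Sum.elim (dn α k) ![false]) (inl k)
        · rw [edge_split hs, edge_split hs, mul_assoc]
        · rw [edge_merge hs, edge_merge hs]
      · rw [zero_mul]
    funext α
    have := congrFun hy α
    rw [pr_apply, pr_apply] at this ⊢
    rw [e1, map_mul, this, ← map_mul]
    congr 1
    by_cases h : α = a
    · subst h; rw [Pi.single_eq_same, Pi.single_eq_same]
    · rw [Pi.single_eq_of_ne h, Pi.single_eq_of_ne h, zero_mul]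
  have h1 : K.pr R ![true] (K.cross ε ![false] 0 w) = 0 := by
    funext α
    rw [pr_apply, cross_apply, edge_merge (hm α), proj_units_smul, map_mul, map_sub,
      proj_pt_eq (ho α), sub_self, mul_zero, smul_zero]
    rfl
  refine ⟨ε, hε, bounds_iff.2 ⟨fun β => if β 0 = true then 0 else w, fun β => ?_⟩⟩
  have d0 : dn ![true] (0 : Fin 1) = ![false] := by decide
  obtain ⟨b, rfl⟩ : ∃ b, β = ![b] := ⟨β 0, by funext i; fin_cases i; rfl⟩
  cases b
  · simpa using h0
  · simp [d0, h1]

end ResCube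

end

/-! ### The flow along the circles of a braid diagram. -/

noncomputable section

namespace ResCube

/-- Being good only depends on the circles on which the arrows start and end. -/
theorem Good.comap {ι Ω Ω' : Type} [DecidableEq ι] {K : ResCube ι Ω} (hK : K.Good)
    {L : ResCube ι Ω'} (f : Ω' → Ω) (hr : ∀ α p q, L.rel α p q ↔ K.rel α (f p) (f q))
    (hs0 : ∀ α k, α k = false → K.rel α (f (L.s0 k)) (K.s0 k))
    (ht0 : ∀ α k, α k = false → K.rel α (f (L.t0 k)) (K.t0 k))
    (hs1 : ∀ α k, α k = true → K.rel α (f (L.s1 k)) (K.s1 k))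
    (ht1 : ∀ α k, α k = true → K.rel α (f (L.t1 k)) (K.t1 k)) : L.Good := by
  have conj : ∀ {α : ι → Bool} {p q p' q'}, K.rel α p p' → K.rel α q q' →
      (K.rel α p q ↔ K.rel α p' q') := fun hp hq =>
    ⟨fun h => rel_conj h hp hq, fun h => rel_conj h ((K.rel _).symm hp) ((K.rel _).symm hq)⟩
  have rf : ∀ α p, K.rel α p p := fun α => (K.rel α).refl
  have sp : ∀ {α : ι → Bool} {k}, α k = false → (L.Splits α k ↔ K.Splits α k) := fun {α k} hk =>
    (hr _ _ _).trans (conj (hs0 α k hk) (ht0 α k hk))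
  have up0 : ∀ {α : ι → Bool} {k l}, k ≠ l → α l = false → up α k l = false := fun hkl h => by
    simp [up, hkl.symm, h]
  have fs : ∀ {α : ι → Bool} {k l}, k ≠ l → α k = false → α l = false →
      L.fsgn α k l = K.fsgn α k l := by
    intro α k l hkl hk hl
    rw [fsgn, fsgn, propext (sp hk), propext (sp hl), propext (sp (up0 hkl hl)),
      propext ((hr _ _ _).trans (conj (ht0 (up α k) l (up0 hkl hl)) (hs1 (up α k) k (by simp)))),
      propext ((hr _ _ _).trans (conj (hs0 α k hk) (hs0 α l hl)))]
  exact {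
    merge_iff := fun {α k} hk hs p q => by
      rw [hr, hr, hr, hr, hr, hr, hK.merge_iff hk (mt (sp hk).2 hs),
        conj (rf α (f p)) (hs0 α k hk), conj (rf α (f q)) (ht0 α k hk),
        conj (rf α (f p)) (ht0 α k hk), conj (rf α (f q)) (hs0 α k hk)]
    split_iff := fun {α k} hk hs p q => by
      rw [hr, hr, hr, hr, hr, hr, hK.split_iff hk ((sp hk).1 hs),
        conj (rf (up α k) (f p)) (hs1 (up α k) k (by simp)),
        conj (rf (up α k) (f q)) (ht1 (up α k) k (by simp)),
        conj (rf (up α k) (f p)) (ht1 (up α k) k (by simp)),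
        conj (rf (up α k) (f q)) (hs1 (up α k) k (by simp))]
    split_ne := fun {α k} hk hs => by
      rw [hr, conj (hs1 (up α k) k (by simp)) (ht1 (up α k) k (by simp))]
      exact hK.split_ne hk ((sp hk).1 hs)
    merge_ends := fun {α k} hk hs => by
      rw [hr, conj (hs1 (up α k) k (by simp)) (ht1 (up α k) k (by simp))]
      exact hK.merge_ends hk (mt (sp hk).2 hs)
    split_splits := fun hkl hk hl h1 h2 h3 => (sp (up0 hkl.symm hk)).2
      (hK.split_splits hkl hk hl ((sp hk).1 h1) ((sp hl).1 h2) ((sp (up0 hkl hl)).1 h3))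
    par := fun {α k l} hkl hk hl h1 h2 h3 h4 => by
      have u1 : up (up α k) l k = true := by simp [up, hkl]
      have u2 : up (up α k) l l = true := by simp
      rw [hr, hr, conj (hs1 _ _ u1) (ht1 _ _ u2), conj (ht1 _ _ u1) (hs1 _ _ u2)]
      rw [hr, conj (hs0 α k hk) (hs0 α l hl)] at h4
      exact hK.par hkl hk hl (mt (sp hk).2 h1) (mt (sp hl).2 h2) ((sp (up0 hkl hl)).1 h3) h4
    antipar := fun {α k l} hkl hk hl h1 h2 h3 h4 => by
      have u1 : up (up α k) l k = true := by simp [up, hkl]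
      have u2 : up (up α k) l l = true := by simp
      rw [hr, hr, conj (hs1 _ _ u1) (hs1 _ _ u2), conj (ht1 _ _ u1) (ht1 _ _ u2)]
      rw [hr, conj (hs0 α k hk) (ht0 α l hl)] at h4
      exact hK.antipar hkl hk hl (mt (sp hk).2 h1) (mt (sp hl).2 h2) ((sp (up0 hkl hl)).1 h3) h4
    fsgn_symm := fun hkl hk hl => by
      rw [fs hkl hk hl, fs hkl.symm hl hk, hK.fsgn_symm hkl hk hl]
    cube := fun {α k l m} hkl hkm hlm hk hl hm => by
      rw [fs hkl hk hl, fs hkl (up0 hkm.symm hk) (up0 hlm.symm hl), fs hkm hk hm,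
        fs hkm (up0 hkl.symm hk) (up0 hlm hm), fs hlm hl hm, fs hlm (up0 hkl hl) (up0 hkm hm),
        hK.cube hkl hkm hlm hk hl hm] }

end ResCube

namespace BraidDiagram

variable (D : BraidDiagram)

theorem right_val (k : D.Crossing) : (D.right k : ℕ) = D.left k + 1 := by
  simp [right, left]

/-- The strand position `j` takes part in a horizontal smoothing at `k`. -/
def Bent (α : D.Resolution) (k : D.Crossing) (j : Fin (D.strands + 1)) : Prop :=
  ¬ D.IsVertical α k ∧ (j = D.left k ∨ j = D.right k)

open Classical in
/-- The next point, if one follows an arc upwards. -/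
def goUp (α : D.Resolution) (p : D.Point) : D.Point :=
  Fin.lastCases (motive := fun _ => D.Point) (0, p.2) (fun k => if D.Bent α k p.2 then
    (k.castSucc, Equiv.swap (D.left k) (D.right k) p.2) else (k.succ, p.2)) p.1

open Classical in
/-- The next point, if one follows an arc downwards. -/
def goDown (α : D.Resolution) (p : D.Point) : D.Point :=
  Fin.cases (motive := fun _ => D.Point) (Fin.last _, p.2) (fun k => if D.Bent α k p.2 then
    (k.succ, Equiv.swap (D.left k) (D.right k) p.2) else (k.castSucc, p.2)) p.1

variable {D} {α : D.Resolution}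

theorem goUp_last (j : Fin (D.strands + 1)) : D.goUp α (Fin.last _, j) = (0, j) := by
  simp [goUp]

theorem goUp_bent {k : D.Crossing} {j : Fin (D.strands + 1)} (h : D.Bent α k j) :
    D.goUp α (k.castSucc, j) = (k.castSucc, Equiv.swap (D.left k) (D.right k) j) := by
  simp [goUp, h]

theorem goUp_straight {k : D.Crossing} {j : Fin (D.strands + 1)} (h : ¬ D.Bent α k j) :
    D.goUp α (k.castSucc, j) = (k.succ, j) := by
  simp [goUp, h]

theorem goDown_zero (j : Fin (D.strands + 1)) : D.goDown α (0, j) = (Fin.last _, j) := by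
  simp [goDown]

theorem goDown_bent {k : D.Crossing} {j : Fin (D.strands + 1)} (h : D.Bent α k j) :
    D.goDown α (k.succ, j) = (k.succ, Equiv.swap (D.left k) (D.right k) j) := by
  simp [goDown, h]

theorem goDown_straight {k : D.Crossing} {j : Fin (D.strands + 1)} (h : ¬ D.Bent α k j) :
    D.goDown α (k.succ, j) = (k.castSucc, j) := by
  simp [goDown, h]

theorem Bent.swap {k : D.Crossing} {j : Fin (D.strands + 1)} (h : D.Bent α k j) :
    D.Bent α k (Equiv.swap (D.left k) (D.right k) j) := by
  refine ⟨h.1, ?_⟩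
  rcases h.2 with rfl | rfl
  · right; simp
  · left; simp

theorem Bent.parity {k : D.Crossing} {j : Fin (D.strands + 1)} (h : D.Bent α k j) :
    Even (Equiv.swap (D.left k) (D.right k) j : ℕ) ↔ ¬ Even (j : ℕ) := by
  have := D.right_val k
  rcases h.2 with rfl | rfl
  · rw [Equiv.swap_apply_left, this, Nat.even_add_one]
  · rw [Equiv.swap_apply_right, this, Nat.even_add_one, not_not]

open Classical in
/-- Follow the circles, upwards in the even and downwards in the odd strand positions. -/
def follow (α : D.Resolution) (p : D.Point) : D.Point :=
  if Even (p.2 : ℕ) then D.goUp α p else D.goDown α p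

open Classical in
/-- Follow the circles backwards. -/
def followBack (α : D.Resolution) (p : D.Point) : D.Point :=
  if Even (p.2 : ℕ) then D.goDown α p else D.goUp α p

/-- A bend leads to a neighbouring strand position and so changes its parity, all other arcs keep
it. The way back therefore goes down if the parity is unchanged and up otherwise; this makes the
alternating orientation consistent. -/
theorem goUp_inverse (p : D.Point) :
    (if Even ((D.goUp α p).2 : ℕ) ↔ Even (p.2 : ℕ) then D.goDown α (D.goUp α p)
      else D.goUp α (D.goUp α p)) = p := by
  obtain ⟨l, j⟩ := p
  induction l using Fin.lastCases with
  | last => rw [goUp_last]; simp [goDown_zero]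
  | cast k =>
    by_cases h : D.Bent α k j
    · rw [goUp_bent h, if_neg, goUp_bent h.swap, Equiv.swap_apply_self]
      rw [h.parity]; tauto
    · rw [goUp_straight h]; simp [goDown_straight h]

theorem goDown_inverse (p : D.Point) :
    (if Even ((D.goDown α p).2 : ℕ) ↔ Even (p.2 : ℕ) then D.goUp α (D.goDown α p)
      else D.goDown α (D.goDown α p)) = p := by
  obtain ⟨l, j⟩ := p
  induction l using Fin.cases with
  | zero => rw [goDown_zero]; simp [goUp_last]
  | succ k =>
    by_cases h : D.Bent α k j
    · rw [goDown_bent h, if_neg, goDown_bent h.swap, Equiv.swap_apply_self]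
      rw [h.parity]; tauto
    · rw [goDown_straight h]; simp [goUp_straight h]

/-- The permutation that follows the circles of a resolution. -/
def flow (α : D.Resolution) : Equiv.Perm D.Point where
  toFun := follow α
  invFun := followBack α
  left_inv p := by
    have h1 := goUp_inverse (α := α) p
    have h2 := goDown_inverse (α := α) p
    by_cases h : Even (p.2 : ℕ)
    · rw [follow, if_pos h, followBack]
      simpa [h] using h1
    · rw [follow, if_neg h, followBack]
      simp only [h, iff_false] at h2
      conv_rhs => rw [← h2]
      split_ifs <;> rfl
  right_inv p := by
    have h1 := goUp_inverse (α := α) p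
    have h2 := goDown_inverse (α := α) p
    by_cases h : Even (p.2 : ℕ)
    · rw [followBack, if_pos h, follow]
      simpa [h] using h2
    · rw [followBack, if_neg h, follow]
      simp only [h, iff_false] at h1
      conv_rhs => rw [← h1]
      split_ifs <;> rfl

theorem flow_even {p : D.Point} (h : Even (p.2 : ℕ)) : flow α p = D.goUp α p := if_pos h

theorem flow_odd {p : D.Point} (h : ¬ Even (p.2 : ℕ)) : flow α p = D.goDown α p := if_neg h

theorem circle_swap {k : D.Crossing} {j : Fin (D.strands + 1)} (h : D.Bent α k j) :
    D.circle α (k.castSucc, Equiv.swap (D.left k) (D.right k) j) = D.circle α (k.castSucc, j) ∧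
      D.circle α (k.succ, Equiv.swap (D.left k) (D.right k) j) = D.circle α (k.succ, j) := by
  have h1 := circle_arc (Arc.lower (D := D) (α := α) k h.1)
  have h2 := circle_arc (Arc.upper (D := D) (α := α) k h.1)
  rcases h.2 with rfl | rfl
  · rw [Equiv.swap_apply_left]; exact ⟨h1.symm, h2.symm⟩
  · rw [Equiv.swap_apply_right]; exact ⟨h1, h2⟩

theorem circle_straight {k : D.Crossing} {j : Fin (D.strands + 1)} (h : ¬ D.Bent α k j) :
    D.circle α (k.castSucc, j) = D.circle α (k.succ, j) := by
  refine circle_arc (.up k j ?_)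
  rw [Bent] at h
  tauto

theorem circle_goUp (p : D.Point) : D.circle α (D.goUp α p) = D.circle α p := by
  obtain ⟨l, j⟩ := p
  induction l using Fin.lastCases with
  | last => rw [goUp_last]; exact (circle_arc (.closing j)).symm
  | cast k =>
    by_cases h : D.Bent α k j
    · rw [goUp_bent h]; exact (circle_swap h).1
    · rw [goUp_straight h]; exact (circle_straight h).symm

theorem circle_goDown (p : D.Point) : D.circle α (D.goDown α p) = D.circle α p := by
  obtain ⟨l, j⟩ := p
  induction l using Fin.cases with
  | zero => rw [goDown_zero]; exact (circle_arc (.closing j))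
  | succ k =>
    by_cases h : D.Bent α k j
    · rw [goDown_bent h]; exact (circle_swap h).2
    · rw [goDown_straight h]; exact circle_straight h

theorem circle_flow (p : D.Point) : D.circle α (flow α p) = D.circle α p := by
  by_cases h : Even (p.2 : ℕ)
  · rw [flow_even h, circle_goUp]
  · rw [flow_odd h, circle_goDown]

/-- The circles of a resolution, as an equivalence relation on the points. -/
def circleRel (α : D.Resolution) : Setoid D.Point := Setoid.ker (D.circle α)

theorem circle_le {S : Setoid D.Point} (h : ∀ p q, D.Arc α p q → S p q) {p q : D.Point}
    (hpq : D.circle α p = D.circle α q) : S p q := by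
  have := Quot.eqvGen_exact hpq
  induction this with
  | rel p q h' => exact h p q h'
  | refl p => exact S.refl p
  | symm p q _ ih => exact S.symm (ih (Quot.eqvGen_sound ‹_›))
  | trans p q r _ _ ih1 ih2 =>
    exact S.trans (ih1 (Quot.eqvGen_sound ‹_›)) (ih2 (Quot.eqvGen_sound ‹_›))

/-- The orientation depends on the strand position only, so all resolutions are oriented at once and
each arc is one step of the flow, forwards or backwards. -/
theorem circle_iff_sameCycle {p q : D.Point} :
    D.circle α p = D.circle α q ↔ (flow α).SameCycle p q := by
  constructor
  · have key : ∀ p, (flow α).SameCycle p (flow α p) := fun p =>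
      Equiv.Perm.sameCycle_apply_right.2 (Equiv.Perm.SameCycle.refl _ _)
    refine circle_le (S := cycles (flow α)) fun p q h => ?_
    rw [cycles_iff]
    cases h with
    | up k j h =>
      have hb : ¬ D.Bent α k j := by rw [Bent]; tauto
      by_cases hj : Even (j : ℕ)
      · have := key (k.castSucc, j)
        rwa [flow_even hj, goUp_straight hb] at this
      · have := key (k.succ, j)
        rw [flow_odd hj, goDown_straight hb] at this
        exact this.symm
    | lower k h =>
      by_cases hj : Even (D.left k : ℕ)
      · have := key (k.castSucc, D.left k)
        rwa [flow_even hj, goUp_bent ⟨h, .inl rfl⟩, Equiv.swap_apply_left] at this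
      · have := key (k.castSucc, D.right k)
        rw [flow_even (by rw [right_val, Nat.even_add_one]; exact hj), goUp_bent ⟨h, .inr rfl⟩,
          Equiv.swap_apply_right] at this
        exact this.symm
    | upper k h =>
      by_cases hj : Even (D.left k : ℕ)
      · have := key (k.succ, D.right k)
        rw [flow_odd (by rw [right_val, Nat.even_add_one]; tauto), goDown_bent ⟨h, .inr rfl⟩,
          Equiv.swap_apply_right] at this
        exact this.symm
      · have := key (k.succ, D.left k)
        rwa [flow_odd hj, goDown_bent ⟨h, .inl rfl⟩, Equiv.swap_apply_left] at this
    | closing j =>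
      by_cases hj : Even (j : ℕ)
      · have := key (Fin.last _, j)
        rwa [flow_even hj, goUp_last] at this
      · have := key (0, j)
        rw [flow_odd hj, goDown_zero] at this
        exact this.symm
  · exact fun h => sameCycle_le (circleRel α) (fun p => (circle_flow p).symm) h

end BraidDiagram

end

/-! ### Parity of circles, and the permutation model of a braid diagram. -/

noncomputable section

namespace BraidDiagram

variable (D : BraidDiagram)

/-! ### The tails of the arrows -/

/-- The even one of the two strand positions at a crossing. -/
def evenCol (k : D.Crossing) : Fin (D.strands + 1) :=
  if Even (D.left k : ℕ) then D.left k else D.right k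

/-- The odd one of the two strand positions at a crossing. -/
def oddCol (k : D.Crossing) : Fin (D.strands + 1) :=
  if Even (D.left k : ℕ) then D.right k else D.left k

/-- The two ends of a crossing at which the flow enters it. -/
def entry (k : D.Crossing) (b : Bool) : D.Point :=
  if b then (k.succ, D.oddCol k) else (k.castSucc, D.evenCol k)

/-- The two ends of a crossing at which the flow leaves it. -/
def exit (k : D.Crossing) (b : Bool) : D.Point :=
  if b then (k.succ, D.evenCol k) else (k.castSucc, D.oddCol k)

variable {D} {α : D.Resolution}

theorem even_evenCol (k : D.Crossing) : Even (D.evenCol k : ℕ) := by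
  rw [evenCol]
  split_ifs with h
  · exact h
  · rwa [right_val, Nat.even_add_one]

theorem not_even_oddCol (k : D.Crossing) : ¬ Even (D.oddCol k : ℕ) := by
  rw [oddCol]
  split_ifs with h
  · rwa [right_val, Nat.even_add_one, not_not]
  · exact h

theorem eq_evenCol {k : D.Crossing} {j : Fin (D.strands + 1)} (hj : Even (j : ℕ))
    (h : j = D.left k ∨ j = D.right k) : j = D.evenCol k := by
  rw [evenCol]
  rcases h with rfl | rfl
  · rw [if_pos hj]
  · rw [right_val, Nat.even_add_one] at hj
    rw [if_neg hj]

theorem eq_oddCol {k : D.Crossing} {j : Fin (D.strands + 1)} (hj : ¬ Even (j : ℕ))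
    (h : j = D.left k ∨ j = D.right k) : j = D.oddCol k := by
  rw [oddCol]
  rcases h with rfl | rfl
  · rw [if_neg hj]
  · rw [right_val, Nat.even_add_one, not_not] at hj
    rw [if_pos hj]

theorem evenCol_or (k : D.Crossing) : D.evenCol k = D.left k ∨ D.evenCol k = D.right k := by
  rw [evenCol]; split_ifs <;> simp

theorem oddCol_or (k : D.Crossing) : D.oddCol k = D.left k ∨ D.oddCol k = D.right k := by
  rw [oddCol]; split_ifs <;> simp

theorem swap_evenCol (k : D.Crossing) :
    Equiv.swap (D.left k) (D.right k) (D.evenCol k) = D.oddCol k := by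
  rw [evenCol, oddCol]; split_ifs <;> simp

theorem swap_oddCol (k : D.Crossing) :
    Equiv.swap (D.left k) (D.right k) (D.oddCol k) = D.evenCol k := by
  rw [evenCol, oddCol]; split_ifs <;> simp

/-- Every crossing has two entries and two exits, whatever its smoothing; changing the smoothing
exchanges the exits. This is the condition `σ_P` of a `PermModel`. -/
theorem flow_entry (k : D.Crossing) (b : Bool) :
    flow α (D.entry k b) = D.exit k (xor b (xor (α k) (D.pos k))) := by
  by_cases hv : D.IsVertical α k
  · have hb : ∀ j, ¬ D.Bent α k j := fun j h => h.1 hv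
    have : xor (α k) (D.pos k) = true := by rw [hv]; simp
    rw [this]
    cases b
    · rw [entry, if_neg (by simp), flow_even (even_evenCol k), goUp_straight (hb _)]
      simp [exit]
    · rw [entry, if_pos rfl, flow_odd (not_even_oddCol k), goDown_straight (hb _)]
      simp [exit]
  · have : xor (α k) (D.pos k) = false := by
      rw [IsVertical] at hv
      revert hv
      cases α k <;> cases D.pos k <;> simp
    rw [this]
    cases b
    · rw [entry, if_neg (by simp), flow_even (even_evenCol k), goUp_bent ⟨hv, evenCol_or k⟩,
        swap_evenCol]
      simp [exit]
    · rw [entry, if_pos rfl, flow_odd (not_even_oddCol k), goDown_bent ⟨hv, oddCol_or k⟩,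
        swap_oddCol]
      simp [exit]

theorem flow_of_ne {p : D.Point} (h : ∀ k b, p ≠ D.entry k b) (α β : D.Resolution) :
    flow α p = flow β p := by
  obtain ⟨l, j⟩ := p
  by_cases hj : Even (j : ℕ)
  · rw [flow_even hj, flow_even hj]
    induction l using Fin.lastCases with
    | last => rw [goUp_last, goUp_last]
    | cast k =>
      have : ∀ α, ¬ D.Bent α k j := fun α hb => h k false (by
        rw [entry, if_neg (by simp), eq_evenCol hj hb.2])
      rw [goUp_straight (this _), goUp_straight (this _)]
  · rw [flow_odd hj, flow_odd hj]
    induction l using Fin.cases with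
    | zero => rw [goDown_zero, goDown_zero]
    | succ k =>
      have : ∀ α, ¬ D.Bent α k j := fun α hb => h k true (by
        rw [entry, if_pos rfl, eq_oddCol hj hb.2])
      rw [goDown_straight (this _), goDown_straight (this _)]

theorem entry_inj {k l : D.Crossing} {b c : Bool} (h : D.entry k b = D.entry l c) :
    k = l ∧ b = c := by
  have h2 := congrArg (fun p : D.Point => Even (p.2 : ℕ)) h
  have h1 := congrArg Prod.fst h
  have e := even_evenCol (D := D)
  have o := not_even_oddCol (D := D)
  cases b <;> cases c <;> simp [entry, e, o] at h1 h2 ⊢ <;> exact h1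

/-! ### The height of a circle above the other circles -/

open Classical in
/-- The indicator function of a circle on a level. -/
def onCircle (α : D.Resolution) (c : D.Circle α) (l : Fin (D.word.length + 1)) (j : ℕ) : ZMod 2 :=
  if h : j < D.strands + 1 then if D.circle α (l, ⟨j, h⟩) = c then 1 else 0 else 0

/-- The number of times one crosses the circle `c` on the way from the left to a point, counted
modulo two; on the circle itself the side is chosen so that it does not change along the circle. -/
def side (α : D.Resolution) (c : D.Circle α) (p : D.Point) : ZMod 2 :=
  ∑ j ∈ Finset.range p.2, onCircle α c p.1 j + onCircle α c p.1 p.2 * (p.2 : ℕ)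

theorem onCircle_congr {c : D.Circle α} {l l' : Fin (D.word.length + 1)} {i j : Fin (D.strands + 1)}
    (h : D.circle α (l, i) = D.circle α (l', j)) : onCircle α c l i = onCircle α c l' j := by
  rw [onCircle, onCircle, dif_pos i.2, dif_pos j.2]
  simp only [Fin.eta]
  rw [h]

theorem onCircle_of_eq {c : D.Circle α} {l : Fin (D.word.length + 1)} {j : Fin (D.strands + 1)}
    (h : D.circle α (l, j) = c) : onCircle α c l j = 1 := by
  rw [onCircle, dif_pos j.2]
  exact if_pos h

theorem onCircle_of_ne {c : D.Circle α} {l : Fin (D.word.length + 1)} {j : Fin (D.strands + 1)}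
    (h : D.circle α (l, j) ≠ c) : onCircle α c l j = 0 := by
  rw [onCircle, dif_pos j.2]
  exact if_neg h

theorem onCircle_straight {c : D.Circle α} {k : D.Crossing} {j : ℕ}
    (h : D.IsVertical α k ∨ (j ≠ D.left k ∧ j ≠ D.left k + 1)) :
    onCircle α c k.castSucc j = onCircle α c k.succ j := by
  by_cases hj : j < D.strands + 1
  · refine onCircle_congr (i := ⟨j, hj⟩) (j := ⟨j, hj⟩) (circle_arc (.up k _ ?_))
    simpa [Fin.ext_iff, right_val] using h
  · rw [onCircle, onCircle, dif_neg hj, dif_neg hj]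

/-- At a horizontal smoothing the two strand positions of the crossing lie on a common circle on
each of the two levels, so together they contribute an even number. Only a count that stops between
them can differ. -/
theorem sum_onCircle {c : D.Circle α} {k : D.Crossing} {j : ℕ}
    (h : D.IsVertical α k ∨ j ≠ D.left k + 1) :
    ∑ i ∈ Finset.range j, onCircle α c k.castSucc i = ∑ i ∈ Finset.range j, onCircle α c k.succ i := by
  by_cases hv : D.IsVertical α k
  · exact Finset.sum_congr rfl fun i _ => onCircle_straight (.inl hv)
  · replace h := h.resolve_left hv
    have e1 : onCircle α c k.castSucc (D.left k + 1) = onCircle α c k.castSucc (D.left k) := by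
      rw [← right_val]; exact (onCircle_congr (circle_arc (.lower k hv))).symm
    have e2 : onCircle α c k.succ (D.left k + 1) = onCircle α c k.succ (D.left k) := by
      rw [← right_val]; exact (onCircle_congr (circle_arc (.upper k hv))).symm
    have le : ∀ j ≤ (D.left k : ℕ), ∑ i ∈ Finset.range j, onCircle α c k.castSucc i =
        ∑ i ∈ Finset.range j, onCircle α c k.succ i := fun j hj =>
      Finset.sum_congr rfl fun i hi => onCircle_straight (.inr (by
        rw [Finset.mem_range] at hi; omega))
    rcases Nat.lt_or_ge (D.left k + 1 : ℕ) j with hj | hj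
    · induction j, hj using Nat.le_induction with
      | base =>
        rw [Finset.sum_range_succ, Finset.sum_range_succ, Finset.sum_range_succ,
          Finset.sum_range_succ, e1, e2, le _ le_rfl, add_assoc, add_assoc, CharTwo.add_self_eq_zero,
          CharTwo.add_self_eq_zero]
      | succ j hj ih =>
        rw [Finset.sum_range_succ, Finset.sum_range_succ, ih (by omega),
          onCircle_straight (.inr (by omega))]
    · exact le j (by omega)

/-- If the arc lies on `c`, one step to the right adds `1` to the count and `1` to the correction by
the strand position; modulo two the sum is unchanged. If not, both are unchanged. -/
theorem side_step {c : D.Circle α} {l : Fin (D.word.length + 1)} {i j : Fin (D.strands + 1)}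
    (hij : (j : ℕ) = i + 1) (h : D.circle α (l, i) = D.circle α (l, j)) :
    side α c (l, i) = side α c (l, j) := by
  have e := onCircle_congr (c := c) h
  simp only [side]
  rw [hij] at e ⊢
  rw [Finset.sum_range_succ, ← e]
  push_cast
  have : onCircle α c l i + onCircle α c l i = 0 := CharTwo.add_self_eq_zero _
  linear_combination -this

theorem side_circle {c : D.Circle α} {p q : D.Point} (h : D.circle α p = D.circle α q) :
    side α c p = side α c q := by
  refine circle_le (S := Setoid.ker (side α c)) (fun p q hpq => ?_) h
  rw [Setoid.ker_def]
  have h := circle_arc hpq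
  cases hpq with
  | up k j hv =>
    simp only [side]
    rw [onCircle_congr h, sum_onCircle]
    refine hv.imp id fun h' hj => h'.2 (Fin.ext ?_)
    rw [right_val, hj]
  | lower k hv => exact side_step (D.right_val k) h
  | upper k hv => exact side_step (D.right_val k) h
  | closing j =>
    have : ∀ i, onCircle α c (Fin.last _) i = onCircle α c 0 i := fun i => by
      by_cases hi : i < D.strands + 1
      · exact onCircle_congr (i := ⟨i, hi⟩) (j := ⟨i, hi⟩) (circle_arc (.closing _))
      · rw [onCircle, onCircle, dif_neg hi, dif_neg hi]
    simp only [side, this]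

theorem circle_entry (k : D.Crossing) :
    (D.IsVertical α k → ((D.circle α (D.entry k false) = D.circle α (k.castSucc, D.left k) ∧
      D.circle α (D.entry k true) = D.circle α (k.castSucc, D.right k)) ∨
      (D.circle α (D.entry k false) = D.circle α (k.castSucc, D.right k) ∧
      D.circle α (D.entry k true) = D.circle α (k.castSucc, D.left k)))) ∧
    (¬ D.IsVertical α k → D.circle α (D.entry k false) = D.circle α (k.castSucc, D.left k) ∧
      D.circle α (D.entry k true) = D.circle α (k.succ, D.left k)) := by
  constructor
  · intro hv
    have h := fun j => (circle_arc (Arc.up (D := D) (α := α) k j (.inl hv))).symm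
    by_cases he : Even (D.left k : ℕ)
    · simp [entry, evenCol, oddCol, he, h]
    · simp [entry, evenCol, oddCol, he, h]
  · intro hv
    have h1 := (circle_arc (Arc.lower (D := D) (α := α) k hv)).symm
    have h2 := (circle_arc (Arc.upper (D := D) (α := α) k hv)).symm
    rw [ptBL, ptBR] at h1
    rw [ptTL, ptTR] at h2
    by_cases he : Even (D.left k : ℕ)
    · simp [entry, evenCol, oddCol, he, h2]
    · simp [entry, evenCol, oddCol, he, h1]

open Classical in
/-- The parity that all arrows between the same two circles have in common. -/
theorem side_entry {c : D.Circle α} {k : D.Crossing}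
    (h : D.circle α (D.entry k false) ≠ D.circle α (D.entry k true))
    (hc : c = D.circle α (D.entry k false) ∨ c = D.circle α (D.entry k true)) :
    side α c (D.entry k false) + side α c (D.entry k true) =
      (D.left k : ℕ) + if D.IsVertical α k then 1 else 0 := by
  obtain ⟨h1, h2⟩ := circle_entry (α := α) k
  have two : ∀ a : ZMod 2, a + a = 0 := CharTwo.add_self_eq_zero
  by_cases hv : D.IsVertical α k
  -- For vertical arcs, with `c` on the left the count rises by one and the correction `left`
  -- appears at the left point; with `c` on the right the correction is `left + 1` at the right
  -- point. Both give `left + 1`.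
  · have key : ∀ (_ : D.circle α (k.castSucc, D.left k) ≠ D.circle α (k.castSucc, D.right k))
        (_ : c = D.circle α (k.castSucc, D.left k) ∨ c = D.circle α (k.castSucc, D.right k)),
        side α c (k.castSucc, D.left k) + side α c (k.castSucc, D.right k) =
          (D.left k : ℕ) + 1 := by
      intro hne hc
      simp only [side]
      rcases hc with rfl | rfl
      · rw [onCircle_of_eq rfl, onCircle_of_ne hne.symm, right_val, Finset.sum_range_succ,
          onCircle_of_eq rfl]
        linear_combination two (∑ j ∈ Finset.range (D.left k), onCircle α _ k.castSucc j)
      · rw [onCircle_of_eq rfl, onCircle_of_ne hne, right_val, Finset.sum_range_succ,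
          onCircle_of_ne hne]
        push_cast
        linear_combination two (∑ j ∈ Finset.range (D.left k), onCircle α _ k.castSucc j)
    rw [if_pos hv]
    rcases h1 hv with ⟨a, b⟩ | ⟨a, b⟩
    · rw [side_circle a, side_circle b]
      rw [a, b] at h hc
      exact key h hc
    · rw [side_circle a, side_circle b, add_comm]
      rw [a, b] at h hc
      exact key h.symm hc.symm
  · obtain ⟨a, b⟩ := h2 hv
    rw [if_neg hv, side_circle a, side_circle b]
    rw [a, b] at h hc
    simp only [side]
    rw [sum_onCircle (.inr (by omega))]
    rcases hc with rfl | rfl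
    · rw [onCircle_of_eq rfl, onCircle_of_ne h.symm]
      linear_combination two (∑ j ∈ Finset.range (D.left k), onCircle α _ k.succ j)
    · rw [onCircle_of_eq rfl, onCircle_of_ne h]
      linear_combination two (∑ j ∈ Finset.range (D.left k), onCircle α _ k.succ j)

/-! ### The cube of resolutions -/

/-- The entry at the start of the arrow is the one with index `false`. -/
def arrowEntry (o : D.Arrows) (k : D.Crossing) (b : Bool) : D.Point :=
  D.entry k (xor b (xor (D.pos k && !decide (Even (D.left k : ℕ))) (!o k)))

/-- Whether the arrow of the 1-smoothing starts at the circle of the end of the arrow. -/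
def arrowColor (k : D.Crossing) : Bool := decide (Even (D.left k : ℕ)) == D.pos k

variable (D) in
/-- The cube of resolutions, with arrows between the entries of the crossings. -/
def entryCube (o : D.Arrows) : ResCube D.Crossing D.Point where
  rel := circleRel
  s0 k := arrowEntry o k false
  t0 k := arrowEntry o k true
  s1 k := arrowEntry o k (arrowColor k)
  t1 k := arrowEntry o k (!arrowColor k)

/-- The substitute for the Jordan curve theorem. As `side` is constant on circles, both crossings
compute the same sum of the sides of the two circles with respect to `c`. By `side_entry` this sum
depends only on the parity of the strand position and the smoothing, which is what the colour
encodes. -/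
theorem entryCube_planar {k l : D.Crossing} {x y : Bool}
    (h : D.circle α (D.entry k x) ≠ D.circle α (D.entry k !x))
    (h' : (D.circle α (D.entry k x) = D.circle α (D.entry l y) ∧
      D.circle α (D.entry k !x) = D.circle α (D.entry l !y))) :
    xor (arrowColor k) (α k) = xor (arrowColor l) (α l) := by
  classical
  set c := D.circle α (D.entry k x)
  have key : ∀ (k : D.Crossing) (x : Bool),
      D.circle α (D.entry k x) ≠ D.circle α (D.entry k !x) → c = D.circle α (D.entry k x) →
      side α c (D.entry k x) + side α c (D.entry k !x) =
        if xor (arrowColor k) (α k) then 1 else 0 := by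
    intro k x h hc
    have : side α c (D.entry k x) + side α c (D.entry k !x) =
        (D.left k : ℕ) + if D.IsVertical α k then 1 else 0 := by
      cases x
      · exact side_entry h (.inl hc)
      · rw [add_comm]; exact side_entry h.symm (.inr hc)
    rw [this, arrowColor]
    rw [IsVertical]
    by_cases he : Even (D.left k : ℕ)
    · rw [(ZMod.natCast_eq_zero_iff_even).2 he]
      cases α k <;> cases D.pos k <;> simp [he]
    · rw [(ZMod.natCast_eq_one_iff_odd).2 (Nat.not_even_iff_odd.1 he)]
      cases α k <;> cases D.pos k <;> simp [he] <;> rfl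
  have h1 := key k x h rfl
  have h2 := key l y (by rw [← h'.1, ← h'.2]; exact h) h'.1
  rw [side_circle h'.1, side_circle h'.2, h2] at h1
  revert h1
  cases xor (arrowColor k) (α k) <;> cases xor (arrowColor l) (α l) <;> simp

/-- The flow describes the cube of resolutions by permutations. -/
def permModel (o : D.Arrows) : (entryCube D o).PermModel where
  P := arrowEntry o
  inj := by
    intro k l b c h
    obtain ⟨rfl, h⟩ := entry_inj h
    exact ⟨rfl, by simpa using h⟩
  base := flow fun _ => false
  σ := flow
  σ_P := by
    intro α k b
    rw [arrowEntry, arrowEntry, flow_entry, flow_entry]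
    congr 1
    cases α k <;> cases b <;> simp
  σ_N := fun α x hx => flow_of_ne (fun k b hp => hx k
    (xor b (xor (D.pos k && !decide (Even (D.left k : ℕ))) (!o k))) (by
      rw [hp, arrowEntry]; simp)) _ _
  rel_iff := circle_iff_sameCycle
  color := arrowColor
  s0 _ := rfl
  t0 _ := rfl
  s1 _ := rfl
  t1 _ := rfl
  planar := by
    intro α k l h h'
    have e : ∀ k, arrowEntry o k true = D.entry k !(xor false
        (xor (D.pos k && !decide (Even (D.left k : ℕ))) (!o k))) := fun k => by
      rw [arrowEntry]; simp
    change ¬ (D.circle α _ = D.circle α _) at h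
    change (D.circle α _ = D.circle α _ ∧ D.circle α _ = D.circle α _) ∨
      (D.circle α _ = D.circle α _ ∧ D.circle α _ = D.circle α _) at h'
    rw [e k] at h
    rw [e k, e l] at h'
    rcases h' with h' | ⟨h1, h2⟩
    · exact entryCube_planar h h'
    · exact entryCube_planar h ⟨h1, by rw [Bool.not_not]; exact h2⟩

theorem entryCube_good (o : D.Arrows) : (entryCube D o).Good := (permModel o).good

end BraidDiagram

end

/-! ### The odd Khovanov complex as an abstract cube. -/

noncomputable section

open PtAlg

namespace BraidDiagram

variable (D : BraidDiagram)

/-- The marked point closest to a pair of coordinates. -/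
def clamp (p : ℕ × ℕ) : D.Point :=
  (⟨min p.1 D.word.length, by omega⟩, ⟨min p.2 D.strands, by omega⟩)

/-- The coordinates of a marked point. -/
def coord (p : D.Point) : ℕ × ℕ := (p.1, p.2)

-- Pairs of natural numbers serve as points for all diagrams, so that maps between diagrams are
-- plain functions of coordinates.
@[simp] theorem clamp_coord (p : D.Point) : D.clamp (D.coord p) = p := by
  obtain ⟨l, j⟩ := p
  simp only [clamp, coord, Prod.mk.injEq, Fin.ext_iff]
  omega

/-- The circle of a resolution that belongs to a pair of coordinates. -/
def circ (α : D.Resolution) (p : ℕ × ℕ) : D.Circle α := D.circle α (D.clamp p)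

/-- The cube of resolutions of a braid diagram. -/
def cube (o : D.Arrows) : ResCube D.Crossing (ℕ × ℕ) where
  rel α := Setoid.ker (D.circ α)
  s0 k := D.coord (D.arrow0 o k).1
  t0 k := D.coord (D.arrow0 o k).2
  s1 k := D.coord (D.arrow1 o k).1
  t1 k := D.coord (D.arrow1 o k).2

variable {D} {α : D.Resolution} {o : D.Arrows}

theorem cube_rel {p q : ℕ × ℕ} : (D.cube o).rel α p q ↔ D.circ α p = D.circ α q := Iff.rfl

theorem circle_entry_eq (k : D.Crossing) (b : Bool) :
    D.circle α (D.entry k b) = D.circle α (D.exit k (xor b (xor (α k) (D.pos k)))) := by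
  rw [← flow_entry, circle_flow]

/-- An arrow is only needed in the smoothing to which it belongs. There its ends can be slid along
their arcs to the entries of the crossing, so `entryCube` computes the same cube; the cases are
sign, arrow and parity. -/
theorem arrow_circle (k : D.Crossing) :
    (α k = false → D.circle α (D.arrow0 o k).1 = D.circle α (arrowEntry o k false) ∧
      D.circle α (D.arrow0 o k).2 = D.circle α (arrowEntry o k true)) ∧
    (α k = true → D.circle α (D.arrow1 o k).1 = D.circle α (arrowEntry o k (arrowColor k)) ∧
      D.circle α (D.arrow1 o k).2 = D.circle α (arrowEntry o k !arrowColor k)) := by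
  have h := fun b => circle_entry_eq (α := α) k b
  have h0 := h false
  have h1 := h true
  constructor <;> intro hk <;> rw [hk] at h0 h1 <;> cases hp : D.pos k <;> cases ho : o k <;>
    by_cases he : Even (D.left k : ℕ) <;>
    simp [arrow0, arrow1, arrowEntry, arrowColor, hp, ho, he, entry, exit, evenCol, oddCol,
      ptBL, ptBR, ptTL] at h0 h1 ⊢ <;> simp [h0, h1]

theorem cube_good (o : D.Arrows) : (D.cube o).Good :=
  (entryCube_good o).comap D.clamp (fun _ _ _ => Iff.rfl)
    (fun α k hk => by
      change D.circle α (D.clamp (D.coord (D.arrow0 o k).1)) = _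
      rw [clamp_coord, ((arrow_circle k).1 hk).1]; rfl)
    (fun α k hk => by
      change D.circle α (D.clamp (D.coord (D.arrow0 o k).2)) = _
      rw [clamp_coord, ((arrow_circle k).1 hk).2]; rfl)
    (fun α k hk => by
      change D.circle α (D.clamp (D.coord (D.arrow1 o k).1)) = _
      rw [clamp_coord, ((arrow_circle k).2 hk).1]; rfl)
    (fun α k hk => by
      change D.circle α (D.clamp (D.coord (D.arrow1 o k).2)) = _
      rw [clamp_coord, ((arrow_circle k).2 hk).2]; rfl)

/-- A marked point on a circle. -/
def markedPoint (c : D.Circle α) : D.Point := Quot.out c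

theorem circle_markedPoint (c : D.Circle α) : D.circle α (markedPoint c) = c := Quot.out_eq _

theorem circ_markedPoint (p : ℕ × ℕ) :
    D.circ α (D.coord (markedPoint (D.circ α p))) = D.circ α p := by
  rw [circ, clamp_coord, circle_markedPoint]

variable {R : Type*} [CommRing R]

theorem relabel_eq (β : D.Resolution) (x : PtAlg R (D.Circle α)) :
    ExteriorAlgebra.map (relabel R D α β) x = emap R (fun c => D.circle β (markedPoint c)) x := rfl

theorem emap_circ_congr {x y : PtAlg R (ℕ × ℕ)}
    (h : (D.cube o).proj R α x = (D.cube o).proj R α y) :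
    emap R (D.circ α) x = emap R (D.circ α) y := by
  have key : ∀ x, emap R (D.circ α) x =
      emap R (Quotient.lift (s := (D.cube o).rel α) (D.circ α) fun _ _ h => h)
        ((D.cube o).proj R α x) := fun x => by
    rw [ResCube.proj, emap_emap]; rfl
  rw [key, key, h]

theorem isMerge_iff {k : D.Crossing} : D.IsMerge o α k ↔ ¬ (D.cube o).Splits α k := by
  rw [IsMerge, ResCube.Splits, cube_rel, circ, circ]
  simp only [cube, clamp_coord]

/-- `relabel` chooses a point on every circle. For a merge the choice is immaterial; for a split two
choices differ by exchanging the two new circles, which the factor `v₀ - v₁` identifies. -/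
theorem edgeMap_emap {k : D.Crossing} (hk : α k = false) (x : PtAlg R (ℕ × ℕ)) :
    edgeMap R D o α (up α k) k (emap R (D.circ α) x) =
      emap R (D.circ (up α k)) ((D.cube o).edge R α k x) := by
  have hout : ∀ p, (D.cube o).rel α p (D.coord (markedPoint (D.circ α p))) := fun p =>
    (circ_markedPoint p).symm
  have hmap : ExteriorAlgebra.map (relabel R D α (up α k)) (emap R (D.circ α) x) =
      emap R (fun p => D.circ (up α k) (D.coord (markedPoint (D.circ α p)))) x := by
    rw [relabel_eq, emap_emap]
    congr 2
    funext p
    rw [circ, clamp_coord]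
    rfl
  by_cases h : (D.cube o).Splits α k
  · rw [edgeMap, if_neg (by rw [isMerge_iff]; exact not_not.2 h), ResCube.edge_split h, map_mul,
      LinearMap.comp_apply, LinearMap.mulLeft_apply, AlgHom.toLinearMap_apply, hmap]
    have e : ExteriorAlgebra.ι R (gen R D (up α k) (D.arrow1 o k).1 -
        gen R D (up α k) (D.arrow1 o k).2) =
        (pt R (D.circle (up α k) (D.arrow1 o k).1) - pt R (D.circle (up α k) (D.arrow1 o k).2) :
          PtAlg R (D.Circle (up α k))) := map_sub _ _ _
    have e1 : D.circ (up α k) ((D.cube o).s1 k) = D.circle (up α k) (D.arrow1 o k).1 := by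
      rw [circ, cube, clamp_coord]
    have e2 : D.circ (up α k) ((D.cube o).t1 k) = D.circle (up α k) (D.arrow1 o k).2 := by
      rw [circ, cube, clamp_coord]
    rw [e, map_sub, emap_pt, emap_pt, e1, e2]
    refine mul_emap_congr _ _ _ _ (fun p => ?_) x
    have := ((cube_good o).split_iff hk h _ _).1 (hout p)
    simp only [cube_rel, e1, e2] at this
    rcases this with h | ⟨h, h'⟩ | ⟨h, h'⟩
    · exact .inl h.symm
    · exact .inr (.inr ⟨h', h⟩)
    · exact .inr (.inl ⟨h', h⟩)
  · rw [edgeMap, if_pos (isMerge_iff.2 h), ResCube.edge_merge h, AlgHom.toLinearMap_apply, hmap]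
    congr 2
    funext p
    exact (((cube_good o).merge_iff hk h _ _).2 (.inl (hout p))).symm

theorem faceType_sgn (α : D.Resolution) (k l : D.Crossing) :
    (D.faceType o α k l).sgn = ((D.cube o).fsgn α k l : ℤ) := by
  have e : ∀ {α : D.Resolution} {p q : D.Point},
      (D.cube o).rel α (D.coord p) (D.coord q) ↔ D.circle α p = D.circle α q := fun {α p q} => by
    rw [cube_rel, circ, circ, clamp_coord, clamp_coord]
  rw [faceType, ResCube.fsgn]
  have m : ∀ (α : D.Resolution) (k : D.Crossing),
      D.IsMerge o α k = ¬ (D.cube o).Splits α k := fun _ _ => propext isMerge_iff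
  have e1 := e (α := D.set1 α k) (p := (D.arrow0 o l).2) (q := (D.arrow1 o k).1)
  have e2 := e (α := α) (p := (D.arrow0 o k).1) (q := (D.arrow0 o l).1)
  change (D.cube o).rel (up α k) ((D.cube o).t0 l) ((D.cube o).s1 k) ↔ _ at e1
  change (D.cube o).rel α ((D.cube o).s0 k) ((D.cube o).s0 l) ↔ _ at e2
  have m3 : D.IsMerge o (D.set1 α k) l = ¬ (D.cube o).Splits (up α k) l := m _ _
  have m1 := m α k
  have m2 := m α l
  clear m e
  revert m1 m2 m3 e1 e2
  generalize (D.cube o).Splits α k = S1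
  generalize (D.cube o).Splits α l = S2
  generalize (D.cube o).Splits (up α k) l = S3
  generalize (D.cube o).rel (up α k) ((D.cube o).t0 l) ((D.cube o).s1 k) = S4
  generalize (D.cube o).rel α ((D.cube o).s0 k) ((D.cube o).s0 l) = S5
  generalize D.IsMerge o α k = T1
  generalize D.IsMerge o α l = T2
  generalize D.IsMerge o (D.set1 α k) l = T3
  generalize (D.circle (D.set1 α k) (D.arrow0 o l).2 = D.circle (D.set1 α k) (D.arrow1 o k).1) = T4
  generalize (D.circle α (D.arrow0 o k).1 = D.circle α (D.arrow0 o l).1) = T5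
  rintro h4 h5 rfl rfl rfl
  obtain rfl := propext h4
  obtain rfl := propext h5
  by_cases h1 : S1 <;> by_cases h2 : S2 <;> by_cases h3 : S3 <;> by_cases h4 : S4 <;>
    by_cases h5 : S5 <;> simp [h1, h2, h3, h4, h5, FaceType.sgn]

theorem edgeSign_eq (π : D.Order) (α : D.Resolution) (k : D.Crossing) :
    D.edgeSign o π α k = ((D.cube o).coneSign (fun k => (π k : ℕ)) α k : ℤ) := by
  rw [edgeSign, ResCube.coneSign, Units.coe_prod]
  refine Finset.prod_congr ?_ fun y _ => ?_
  · ext y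
    simp only [Finset.mem_filter, Fin.lt_def]
  · rw [faceType_sgn, Units.val_neg]
    simp only [Fin.le_def]

theorem diff_emap (π : D.Order) (x : D.Resolution → PtAlg R (ℕ × ℕ)) (β : D.Resolution) :
    diff R D o π (fun α => emap R (D.circ α) (x α)) β =
      emap R (D.circ β) ((D.cube o).d ((D.cube o).coneSign fun k => (π k : ℕ)) x β) := by
  simp only [diff, LinearMap.pi_apply, LinearMap.sum_apply, LinearMap.smul_apply,
    LinearMap.comp_apply, LinearMap.proj_apply, ResCube.d, map_sum]
  rw [Finset.sum_filter]
  refine Finset.sum_congr rfl fun k _ => ?_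
  by_cases hk : β k = true
  · rw [if_pos hk, if_pos hk, edgeSign_eq, Units.smul_def, map_zsmul]
    congr 1
    have := edgeMap_emap (R := R) (o := o) (α := dn β k) (k := k) (by simp [dn]) (x (dn β k))
    rw [up_dn hk] at this
    exact this
  · rw [if_neg hk, if_neg hk, map_zero]

/-- The points at the bottom of the strands. -/
def bottom (m : ℕ) : List (ℕ × ℕ) := (List.range (m + 1)).map fun j => (0, j)

/-- The product of the generators at the bottom of the strands. -/
def strandProd (R : Type*) [CommRing R] (m : ℕ) : PtAlg R (ℕ × ℕ) := ((bottom m).map (pt R)).prod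

theorem psiChain_eq : psiChain R D D.braidRes = emap R (D.circ D.braidRes)
    (strandProd R D.strands) := by
  rw [psiChain, Pi.single_eq_same, ExteriorAlgebra.ιMulti_apply, strandProd, map_list_prod]
  congr 1
  rw [bottom, List.map_map, List.map_map]
  refine List.ext_getElem (by simp) fun j h1 h2 => ?_
  have hj : j < D.strands + 1 := by simpa using h1
  have : D.circ D.braidRes (0, j) = D.circle D.braidRes (0, ⟨j, hj⟩) := by
    rw [circ, clamp]
    congr 2
    ext
    simp
    omega
  simp only [List.getElem_ofFn, List.getElem_map, List.getElem_range, Function.comp_apply, emap_pt,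
    this]
  rfl

variable (R D) in
/-- The invariant vanishes. -/
def Null : Prop := (D.cube D.pos).Bounding D.braidRes (strandProd R D.strands)

/-- The choice in `Null` is removed in two steps: arrows are reversed where `o` differs from
`D.pos`, and the sign assignment is replaced by the one of the iterated cone in the order `π`. The
bounding family is finally projected to the circles. -/
theorem psi_eq_zero (h : D.Null R) (o : D.Arrows) (π : D.Order) : psi R D o π = 0 := by
  have hflip : (D.cube D.pos).flip (fun k => xor (o k) (D.pos k)) = D.cube o := by
    rw [ResCube.flip, cube, cube]
    congr 1 <;> funext k <;> cases h1 : o k <;> cases h2 : D.pos k <;>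
      simp [arrow0, arrow1, h1, h2]
  have hb := (cube_good D.pos).bounding_flip (fun k => xor (o k) (D.pos k)) h
  rw [hflip] at hb
  obtain ⟨ε, hε, hb⟩ := hb
  have hr : Function.Injective fun k : D.Crossing => (π k : ℕ) :=
    Fin.val_injective.comp π.injective
  obtain ⟨x, hx⟩ := hb.of_valid hε ((cube_good o).valid_coneSign hr)
  rw [psi, Submodule.Quotient.mk_eq_zero, Submodule.mem_comap]
  refine ⟨fun α => emap R (D.circ α) (x α), ?_⟩
  funext β
  rw [diff_emap, Submodule.subtype_apply]
  change _ = psiChain R D β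
  by_cases hβ : β = D.braidRes
  · have := emap_circ_congr ((hx β).1 hβ)
    subst hβ
    rw [this, psiChain_eq]
  · have := emap_circ_congr (((hx β).2 hβ).trans (map_zero _).symm)
    rw [this, map_zero, psiChain, Pi.single_eq_of_ne hβ]

end BraidDiagram

end

/-! ### Renaming of crossings, and charts of braid words. -/

noncomputable section

open PtAlg

namespace ResCube

variable {ι κ Ω : Type} [DecidableEq ι] [DecidableEq κ] {R : Type*} [CommRing R]

/-- Rename the crossings. -/
def reindex (K : ResCube ι Ω) (e : κ ≃ ι) : ResCube κ Ω where
  rel α := K.rel (α ∘ e.symm)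
  s0 k := K.s0 (e k)
  t0 k := K.t0 (e k)
  s1 k := K.s1 (e k)
  t1 k := K.t1 (e k)

theorem hom_reindex (K : ResCube ι Ω) (e : κ ≃ ι) : K.Hom (K.reindex e) e id where
  rel α p q h := by
    change K.rel ((α ∘ e) ∘ e.symm) p q
    rwa [comp_symm]
  s0 α _ _ := ((K.reindex e).rel _).refl _
  t0 α _ _ := ((K.reindex e).rel _).refl _
  s1 α _ _ := ((K.reindex e).rel _).refl _
  t1 α _ _ := ((K.reindex e).rel _).refl _

theorem reindex_hom (K : ResCube ι Ω) (e : κ ≃ ι) : (K.reindex e).Hom K e.symm id where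
  rel α p q h := h
  s0 α k _ := by
    change K.rel _ (K.s0 (e (e.symm k))) _
    rw [Equiv.apply_symm_apply]
  t0 α k _ := by
    change K.rel _ (K.t0 (e (e.symm k))) _
    rw [Equiv.apply_symm_apply]
  s1 α k _ := by
    change K.rel _ (K.s1 (e (e.symm k))) _
    rw [Equiv.apply_symm_apply]
  t1 α k _ := by
    change K.rel _ (K.t1 (e (e.symm k))) _
    rw [Equiv.apply_symm_apply]

theorem bounding_reindex_iff [Fintype ι] [Fintype κ] {K : ResCube ι Ω} (e : κ ≃ ι) {a : ι → Bool}
    {z : PtAlg R Ω} : (K.reindex e).Bounding (a ∘ e) z ↔ K.Bounding a z := by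
  constructor
  · intro h
    have := (K.reindex_hom e).bounding (K.hom_reindex e) h
    rwa [emap_id, comp_symm] at this
  · intro h
    have := (K.hom_reindex e).bounding (K.reindex_hom e) h
    rwa [emap_id] at this

theorem up_comp_symm (e : κ ≃ ι) (α : κ → Bool) (k : κ) :
    up α k ∘ e.symm = up (α ∘ e.symm) (e k) := by
  have := up_comp e.symm α (e k)
  rwa [Equiv.symm_apply_apply] at this

theorem Good.reindex {K : ResCube ι Ω} (hK : K.Good) (e : κ ≃ ι) : (K.reindex e).Good := by
  have r : ∀ {α p q}, (K.reindex e).rel α p q ↔ K.rel (α ∘ e.symm) p q := Iff.rfl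
  have sp : ∀ {α k}, (K.reindex e).Splits α k ↔ K.Splits (α ∘ e.symm) (e k) := Iff.rfl
  have u := up_comp_symm e
  have v : ∀ {α : κ → Bool} {k}, α k = false → (α ∘ e.symm) (e k) = false := by simp
  have ne : ∀ {k l : κ}, k ≠ l → e k ≠ e l := fun h => e.injective.ne h
  have fs : ∀ α k l, (K.reindex e).fsgn α k l = K.fsgn (α ∘ e.symm) (e k) (e l) := by
    intro α k l
    rw [fsgn, fsgn, ← u]
    rfl
  exact {
    merge_iff := fun {α k} hk h p q => by
      rw [r, u]; exact hK.merge_iff (v hk) h p q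
    split_iff := fun {α k} hk h p q => by
      rw [r, r, r, r, r, r, u]; exact hK.split_iff (v hk) h p q
    split_ne := fun {α k} hk h => by
      rw [r, u]; exact hK.split_ne (v hk) h
    merge_ends := fun {α k} hk h => by
      rw [r, u]; exact hK.merge_ends (v hk) h
    split_splits := fun {α k l} hkl hk hl h1 h2 h3 => by
      rw [sp, u] at h3 ⊢
      exact hK.split_splits (ne hkl) (v hk) (v hl) h1 h2 h3
    par := fun {α k l} hkl hk hl h1 h2 h3 h4 => by
      rw [sp, u] at h3
      rw [r, r, u, u]
      exact hK.par (ne hkl) (v hk) (v hl) h1 h2 h3 h4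
    antipar := fun {α k l} hkl hk hl h1 h2 h3 h4 => by
      rw [sp, u] at h3
      rw [r, r, u, u]
      exact hK.antipar (ne hkl) (v hk) (v hl) h1 h2 h3 h4
    fsgn_symm := fun hkl hk hl => by
      rw [fs, fs]; exact hK.fsgn_symm (ne hkl) (v hk) (v hl)
    cube := fun hkl hkm hlm hk hl hm => by
      simp only [fs, u]
      exact hK.cube (ne hkl) (ne hkm) (ne hlm) (v hk) (v hl) (v hm) }

theorem proj_edge_eq_zero {K : ResCube ι Ω} {α β : ι → Bool} {k : ι} {x : PtAlg R Ω}
    (h : K.proj R β x = 0) : K.proj R β (K.edge R α k x) = 0 := by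
  by_cases hs : K.Splits α k
  · rw [edge_split hs, map_mul, h, mul_zero]
  · rw [edge_merge hs, h]

theorem proj_list_prod (K : ResCube ι Ω) (α : ι → Bool) (l : List Ω) :
    K.proj R α (l.map (pt R)).prod = (l.map fun p => pt R (Quotient.mk (K.rel α) p)).prod := by
  rw [map_list_prod, List.map_map]
  congr 2
  funext p
  exact emap_pt _ _

end ResCube

namespace BraidDiagram

/-- Half of the conditions on a function of the marked points to be constant on circles: it is
constant on the arcs at the crossing between the levels `l` and `l + 1`, which has its left strand
in position `i`. -/
def Slot {X : Type} (g : ℕ × ℕ → X) (m l i : ℕ) (vert : Prop) : Prop :=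
  (vert → ∀ j ≤ m, g (l, j) = g (l + 1, j)) ∧
    (¬ vert → (∀ j ≤ m, j ≠ i → j ≠ i + 1 → g (l, j) = g (l + 1, j)) ∧ g (l, i) = g (l, i + 1) ∧
      g (l + 1, i) = g (l + 1, i + 1))

/-- The start of the arrow of the 0-smoothing of a crossing above level `l`, if the arrows
point left to right, or from top to bottom. -/
def start0 (c : ℕ × Bool) (l : ℕ) : ℕ × ℕ := if c.2 then (l, c.1) else (l + 1, c.1)
/-- The end of the arrow of the 0-smoothing. -/
def end0 (c : ℕ × Bool) (l : ℕ) : ℕ × ℕ := if c.2 then (l, c.1 + 1) else (l, c.1)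
/-- The start of the arrow of the 1-smoothing. -/
def start1 (c : ℕ × Bool) (l : ℕ) : ℕ × ℕ := if c.2 then (l + 1, c.1) else (l, c.1 + 1)
/-- The end of the arrow of the 1-smoothing. -/
def end1 (c : ℕ × Bool) (l : ℕ) : ℕ × ℕ := (l, c.1)

/-- A letter, with its position as a natural number. -/
def letter {m : ℕ} (x : Fin m × Bool) : ℕ × Bool := (x.1, x.2)

/-- An indexing of the letters of a word; `lv` is the level below a letter and `lt` is the
letter. -/
structure Chart {m : ℕ} (w : BraidWord m) {ι : Type} (lv : ι → ℕ) (lt : ι → ℕ × Bool) where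
  e : ι ≃ Fin w.length
  val : ∀ k, (e k : ℕ) = lv k
  letter_eq : ∀ k, letter (w.get (e k)) = lt k

namespace Chart

variable {m : ℕ} {w : BraidWord m} {ι : Type} {lv : ι → ℕ} {lt : ι → ℕ × Bool} (X : Chart w lv lt)

/-- The cube of resolutions, with the crossings named as in the chart. -/
def cube : ResCube ι (ℕ × ℕ) :=
  ((⟨m, w⟩ : BraidDiagram).cube (⟨m, w⟩ : BraidDiagram).pos).reindex X.e

/-- The circle through a point. -/
def circ (γ : ι → Bool) (p : ℕ × ℕ) : (⟨m, w⟩ : BraidDiagram).Circle (γ ∘ X.e.symm) :=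
  (⟨m, w⟩ : BraidDiagram).circ (γ ∘ X.e.symm) p

theorem cube_rel {γ : ι → Bool} {p q : ℕ × ℕ} : X.cube.rel γ p q ↔ X.circ γ p = X.circ γ q :=
  Iff.rfl

theorem good [DecidableEq ι] : X.cube.Good := (cube_good _).reindex _

/-- The marked point closest to a pair of coordinates. -/
def near (m n : ℕ) (p : ℕ × ℕ) : ℕ × ℕ := (min p.1 n, min p.2 m)

theorem circ_near (γ : ι → Bool) (p : ℕ × ℕ) : X.circ γ (near m w.length p) = X.circ γ p := by
  have : clamp ⟨m, w⟩ (near m w.length p) = clamp ⟨m, w⟩ p := by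
    simp [clamp, near]
  rw [circ, circ, BraidDiagram.circ, BraidDiagram.circ, this]

theorem clamp_mk {l j : ℕ} (hl : l ≤ w.length) (hj : j ≤ m) :
    clamp ⟨m, w⟩ (l, j) = (⟨l, by simpa [Nat.lt_succ_iff] using hl⟩,
      ⟨j, by simpa [Nat.lt_succ_iff] using hj⟩) := by
  simp [clamp, hl, hj]

theorem lv_lt (X : Chart w lv lt) (k : ι) : lv k < w.length := by rw [← X.val k]; exact (X.e k).2

theorem left_eq (k : ι) : (left ⟨m, w⟩ (X.e k) : ℕ) = (lt k).1 := by
  rw [← X.letter_eq k]; rfl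

theorem pos_eq (k : ι) : pos ⟨m, w⟩ (X.e k) = (lt k).2 := by
  rw [← X.letter_eq k]; rfl

theorem lt_fst (X : Chart w lv lt) (k : ι) : (lt k).1 < m := by
  rw [← X.letter_eq k]; exact (w.get (X.e k)).1.2

theorem vertical_iff (γ : ι → Bool) (k : ι) :
    IsVertical ⟨m, w⟩ (γ ∘ X.e.symm) (X.e k) ↔ γ k = !(lt k).2 := by
  rw [IsVertical, X.pos_eq]; simp

/-- With `closing` these are all the arcs, and `le` is the converse: a function that satisfies them
factors through the circles. Maps between diagrams can thus be checked crossing by crossing. -/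
theorem slot (γ : ι → Bool) (k : ι) :
    Slot (X.circ γ) m (lv k) (lt k).1 (γ k = !(lt k).2) := by
  have hl := X.lv_lt k
  have hi := X.lt_fst k
  have c0 : ∀ j (h : j < m + 1), clamp ⟨m, w⟩ (lv k, j) = ((X.e k).castSucc, ⟨j, h⟩) := by
    intro j h
    rw [clamp_mk hl.le (by omega)]
    exact Prod.ext (Fin.ext (X.val k).symm) rfl
  have c1 : ∀ j (h : j < m + 1), clamp ⟨m, w⟩ (lv k + 1, j) = ((X.e k).succ, ⟨j, h⟩) := by
    intro j h
    rw [clamp_mk hl (by omega)]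
    refine Prod.ext (Fin.ext ?_) rfl
    simp [X.val k]
  have cl : left ⟨m, w⟩ (X.e k) = ⟨(lt k).1, by change _ < m + 1; omega⟩ := Fin.ext (X.left_eq k)
  have cr : right ⟨m, w⟩ (X.e k) = ⟨(lt k).1 + 1, by change _ < m + 1; omega⟩ := Fin.ext (by
    rw [right_val, X.left_eq])
  have arc := @circle_arc ⟨m, w⟩ (γ ∘ X.e.symm)
  constructor
  · intro hv j hj
    rw [circ, circ, BraidDiagram.circ, BraidDiagram.circ, c0 j (by omega), c1 j (by omega)]
    exact arc (.up _ _ (.inl ((X.vertical_iff γ k).2 hv)))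
  · intro hv
    rw [← X.vertical_iff] at hv
    refine ⟨fun j hj h1 h2 => ?_, ?_, ?_⟩
    · rw [circ, circ, BraidDiagram.circ, BraidDiagram.circ, c0 j (by omega), c1 j (by omega)]
      exact arc (.up _ _ (.inr (by simp [cl, cr, h1, h2])))
    · rw [circ, circ, BraidDiagram.circ, BraidDiagram.circ, c0 _ (by omega), c0 _ (by omega)]
      have := arc (.lower _ hv)
      rwa [ptBL, ptBR, cl, cr] at this
    · rw [circ, circ, BraidDiagram.circ, BraidDiagram.circ, c1 _ (by omega), c1 _ (by omega)]
      have := arc (.upper _ hv)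
      rwa [ptTL, ptTR, cl, cr] at this

theorem closing (γ : ι → Bool) {j : ℕ} (hj : j ≤ m) :
    X.circ γ (w.length, j) = X.circ γ (0, j) := by
  rw [circ, circ, BraidDiagram.circ, BraidDiagram.circ, clamp_mk le_rfl hj,
    clamp_mk (Nat.zero_le _) hj]
  exact circle_arc (.closing _)

/-- A function that is constant on the arcs is constant on the circles. -/
theorem le {Y : Type} (g : ℕ × ℕ → Y) {γ : ι → Bool}
    (hs : ∀ k, Slot g m (lv k) (lt k).1 (γ k = !(lt k).2))
    (hc : ∀ j ≤ m, g (w.length, j) = g (0, j)) {p q : ℕ × ℕ} (h : X.circ γ p = X.circ γ q) :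
    g (near m w.length p) = g (near m w.length q) := by
  have hcoord : ∀ p, near m w.length p = coord ⟨m, w⟩ (clamp ⟨m, w⟩ p) := fun p => rfl
  rw [hcoord, hcoord]
  refine circle_le (S := Setoid.ker fun p => g (coord ⟨m, w⟩ p)) (fun p q hpq => ?_) h
  have hs' : ∀ k : Fin w.length, Slot g m k (left ⟨m, w⟩ k)
      (IsVertical ⟨m, w⟩ (γ ∘ X.e.symm) k) := by
    intro k
    obtain ⟨k, rfl⟩ := X.e.surjective k
    rw [propext (X.vertical_iff γ k), X.val, X.left_eq]
    exact hs k
  change g _ = g _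
  cases hpq with
  | up k j h =>
    by_cases hv : IsVertical ⟨m, w⟩ (γ ∘ X.e.symm) k
    · exact (hs' k).1 hv j (Nat.lt_succ_iff.1 j.2)
    · have h := h.resolve_left hv
      refine ((hs' k).2 hv).1 j (Nat.lt_succ_iff.1 j.2) (fun hj => h.1 (Fin.ext hj))
        (fun hj => h.2 (Fin.ext ?_))
      rw [right_val]; exact hj
  | lower k h =>
    have := ((hs' k).2 h).2.1
    rwa [← right_val] at this
  | upper k h =>
    have := ((hs' k).2 h).2.2
    rwa [← right_val] at this
  | closing j => exact hc j (Nat.lt_succ_iff.1 j.2)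

theorem arrows (k : ι) : X.cube.s0 k = start0 (lt k) (lv k) ∧ X.cube.t0 k = end0 (lt k) (lv k) ∧
    X.cube.s1 k = start1 (lt k) (lv k) ∧ X.cube.t1 k = end1 (lt k) (lv k) := by
  have h1 := X.pos_eq k
  have h2 := X.left_eq k
  have h3 : (right ⟨m, w⟩ (X.e k) : ℕ) = (lt k).1 + 1 := by rw [right_val, h2]
  have h4 := X.val k
  simp only [cube, ResCube.reindex, BraidDiagram.cube, arrow0, arrow1, start0, end0, start1, end1, h1]
  cases (lt k).2 <;> simp [coord, ptBL, ptBR, ptTL, h2, h3, h4]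

theorem s0_eq (k : ι) : X.cube.s0 k = start0 (lt k) (lv k) := (X.arrows k).1
theorem t0_eq (k : ι) : X.cube.t0 k = end0 (lt k) (lv k) := (X.arrows k).2.1
theorem s1_eq (k : ι) : X.cube.s1 k = start1 (lt k) (lv k) := (X.arrows k).2.2.1
theorem t1_eq (k : ι) : X.cube.t1 k = end1 (lt k) (lv k) := (X.arrows k).2.2.2

variable {R : Type*} [CommRing R] [Fintype ι] [DecidableEq ι]

theorem null_iff : (⟨m, w⟩ : BraidDiagram).Null R ↔
    X.cube.Bounding (fun k => !(lt k).2) (strandProd R m) := by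
  rw [Null, ← ResCube.bounding_reindex_iff X.e]
  have : (⟨m, w⟩ : BraidDiagram).braidRes ∘ X.e = fun k => !(lt k).2 := by
    funext k
    rw [Function.comp_apply, braidRes, X.pos_eq]
  rw [this]
  rfl

end Chart

theorem mem_bottom {m : ℕ} {p : ℕ × ℕ} (h : p ∈ bottom m) : p.1 = 0 ∧ p.2 ≤ m := by
  simp only [bottom, List.mem_map, List.mem_range] at h
  obtain ⟨j, hj, rfl⟩ := h
  exact ⟨rfl, by simpa [Nat.lt_succ_iff] using hj⟩

variable {R : Type*} [CommRing R]

theorem emap_list_prod {Ω Ω' : Type} (φ : Ω → Ω') (l : List Ω) :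
    emap R φ (l.map (pt R)).prod = ((l.map φ).map (pt R)).prod := by
  rw [map_list_prod, List.map_map, List.map_map]
  congr 2
  funext p
  exact emap_pt _ _

/-- A map that keeps the circles through the bottom points does not change their product. -/
theorem proj_emap_strandProd {ι : Type} [DecidableEq ι] {K : ResCube ι (ℕ × ℕ)} {α : ι → Bool} {m : ℕ}
    {φ : ℕ × ℕ → ℕ × ℕ} (h : ∀ j ≤ m, K.rel α (φ (0, j)) (0, j)) :
    K.proj R α (emap R φ (strandProd R m)) = K.proj R α (strandProd R m) := by
  rw [strandProd, emap_list_prod, ResCube.proj_list_prod, ResCube.proj_list_prod, List.map_map]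
  congr 1
  refine List.map_congr_left fun p hp => ?_
  obtain ⟨h1, h2⟩ := mem_bottom hp
  obtain ⟨l, j⟩ := p
  obtain rfl : l = 0 := h1
  rw [Function.comp_apply, Quotient.sound (h j h2)]

theorem list_prod_eq_zero {Ω : Type} {l : List Ω} {Ω' : Type} {g : Ω → Ω'}
    {i j : ℕ} (hij : i < j) (hj : j < l.length) (h : g l[i] = g l[j]) :
    (l.map fun p => pt R (g p)).prod = 0 := by
  have := (ExteriorAlgebra.ιMulti R l.length (M := Ω' →₀ R)).map_eq_zero_of_eq
    (fun k => Finsupp.single (g l[k]) 1) (i := ⟨i, hij.trans hj⟩) (j := ⟨j, hj⟩) (by simp [h])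
    (by simp [Fin.ext_iff, hij.ne])
  rw [ExteriorAlgebra.ιMulti_apply] at this
  rw [← this]
  congr 1
  exact List.ext_getElem (by simp) fun k h1 h2 => by simp [pt]

/-- The product of the bottom points vanishes if two of them lie on the same circle. -/
theorem proj_strandProd_eq_zero {ι : Type} [DecidableEq ι] {K : ResCube ι (ℕ × ℕ)} {α : ι → Bool} {m i j : ℕ}
    (hij : i < j) (hj : j ≤ m) (h : K.rel α (0, i) (0, j)) :
    K.proj R α (strandProd R m) = 0 := by
  rw [strandProd, ResCube.proj_list_prod]
  refine list_prod_eq_zero hij (by simp [bottom]; omega) ?_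
  simp only [bottom, List.getElem_map, List.getElem_range]
  exact Quotient.sound h

end BraidDiagram

end

/-! ### Conjugation. -/

noncomputable section

open PtAlg Sum

namespace BraidDiagram

theorem Slot.mono {X : Type} {g : ℕ × ℕ → X} {m m' l i : ℕ} {vert : Prop} (h : Slot g m' l i vert)
    (hm : m ≤ m') : Slot g m l i vert :=
  ⟨fun hv j hj => h.1 hv j (hj.trans hm),
    fun hv => ⟨fun j hj => (h.2 hv).1 j (hj.trans hm), (h.2 hv).2⟩⟩

theorem Slot.comp {X : Type} {g : ℕ × ℕ → X} {φ : ℕ × ℕ → ℕ × ℕ} {m c c' l i : ℕ} {vert : Prop}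
    (hφ : ∀ l j, φ (c + l, j) = (c' + l, j)) (h : Slot g m (c' + l) i vert) :
    Slot (g ∘ φ) m (c + l) i vert := by
  simpa only [Slot, Function.comp_apply, add_assoc, hφ] using h

namespace Chart

variable {m : ℕ}

/-- Change the description of a chart. -/
def copy {w : BraidWord m} {ι : Type} {lv lv' : ι → ℕ} {lt lt' : ι → ℕ × Bool} (X : Chart w lv lt)
    (h : ∀ k, lv k = lv' k) (h' : ∀ k, lt k = lt' k) : Chart w lv' lt' where
  e := X.e
  val k := (X.val k).trans (h k)
  letter_eq k := (X.letter_eq k).trans (h' k)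

/-- A chart of a product of two words. -/
def append (W v : BraidWord m) {n c : ℕ} (σ : Fin n ≃ Fin v.length) (τ : Fin c ≃ Fin W.length) :
    Chart (W ++ v) (Sum.elim (fun k => W.length + σ k) fun t => (τ t : ℕ))
      (Sum.elim (fun k => letter (v.get (σ k))) fun t => letter (W.get (τ t))) where
  e := (Equiv.sumCongr σ τ).trans ((Equiv.sumComm _ _).trans
    (finSumFinEquiv.trans (finCongr List.length_append.symm)))
  val k := by rcases k with k | k <;> simp
  letter_eq k := by rcases k with k | k <;> simp

/-- The same with the roles of the two words exchanged. -/
def append' (v W : BraidWord m) {n c : ℕ} (σ : Fin n ≃ Fin v.length) (τ : Fin c ≃ Fin W.length) :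
    Chart (v ++ W) (Sum.elim (fun k => (σ k : ℕ)) fun t => v.length + (τ t : ℕ))
      (Sum.elim (fun k => letter (v.get (σ k))) fun t => letter (W.get (τ t))) where
  e := (Equiv.sumCongr σ τ).trans (finSumFinEquiv.trans (finCongr List.length_append.symm))
  val k := by rcases k with k | k <;> simp
  letter_eq k := by rcases k with k | k <;> simp

/-- The chart of a word that keeps the numbering of the letters. -/
def self (v : BraidWord m) :
    Chart v (fun k : Fin v.length => (k : ℕ)) fun k => letter (v.get k) where
  e := Equiv.refl _
  val _ := rfl
  letter_eq _ := rfl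

theorem near_mk {n l j : ℕ} (hl : l ≤ n) (hj : j ≤ m) : near m n (l, j) = (l, j) := by
  simp [near, hl, hj]

variable {w : BraidWord m} {ι : Type} {lv : ι → ℕ} {lt : ι → ℕ × Bool} (X : Chart w lv lt)

include X in
theorem near_arrow (k : ι) : near m w.length (start0 (lt k) (lv k)) = start0 (lt k) (lv k) ∧
    near m w.length (end0 (lt k) (lv k)) = end0 (lt k) (lv k) ∧
    near m w.length (start1 (lt k) (lv k)) = start1 (lt k) (lv k) ∧
    near m w.length (end1 (lt k) (lv k)) = end1 (lt k) (lv k) := by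
  have h1 := X.lv_lt k
  have h2 := X.lt_fst k
  simp only [start0, end0, start1, end1]
  cases (lt k).2 <;> simp only [if_true, Bool.false_eq_true, if_false] <;>
    refine ⟨near_mk ?_ ?_, near_mk ?_ ?_, near_mk ?_ ?_, near_mk ?_ ?_⟩ <;> omega

theorem closing_eq (γ : ι → Bool) {n j : ℕ} (hn : w.length = n) (hj : j ≤ m) :
    X.circ γ (n, j) = X.circ γ (0, j) := by
  rw [← hn]; exact X.closing γ hj

/-- A map between charts induces a homomorphism, if it is compatible with the arcs and the
arrows. -/
theorem hom {m' : ℕ} {w' : BraidWord m'} {lv' : ι → ℕ} {lt' : ι → ℕ × Bool} (X' : Chart w' lv' lt')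
    (φ : ℕ × ℕ → ℕ × ℕ)
    (hs : ∀ γ k, Slot (X'.circ γ ∘ φ) m (lv k) (lt k).1 (γ k = !(lt k).2))
    (hc : ∀ γ, ∀ j ≤ m, X'.circ γ (φ (w.length, j)) = X'.circ γ (φ (0, j)))
    (ha : ∀ γ k, γ k = false →
      X'.circ γ (φ (start0 (lt k) (lv k))) = X'.circ γ (start0 (lt' k) (lv' k)) ∧
      X'.circ γ (φ (end0 (lt k) (lv k))) = X'.circ γ (end0 (lt' k) (lv' k)))
    (hb : ∀ γ k, γ k = true →
      X'.circ γ (φ (start1 (lt k) (lv k))) = X'.circ γ (start1 (lt' k) (lv' k)) ∧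
      X'.circ γ (φ (end1 (lt k) (lv k))) = X'.circ γ (end1 (lt' k) (lv' k))) :
    X.cube.Hom X'.cube (Equiv.refl _) (φ ∘ near m w.length) where
  rel γ p q h := X.le (X'.circ γ ∘ φ) (hs γ) (hc γ) h
  s0 γ k hk := by
    have h := X.near_arrow k
    rw [X.s0_eq, X'.s0_eq, Function.comp_apply, Equiv.refl_apply, h.1]
    exact (ha γ k hk).1
  t0 γ k hk := by
    have h := X.near_arrow k
    rw [X.t0_eq, X'.t0_eq, Function.comp_apply, Equiv.refl_apply, h.2.1]
    exact (ha γ k hk).2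
  s1 γ k hk := by
    have h := X.near_arrow k
    rw [X.s1_eq, X'.s1_eq, Function.comp_apply, Equiv.refl_apply, h.2.2.1]
    exact (hb γ k hk).1
  t1 γ k hk := by
    have h := X.near_arrow k
    rw [X.t1_eq, X'.t1_eq, Function.comp_apply, Equiv.refl_apply, h.2.2.2]
    exact (hb γ k hk).2

theorem start0_shift {c c' : ℕ} {φ : ℕ × ℕ → ℕ × ℕ} (hφ : ∀ l j, φ (c + l, j) = (c' + l, j))
    (x : ℕ × Bool) (l : ℕ) : φ (start0 x (c + l)) = start0 x (c' + l) ∧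
      φ (end0 x (c + l)) = end0 x (c' + l) ∧ φ (start1 x (c + l)) = start1 x (c' + l) ∧
      φ (end1 x (c + l)) = end1 x (c' + l) := by
  obtain ⟨i, ε⟩ := x
  cases ε <;> simp [start0, end0, start1, end1, add_assoc, hφ]

variable {R : Type*} [CommRing R]

theorem bounding_of_hom [Fintype ι] [DecidableEq ι] {L : ResCube ι (ℕ × ℕ)}
    {K : ResCube ι (ℕ × ℕ)} {φ ψ : ℕ × ℕ → ℕ × ℕ} (h : K.Hom L (Equiv.refl _) φ)
    (h' : L.Hom K (Equiv.refl _) ψ) {a : ι → Bool} {m : ℕ}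
    (h0 : ∀ j ≤ m, L.rel a (φ (0, j)) (0, j)) (hb : K.Bounding a (strandProd R m)) :
    L.Bounding a (strandProd R m) :=
  (h.bounding h' hb).congr (proj_emap_strandProd h0)

/-- A chart for a letter in front of a word. -/
def cons (x : Fin m × Bool) (v : BraidWord m) : Chart (x :: v)
    (Sum.elim (fun k : Fin v.length => 1 + (k : ℕ)) (![0] : Fin 1 → ℕ))
    (Sum.elim (fun k => letter (v.get k)) ![letter x]) :=
  (append [x] v (Equiv.refl _) (Equiv.refl _)).copy
    (by rintro (k | k); · rfl
        · fin_cases k; rfl)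
    (by rintro (k | k); · rfl
        · fin_cases k; rfl)

/-- A chart for a letter at the end of a word. -/
def concat (v : BraidWord m) (x : Fin m × Bool) : Chart (v ++ [x])
    (Sum.elim (fun k : Fin v.length => 0 + (k : ℕ)) (![v.length] : Fin 1 → ℕ))
    (Sum.elim (fun k => letter (v.get k)) ![letter x]) :=
  (append' v [x] (Equiv.refl _) (Equiv.refl _)).copy
    (by rintro (k | k); · simp
        · fin_cases k; rfl)
    (by rintro (k | k); · rfl
        · fin_cases k; rfl)

/-- When the lowest letter moves to the top, every level drops by one, and the level below this
letter becomes the level below the new top letter. -/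
theorem cons_hom_concat (x : Fin m × Bool) (v : BraidWord m) : (cons x v).cube.Hom
    (concat v x).cube (Equiv.refl _)
      ((fun p => if p.1 = 0 then (v.length, p.2) else (p.1 - 1, p.2)) ∘ near m (x :: v).length) := by
  set φ : ℕ × ℕ → ℕ × ℕ := fun p => if p.1 = 0 then (v.length, p.2) else (p.1 - 1, p.2)
  have hφ : ∀ l j, φ (1 + l, j) = (0 + l, j) := by
    intro l j
    simp [φ]
  have hφ0 : ∀ j, φ (0, j) = (v.length, j) := fun j => rfl
  have hφ1 : ∀ j, φ (1, j) = (0, j) := fun j => rfl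
  have hl : (v ++ [x]).length = v.length + 1 := by simp
  have hi : (letter x).1 < m := x.1.2
  refine (cons x v).hom (concat v x) φ ?_ ?_ ?_ ?_
  · intro γ k
    have h := (concat v x).slot γ k
    rcases k with k | k
    · exact h.comp hφ
    · obtain rfl : k = 0 := Subsingleton.elim _ _
      have hc := fun j (hj : j ≤ m) => (concat v x).closing_eq γ hl hj
      simp only [Slot, Function.comp_apply, Sum.elim_inr, Matrix.cons_val_zero, hφ0, zero_add,
        hφ1] at h ⊢
      refine ⟨fun hv j hj => (h.1 hv j hj).trans (hc j hj), fun hv => ?_⟩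
      obtain ⟨h1, h2, h3⟩ := h.2 hv
      refine ⟨fun j hj a b => (h1 j hj a b).trans (hc j hj), h2, ?_⟩
      rw [← hc _ hi.le, ← hc _ hi, h3]
  · intro γ j hj
    rw [List.length_cons, add_comm, hφ, hφ0, zero_add]
  · intro γ k _
    rcases k with k | k
    · have := start0_shift hφ (letter (v.get k)) k
      exact ⟨congrArg _ this.1, congrArg _ this.2.1⟩
    · obtain rfl : k = 0 := Subsingleton.elim _ _
      have hc := fun j (hj : j ≤ m) => (concat v x).closing_eq γ hl hj
      simp only [Sum.elim_inr, Matrix.cons_val_zero]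
      cases hε : (letter x).2 <;> simp [hε, start0, end0, hφ0, hφ1, hc _ hi.le]
  · intro γ k _
    rcases k with k | k
    · have := start0_shift hφ (letter (v.get k)) k
      exact ⟨congrArg _ this.2.2.1, congrArg _ this.2.2.2⟩
    · obtain rfl : k = 0 := Subsingleton.elim _ _
      have hc := fun j (hj : j ≤ m) => (concat v x).closing_eq γ hl hj
      simp only [Sum.elim_inr, Matrix.cons_val_zero]
      cases hε : (letter x).2 <;> simp [hε, start1, end1, hφ0, hφ1, hc _ hi.le]

theorem concat_hom_cons (x : Fin m × Bool) (v : BraidWord m) : (concat v x).cube.Hom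
    (cons x v).cube (Equiv.refl _)
      ((fun p => if p.1 ≤ v.length then (p.1 + 1, p.2) else (1, p.2)) ∘
        near m (v ++ [x]).length) := by
  have hi : (letter x).1 < m := x.1.2
  have hl : (v ++ [x]).length = v.length + 1 := by simp
  set φ : ℕ × ℕ → ℕ × ℕ := fun p => if p.1 ≤ v.length then (p.1 + 1, p.2) else (1, p.2) with hφ'
  have hφ : ∀ l j, l ≤ v.length → φ (l, j) = (l + 1, j) := by
    intro l j h
    simp [φ, h]
  have hφ1 : ∀ j, φ (v.length + 1, j) = (1, j) := by
    intro j
    simp [φ]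
  refine (concat v x).hom (cons x v) φ ?_ ?_ ?_ ?_
  · intro γ k
    have h := (cons x v).slot γ k
    rcases k with k | k
    · have hk := k.2
      simp only [Slot, Function.comp_apply, Sum.elim_inl] at h ⊢
      simp only [zero_add, hφ _ _ hk.le, hφ _ _ hk]
      simpa only [add_comm 1] using h
    · obtain rfl : k = 0 := Subsingleton.elim _ _
      have hc := fun j (hj : j ≤ m) => (cons x v).closing_eq γ rfl hj
      simp only [Slot, Function.comp_apply, Sum.elim_inr, Matrix.cons_val_zero] at h ⊢
      simp only [hφ _ _ le_rfl, hφ1]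
      simp only [List.length_cons] at hc
      refine ⟨fun hv j hj => (hc j hj).trans (h.1 hv j hj), fun hv => ?_⟩
      obtain ⟨h1, h2, h3⟩ := h.2 hv
      refine ⟨fun j hj a b => (hc j hj).trans (h1 j hj a b), ?_, h3⟩
      rw [hc _ hi.le, hc _ hi, h2]
  · intro γ j hj
    rw [hl, hφ1, hφ _ _ (Nat.zero_le _)]
  · intro γ k _
    have hc := fun j (hj : j ≤ m) => (cons x v).closing_eq γ rfl hj
    simp only [List.length_cons] at hc
    rcases k with k | k
    · have hk := k.2
      simp only [Sum.elim_inl, zero_add]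
      generalize hx : letter (v.get k) = y
      obtain ⟨i, ε⟩ := y
      cases ε <;> simp only [start0, end0, if_true, Bool.false_eq_true, if_false, hφ _ _ hk.le,
        hφ _ _ hk, add_comm 1, and_self]
    · obtain rfl : k = 0 := Subsingleton.elim _ _
      simp only [Sum.elim_inr, Matrix.cons_val_zero]
      cases hε : (letter x).2 <;> simp [hε, start0, end0, hφ1, hφ _ _ le_rfl, hc _ hi.le, hc _ (Nat.succ_le_of_lt hi)]
  · intro γ k _
    have hc := fun j (hj : j ≤ m) => (cons x v).closing_eq γ rfl hj
    simp only [List.length_cons] at hc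
    rcases k with k | k
    · have hk := k.2
      simp only [Sum.elim_inl, zero_add]
      generalize hx : letter (v.get k) = y
      obtain ⟨i, ε⟩ := y
      cases ε <;> simp only [start1, end1, if_true, Bool.false_eq_true, if_false, hφ _ _ hk.le,
        hφ _ _ hk, add_comm 1, and_self]
    · obtain rfl : k = 0 := Subsingleton.elim _ _
      simp only [Sum.elim_inr, Matrix.cons_val_zero]
      cases hε : (letter x).2 <;> simp [hε, start1, end1, hφ1, hφ _ _ le_rfl, hc _ hi.le, hc _ (Nat.succ_le_of_lt hi)]

end Chart

variable {m : ℕ} {R : Type*} [CommRing R]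

/-- The bottom points move across one crossing. This crossing is vertical in the braid resolution,
so they stay on the same circles and the product of their generators is unchanged. -/
theorem null_concat_iff (x : Fin m × Bool) (v : BraidWord m) :
    Null ⟨m, v ++ [x]⟩ R ↔ Null ⟨m, x :: v⟩ R := by
  rw [(Chart.cons x v).null_iff, (Chart.concat v x).null_iff]
  have hl : (v ++ [x]).length = v.length + 1 := by simp
  constructor
  · refine Chart.bounding_of_hom (Chart.concat_hom_cons x v) (Chart.cons_hom_concat x v)
      fun j hj => ?_
    rw [Chart.cube_rel]
    simp only [Function.comp_apply]
    rw [Chart.near_mk (Nat.zero_le _) hj, if_pos (Nat.zero_le _)]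
    exact (((Chart.cons x v).slot _ (inr 0)).1 rfl j hj).symm
  · refine Chart.bounding_of_hom (Chart.cons_hom_concat x v) (Chart.concat_hom_cons x v)
      fun j hj => ?_
    rw [Chart.cube_rel]
    simp only [Function.comp_apply]
    rw [Chart.near_mk (Nat.zero_le _) hj, if_pos rfl, ← Chart.closing_eq _ _ hl hj]
    exact (((Chart.concat v x).slot _ (inr 0)).1 rfl j hj)

theorem null_append_comm (u v : BraidWord m) : Null ⟨m, u ++ v⟩ R ↔ Null ⟨m, v ++ u⟩ R := by
  induction u generalizing v with
  | nil => rw [List.nil_append, List.append_nil]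
  | cons x u ih =>
    rw [List.cons_append, ← null_concat_iff, List.append_assoc, ih, List.append_assoc]
    rfl

end BraidDiagram

end

/-! ### Commutation of distant crossings. -/

noncomputable section

open PtAlg Sum

namespace BraidDiagram

namespace Chart

variable {m : ℕ}

/-- A chart for two letters in front of a word. -/
def pair (x y : Fin m × Bool) (v : BraidWord m) : Chart (x :: y :: v)
    (Sum.elim (fun k : Fin v.length => 2 + (k : ℕ)) ![0, 1])
    (Sum.elim (fun k => letter (v.get k)) ![letter x, letter y]) :=
  (append [x, y] v (Equiv.refl _) (Equiv.refl _)).copy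
    (by rintro (k | k); · rfl
        · fin_cases k <;> rfl)
    (by rintro (k | k); · rfl
        · fin_cases k <;> rfl)

/-- A chart for two letters in front of a word, with the letters counted from the top. -/
def pair' (x y : Fin m × Bool) (v : BraidWord m) : Chart (x :: y :: v)
    (Sum.elim (fun k : Fin v.length => 2 + (k : ℕ)) ![1, 0])
    (Sum.elim (fun k => letter (v.get k)) ![letter y, letter x]) :=
  (append [x, y] v (Equiv.refl _) Fin.revPerm).copy
    (by rintro (k | k); · rfl
        · fin_cases k <;> rfl)
    (by rintro (k | k); · rfl
        · fin_cases k <;> rfl)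

section Shift

variable {n c c' d d' : ℕ} {V : Fin n → ℕ × Bool} {lev : Fin d → ℕ} {W : Fin d → ℕ × Bool}
  {lev' : Fin d' → ℕ} {W' : Fin d' → ℕ × Bool} {m' : ℕ} {w : BraidWord m} {w' : BraidWord m'}
  {φ : ℕ × ℕ → ℕ × ℕ}

/-- Above the first few letters the map is a translation of levels, where the words agree; only the
window with these letters has to be checked. -/
theorem shift_rel (X : Chart w (Sum.elim (fun k : Fin n => c + (k : ℕ)) lev) (Sum.elim V W))
    (X' : Chart w' (Sum.elim (fun k : Fin n => c' + (k : ℕ)) lev') (Sum.elim V W'))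
    (hφ : ∀ l j, φ (c + l, j) = (c' + l, j)) (hw : w.length = c + n) (hw' : w'.length = c' + n)
    (hm : m ≤ m') {γ : Fin n ⊕ Fin d → Bool} {γ' : Fin n ⊕ Fin d' → Bool}
    (hr : ∀ k, γ (inl k) = γ' (inl k))
    (hwin : ∀ t, Slot (X'.circ γ' ∘ φ) m (lev t) (W t).1 (γ (inr t) = !(W t).2))
    (h0 : ∀ j ≤ m, X'.circ γ' (φ (0, j)) = X'.circ γ' (0, j)) {p q : ℕ × ℕ}
    (h : X.circ γ p = X.circ γ q) :
    X'.circ γ' ((φ ∘ near m w.length) p) = X'.circ γ' ((φ ∘ near m w.length) q) := by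
  refine X.le (X'.circ γ' ∘ φ) (fun k => ?_) (fun j hj => ?_) h
  · rcases k with k | k
    · have := X'.slot γ' (inl k)
      rw [← hr] at this
      exact (this.mono hm).comp hφ
    · exact hwin k
  · rw [hw, Function.comp_apply, hφ, X'.closing_eq γ' hw' (hj.trans hm), Function.comp_apply, h0 j hj]

theorem shift_arrows (X : Chart w (Sum.elim (fun k : Fin n => c + (k : ℕ)) lev) (Sum.elim V W))
    (X' : Chart w' (Sum.elim (fun k : Fin n => c' + (k : ℕ)) lev') (Sum.elim V W'))
    (hφ : ∀ l j, φ (c + l, j) = (c' + l, j)) (k : Fin n) :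
    (φ ∘ near m w.length) (X.cube.s0 (inl k)) = X'.cube.s0 (inl k) ∧
      (φ ∘ near m w.length) (X.cube.t0 (inl k)) = X'.cube.t0 (inl k) ∧
      (φ ∘ near m w.length) (X.cube.s1 (inl k)) = X'.cube.s1 (inl k) ∧
      (φ ∘ near m w.length) (X.cube.t1 (inl k)) = X'.cube.t1 (inl k) := by
  have h := X.near_arrow (inl k)
  have h' := start0_shift hφ (V k) k
  simp only [X.s0_eq, X.t0_eq, X.s1_eq, X.t1_eq, X'.s0_eq, X'.t0_eq, X'.s1_eq, X'.t1_eq,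
    Function.comp_apply, h]
  exact h'

end Shift

/-- The map that moves the points between two distant crossings to the other end. -/
def slide (i : ℕ) (p : ℕ × ℕ) : ℕ × ℕ :=
  if p.1 = 1 then if p.2 = i ∨ p.2 = i + 1 then (2, p.2) else (0, p.2) else p

theorem slide_add (i l j : ℕ) : slide i (2 + l, j) = (2 + l, j) := by
  rw [slide, if_neg (by simp; omega)]

/-- On the intermediate level the strands `i` and `i + 1` have already passed their crossing, so
they go to the level above it; all other strands go to the level below. The local conditions for the
interchanged crossings follow. -/
theorem slide_slot {Y : Type} {g : ℕ × ℕ → Y} {i j : ℕ} (hi : i < m) (hj : j < m)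
    (h : i + 2 ≤ j ∨ j + 2 ≤ i) {b b' : Bool} (h0 : Slot g m 1 i (b = false))
    (h1 : Slot g m 0 j (b' = false)) :
    Slot (g ∘ slide i) m 0 i (b = false) ∧ Slot (g ∘ slide i) m 1 j (b' = false) ∧
      g (slide i (0, i)) = g (1, i) ∧ g (slide i (0, i + 1)) = g (1, i + 1) ∧
      g (slide i (1, i)) = g (2, i) ∧ g (slide i (1, j)) = g (0, j) ∧
      g (slide i (1, j + 1)) = g (0, j + 1) ∧ g (slide i (2, j)) = g (1, j) := by
  cases b <;> cases b' <;> simp [Slot, slide] at h0 h1 ⊢ <;> grind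

theorem pair_hom_pair' {i j : Fin m} (h : (i : ℕ) + 2 ≤ j ∨ (j : ℕ) + 2 ≤ i) (v : BraidWord m) :
    (pair (i, true) (j, true) v).cube.Hom (pair' (j, true) (i, true) v).cube (Equiv.refl _)
      (slide i ∘ near m ((i, true) :: (j, true) :: v).length) := by
  have key := fun γ => slide_slot i.2 j.2 h ((pair' (j, true) (i, true) v).slot γ (inr 0))
    ((pair' (j, true) (i, true) v).slot γ (inr 1))
  refine (pair _ _ v).hom (pair' _ _ v) (slide i) ?_ ?_ ?_ ?_
  · intro γ k
    rcases k with k | k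
    · exact ((pair' (j, true) (i, true) v).slot γ (inl k)).comp (slide_add i)
    · fin_cases k
      · exact (key γ).1
      · exact (key γ).2.1
  · intro γ k hk
    exact (pair' (j, true) (i, true) v).closing_eq γ rfl hk
  · intro γ k _
    rcases k with k | k
    · have := start0_shift (slide_add i) (letter (v.get k)) k
      exact ⟨congrArg _ this.1, congrArg _ this.2.1⟩
    · have := key γ
      fin_cases k
      · exact ⟨this.2.2.1, this.2.2.2.1⟩
      · exact ⟨this.2.2.2.2.2.1, this.2.2.2.2.2.2.1⟩
  · intro γ k _
    rcases k with k | k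
    · have := start0_shift (slide_add i) (letter (v.get k)) k
      exact ⟨congrArg _ this.2.2.1, congrArg _ this.2.2.2⟩
    · have := key γ
      fin_cases k
      · exact ⟨this.2.2.2.2.1, this.2.2.1⟩
      · exact ⟨this.2.2.2.2.2.2.2, this.2.2.2.2.2.1⟩

theorem pair'_hom_pair {i j : Fin m} (h : (i : ℕ) + 2 ≤ j ∨ (j : ℕ) + 2 ≤ i) (v : BraidWord m) :
    (pair' (j, true) (i, true) v).cube.Hom (pair (i, true) (j, true) v).cube (Equiv.refl _)
      (slide j ∘ near m ((j, true) :: (i, true) :: v).length) := by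
  have key := fun γ => slide_slot j.2 i.2 h.symm ((pair (i, true) (j, true) v).slot γ (inr 1))
    ((pair (i, true) (j, true) v).slot γ (inr 0))
  refine (pair' _ _ v).hom (pair _ _ v) (slide j) ?_ ?_ ?_ ?_
  · intro γ k
    rcases k with k | k
    · exact ((pair (i, true) (j, true) v).slot γ (inl k)).comp (slide_add j)
    · fin_cases k
      · exact (key γ).2.1
      · exact (key γ).1
  · intro γ k hk
    exact (pair (i, true) (j, true) v).closing_eq γ rfl hk
  · intro γ k _
    rcases k with k | k
    · have := start0_shift (slide_add j) (letter (v.get k)) k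
      exact ⟨congrArg _ this.1, congrArg _ this.2.1⟩
    · have := key γ
      fin_cases k
      · exact ⟨this.2.2.2.2.2.1, this.2.2.2.2.2.2.1⟩
      · exact ⟨this.2.2.1, this.2.2.2.1⟩
  · intro γ k _
    rcases k with k | k
    · have := start0_shift (slide_add j) (letter (v.get k)) k
      exact ⟨congrArg _ this.2.2.1, congrArg _ this.2.2.2⟩
    · have := key γ
      fin_cases k
      · exact ⟨this.2.2.2.2.2.2.2, this.2.2.2.2.2.1⟩
      · exact ⟨this.2.2.2.2.1, this.2.2.1⟩

end Chart

variable {m : ℕ} {R : Type*} [CommRing R]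

/-- Distant positive crossings commute. -/
theorem null_comm_iff {i j : Fin m} (h : (i : ℕ) + 2 ≤ j ∨ (j : ℕ) + 2 ≤ i) (v : BraidWord m) :
    Null ⟨m, (i, true) :: (j, true) :: v⟩ R ↔ Null ⟨m, (j, true) :: (i, true) :: v⟩ R := by
  rw [(Chart.pair _ _ v).null_iff, (Chart.pair' _ _ v).null_iff]
  have hs : ∀ i : ℕ, ∀ j ≤ m, ∀ n, (Chart.slide i ∘ Chart.near m n) (0, j) = (0, j) := by
    intro i j hj n
    rw [Function.comp_apply, Chart.near_mk (Nat.zero_le _) hj]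
    rfl
  constructor
  · exact Chart.bounding_of_hom (Chart.pair_hom_pair' h v) (Chart.pair'_hom_pair h v)
      fun j hj => by rw [hs _ _ hj]
  · exact Chart.bounding_of_hom (Chart.pair'_hom_pair h v) (Chart.pair_hom_pair' h v)
      fun j hj => by rw [hs _ _ hj]

end BraidDiagram

end

/-! ### Cancellation of opposite crossings. -/

noncomputable section

open PtAlg Sum

namespace BraidDiagram

namespace Chart

variable {m n : ℕ} {w v : BraidWord m} {V : Fin n → ℕ × Bool} {R : Type*} [CommRing R]

section Cancel

variable {lev : Fin 2 → ℕ} {i : ℕ}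
  (X : Chart w (Sum.elim (fun k : Fin n => 2 + (k : ℕ)) lev) (Sum.elim V ![(i, true), (i, false)]))

/-- The points between two opposite crossings. -/
def Middle (i : ℕ) (p : ℕ × ℕ) : Prop := p.1 = 1 ∧ (p.2 = i ∨ p.2 = i + 1)

theorem not_middle_arrow (i l : ℕ) (x : ℕ × Bool) : ¬ Middle i (start0 x (2 + l)) ∧
    ¬ Middle i (end0 x (2 + l)) ∧ ¬ Middle i (start1 x (2 + l)) ∧ ¬ Middle i (end1 x (2 + l)) := by
  obtain ⟨j, ε⟩ := x
  cases ε <;> simp [Middle, start0, end0, start1, end1] <;> omega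

theorem levels (hlev : lev = ![0, 1] ∨ lev = ![1, 0]) :
    (lev 0 = 0 ∧ lev 1 = 1) ∨ (lev 0 = 1 ∧ lev 1 = 0) := by
  rcases hlev with rfl | rfl
  · exact .inl ⟨rfl, rfl⟩
  · exact .inr ⟨rfl, rfl⟩

/-- Two opposite crossings form a bigon. -/
def bigon (hlev : lev = ![0, 1] ∨ lev = ![1, 0]) (hw : w.length = 2 + n) :
    X.cube.Bigon ![false, false] ![true, false] 0 1 where
  O q := Middle i (near m w.length q)
  a := (1, i)
  -- The crossing with index `0` is the positive one; it is the lower one if `lev 0 = 0`. The point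
  -- `b` lies beyond it, and `v` lies beyond the negative crossing.
  b := if lev 0 = 0 then (0, i) else (2, i)
  a' := (1, i)
  v := if lev 0 = 0 then (2, i) else (0, i)
  hp := rfl
  hβ := by decide
  hn := rfl
  sat α q q' h hq := by
    have := X.le (Middle i) (γ := Sum.elim α ![true, false]) ?_ ?_ h
    · exact this ▸ hq
    · rintro (k | k)
      · have h1 : 2 + (k : ℕ) ≠ 1 := by omega
        simp [Slot, Middle, h1]
      · fin_cases k <;> rcases levels hlev with ⟨h0, h1⟩ | ⟨h0, h1⟩ <;>
          simp [Slot, Middle, h0, h1] <;> omega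
    · intro j _
      have : 2 + n ≠ 1 := by omega
      simp [Middle, hw, this]
  single α q q' hq hq' := by
    rw [cube_rel, ← X.circ_near, ← X.circ_near _ q']
    have : X.circ (Sum.elim α ![true, false]) (1, i) =
        X.circ (Sum.elim α ![true, false]) (1, i + 1) := by
      have h := ((X.slot (Sum.elim α ![true, false]) (inr 0)).2 (by simp)).2
      simp only [Sum.elim_inr, Matrix.cons_val_zero] at h
      rcases levels hlev with ⟨h0, h1⟩ | ⟨h0, h1⟩
      · rw [h0] at h; exact h.2
      · rw [h0] at h; exact h.1
    revert hq hq'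
    generalize near m w.length q = p
    generalize near m w.length q' = p'
    rintro ⟨h1, h2⟩ ⟨h3, h4⟩
    obtain ⟨l, j⟩ := p
    obtain ⟨l', j'⟩ := p'
    dsimp only at h1 h2 h3 h4
    subst h1 h3
    rcases h2 with rfl | rfl <;> rcases h4 with rfl | rfl <;> simp [this]
  s0 k := by
    rw [X.s0_eq, (X.near_arrow (inl k)).1]; exact (not_middle_arrow i k (V k)).1
  t0 k := by
    rw [X.t0_eq, (X.near_arrow (inl k)).2.1]; exact (not_middle_arrow i k (V k)).2.1
  s1 k := by
    rw [X.s1_eq, (X.near_arrow (inl k)).2.2.1]; exact (not_middle_arrow i k (V k)).2.2.1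
  t1 k := by
    rw [X.t1_eq, (X.near_arrow (inl k)).2.2.2]; exact (not_middle_arrow i k (V k)).2.2.2
  ha := by
    have := X.lt_fst (inr 0)
    simp only [Sum.elim_inr, Matrix.cons_val_zero] at this
    rw [near_mk (by omega) (by omega)]
    exact ⟨rfl, .inl rfl⟩
  hb := by
    have := X.lt_fst (inr 0)
    simp only [Sum.elim_inr, Matrix.cons_val_zero] at this
    split_ifs <;> rw [near_mk (by omega) (by omega)] <;> simp [Middle]
  ha' := by
    have := X.lt_fst (inr 0)
    simp only [Sum.elim_inr, Matrix.cons_val_zero] at this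
    rw [near_mk (by omega) (by omega)]
    exact ⟨rfl, .inl rfl⟩
  hv := by
    have := X.lt_fst (inr 0)
    simp only [Sum.elim_inr, Matrix.cons_val_zero] at this
    split_ifs <;> rw [near_mk (by omega) (by omega)] <;> simp [Middle]
  ends_p := by
    rw [X.s1_eq, X.t1_eq]
    rcases levels hlev with ⟨h0, h1⟩ | ⟨h0, h1⟩ <;> simp [start1, end1, h0]
  ends_n := by
    rw [X.s0_eq, X.t0_eq]
    rcases levels hlev with ⟨h0, h1⟩ | ⟨h0, h1⟩ <;> simp [start0, end0, h0, h1]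

/-- In this slice both crossings are smoothed vertically, and the levels `0`, `1`, `2` of each
strand belong together. The truncated subtraction sends all three to level `0`. -/
theorem slice_hom (hlev : lev = ![0, 1] ∨ lev = ![1, 0]) (hw : w.length = 2 + n)
    (Y : Chart v (fun k : Fin n => (k : ℕ)) V) (hv : v.length = n) :
    (X.cube.slice ![false, true]).Hom Y.cube (Equiv.refl _)
      ((fun p => (p.1 - 2, p.2)) ∘ near m w.length) := by
  set φ : ℕ × ℕ → ℕ × ℕ := fun p => (p.1 - 2, p.2)
  have hφ : ∀ l j, φ (2 + l, j) = (0 + l, j) := fun l j => by simp [φ]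
  have arr := fun k : Fin n => start0_shift hφ (V k) k
  simp only [zero_add] at arr
  have near := fun k : Fin n => X.near_arrow (inl k)
  refine ⟨fun α p q h => X.le (Y.circ α ∘ φ) ?_ (fun j hj => ?_) h, fun α k _ => ?_,
    fun α k _ => ?_, fun α k _ => ?_, fun α k _ => ?_⟩
  · rintro (k | k)
    · have := Y.slot α k
      rw [← zero_add (k : ℕ)] at this
      exact this.comp hφ
    · fin_cases k <;> rcases levels hlev with ⟨h0, h1⟩ | ⟨h0, h1⟩ <;> simp [Slot, h0, h1, φ]
  · rw [Function.comp_apply, hw, hφ, zero_add, Y.closing_eq α hv hj]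
    rfl
  all_goals
    rw [Chart.cube_rel]
    refine congrArg _ ?_
    rw [Function.comp_apply]
  · exact ((congrArg φ ((congrArg _ (X.s0_eq (inl k))).trans (near k).1)).trans (arr k).1).trans
      (Y.s0_eq k).symm
  · exact ((congrArg φ ((congrArg _ (X.t0_eq (inl k))).trans (near k).2.1)).trans (arr k).2.1).trans
      (Y.t0_eq k).symm
  · exact ((congrArg φ ((congrArg _ (X.s1_eq (inl k))).trans (near k).2.2.1)).trans
      (arr k).2.2.1).trans (Y.s1_eq k).symm
  · exact ((congrArg φ ((congrArg _ (X.t1_eq (inl k))).trans (near k).2.2.2)).trans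
      (arr k).2.2.2).trans (Y.t1_eq k).symm

/-- The circles of a vertical window. -/
theorem circ_vertical (hlev : lev = ![0, 1] ∨ lev = ![1, 0]) (α : Fin n → Bool) {j : ℕ}
    (hj : j ≤ m) : X.circ (Sum.elim α ![false, true]) (2, j) =
      X.circ (Sum.elim α ![false, true]) (0, j) := by
  have h0 := (X.slot (Sum.elim α ![false, true]) (inr 0)).1 rfl j hj
  have h1 := (X.slot (Sum.elim α ![false, true]) (inr 1)).1 rfl j hj
  simp only [Sum.elim_inr] at h0 h1
  rcases levels hlev with ⟨e0, e1⟩ | ⟨e0, e1⟩ <;> rw [e0] at h0 <;> rw [e1] at h1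
  · exact (h0.trans h1).symm
  · exact (h1.trans h0).symm

theorem hom_slice (hlev : lev = ![0, 1] ∨ lev = ![1, 0]) (hw : w.length = 2 + n)
    (Y : Chart v (fun k : Fin n => (k : ℕ)) V) (hv : v.length = n) :
    Y.cube.Hom (X.cube.slice ![false, true]) (Equiv.refl _)
      ((fun p => (2 + p.1, p.2)) ∘ near m v.length) := by
  set φ : ℕ × ℕ → ℕ × ℕ := fun p => (2 + p.1, p.2)
  have hφ : ∀ l j, φ (0 + l, j) = (2 + l, j) := fun l j => by simp [φ]
  have arr := fun k : Fin n => start0_shift hφ (V k) k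
  simp only [zero_add] at arr
  have near := Y.near_arrow
  refine ⟨fun α p q h => Y.le (X.circ (Sum.elim α ![false, true]) ∘ φ) (fun k => ?_)
    (fun j hj => ?_) h, fun α k _ => ?_, fun α k _ => ?_, fun α k _ => ?_, fun α k _ => ?_⟩
  · have := (X.slot (Sum.elim α ![false, true]) (inl k)).comp hφ
    rwa [zero_add] at this
  · rw [Function.comp_apply, hv, Function.comp_apply]
    change X.circ _ (2 + n, j) = X.circ _ (2, j)
    rw [X.closing_eq _ hw hj, X.circ_vertical hlev α hj]
  all_goals
    refine (X.cube_rel (γ := Sum.elim α ![false, true])).2 (congrArg _ ?_)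
    rw [Function.comp_apply]
  · exact ((congrArg φ ((congrArg _ (Y.s0_eq k)).trans (near k).1)).trans (arr k).1).trans
      (X.s0_eq (inl k)).symm
  · exact ((congrArg φ ((congrArg _ (Y.t0_eq k)).trans (near k).2.1)).trans (arr k).2.1).trans
      (X.t0_eq (inl k)).symm
  · exact ((congrArg φ ((congrArg _ (Y.s1_eq k)).trans (near k).2.2.1)).trans
      (arr k).2.2.1).trans (X.s1_eq (inl k)).symm
  · exact ((congrArg φ ((congrArg _ (Y.t1_eq k)).trans (near k).2.2.2)).trans
      (arr k).2.2.2).trans (X.t1_eq (inl k)).symm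

include X in
/-- Cancellation of two opposite crossings. -/
theorem null_cancel_iff (hlev : lev = ![0, 1] ∨ lev = ![1, 0]) (hw : w.length = 2 + n)
    (Y : Chart v (fun k : Fin n => (k : ℕ)) V) (hv : v.length = n) :
    Null ⟨m, w⟩ R ↔ Null ⟨m, v⟩ R := by
  have hi := X.lt_fst (inr 0)
  simp only [Sum.elim_inr, Matrix.cons_val_zero] at hi
  have ha : (fun k => !(Sum.elim V ![(i, true), (i, false)] k).2) =
      Sum.elim (fun k => !(V k).2) ![false, true] := by
    funext k
    rcases k with k | k
    · rfl
    · fin_cases k <;> rfl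
  rw [X.null_iff, Y.null_iff, ha, (X.bigon hlev hw).bounding_iff X.good]
  · constructor
    · refine bounding_of_hom (X.slice_hom hlev hw Y hv) (X.hom_slice hlev hw Y hv) fun j hj => ?_
      rw [Function.comp_apply, near_mk (Nat.zero_le _) hj]
      exact (Y.cube.rel _).refl _
    · refine bounding_of_hom (X.hom_slice hlev hw Y hv) (X.slice_hom hlev hw Y hv) fun j hj => ?_
      rw [Function.comp_apply, near_mk (Nat.zero_le _) hj]
      exact X.circ_vertical hlev _ hj
  -- At `![true, true]` the positive crossing is horizontal and joins the strands `i` and `i + 1`,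
  -- so the product contains one circle twice.
  · refine ResCube.proj_edge_eq_zero (proj_strandProd_eq_zero (Nat.lt_succ_self i) hi ?_)
    rw [cube_rel]
    have h0 := ((X.slot (Sum.elim (fun k => !(V k).2) ![true, true]) (inr 0)).2 (by simp)).2.1
    have h1 := (X.slot (Sum.elim (fun k => !(V k).2) ![true, true]) (inr 1)).1 rfl
    simp only [Sum.elim_inr, Matrix.cons_val_zero] at h0 h1
    rcases levels hlev with ⟨e0, e1⟩ | ⟨e0, e1⟩ <;> rw [e0] at h0 <;> rw [e1] at h1
    · exact h0
    · exact (h1 i hi.le).trans (h0.trans (h1 (i + 1) hi).symm)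

end Cancel

end Chart

variable {m : ℕ} {R : Type*} [CommRing R]

/-- Opposite crossings cancel. -/
theorem null_cancel_iff (i : Fin m) (ε : Bool) (v : BraidWord m) :
    Null ⟨m, (i, ε) :: (i, !ε) :: v⟩ R ↔ Null ⟨m, v⟩ R := by
  cases ε
  · exact (Chart.pair' (i, false) (i, true) v).null_cancel_iff (.inr rfl) (by simp; omega)
      (Chart.self v) rfl
  · exact (Chart.pair (i, true) (i, false) v).null_cancel_iff (.inl rfl) (by simp; omega)
      (Chart.self v) rfl

end BraidDiagram

end

/-! ### The third Reidemeister move in a braid diagram. -/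

noncomputable section

open PtAlg Sum

namespace BraidDiagram

namespace Chart

variable {m n : ℕ} {Y : Type}

/-- A chart for three letters in front of a word. -/
def triple (x y z : Fin m × Bool) (v : BraidWord m) : Chart (x :: y :: z :: v)
    (Sum.elim (fun k : Fin v.length => 3 + (k : ℕ)) ![0, 1, 2])
    (Sum.elim (fun k => letter (v.get k)) ![letter x, letter y, letter z]) :=
  (append [x, y, z] v (Equiv.refl _) (Equiv.refl _)).copy
    (by rintro (k | k); · rfl
        · fin_cases k <;> rfl)
    (by rintro (k | k); · rfl
        · fin_cases k <;> rfl)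

/-- A chart for three letters in front of a word, with the letters counted from the top. -/
def triple' (x y z : Fin m × Bool) (v : BraidWord m) : Chart (x :: y :: z :: v)
    (Sum.elim (fun k : Fin v.length => 3 + (k : ℕ)) ![2, 1, 0])
    (Sum.elim (fun k => letter (v.get k)) ![letter z, letter y, letter x]) :=
  (append [x, y, z] v (Equiv.refl _) Fin.revPerm).copy
    (by rintro (k | k); · rfl
        · fin_cases k <;> rfl)
    (by rintro (k | k); · rfl
        · fin_cases k <;> rfl)

/-! ### The identifications of the faces in the third Reidemeister move -/

/-- Move the window up by one level. -/
def raise (p : ℕ × ℕ) : ℕ × ℕ := if p.1 < 3 then (p.1 + 1, p.2) else p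

/-- Move the window down by one level. -/
def lower (p : ℕ × ℕ) : ℕ × ℕ := if p.1 = 1 ∨ p.1 = 2 then (p.1 - 1, p.2) else p

/-- Move a bend to the right. -/
def bendRight (i : ℕ) (p : ℕ × ℕ) : ℕ × ℕ :=
  if p.1 = 1 then if p.2 = i then (2, i + 2) else if p.2 = i + 1 then (0, i + 2) else (0, p.2)
  else if p.1 = 2 then if p.2 = i then (2, i + 2) else if p.2 = i + 1 then (3, i + 2) else (3, p.2)
  else p

/-- Move a bend to the left. -/
def bendLeft (i : ℕ) (p : ℕ × ℕ) : ℕ × ℕ :=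
  if p.1 = 1 then if p.2 = i + 2 then (1, i) else if p.2 = i + 1 then (0, i) else (0, p.2)
  else if p.1 = 2 then if p.2 = i + 2 then (1, i) else if p.2 = i + 1 then (3, i) else (3, p.2)
  else p

theorem raise_add (l j : ℕ) : raise (3 + l, j) = (3 + l, j) := by
  rw [raise, if_neg (by simp)]

theorem lower_add (l j : ℕ) : lower (3 + l, j) = (3 + l, j) := by
  rw [lower, if_neg (by dsimp only; omega)]

theorem bendRight_add (i l j : ℕ) : bendRight i (3 + l, j) = (3 + l, j) := by
  rw [bendRight, if_neg (by dsimp only; omega), if_neg (by dsimp only; omega)]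

theorem bendLeft_add (i l j : ℕ) : bendLeft i (3 + l, j) = (3 + l, j) := by
  rw [bendLeft, if_neg (by dsimp only; omega), if_neg (by dsimp only; omega)]

/-- If the negative crossing is smoothed vertically, both diagrams show the remaining two crossings
in the same order, only one level apart. -/
theorem raise_slots {g : ℕ × ℕ → Y} {i : ℕ} {c d : Bool}
    (h0 : Slot g m 0 (i + 1) True) (h1 : Slot g m 1 i (c = false))
    (h2 : Slot g m 2 (i + 1) (d = false)) :
    Slot (g ∘ raise) m 0 i (c = false) ∧ Slot (g ∘ raise) m 1 (i + 1) (d = false) ∧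
      Slot (g ∘ raise) m 2 i True ∧ ∀ j ≤ m, g (raise (0, j)) = g (0, j) :=
  ⟨h1, h2, ⟨fun _ _ _ => rfl, fun h => absurd trivial h⟩, fun j hj => (h0.1 trivial j hj).symm⟩

theorem lower_slots {g : ℕ × ℕ → Y} {i : ℕ} (hi : i + 2 ≤ m) {c d : Bool}
    (h0 : Slot g m 0 i (c = false)) (h1 : Slot g m 1 (i + 1) (d = false))
    (h2 : Slot g m 2 i True) :
    Slot (g ∘ lower) m 0 (i + 1) True ∧ Slot (g ∘ lower) m 1 i (c = false) ∧
      Slot (g ∘ lower) m 2 (i + 1) (d = false) ∧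
      g (lower (3, i + 1)) = g (2, i + 1) := by
  cases c <;> cases d <;> simp [Slot, lower] at h0 h1 h2 ⊢ <;> grind

/-- If the middle crossing is smoothed horizontally, the other crossings slide along its bends from
the positions `i, i + 1` to `i + 1, i + 2`. Vertical and horizontal smoothings are exchanged and so
are the signs of the crossings, hence 0-smoothings still match 0-smoothings. -/
theorem bendRight_slots {g : ℕ × ℕ → Y} {i : ℕ} (hi : i + 2 ≤ m) {c d : Bool}
    (h0 : Slot g m 0 (i + 1) (c = true)) (h1 : Slot g m 1 i False)
    (h2 : Slot g m 2 (i + 1) (d = false)) :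
    Slot (g ∘ bendRight i) m 0 i (c = false) ∧ Slot (g ∘ bendRight i) m 1 (i + 1) False ∧
      Slot (g ∘ bendRight i) m 2 i (d = true) ∧
    ((c = false → g (bendRight i (start0 (i, true) 0)) = g (start0 (i + 1, false) 0) ∧
      g (bendRight i (end0 (i, true) 0)) = g (end0 (i + 1, false) 0)) ∧
    (c = true → g (bendRight i (start1 (i, true) 0)) = g (start1 (i + 1, false) 0) ∧
      g (bendRight i (end1 (i, true) 0)) = g (end1 (i + 1, false) 0))) ∧
    ((d = false → g (bendRight i (start0 (i, false) 2)) = g (start0 (i + 1, true) 2) ∧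
      g (bendRight i (end0 (i, false) 2)) = g (end0 (i + 1, true) 2)) ∧
    (d = true → g (bendRight i (start1 (i, false) 2)) = g (start1 (i + 1, true) 2) ∧
      g (bendRight i (end1 (i, false) 2)) = g (end1 (i + 1, true) 2))) := by
  cases c <;> cases d <;> simp [Slot, bendRight, start0, end0, start1, end1] at h0 h1 h2 ⊢ <;>
    grind

theorem bendLeft_slots {g : ℕ × ℕ → Y} {i : ℕ} (hi : i + 2 ≤ m) {c d : Bool}
    (h0 : Slot g m 0 i (c = false)) (h1 : Slot g m 1 (i + 1) False)
    (h2 : Slot g m 2 i (d = true)) :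
    Slot (g ∘ bendLeft i) m 0 (i + 1) (c = true) ∧ Slot (g ∘ bendLeft i) m 1 i False ∧
      Slot (g ∘ bendLeft i) m 2 (i + 1) (d = false) ∧
    ((c = false → g (bendLeft i (start0 (i + 1, false) 0)) = g (start0 (i, true) 0) ∧
      g (bendLeft i (end0 (i + 1, false) 0)) = g (end0 (i, true) 0)) ∧
    (c = true → g (bendLeft i (start1 (i + 1, false) 0)) = g (start1 (i, true) 0) ∧
      g (bendLeft i (end1 (i + 1, false) 0)) = g (end1 (i, true) 0))) ∧
    ((d = false → g (bendLeft i (start0 (i + 1, true) 2)) = g (start0 (i, false) 2) ∧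
      g (bendLeft i (end0 (i + 1, true) 2)) = g (end0 (i, false) 2)) ∧
    (d = true → g (bendLeft i (start1 (i + 1, true) 2)) = g (start1 (i, false) 2) ∧
      g (bendLeft i (end1 (i + 1, true) 2)) = g (end1 (i, false) 2))) := by
  cases c <;> cases d <;> simp [Slot, bendLeft, start0, end0, start1, end1] at h0 h1 h2 ⊢ <;>
    grind

end Chart

end BraidDiagram

end

noncomputable section

open PtAlg Sum

namespace BraidDiagram

namespace Chart

variable {m n : ℕ} {w w' : BraidWord m} {V : Fin n → ℕ × Bool}

/-! ### The bigon in the third Reidemeister move -/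

section

variable {lev : Fin 3 → ℕ} {i i' : ℕ}
  (X : Chart w (Sum.elim (fun k : Fin n => 3 + (k : ℕ)) lev)
    (Sum.elim V ![(i, true), (i', true), (i, false)]))

/-- The points between two opposite crossings, which are separated by a third one. -/
def Middle₂ (i : ℕ) (p : ℕ × ℕ) : Prop := (p.1 = 1 ∨ p.1 = 2) ∧ (p.2 = i ∨ p.2 = i + 1)

theorem not_middle₂_arrow (i l : ℕ) (x : ℕ × Bool) : ¬ Middle₂ i (start0 x (3 + l)) ∧
    ¬ Middle₂ i (end0 x (3 + l)) ∧ ¬ Middle₂ i (start1 x (3 + l)) ∧ ¬ Middle₂ i (end1 x (3 + l)) := by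
  obtain ⟨j, ε⟩ := x
  cases ε <;> simp [Middle₂, start0, end0, start1, end1] <;> omega

theorem levels₃ (hlev : lev = ![0, 1, 2] ∨ lev = ![2, 1, 0]) :
    (lev 0 = 0 ∧ lev 1 = 1 ∧ lev 2 = 2) ∨ (lev 0 = 2 ∧ lev 1 = 1 ∧ lev 2 = 0) := by
  rcases hlev with rfl | rfl
  · exact .inl ⟨rfl, rfl, rfl⟩
  · exact .inr ⟨rfl, rfl, rfl⟩

/-- Two opposite crossings, separated by a crossing with a vertical smoothing, form a bigon. -/
def bigon₃ (hlev : lev = ![0, 1, 2] ∨ lev = ![2, 1, 0]) (hw : w.length = 3 + n) :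
    X.cube.Bigon ![false, false, false] ![true, false, false] 0 2 where
  O q := Middle₂ i (near m w.length q)
  a := if lev 0 = 0 then (1, i) else (2, i)
  b := if lev 0 = 0 then (0, i) else (3, i)
  a' := if lev 0 = 0 then (2, i) else (1, i)
  v := if lev 0 = 0 then (3, i) else (0, i)
  hp := rfl
  hβ := by decide
  hn := rfl
  sat α q q' h hq := by
    have := X.le (Middle₂ i) (γ := Sum.elim α ![true, false, false]) ?_ ?_ h
    · exact this ▸ hq
    · rintro (k | k)
      · have h1 : 3 + (k : ℕ) ≠ 1 := by omega
        have h2 : 3 + (k : ℕ) ≠ 2 := by omega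
        have h4 : 3 + (k : ℕ) + 1 ≠ 2 := by omega
        simp [Slot, Middle₂, h1, h2, h4]
      · fin_cases k <;> rcases levels₃ hlev with ⟨h0, h1, h2⟩ | ⟨h0, h1, h2⟩ <;>
          simp [Slot, Middle₂, h0, h1, h2] <;> omega
    · intro j _
      have h1 : 3 + n ≠ 1 := by omega
      have h2 : 3 + n ≠ 2 := by omega
      simp [Middle₂, hw, h1, h2]
  single α q q' hq hq' := by
    rw [cube_rel, ← X.circ_near, ← X.circ_near _ q']
    have hi := X.lt_fst (inr 0)
    have h0 := ((X.slot (Sum.elim α ![true, false, false]) (inr 0)).2 (by simp)).2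
    have h1 := (X.slot (Sum.elim α ![true, false, false]) (inr 1)).1 rfl
    simp only [Sum.elim_inr, Matrix.cons_val_zero] at h0 h1 hi
    have e : X.circ (Sum.elim α ![true, false, false]) (1, i) =
        X.circ (Sum.elim α ![true, false, false]) (1, i + 1) ∧
        X.circ (Sum.elim α ![true, false, false]) (2, i) =
        X.circ (Sum.elim α ![true, false, false]) (1, i + 1) ∧
        X.circ (Sum.elim α ![true, false, false]) (2, i + 1) =
        X.circ (Sum.elim α ![true, false, false]) (1, i + 1) := by
      rcases levels₃ hlev with ⟨e0, e1, e2⟩ | ⟨e0, e1, e2⟩ <;> rw [e0] at h0 <;> rw [e1] at h1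
      · exact ⟨h0.2, (h1 i hi.le).symm.trans h0.2, (h1 (i + 1) hi).symm⟩
      · have := h0.1
        have a1 := h1 i hi.le
        have a2 := h1 (i + 1) hi
        exact ⟨a1.trans (this.trans a2.symm), this.trans a2.symm, a2.symm⟩
    revert hq hq'
    generalize near m w.length q = p
    generalize near m w.length q' = p'
    have key : ∀ p, Middle₂ i p → X.circ (Sum.elim α ![true, false, false]) p =
        X.circ (Sum.elim α ![true, false, false]) (1, i + 1) := by
      rintro ⟨l, j⟩ ⟨h1, h2⟩
      dsimp only at h1 h2
      rcases h1 with rfl | rfl <;> rcases h2 with rfl | rfl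
      · exact e.1
      · rfl
      · exact e.2.1
      · exact e.2.2
    exact fun hp hp' => (key p hp).trans (key p' hp').symm
  s0 k := by
    rw [X.s0_eq, (X.near_arrow (inl k)).1]; exact (not_middle₂_arrow i k (V k)).1
  t0 k := by
    rw [X.t0_eq, (X.near_arrow (inl k)).2.1]; exact (not_middle₂_arrow i k (V k)).2.1
  s1 k := by
    rw [X.s1_eq, (X.near_arrow (inl k)).2.2.1]; exact (not_middle₂_arrow i k (V k)).2.2.1
  t1 k := by
    rw [X.t1_eq, (X.near_arrow (inl k)).2.2.2]; exact (not_middle₂_arrow i k (V k)).2.2.2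
  ha := by
    have := X.lt_fst (inr 0)
    simp only [Sum.elim_inr, Matrix.cons_val_zero] at this
    split_ifs <;> rw [near_mk (by omega) (by omega)] <;> simp [Middle₂]
  hb := by
    have := X.lt_fst (inr 0)
    simp only [Sum.elim_inr, Matrix.cons_val_zero] at this
    split_ifs <;> rw [near_mk (by omega) (by omega)] <;> simp [Middle₂]
  ha' := by
    have := X.lt_fst (inr 0)
    simp only [Sum.elim_inr, Matrix.cons_val_zero] at this
    split_ifs <;> rw [near_mk (by omega) (by omega)] <;> simp [Middle₂]
  hv := by
    have := X.lt_fst (inr 0)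
    simp only [Sum.elim_inr, Matrix.cons_val_zero] at this
    split_ifs <;> rw [near_mk (by omega) (by omega)] <;> simp [Middle₂]
  ends_p := by
    rw [X.s1_eq, X.t1_eq]
    rcases levels₃ hlev with ⟨h0, h1, h2⟩ | ⟨h0, h1, h2⟩ <;> simp [start1, end1, h0]
  ends_n := by
    rw [X.s0_eq, X.t0_eq]
    rcases levels₃ hlev with ⟨h0, h1, h2⟩ | ⟨h0, h1, h2⟩ <;> simp [start0, end0, h0, h2]

/-- Of the two arcs of the middle crossing exactly one runs along the small circle. -/
theorem middle_merges (hlev : lev = ![0, 1, 2] ∨ lev = ![2, 1, 0]) (hw : w.length = 3 + n)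
    (hi : i' = i + 1 ∨ i = i' + 1) (α : Fin n → Bool) :
    ¬ X.cube.Splits (Sum.elim α ![true, false, false]) (inr 1) := by
  intro h
  have h0 := X.lt_fst (inr 0)
  have h1 := X.lt_fst (inr 1)
  simp only [Sum.elim_inr, Matrix.cons_val_zero, Matrix.cons_val_one] at h0 h1
  have e1 := (X.bigon₃ hlev hw).sat α _ _ h
  have e2 := (X.bigon₃ hlev hw).sat α _ _ ((X.cube.rel _).symm h)
  change Middle₂ i (near m w.length _) → Middle₂ i (near m w.length _) at e1 e2
  have hl : lev 1 = 1 := by rcases levels₃ hlev with ⟨-, h, -⟩ | ⟨-, h, -⟩ <;> exact h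
  rw [X.s0_eq, X.t0_eq, (X.near_arrow (inr 1)).1, (X.near_arrow (inr 1)).2.1] at e1 e2
  simp [Middle₂, start0, end0, hl] at e1 e2
  omega

/-- With arrows given by the signs of the crossings, exactly one of the two arrows starts on the
small circle. This excludes a face of type A. -/
theorem middle_ne (hlev : lev = ![0, 1, 2] ∧ i' = i + 1 ∨ lev = ![2, 1, 0] ∧ i = i' + 1)
    (hw : w.length = 3 + n) (α : Fin n → Bool) :
    ¬ X.cube.rel (Sum.elim α ![true, false, false]) (X.cube.s0 (inr 1)) (X.cube.s0 (inr 2)) := by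
  have hlev' : lev = ![0, 1, 2] ∨ lev = ![2, 1, 0] := hlev.imp And.left And.left
  intro h
  have h0 := X.lt_fst (inr 0)
  have h1 := X.lt_fst (inr 1)
  simp only [Sum.elim_inr, Matrix.cons_val_zero, Matrix.cons_val_one] at h0 h1
  have e1 := (X.bigon₃ hlev' hw).sat α _ _ h
  have e2 := (X.bigon₃ hlev' hw).sat α _ _ ((X.cube.rel _).symm h)
  change Middle₂ i (near m w.length _) → Middle₂ i (near m w.length _) at e1 e2
  rw [X.s0_eq, X.s0_eq, (X.near_arrow (inr 1)).1, (X.near_arrow (inr 2)).1] at e1 e2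
  rcases hlev with ⟨rfl, rfl⟩ | ⟨rfl, rfl⟩ <;> simp [Middle₂, start0] at e1 e2
  omega

end

/-! ### The homomorphisms of faces -/

section

variable {lev lev' : Fin 3 → ℕ} {W W' : Fin 3 → ℕ × Bool} {φ : ℕ × ℕ → ℕ × ℕ}

theorem face_hom (X : Chart w (Sum.elim (fun k : Fin n => 3 + (k : ℕ)) lev) (Sum.elim V W))
    (X' : Chart w' (Sum.elim (fun k : Fin n => 3 + (k : ℕ)) lev') (Sum.elim V W'))
    (hφ : ∀ l j, φ (3 + l, j) = (3 + l, j)) (hw : w.length = 3 + n)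
    (hw' : w'.length = 3 + n) {j j' : Fin 2 → Fin 3} {b b' : (Fin 2 → Bool) → Fin 3 → Bool}
    (hs : ∀ α c t, Slot (X'.circ (Sum.elim α (b' c)) ∘ φ) m (lev t) (W t).1 (b c t = !(W t).2))
    (h0 : ∀ α c, ∀ j ≤ m, X'.circ (Sum.elim α (b' c)) (φ (0, j)) = X'.circ (Sum.elim α (b' c)) (0, j))
    (ha : ∀ α c k, (c k = false →
      X'.circ (Sum.elim α (b' c)) (φ (start0 (W (j k)) (lev (j k)))) =
        X'.circ (Sum.elim α (b' c)) (start0 (W' (j' k)) (lev' (j' k))) ∧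
      X'.circ (Sum.elim α (b' c)) (φ (end0 (W (j k)) (lev (j k)))) =
        X'.circ (Sum.elim α (b' c)) (end0 (W' (j' k)) (lev' (j' k)))) ∧ (c k = true →
      X'.circ (Sum.elim α (b' c)) (φ (start1 (W (j k)) (lev (j k)))) =
        X'.circ (Sum.elim α (b' c)) (start1 (W' (j' k)) (lev' (j' k))) ∧
      X'.circ (Sum.elim α (b' c)) (φ (end1 (W (j k)) (lev (j k)))) =
        X'.circ (Sum.elim α (b' c)) (end1 (W' (j' k)) (lev' (j' k))))) :
    (X.cube.face j b).Hom (X'.cube.face j' b') (Equiv.refl _) (φ ∘ near m w.length) := by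
  have arr := shift_arrows X X' hφ
  have near := fun k => X.near_arrow (inr k)
  refine ⟨fun γ p q h => ?_, fun γ k hk => ?_, fun γ k hk => ?_, fun γ k hk => ?_,
    fun γ k hk => ?_⟩
  · exact shift_rel X X' hφ hw hw' le_rfl (γ := Sum.elim (γ ∘ inl) (b (γ ∘ inr)))
      (γ' := Sum.elim (γ ∘ inl) (b' (γ ∘ inr)))
      (fun _ => rfl) (hs _ _) (h0 _ _) h
  all_goals
    refine (X'.cube_rel (γ := Sum.elim (γ ∘ inl) (b' (γ ∘ inr)))).2 ?_
    rcases k with k | k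
  · exact congrArg _ (arr k).1
  · refine Eq.trans (congrArg (X'.circ _ ∘ φ) ((congrArg _ (X.s0_eq (inr (j k)))).trans (near _).1)) ?_
    exact (((ha (γ ∘ inl) (γ ∘ inr) k).1 hk).1).trans (congrArg _ (X'.s0_eq (inr (j' k))).symm)
  · exact congrArg _ (arr k).2.1
  · refine Eq.trans (congrArg (X'.circ _ ∘ φ) ((congrArg _ (X.t0_eq (inr (j k)))).trans (near _).2.1)) ?_
    exact (((ha (γ ∘ inl) (γ ∘ inr) k).1 hk).2).trans (congrArg _ (X'.t0_eq (inr (j' k))).symm)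
  · exact congrArg _ (arr k).2.2.1
  · refine Eq.trans (congrArg (X'.circ _ ∘ φ) ((congrArg _ (X.s1_eq (inr (j k)))).trans (near _).2.2.1)) ?_
    exact (((ha (γ ∘ inl) (γ ∘ inr) k).2 hk).1).trans (congrArg _ (X'.s1_eq (inr (j' k))).symm)
  · exact congrArg _ (arr k).2.2.2
  · refine Eq.trans (congrArg (X'.circ _ ∘ φ) ((congrArg _ (X.t1_eq (inr (j k)))).trans (near _).2.2.2)) ?_
    exact (((ha (γ ∘ inl) (γ ∘ inr) k).2 hk).2).trans (congrArg _ (X'.t1_eq (inr (j' k))).symm)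

end

end Chart

end BraidDiagram

end

noncomputable section

open PtAlg Sum ResCube

namespace BraidDiagram

namespace Chart

variable {m n : ℕ} {w w' : BraidWord m} {V : Fin n → ℕ × Bool} {i : ℕ}
  (X : Chart w (Sum.elim (fun k : Fin n => 3 + (k : ℕ)) ![0, 1, 2])
    (Sum.elim V ![(i, true), (i + 1, true), (i, false)]))
  (Y : Chart w' (Sum.elim (fun k : Fin n => 3 + (k : ℕ)) ![2, 1, 0])
    (Sum.elim V ![(i + 1, true), (i, true), (i + 1, false)]))

include X in
theorem add_two_le (_ : Chart w' (Sum.elim (fun k : Fin n => 3 + (k : ℕ)) ![2, 1, 0])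
    (Sum.elim V ![(i + 1, true), (i, true), (i + 1, false)])) : i + 2 ≤ m := by
  have := X.lt_fst (inr 1)
  simp only [Sum.elim_inr, Matrix.cons_val_one, Matrix.cons_val_zero] at this
  omega

theorem raise_facts (α : Fin n → Bool) (c d : Bool) :
    Slot (Y.circ (Sum.elim α ![d, c, true]) ∘ raise) m 0 i (c = false) ∧
    Slot (Y.circ (Sum.elim α ![d, c, true]) ∘ raise) m 1 (i + 1) (d = false) ∧
    Slot (Y.circ (Sum.elim α ![d, c, true]) ∘ raise) m 2 i True ∧
    ∀ j ≤ m, Y.circ (Sum.elim α ![d, c, true]) (raise (0, j)) =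
      Y.circ (Sum.elim α ![d, c, true]) (0, j) := by
  have h0 := Y.slot (Sum.elim α ![d, c, true]) (inr 0)
  have h1 := Y.slot (Sum.elim α ![d, c, true]) (inr 1)
  have h2 := Y.slot (Sum.elim α ![d, c, true]) (inr 2)
  exact raise_slots (by simpa using h2) h1 h0

theorem lower_facts (hi : i + 2 ≤ m) (α : Fin n → Bool) (c d : Bool) :
    Slot (X.circ (Sum.elim α ![c, d, true]) ∘ lower) m 0 (i + 1) True ∧
    Slot (X.circ (Sum.elim α ![c, d, true]) ∘ lower) m 1 i (c = false) ∧
    Slot (X.circ (Sum.elim α ![c, d, true]) ∘ lower) m 2 (i + 1) (d = false) ∧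
    X.circ (Sum.elim α ![c, d, true]) (lower (3, i + 1)) =
      X.circ (Sum.elim α ![c, d, true]) (2, i + 1) := by
  have h0 := X.slot (Sum.elim α ![c, d, true]) (inr 0)
  have h1 := X.slot (Sum.elim α ![c, d, true]) (inr 1)
  have h2 := X.slot (Sum.elim α ![c, d, true]) (inr 2)
  exact lower_slots hi h0 h1 (by simpa using h2)

section Homs

variable (hw : w.length = 3 + n) (hw' : w'.length = 3 + n) {p q : Fin 2} (hpq : ∀ k, k = p ∨ k = q)
  {j j' : Fin 2 → Fin 3}
include hw hw' hpq

theorem hom_raise (h1 : j p = 0) (h2 : j q = 1) (h3 : j' p = 1) (h4 : j' q = 0) :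
    (X.cube.face j fun c => ![c p, c q, true]).Hom (Y.cube.face j' fun c => ![c q, c p, true])
      (Equiv.refl _) (raise ∘ near m w.length) := by
  have key := fun α (c : Fin 2 → Bool) => raise_facts Y α (c p) (c q)
  refine face_hom X Y raise_add hw hw' (fun α c t => ?_) (fun α c => (key α c).2.2.2)
    fun α c k => ?_
  · fin_cases t
    · exact (key α c).1
    · exact (key α c).2.1
    · simpa using (key α c).2.2.1
  · rcases hpq k with rfl | rfl
    · rw [h1, h3]
      exact ⟨fun _ => ⟨rfl, rfl⟩, fun _ => ⟨rfl, rfl⟩⟩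
    · rw [h2, h4]
      exact ⟨fun _ => ⟨rfl, rfl⟩, fun _ => ⟨rfl, rfl⟩⟩

theorem hom_lower (h1 : j p = 0) (h2 : j q = 1) (h3 : j' p = 1) (h4 : j' q = 0) :
    (Y.cube.face j' fun c => ![c q, c p, true]).Hom (X.cube.face j fun c => ![c p, c q, true])
      (Equiv.refl _) (lower ∘ near m w'.length) := by
  have key := fun α (c : Fin 2 → Bool) => lower_facts X (add_two_le X Y) α (c p) (c q)
  refine face_hom Y X lower_add hw' hw (fun α c t => ?_) (fun α c j hj => rfl)
    fun α c k => ?_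
  · fin_cases t
    · exact (key α c).2.2.1
    · exact (key α c).2.1
    · simpa using (key α c).1
  · rcases hpq k with rfl | rfl
    · rw [h1, h3]
      exact ⟨fun _ => ⟨rfl, rfl⟩, fun _ => ⟨rfl, rfl⟩⟩
    · rw [h2, h4]
      exact ⟨fun _ => ⟨rfl, rfl⟩, fun _ => ⟨(key α c).2.2.2, rfl⟩⟩

theorem hom_bendRight (h1 : j p = 0) (h2 : j q = 2) (h3 : j' p = 2) (h4 : j' q = 0) :
    (X.cube.face j fun c => ![c p, true, c q]).Hom (Y.cube.face j' fun c => ![c q, true, c p])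
      (Equiv.refl _) (bendRight i ∘ near m w.length) := by
  have key := fun α (c : Fin 2 → Bool) => bendRight_slots (add_two_le X Y) (c := c p) (d := c q)
    (g := Y.circ (Sum.elim α ![c q, true, c p])) (Y.slot (Sum.elim α ![c q, true, c p]) (inr 2))
    (by simpa using Y.slot (Sum.elim α ![c q, true, c p]) (inr 1))
    (Y.slot (Sum.elim α ![c q, true, c p]) (inr 0))
  refine face_hom X Y (bendRight_add i) hw hw' (fun α c t => ?_) (fun α c j hj => rfl)
    fun α c k => ?_
  · fin_cases t
    · exact (key α c).1
    · simpa using (key α c).2.1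
    · exact (key α c).2.2.1
  · rcases hpq k with rfl | rfl
    · rw [h1, h3]
      exact (key α c).2.2.2.1
    · rw [h2, h4]
      exact (key α c).2.2.2.2

theorem hom_bendLeft (h1 : j p = 0) (h2 : j q = 2) (h3 : j' p = 2) (h4 : j' q = 0) :
    (Y.cube.face j' fun c => ![c q, true, c p]).Hom (X.cube.face j fun c => ![c p, true, c q])
      (Equiv.refl _) (bendLeft i ∘ near m w'.length) := by
  have key := fun α (c : Fin 2 → Bool) => bendLeft_slots (add_two_le X Y) (c := c p) (d := c q)
    (g := X.circ (Sum.elim α ![c p, true, c q])) (X.slot (Sum.elim α ![c p, true, c q]) (inr 0))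
    (by simpa using X.slot (Sum.elim α ![c p, true, c q]) (inr 1))
    (X.slot (Sum.elim α ![c p, true, c q]) (inr 2))
  refine face_hom Y X (bendLeft_add i) hw' hw (fun α c t => ?_) (fun α c j hj => rfl)
    fun α c k => ?_
  · fin_cases t
    · exact (key α c).2.2.1
    · simpa using (key α c).2.1
    · exact (key α c).1
  · rcases hpq k with rfl | rfl
    · rw [h1, h3]
      exact (key α c).2.2.2.1
    · rw [h2, h4]
      exact (key α c).2.2.2.2

end Homs

theorem braid_sign : (fun k : Fin n ⊕ Fin 3 =>
    !(Sum.elim V ![(i, true), (i + 1, true), (i, false)] k).2) =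
      Sum.elim (fun k => !(V k).2) ![false, false, true] := by
  funext k
  rcases k with k | k
  · rfl
  · fin_cases k <;> rfl

theorem braid_sign' : (fun k : Fin n ⊕ Fin 3 =>
    !(Sum.elim V ![(i + 1, true), (i, true), (i + 1, false)] k).2) =
      Sum.elim (fun k => !(V k).2) ![false, false, true] := by
  funext k
  rcases k with k | k
  · rfl
  · fin_cases k <;> rfl

variable {R : Type*} [CommRing R]

/-! ### Comparison of the collapses of the bigons -/

/-- This lemma and the next three compare the two identifications of faces with the collapses of the
bigons, as `Bigon.bounding_of_faceIso` requires. -/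
theorem bendRight_collapse {T : Type} {g : ℕ × ℕ → T} (hi : i + 2 ≤ m)
    (h0 : Slot g m 0 (i + 1) True) (h1 : Slot g m 1 i False) (h2 : Slot g m 2 (i + 1) True)
    {p : ℕ × ℕ} (hp : p.2 ≤ m) :
    g (bendRight i (collapse (Middle₂ i) (3, i) p)) = g (raise p) := by
  obtain ⟨l, j⟩ := p
  rcases Nat.lt_or_ge l 3 with hl | hl
  · interval_cases l <;> simp [Slot, collapse, Middle₂, bendRight, raise] at h0 h1 h2 hp ⊢ <;> grind
  · obtain ⟨l, rfl⟩ := Nat.exists_eq_add_of_le hl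
    rw [raise_add, collapse_neg (by simp [Middle₂]; omega), bendRight_add]

theorem bendRight_eq_collapse {T : Type} {g : ℕ × ℕ → T} (hi : i + 2 ≤ m)
    (h0 : Slot g m 0 (i + 1) False) (h1 : Slot g m 1 i False) (h2 : Slot g m 2 (i + 1) False)
    {p : ℕ × ℕ} (hp : p.2 ≤ m) :
    g (bendRight i p) = g (collapse (Middle₂ (i + 1)) (0, i + 1) (raise p)) := by
  obtain ⟨l, j⟩ := p
  rcases Nat.lt_or_ge l 3 with hl | hl
  · interval_cases l <;> simp [Slot, collapse, Middle₂, bendRight, raise] at h0 h1 h2 hp ⊢ <;> grind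
  · obtain ⟨l, rfl⟩ := Nat.exists_eq_add_of_le hl
    rw [raise_add, collapse_neg (by simp [Middle₂]; omega), bendRight_add]

theorem bendLeft_collapse {T : Type} {g : ℕ × ℕ → T} (hi : i + 2 ≤ m)
    (h0 : Slot g m 0 i True) (h1 : Slot g m 1 (i + 1) False) (h2 : Slot g m 2 i True)
    {p : ℕ × ℕ} (hp : p.2 ≤ m) :
    g (bendLeft i (collapse (Middle₂ (i + 1)) (0, i + 1) p)) = g (lower p) := by
  obtain ⟨l, j⟩ := p
  rcases Nat.lt_or_ge l 3 with hl | hl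
  · interval_cases l <;> simp [Slot, collapse, Middle₂, bendLeft, lower] at h0 h1 h2 hp ⊢ <;> grind
  · obtain ⟨l, rfl⟩ := Nat.exists_eq_add_of_le hl
    rw [lower_add, collapse_neg (by simp [Middle₂]; omega), bendLeft_add]

theorem bendLeft_eq_collapse {T : Type} {g : ℕ × ℕ → T} (hi : i + 2 ≤ m)
    (h0 : Slot g m 0 i False) (h1 : Slot g m 1 (i + 1) False) (h2 : Slot g m 2 i False)
    {p : ℕ × ℕ} (hp : p.2 ≤ m) :
    g (bendLeft i p) = g (collapse (Middle₂ i) (3, i) (lower p)) := by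
  obtain ⟨l, j⟩ := p
  rcases Nat.lt_or_ge l 3 with hl | hl
  · interval_cases l <;> simp [Slot, collapse, Middle₂, bendLeft, lower] at h0 h1 h2 hp ⊢ <;> grind
  · obtain ⟨l, rfl⟩ := Nat.exists_eq_add_of_le hl
    rw [lower_add, collapse_neg (by simp [Middle₂]; omega), bendLeft_add]

theorem collapse_near {n : ℕ} {O : ℕ × ℕ → Prop} {v q : ℕ × ℕ} (hv : near m n v = v) :
    near m n (collapse (fun q => O (near m n q)) v q) = collapse O v (near m n q) := by
  by_cases h : O (near m n q)
  · rw [collapse_pos (O := fun q => O (near m n q)) h, collapse_pos h, hv]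
  · rw [collapse_neg (O := fun q => O (near m n q)) h, collapse_neg h]

theorem near_raise {N : ℕ} (q : ℕ × ℕ) (hN : 3 ≤ N) :
    near m N (raise (near m N q)) = raise (near m N q) := by
  have h1 : (near m N q).1 ≤ N := min_le_right _ _
  have h2 : (near m N q).2 ≤ m := min_le_right _ _
  generalize near m N q = p at h1 h2
  rw [raise]
  split_ifs with h
  · exact near_mk (by omega) h2
  · exact near_mk h1 h2

theorem near_lower {N : ℕ} (q : ℕ × ℕ) : near m N (lower (near m N q)) = lower (near m N q) := by
  have h1 : (near m N q).1 ≤ N := min_le_right _ _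
  have h2 : (near m N q).2 ≤ m := min_le_right _ _
  generalize near m N q = p at h1 h2
  rw [lower]
  split_ifs with h
  · exact near_mk (by omega) h2
  · exact near_mk h1 h2

include X Y in
theorem null_of_braid (hw : w.length = 3 + n) (hw' : w'.length = 3 + n) (h : Null ⟨m, w⟩ R) :
    Null ⟨m, w'⟩ R := by
  have hi := add_two_le X Y
  rw [X.null_iff, braid_sign] at h
  rw [Y.null_iff, braid_sign']
  have h01 : ∀ k : Fin 2, k = 0 ∨ k = 1 := by decide
  have hφ₁ : ∀ α c d, ∀ j ≤ m, Y.cube.rel (Sum.elim α ![d, c, true])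
      ((raise ∘ near m w.length) (0, j)) (0, j) := by
    intro α c d j hj
    rw [Function.comp_apply, near_mk (Nat.zero_le _) hj]
    exact (raise_facts Y α c d).2.2.2 j hj
  refine (Bigon.bounding_of_faceIso X.good Y.good (X.bigon₃ (.inl rfl) hw)
    (Y.bigon₃ (.inr rfl) hw') (X.middle_merges (.inl rfl) hw (.inl rfl))
    (X.middle_ne (.inl ⟨rfl, rfl⟩) hw) (Y.middle_merges (.inr rfl) hw' (.inr rfl))
    (Y.middle_ne (.inr ⟨rfl, rfl⟩) hw') (φ₁ := raise ∘ near m w.length)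
    (φ₂ := bendRight i ∘ near m w.length) (ψ₁ := lower ∘ near m w'.length)
    (ψ₂ := bendLeft i ∘ near m w'.length)
    ⟨⟨by decide, by decide, by decide⟩, ⟨by decide, by decide, by decide⟩,
      hom_raise X Y hw hw' h01 rfl rfl rfl rfl, hom_lower X Y hw hw' h01 rfl rfl rfl rfl⟩
    ⟨⟨by decide, by decide, by decide⟩, ⟨by decide, by decide, by decide⟩,
      hom_bendRight X Y hw hw' h01 rfl rfl rfl rfl, hom_bendLeft X Y hw hw' h01 rfl rfl rfl rfl⟩
    ?_ ?_ ?_ h).congr ?_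
  · intro α q
    refine (congrArg (Y.circ _ ∘ bendRight i) (collapse_near (near_mk ?_ ?_))).trans
      (bendRight_collapse hi ?_ ?_ ?_ (min_le_right _ _))
    · omega
    · omega
    · simpa using Y.slot (Sum.elim α ![false, true, true]) (inr 2)
    · simpa using Y.slot (Sum.elim α ![false, true, true]) (inr 1)
    · simpa using Y.slot (Sum.elim α ![false, true, true]) (inr 0)
  · intro α q
    refine (bendRight_eq_collapse hi (g := Y.circ (Sum.elim α ![true, true, false])) ?_ ?_ ?_
      (min_le_right _ _)).trans ?_
    · simpa using Y.slot (Sum.elim α ![true, true, false]) (inr 2)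
    · simpa using Y.slot (Sum.elim α ![true, true, false]) (inr 1)
    · simpa using Y.slot (Sum.elim α ![true, true, false]) (inr 0)
    · refine Eq.trans (congrArg (Y.circ _) ?_) (Y.circ_near _ _)
      refine Eq.trans ?_ (collapse_near (O := Middle₂ (i + 1)) (v := (0, i + 1)) ?_).symm
      · refine congrArg (collapse _ _) ?_
        rw [Function.comp_apply, hw, hw', near_raise _ (by omega)]
      · exact near_mk (Nat.zero_le _) (by omega)
  -- Only the top crossing is horizontal here. It joins the strands `i + 1` and `i + 2`, which
  -- repeats a generator.
  · refine ResCube.proj_edge_eq_zero ?_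
    rw [proj_emap_strandProd (hφ₁ _ _ _)]
    refine proj_strandProd_eq_zero (i := i + 1) (j := i + 2) (by omega) hi ?_
    have h0 := (Y.slot (Sum.elim (fun k => !(V k).2) ![true, false, true]) (inr 2)).1 (by simp)
    have h1 := (Y.slot (Sum.elim (fun k => !(V k).2) ![true, false, true]) (inr 1)).1 (by simp)
    have h2 := (Y.slot (Sum.elim (fun k => !(V k).2) ![true, false, true]) (inr 0)).2 (by simp)
    exact (h0 (i + 1) (by omega)).trans ((h1 (i + 1) (by omega)).trans (h2.2.1.trans
      ((h0 _ hi).trans (h1 _ hi)).symm))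
  · exact proj_emap_strandProd (hφ₁ _ _ _)

include X Y in
theorem null_of_braid' (hw : w.length = 3 + n) (hw' : w'.length = 3 + n) (h : Null ⟨m, w'⟩ R) :
    Null ⟨m, w⟩ R := by
  have hi := add_two_le X Y
  rw [Y.null_iff, braid_sign'] at h
  rw [X.null_iff, braid_sign]
  have h01 : ∀ k : Fin 2, k = 1 ∨ k = 0 := by decide
  have hφ₁ : ∀ α c d, ∀ j ≤ m, X.cube.rel (Sum.elim α ![d, c, true])
      ((lower ∘ near m w'.length) (0, j)) (0, j) := by
    intro α c d j hj
    rw [Function.comp_apply, near_mk (Nat.zero_le _) hj]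
    exact (X.cube.rel _).refl _
  refine (Bigon.bounding_of_faceIso Y.good X.good (Y.bigon₃ (.inr rfl) hw')
    (X.bigon₃ (.inl rfl) hw) (Y.middle_merges (.inr rfl) hw' (.inr rfl))
    (Y.middle_ne (.inr ⟨rfl, rfl⟩) hw') (X.middle_merges (.inl rfl) hw (.inl rfl))
    (X.middle_ne (.inl ⟨rfl, rfl⟩) hw) (φ₁ := lower ∘ near m w'.length)
    (φ₂ := bendLeft i ∘ near m w'.length) (ψ₁ := raise ∘ near m w.length)
    (ψ₂ := bendRight i ∘ near m w.length)
    ⟨⟨by decide, by decide, by decide⟩, ⟨by decide, by decide, by decide⟩,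
      hom_lower X Y hw hw' h01 rfl rfl rfl rfl, hom_raise X Y hw hw' h01 rfl rfl rfl rfl⟩
    ⟨⟨by decide, by decide, by decide⟩, ⟨by decide, by decide, by decide⟩,
      hom_bendLeft X Y hw hw' h01 rfl rfl rfl rfl, hom_bendRight X Y hw hw' h01 rfl rfl rfl rfl⟩
    ?_ ?_ ?_ h).congr ?_
  · intro α q
    refine (congrArg (X.circ _ ∘ bendLeft i) (collapse_near (near_mk ?_ ?_))).trans
      (bendLeft_collapse hi ?_ ?_ ?_ (min_le_right _ _))
    · exact Nat.zero_le _
    · omega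
    · simpa using X.slot (Sum.elim α ![false, true, true]) (inr 0)
    · simpa using X.slot (Sum.elim α ![false, true, true]) (inr 1)
    · simpa using X.slot (Sum.elim α ![false, true, true]) (inr 2)
  · intro α q
    refine (bendLeft_eq_collapse hi (g := X.circ (Sum.elim α ![true, true, false])) ?_ ?_ ?_
      (min_le_right _ _)).trans ?_
    · simpa using X.slot (Sum.elim α ![true, true, false]) (inr 0)
    · simpa using X.slot (Sum.elim α ![true, true, false]) (inr 1)
    · simpa using X.slot (Sum.elim α ![true, true, false]) (inr 2)
    · refine Eq.trans (congrArg (X.circ _) ?_) (X.circ_near _ _)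
      refine Eq.trans ?_ (collapse_near (O := Middle₂ i) (v := (3, i)) ?_).symm
      · refine congrArg (collapse _ _) ?_
        rw [Function.comp_apply, hw, hw', near_lower]
      · exact near_mk (by omega) (by omega)
  · refine ResCube.proj_edge_eq_zero ?_
    rw [proj_emap_strandProd (hφ₁ _ _ _)]
    refine proj_strandProd_eq_zero (i := i) (j := i + 1) (by omega) (by omega) ?_
    exact ((X.slot (Sum.elim (fun k => !(V k).2) ![true, false, true]) (inr 0)).2 (by simp)).2.1
  · exact proj_emap_strandProd (hφ₁ _ _ _)

end Chart

/-- In this form of the braid relation each side contains a pair of opposite crossings and hence a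
bigon. Counting the letters of the second word from the top makes the positive crossing of the pair
come first on both sides. -/
theorem null_braid_inv_iff {m : ℕ} {i j : Fin m} (h : (i : ℕ) + 1 = j) (v : BraidWord m)
    {R : Type*} [CommRing R] :
    Null ⟨m, (i, true) :: (j, true) :: (i, false) :: v⟩ R ↔
      Null ⟨m, (j, false) :: (i, true) :: (j, true) :: v⟩ R := by
  have X : Chart ((i, true) :: (j, true) :: (i, false) :: v) _ _ := Chart.triple _ _ _ v
  have Y : Chart ((j, false) :: (i, true) :: (j, true) :: v) _ _ := Chart.triple' _ _ _ v
  simp only [letter, ← h] at X Y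
  have hw : ∀ x y z : Fin m × Bool, (x :: y :: z :: v).length = 3 + v.length := fun x y z => by
    simp only [List.length_cons]; omega
  exact ⟨Chart.null_of_braid X Y (hw _ _ _) (hw _ _ _), Chart.null_of_braid' X Y (hw _ _ _) (hw _ _ _)⟩

end BraidDiagram

end

/-! ### The braid relation for positive letters. -/

noncomputable section

open PtAlg Sum

namespace BraidDiagram

variable {m : ℕ} {R : Type*} [CommRing R]

theorem null_rotate_iff (u w v : BraidWord m) :
    Null ⟨m, u ++ (w ++ v)⟩ R ↔ Null ⟨m, w ++ (v ++ u)⟩ R := by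
  rw [null_append_comm, List.append_assoc]

/-- Insert `σⱼ σⱼ⁻¹` in front and rotate `σⱼ` to the end. The word now starts with `σⱼ⁻¹ σᵢ σⱼ`,
which becomes `σᵢ σⱼ σᵢ⁻¹`; after another rotation `σᵢ⁻¹ σᵢ` cancels. -/
theorem null_braid_iff {i j : Fin m} (h : (i : ℕ) + 1 = j) (v : BraidWord m) :
    Null ⟨m, (i, true) :: (j, true) :: (i, true) :: v⟩ R ↔
      Null ⟨m, (j, true) :: (i, true) :: (j, true) :: v⟩ R := by
  rw [← null_cancel_iff j true]
  refine (null_append_comm [(j, true)] _).trans ?_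
  refine (null_braid_inv_iff h ((i, true) :: v ++ [(j, true)])).symm.trans ?_
  refine (null_append_comm [(i, true), (j, true)] _).trans ?_
  refine (null_cancel_iff i false _).trans ?_
  change Null ⟨m, v ++ [(j, true)] ++ [(i, true), (j, true)]⟩ R ↔ _
  rw [List.append_assoc, null_append_comm]
  rfl

end BraidDiagram

end

/-! ### Negative stabilization. -/

noncomputable section

open PtAlg Sum ResCube

namespace ResCube

variable {ι Ω : Type} [DecidableEq ι] [Fintype ι] {R : Type*} [CommRing R]

/-- If all but one of the edges at a vertex kill an element, then the image under the remaining
edge is a boundary. -/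
theorem Good.bounding_edge {K : ResCube ι Ω} (hK : K.Good) {α : ι → Bool} {k : ι} {x : PtAlg R Ω}
    (hk : α k = false)
    (h : ∀ l, l ≠ k → α l = false → K.proj R (up α l) (K.edge R α l x) = 0) :
    K.Bounding (up α k) (K.edge R α k x) := by
  obtain ⟨ε, hε⟩ := hK.exists_valid
  have key : ∀ β, K.proj R β (K.d ε (Pi.single α x) β) =
      if β = up α k then K.proj R β (ε α k • K.edge R α k x) else 0 := by
    intro β
    have e : ∀ l, (if β l = true then K.proj R β (ε (dn β l) l • K.edge R (dn β l) l
        ((Pi.single α x : (ι → Bool) → PtAlg R Ω) (dn β l))) else 0) =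
        if l = k ∧ β = up α k then K.proj R β (ε α k • K.edge R α k x) else 0 := by
      intro l
      by_cases hl : β l = true
      · rw [if_pos hl]
        by_cases hd : dn β l = α
        · rw [hd, Pi.single_eq_same]
          have hβ : β = up α l := by rw [← hd, up_dn hl]
          by_cases hlk : l = k
          · subst hlk
            rw [if_pos ⟨rfl, hβ⟩]
          · rw [if_neg (fun h => hlk h.1), hβ, proj_units_smul, h l hlk (by rw [← hd]; simp), smul_zero]
        · rw [Pi.single_eq_of_ne hd, map_zero, smul_zero, map_zero, if_neg]
          rintro ⟨rfl, rfl⟩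
          exact hd (dn_up hk)
      · rw [if_neg hl, if_neg]
        rintro ⟨rfl, rfl⟩
        exact hl (by simp)
    rw [proj_d, Finset.sum_congr rfl fun l _ => e l]
    by_cases hβ : β = up α k
    · simp [hβ]
    · simp [hβ]
  have hb : K.Bounding (up α k) (ε α k • K.edge R α k x) :=
    ⟨ε, hε, Pi.single α x, fun β => ⟨fun hβ => by rw [key, if_pos hβ], fun hβ => by
      rw [key, if_neg hβ]⟩⟩
  have := hb.units_smul (ε α k)
  rwa [smul_smul, Int.units_mul_self, one_smul] at this

end ResCube

namespace BraidDiagram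

variable {m : ℕ} {R : Type*} [CommRing R]

theorem exists_pt_mul_list_prod {Ω : Type} (o : Ω) (l : List Ω) :
    ∃ u : ℤˣ, pt R o * (l.map (pt R)).prod = u • ((l.map (pt R)).prod * pt R o) := by
  induction l with
  | nil => exact ⟨1, by simp⟩
  | cons p l ih =>
    obtain ⟨u, hu⟩ := ih
    refine ⟨-u, ?_⟩
    have e : pt R o * pt R p = -(pt R p * pt R o) :=
      eq_neg_of_add_eq_zero_left (ExteriorAlgebra.ι_add_mul_swap _ _)
    rw [List.map_cons, List.prod_cons, ← mul_assoc, e, neg_mul, mul_assoc, hu, mul_smul_comm,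
      mul_assoc]
    simp [Units.smul_def]

theorem strandProd_succ : strandProd R (m + 1) = strandProd R m * pt R (0, m + 1) := by
  rw [strandProd, bottom, List.range_succ, List.map_append, List.map_append, List.prod_append]
  simp [strandProd, bottom]

theorem strandProd_mul_pt : strandProd R m * pt R (0, m) = 0 := by
  have := list_prod_eq_zero (R := R) (l := bottom m ++ [(0, m)]) (g := id) (i := m) (j := m + 1)
    (by omega) (by simp [bottom]) (by simp [bottom])
  simpa [strandProd] using this

namespace Chart

/-- A chart for the stabilization of a braid. -/
def stab (ε : Bool) (w : BraidWord m) : Chart ((Fin.last m, ε) :: addStrand w)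
    (Sum.elim (fun k : Fin w.length => 1 + (k : ℕ)) (![0] : Fin 1 → ℕ))
    (Sum.elim (fun k => letter (w.get k)) ![(m, ε)]) :=
  (append [(Fin.last m, ε)] (addStrand w) (finCongr (by simp [addStrand])) (Equiv.refl _)).copy
    (by rintro (k | k); · simp
        · fin_cases k; rfl)
    (by rintro (k | k)
        · simp only [addStrand, letter, Sum.elim_inl, List.get_eq_getElem, List.getElem_map]
          rfl
        · fin_cases k; rfl)

theorem stab_length (ε : Bool) (w : BraidWord m) :
    ((Fin.last m, ε) :: addStrand w).length = 1 + w.length := by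
  simp [addStrand, add_comm]

/-- The strands of a stabilization are closed circles above the last horizontal smoothing. -/
theorem stab_circ {ε : Bool} {w : BraidWord m} {γ : Fin w.length ⊕ Fin 1 → Bool} {j t : ℕ}
    (hj : j ≤ m + 1) (ht : t ≤ w.length)
    (h : ∀ k : Fin w.length, t ≤ k → γ (inl k) = !(letter (w.get k)).2) :
    (stab ε w).circ γ (1 + t, j) = (stab ε w).circ γ (0, j) := by
  induction ht using Nat.decreasingInduction with
  | self => exact (stab ε w).closing_eq γ (stab_length ε w) hj
  | of_succ t ht ih =>
    rw [← ih fun k hk => h k (by omega)]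
    exact ((stab ε w).slot γ (inl ⟨t, ht⟩)).1 (h ⟨t, ht⟩ le_rfl) j hj

end Chart

open Chart

/-- The computation at the heart of the theorem: the product of the first `m + 1` strands, placed at
the vertex where only the stabilizing crossing is changed, has the product of all strands as its
boundary, up to sign. -/
theorem null_negative_stab (w : BraidWord m) :
    Null ⟨m + 1, addStrand w ++ [(Fin.last m, false)]⟩ R := by
  rw [null_concat_iff, (stab false w).null_iff]
  set X := stab false w
  set a : Fin w.length ⊕ Fin 1 → Bool :=
    Sum.elim (fun k => !(letter (w.get k)).2) ![false] with ha
  have hup : (fun k => !(Sum.elim (fun k => letter (w.get k)) ![(m, false)] k).2) =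
      up a (inr 0) := by
    funext k
    rcases k with k | k
    · simp [a, up]
    · obtain rfl : k = 0 := Subsingleton.elim _ _
      simp [up]
  -- The two arcs of the horizontal smoothing are connected by the strand `m`, which runs once
  -- around the braid.
  have hs : X.cube.Splits a (inr 0) := by
    rw [ResCube.Splits, X.s0_eq, X.t0_eq]
    exact stab_circ (t := 0) (by simp) (Nat.zero_le _) fun k _ => rfl
  have hb := X.good.bounding_edge (R := R) (x := strandProd R m) (α := a) (k := inr 0) rfl ?_
  · rw [edge_split hs, X.s1_eq, X.t1_eq] at hb
    obtain ⟨u, hu⟩ := exists_pt_mul_list_prod (R := R) (0, m + 1) (bottom m)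
    obtain ⟨u', hu'⟩ := exists_pt_mul_list_prod (R := R) (0, m) (bottom m)
    -- The generator of the strand `m` already occurs in the product, so only the new strand
    -- survives from the difference.
    have e : (pt R (start1 (m, false) 0) - pt R (end1 (m, false) 0)) * strandProd R m =
        u • strandProd R (m + 1) := by
      change (pt R (0, m + 1) - pt R (0, m)) * strandProd R m = _
      rw [sub_mul, strandProd_succ]
      change pt R (0, m + 1) * (List.map _ (bottom m)).prod - pt R (0, m) * (List.map _ (bottom m)).prod = _
      rw [hu, hu']
      change _ - u' • (strandProd R m * _) = _
      rw [strandProd_mul_pt, smul_zero, sub_zero]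
      rfl
    have hb := (e ▸ hb : X.cube.Bounding _ (u • strandProd R (m + 1))).units_smul u
    rw [smul_smul, Int.units_mul_self, one_smul] at hb
    rwa [hup]
  · rintro (k | k) hk h0
    -- A letter that is 0-smoothed at `a` is positive. Its 1-smoothing joins two of the old strands,
    -- as one sees above it and through the closing arcs, since the bottom is occupied by the
    -- stabilizing crossing.
    · refine ResCube.proj_edge_eq_zero ?_
      have hi : (letter (w.get k)).1 < m := (w.get k).1.2
      refine proj_strandProd_eq_zero (i := (letter (w.get k)).1) (j := (letter (w.get k)).1 + 1)
        (by omega) hi ?_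
      have hv : ∀ k' : Fin w.length, (k : ℕ) + 1 ≤ k' →
          up a (inl k) (inl k') = !(letter (w.get k')).2 := by
        intro k' hk'
        have : k' ≠ k := by rintro rfl; omega
        simp [up, a, this]
      have hl := (X.slot (up a (inl k)) (inl k)).2 (by
        simp only [up, Function.update_self, Sum.elim_inl]
        intro hc
        simp only [a, Sum.elim_inl] at h0
        rw [← hc] at h0
        simp at h0)
      exact (stab_circ (Nat.le_succ_of_le hi.le) k.2 hv).symm.trans
        (hl.2.2.trans (stab_circ (Nat.succ_le_succ hi.le) k.2 hv))
    · exact absurd (Subsingleton.elim k 0 ▸ rfl) hk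

end BraidDiagram

end

/-! ### Positive stabilization, and invariance under transverse moves. -/

noncomputable section

open PtAlg Sum ResCube

namespace BraidDiagram

variable {m : ℕ} {R : Type*} [CommRing R]

namespace Chart

/-- Forget the last strand. -/
def forget (m : ℕ) (p : ℕ × ℕ) : ℕ × ℕ := if p.2 ≤ m then (p.1 - 1, p.2) else (0, m)

/-- Shift the levels by one. -/
def shiftUp (p : ℕ × ℕ) : ℕ × ℕ := (1 + p.1, p.2)

theorem shiftUp_add (l j : ℕ) : shiftUp (0 + l, j) = (1 + l, j) := by simp [shiftUp]

theorem self_hom_stab (w : BraidWord m) :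
    (self w).cube.Hom ((stab true w).cube.slice ![false]) (Equiv.refl _)
      (shiftUp ∘ near m w.length) := by
  set X := stab true w
  have near := (self w).near_arrow
  have arr := fun k : Fin w.length => start0_shift shiftUp_add (letter (w.get k)) k
  simp only [zero_add] at arr
  refine ⟨fun γ p q h => ?_, fun γ k _ => ?_, fun γ k _ => ?_, fun γ k _ => ?_, fun γ k _ => ?_⟩
  · refine (self w).le (X.circ (Sum.elim γ ![false]) ∘ shiftUp) (γ := γ)
      (fun k => ?_) (fun j hj => ?_) h
    · have := (X.slot (Sum.elim γ ![false]) (inl k)).comp shiftUp_add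
      simpa using this.mono (Nat.le_succ m)
    · have h0 := (X.slot (Sum.elim γ ![false]) (inr 0)).1 rfl j (Nat.le_succ_of_le hj)
      exact (X.closing_eq _ (stab_length true w) (Nat.le_succ_of_le hj)).trans h0
  all_goals refine X.cube_rel.2 (congrArg _ ?_)
  · exact (congrArg _ ((congrArg _ ((self w).s0_eq k)).trans (near k).1)).trans
      ((arr k).1.trans (X.s0_eq (inl k)).symm)
  · exact (congrArg _ ((congrArg _ ((self w).t0_eq k)).trans (near k).2.1)).trans
      ((arr k).2.1.trans (X.t0_eq (inl k)).symm)
  · exact (congrArg _ ((congrArg _ ((self w).s1_eq k)).trans (near k).2.2.1)).trans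
      ((arr k).2.2.1.trans (X.s1_eq (inl k)).symm)
  · exact (congrArg _ ((congrArg _ ((self w).t1_eq k)).trans (near k).2.2.2)).trans
      ((arr k).2.2.2.trans (X.t1_eq (inl k)).symm)

theorem forget_arrow {x : ℕ × Bool} (hx : x.1 < m) (l : ℕ) :
    forget m (start0 x (1 + l)) = start0 x l ∧ forget m (end0 x (1 + l)) = end0 x l ∧
      forget m (start1 x (1 + l)) = start1 x l ∧ forget m (end1 x (1 + l)) = end1 x l := by
  obtain ⟨i, ε⟩ := x
  have h1 : i ≤ m := hx.le
  have h2 : i + 1 ≤ m := hx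
  cases ε <;> simp [start0, end0, start1, end1, forget, h1, h2, add_assoc]

theorem forget_slot {T : Type} {g : ℕ × ℕ → T} {l i : ℕ} {vert : Prop} (hi : i < m)
    (h : Slot g m l i vert) : Slot (g ∘ forget m) (m + 1) (1 + l) i vert := by
  have hf : ∀ l j, forget m (1 + l, j) = if j ≤ m then (l, j) else (0, m) := by
    intro l j
    simp [forget]
  simp only [Slot, Function.comp_apply, add_assoc, hf] at h ⊢
  have h1 : i ≤ m := hi.le
  have h2 : i + 1 ≤ m := hi
  refine ⟨fun hv j _ => ?_, fun hv => ⟨fun j _ a b => ?_, ?_, ?_⟩⟩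
  · split_ifs with hj
    · exact h.1 hv j hj
    · rfl
  · split_ifs with hj
    · exact (h.2 hv).1 j hj a b
    · rfl
  · rw [if_pos h1, if_pos h2]
    exact (h.2 hv).2.1
  · rw [if_pos h1, if_pos h2]
    exact (h.2 hv).2.2

/-- The added strand is a circle of its own in this slice and may be sent anywhere, here to the
point `(0, m)`, because a `Hom` need not separate circles. -/
theorem stab_hom_self (w : BraidWord m) :
    ((stab true w).cube.slice ![false]).Hom (self w).cube (Equiv.refl _)
      (forget m ∘ near (m + 1) ((Fin.last m, true) :: addStrand w).length) := by
  set X := stab true w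
  have near := fun k => X.near_arrow (inl k)
  have arr := fun k : Fin w.length => forget_arrow (w.get k).1.2 (x := letter (w.get k)) k
  refine ⟨fun γ p q h => ?_, fun γ k _ => ?_, fun γ k _ => ?_, fun γ k _ => ?_, fun γ k _ => ?_⟩
  · refine X.le ((self w).circ γ ∘ forget m) (γ := Sum.elim γ ![false]) ?_ ?_ h
    · rintro (k | k)
      · exact forget_slot (w.get k).1.2 ((self w).slot γ k)
      · obtain rfl : k = 0 := Subsingleton.elim _ _
        refine ⟨fun _ j _ => ?_, fun h => absurd rfl h⟩
        simp [forget]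
    · intro j _
      rw [stab_length]
      by_cases hj : j ≤ m
      · simp only [Function.comp_apply, forget, if_pos hj, Nat.add_sub_cancel_left]
        exact (self w).closing_eq γ rfl hj
      · simp [forget, hj]
  all_goals refine (self w).cube_rel.2 (congrArg _ ?_)
  · exact (congrArg _ ((congrArg _ (X.s0_eq (inl k))).trans (near k).1)).trans
      ((arr k).1.trans ((self w).s0_eq k).symm)
  · exact (congrArg _ ((congrArg _ (X.t0_eq (inl k))).trans (near k).2.1)).trans
      ((arr k).2.1.trans ((self w).t0_eq k).symm)
  · exact (congrArg _ ((congrArg _ (X.s1_eq (inl k))).trans (near k).2.2.1)).trans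
      ((arr k).2.2.1.trans ((self w).s1_eq k).symm)
  · exact (congrArg _ ((congrArg _ (X.t1_eq (inl k))).trans (near k).2.2.2)).trans
      ((arr k).2.2.2.trans ((self w).t1_eq k).symm)

/-- The last strand of a stabilization is a circle of its own in one of the smoothings. -/
theorem stab_last_strand (w : BraidWord m) {γ : Fin w.length → Bool} {p q : ℕ × ℕ}
    (h : (stab true w).cube.rel (Sum.elim γ ![false]) p q) (hp : m < p.2) : m < q.2 := by
  set X := stab true w
  have := X.le (fun p => m < p.2) (γ := Sum.elim γ ![false]) ?_ ?_ h
  · have h2 : m < (near (m + 1) ((Fin.last m, true) :: addStrand w).length q).2 := by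
      rw [← this]
      exact lt_min hp (Nat.lt_succ_self m)
    exact h2.trans_le (min_le_left _ _)
  · rintro (k | k)
    · have h1 : (letter (w.get k)).1 < m := (w.get k).1.2
      have h2 : (m < (letter (w.get k)).1) = (m < (letter (w.get k)).1 + 1) :=
        propext ⟨fun h => by omega, fun h => by omega⟩
      exact ⟨fun _ _ _ => rfl, fun _ => ⟨fun _ _ _ _ => rfl, h2, h2⟩⟩
    · obtain rfl : k = 0 := Subsingleton.elim _ _
      exact ⟨fun _ j _ => rfl, fun h => absurd rfl h⟩
  · exact fun j _ => rfl

end Chart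

open Chart

/-- In the 0-smoothing of the new crossing the new strand is an isolated circle, which its
1-smoothing merges with the strand `m`. Adding it multiplies by the difference of the two
generators; the strand `m` already occurs in the product, so this is the generator of the new
strand. Conversely, restrict to the slice and remove the circle. -/
theorem null_stab_iff (w : BraidWord m) :
    Null ⟨m, w⟩ R ↔ Null ⟨m + 1, addStrand w ++ [(Fin.last m, true)]⟩ R := by
  rw [null_concat_iff, (stab true w).null_iff, (self w).null_iff]
  set X := stab true w
  set a : Fin w.length → Bool := fun k => !(letter (w.get k)).2
  have ha : (fun k => !(Sum.elim (fun k => letter (w.get k)) ![(m, true)] k).2) =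
      Sum.elim a ![false] := by
    funext k
    rcases k with k | k
    · rfl
    · obtain rfl : k = 0 := Subsingleton.elim _ _
      rfl
  rw [ha]
  constructor
  · intro h
    have h := bounding_of_hom (self_hom_stab w) (stab_hom_self w) (fun j hj => ?_) h
    · have := h.of_slice_zero X.good (o := (0, m + 1)) (v := (0, m)) ?_ ?_
      · rwa [mul_sub, strandProd_mul_pt, sub_zero, ← strandProd_succ] at this
      · intro α hs
        have hs := (X.cube.rel _).symm hs
        rw [X.s0_eq, X.t0_eq] at hs
        exact absurd (stab_last_strand w hs (Nat.lt_succ_self m)) (lt_irrefl m)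
      · intro α
        exact ((X.slot (Sum.elim α ![true]) (inr 0)).2 (by simp)).2.1.symm
    · rw [Function.comp_apply, near_mk (Nat.zero_le _) hj]
      exact ((X.slot (Sum.elim a ![false]) (inr 0)).1 rfl j (Nat.le_succ_of_le hj)).symm
  · intro h
    have h := h.slice_zero
    rw [strandProd_succ, strandProd] at h
    have h := h.of_isolated (O := fun p => m < p.2) (fun α p q => stab_last_strand w)
      (fun k => ?_) (fun k => ?_) (Nat.lt_succ_self m) (fun p hp => not_lt.2 (mem_bottom hp).2)
    · refine bounding_of_hom (stab_hom_self w) (self_hom_stab w) (fun j hj => ?_) h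
      rw [Function.comp_apply, near_mk (Nat.zero_le _) (Nat.le_succ_of_le hj), forget, if_pos hj]
      exact ((self w).cube.rel _).refl _
    · change ¬ m < (X.cube.s1 (inl k)).2
      have := (w.get k).1.2
      rw [X.s1_eq, start1]
      split_ifs <;> simp [letter]
    · change ¬ m < (X.cube.t1 (inl k)).2
      have := (w.get k).1.2
      rw [X.t1_eq, end1]
      simp [letter]

/-- Conjugation brings the letters of a relation to the front of the word, where the moves were
established. -/
theorem TransverseMove.null_iff {D D' : BraidDiagram} (h : TransverseMove D D') :
    Null D R ↔ Null D' R := by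
  cases h with
  | cancel u v i ε =>
    rw [null_append_comm u v]
    exact (null_rotate_iff u [(i, ε), (i, !ε)] v).trans (null_cancel_iff i ε _)
  | comm u v i j h =>
    exact (null_rotate_iff u [(i, true), (j, true)] v).trans ((null_comm_iff (.inl h) _).trans
      (null_rotate_iff u [(j, true), (i, true)] v).symm)
  | braid u v i j h =>
    exact (null_rotate_iff u [(i, true), (j, true), (i, true)] v).trans ((null_braid_iff h _).trans
      (null_rotate_iff u [(j, true), (i, true), (j, true)] v).symm)
  | conj u v => exact null_append_comm u v
  | stab w => exact null_stab_iff w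

theorem null_iff_of_eqvGen {D D' : BraidDiagram} (h : Relation.EqvGen TransverseMove D D') :
    Null D R ↔ Null D' R := by
  induction h with
  | rel D D' h => exact h.null_iff
  | refl D => exact Iff.rfl
  | symm D D' _ h => exact h.symm
  | trans D D' D'' _ _ h h' => exact h.trans h'

end BraidDiagram

end

theorem proposition4p2 (R : Type*) [CommRing R] (L L' : TransverseLink)
    (h : L.IsNegativeStabilizationOf L') (D : BraidDiagram) (hD : D.IsDiagramOf L)
    (o : D.Arrows) (π : D.Order) : BraidDiagram.psi R D o π = 0 := by
  obtain ⟨m, w, -, hw⟩ := h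
  refine BraidDiagram.psi_eq_zero ?_ o π
  exact (BraidDiagram.null_iff_of_eqvGen (Quot.eqvGen_exact (hw.trans hD.symm))).1
    (BraidDiagram.null_negative_stab w)
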